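/- **Theorem 3.6.** Let $d\ge 1$, write $\langle\xi\rangle=(1+|\xi|^2)^{1/2}$, and let $S^m$ be the space of $f\in C^\infty(\mathbb R^d\times\mathbb R^d)$ with $\sup_{x,\xi}\langle\xi\rangle^{|\beta|-m}|\partial_x^\alpha\partial_\xi^\beta f(x,\xi)|<\infty$ for all multi-indices $\alpha,\beta$. Let $B=\frac12\sum_{j,k}B_{jk}\,dx_j\wedge dx_k$ be a closed 2-form on $\mathbb R^d$ with real coefficients $B_{jk}=-B_{kj}$ that are smooth and bounded together with all their derivatives. Let $A=\sum_j A_j\,dx_j$ with $dA=B$, where the $A_j$ are real and smooth and all their derivatives have at most polynomial growth. Put $$\omega^A(x,y)=\exp\Big(i\Big\langle x-y,\int_0^1A((1-s)x+sy)\,ds\Big\rangle\Big).$$ Let $U(x,\eta)=\langle x,\eta\rangle+d(x,\eta)$ be real and smooth (the function $d(x,\eta)$ is not to be confused with the dimension $d$), where $\partial_{x_j}d\in S^1$ and $\partial_{\eta_j}d\in S^0$ for all $j$, and $\sup_{x,\eta}\|\nabla^2_{x,\eta}d(x,\eta)\|\le\delta$ (operator norm) for some $\delta\in[0,1)$; let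 $\Phi$ be the symplectomorphism with generating function $U$. For a symbol $a$ and $u\in\mathcal S(\mathbb R^d)$ define $$[a^A(x,D)u](x)=(2\pi)^{-d}\iint e^{i\langle x-y,\eta\rangle}\omega^A(x,y)\,a(x,\eta)\,u(y)\,dy\,d\eta,$$ $$[\mathfrak{Op}^A_\Phi(a)u](x)=(2\pi)^{-d}\iint e^{i(U(x,\eta)-\langle y,\eta\rangle)}\omega^A(x,y)\,a(x,\eta)\,u(y)\,dy\,d\eta,$$ as oscillating integrals: the limit as $\varepsilon\searrow0$ of the integrals with an additional factor $\chi(\varepsilon\eta)$, where $\chi\in C_0^\infty(\mathbb R^d)$ is any function equal to $1$ on the closed unit ball. Both are continuous linear operators on $\mathcal S(\mathbb R^d)$. Let $m',m''\in\mathbb R$, $a\in S^{m''}$ and $b\in S^{m'}$. Then there is $c\in S^{m'+m''}$ such that $$a^A(x,D)\circ\mathfrak{Op}^A_\Phi(b)=\mathfrak{Op}^A_\Phi(c)\qquad\text{and}\qquad c-(c_0+e_B)\in S^{m'+m''-2},$$ where, with $a=a(x,\zeta)$ and with $\langle\cdot,\cdot\rangle$ extended bilinearly to complex vectors, $$\begin{aligned}c_0(x,\xi)={}&a(x,\nabla_xU(x,\xi))\,b(x,\xi)-i\big\langle(\nabla_\zeta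 a)(x,\nabla_xU(x,\xi)),(\nabla_xb)(x,\xi)\big\rangle\\&-\tfrac i2\operatorname{Tr}\big[(\nabla^2_{\zeta,\zeta}a)(x,\nabla_xU(x,\xi))\,(\nabla^2_{x,x}U)(x,\xi)\big]\,b(x,\xi),\end{aligned}$$ $$e_B(x,\xi)=\big\langle M(x,\xi)\,(\nabla_\zeta a)(x,\nabla_xU(x,\xi)),(\nabla_\xi d)(x,\xi)\big\rangle\,b(x,\xi),\qquad M(x,\xi)=\int_0^1(1-t)\,B\big(x+t\nabla_\xi d(x,\xi)\big)\,dt,$$ and $B(\cdot)$ denotes the matrix $(B_{jk}(\cdot))_{j,k}$. -/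

import Mathlib

open MeasureTheory Filter Topology
open scoped ContDiff SchwartzMap

noncomputable section

namespace MagneticFIO

/-- The configuration space `ℝ^d` with its Euclidean structure. -/
abbrev Conf (d : ℕ) : Type := EuclideanSpace ℝ (Fin d)

section Symbols

variable {d : ℕ} {F : Type*} [NormedAddCommGroup F] [NormedSpace ℝ F]

/-- `⟨ξ⟩ = (1 + |ξ|²)^{1/2}`. -/
def bracket (ξ : Conf d) : ℝ := Real.sqrt (1 + ‖ξ‖ ^ 2)

/-- The partial derivative `∂_{x_j} f` of a function `f(x, ξ)`. -/
def dX (j : Fin d) (f : Conf d → Conf d → F) : Conf d → Conf d → F :=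
  fun x ξ => fderiv ℝ (fun y => f y ξ) x (EuclideanSpace.single j 1)

/-- The partial derivative `∂_{ξ_j} f` of a function `f(x, ξ)`. -/
def dXi (j : Fin d) (f : Conf d → Conf d → F) : Conf d → Conf d → F :=
  fun x ξ => fderiv ℝ (fun η => f x η) ξ (EuclideanSpace.single j 1)

/-- The mixed partial derivative `∂_{x_{i₁}} ⋯ ∂_{x_{i_p}} ∂_{ξ_{j₁}} ⋯ ∂_{ξ_{j_q}} f` for
`I = [i₁, …, i_p]` and `J = [j₁, …, j_q]`. For smooth `f` these are exactly the derivatives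
`∂_x^α ∂_ξ^β f`, with `|α| = p` and `|β| = q`. -/
def mixedPartial (I J : List (Fin d)) (f : Conf d → Conf d → F) : Conf d → Conf d → F :=
  I.foldr dX (J.foldr dXi f)

/-- The symbol class `S^m(ℝ^d)`: smooth functions on `ℝ^d × ℝ^d` with
`sup ⟨ξ⟩^{|β| - m} |∂_x^α ∂_ξ^β f(x, ξ)| < ∞` for all `α, β`. -/
structure IsSymbol (m : ℝ) (f : Conf d → Conf d → F) : Prop where
  smooth : ContDiff ℝ ∞ (fun p : Conf d × Conf d => f p.1 p.2)
  bounded : ∀ I J : List (Fin d), ∃ C : ℝ, ∀ x ξ : Conf d,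
    bracket ξ ^ ((J.length : ℝ) - m) * ‖mixedPartial I J f x ξ‖ ≤ C

/-- The class `S^+` (here for real functions): smooth `f` with `∂_{x_j} f ∈ S^1` and
`∂_{ξ_j} f ∈ S^0` for all `j`. -/
structure IsSymbolPlus (f : Conf d → Conf d → ℝ) : Prop where
  smooth : ContDiff ℝ ∞ (fun p : Conf d × Conf d => f p.1 p.2)
  dX_symbol : ∀ j, IsSymbol 1 (dX j f)
  dXi_symbol : ∀ j, IsSymbol 0 (dXi j f)

end Symbols

section Phase

variable {d : ℕ}

/-- The gradient `(∇_x f)(x, ξ)`. -/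
def gradX (f : Conf d → Conf d → ℝ) (x ξ : Conf d) : Conf d :=
  WithLp.toLp 2 (fun j => dX j f x ξ)

/-- The gradient `(∇_ξ f)(x, ξ)`. -/
def gradXi (f : Conf d → Conf d → ℝ) (x ξ : Conf d) : Conf d :=
  WithLp.toLp 2 (fun j => dXi j f x ξ)

/-- The matrix `∇²_{x,ξ} f = (∂_{x_j} ∂_{ξ_k} f)_{j,k}`. -/
def mixedHessian (f : Conf d → Conf d → ℝ) (x ξ : Conf d) : Matrix (Fin d) (Fin d) ℝ :=
  Matrix.of (fun j k => dX j (dXi k f) x ξ)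

/-- The function `d` in the decomposition `U(x, η) = ⟨x, η⟩ + d(x, η)`. -/
def phaseRemainder (U : Conf d → Conf d → ℝ) (x η : Conf d) : ℝ :=
  U x η - inner ℝ x η

/-- Admissible generating functions: `U(x, η) = ⟨x, η⟩ + d(x, η)` with `d ∈ S^+` real and
`‖∇²_{x,η} d‖ ≤ δ` everywhere (operator norm on Euclidean space) for some `δ ∈ [0, 1)`. -/
structure IsGeneratingPhase (U : Conf d → Conf d → ℝ) : Prop where
  smooth : ContDiff ℝ ∞ (fun p : Conf d × Conf d => U p.1 p.2)
  remainder : IsSymbolPlus (phaseRemainder U)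
  hessian_lt_one : ∃ δ : ℝ, 0 ≤ δ ∧ δ < 1 ∧ ∀ x η : Conf d,
    ‖Matrix.toEuclideanCLM (𝕜 := ℝ) (n := Fin d) (mixedHessian (phaseRemainder U) x η)‖ ≤ δ

end Phase

section Field

variable {d : ℕ}

/-- A magnetic field: a closed 2-form `B = (1/2) ∑ B_{jk} dx_j ∧ dx_k` with antisymmetric
coefficients in `BC^∞(ℝ^d)`. -/
structure IsMagneticField (B : Conf d → Matrix (Fin d) (Fin d) ℝ) : Prop where
  antisymm : ∀ x j k, B x j k = -B x k j
  smooth : ∀ j k, ContDiff ℝ ∞ (fun x => B x j k)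
  bounded : ∀ j k, ∀ n : ℕ, ∃ C : ℝ, ∀ x, ‖iteratedFDeriv ℝ n (fun y => B y j k) x‖ ≤ C
  closed : ∀ x i j k,
    fderiv ℝ (fun y => B y j k) x (EuclideanSpace.single i 1) +
    fderiv ℝ (fun y => B y k i) x (EuclideanSpace.single j 1) +
    fderiv ℝ (fun y => B y i j) x (EuclideanSpace.single k 1) = 0

/-- `A = ∑ A_j dx_j` is a vector potential of class `C^∞_pol` (smooth, every derivative
polynomially bounded) for `B`, that is `B = dA`: `B_{jk} = ∂_j A_k - ∂_k A_j`. -/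
structure IsVectorPotential (A : Conf d → Conf d) (B : Conf d → Matrix (Fin d) (Fin d) ℝ) :
    Prop where
  temperate : Function.HasTemperateGrowth A
  d_eq : ∀ x j k, B x j k =
    fderiv ℝ (fun y => A y k) x (EuclideanSpace.single j 1) -
    fderiv ℝ (fun y => A y j) x (EuclideanSpace.single k 1)

/-- The circulation `∫_{[x,y]} A = -⟨x - y, ∫_0^1 A((1-s)x + sy) ds⟩`. -/
def circulation (A : Conf d → Conf d) (x y : Conf d) : ℝ :=
  -inner ℝ (x - y) (∫ s in (0 : ℝ)..1, A ((1 - s) • x + s • y))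

/-- `ω^A(x, y) = exp(-i ∫_{[x,y]} A)`. -/
def magPhase (A : Conf d → Conf d) (x y : Conf d) : ℂ :=
  Complex.exp (-Complex.I * (circulation A x y : ℂ))

end Field

section Operators

variable {d : ℕ}

/-- The regularized integral
`(2π)^{-d} ∬ e^{iφ(x,y,η)} ω^A(x,y) χ(εη) a(x,η) u(y) dy dη`. -/
def regularizedIntegral (A : Conf d → Conf d) (φ : Conf d → Conf d → Conf d → ℝ)
    (a : Conf d → Conf d → ℂ) (u : 𝓢(Conf d, ℂ)) (χ : Conf d → ℝ) (ε : ℝ) (x : Conf d) : ℂ :=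
  (((2 * Real.pi) ^ d : ℝ) : ℂ)⁻¹ * ∫ p : Conf d × Conf d,
    Complex.exp (Complex.I * (φ x p.1 p.2 : ℂ)) * magPhase A x p.1 * (χ (ε • p.2) : ℂ) *
      a x p.2 * u p.1

/-- `v` is the value of the oscillating integral
`(2π)^{-d} ∬ e^{iφ(x,y,η)} ω^A(x,y) a(x,η) u(y) dy dη`: the limit as `ε ↘ 0` of the integrals with
cut-off `χ(εη)`, for every `χ ∈ C_0^∞(ℝ^d)` that is equal to `1` on the unit ball. -/
def IsOscillatingIntegral (A : Conf d → Conf d) (φ : Conf d → Conf d → Conf d → ℝ)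
    (a : Conf d → Conf d → ℂ) (u : 𝓢(Conf d, ℂ)) (x : Conf d) (v : ℂ) : Prop :=
  ∀ χ : Conf d → ℝ, ContDiff ℝ ∞ χ → HasCompactSupport χ → (∀ η, ‖η‖ ≤ 1 → χ η = 1) →
    Tendsto (fun ε : ℝ => regularizedIntegral A φ a u χ ε x) (𝓝[>] 0) (𝓝 v)

/-- `T` is the left-quantized magnetic pseudodifferential operator `a^A(x, D)`, a continuous linear
operator on the Schwartz space:
`(T u)(x) = (2π)^{-d} ∬ e^{i⟨x-y,η⟩} ω^A(x,y) a(x,η) u(y) dy dη`. -/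
def IsMagneticPsiDO (A : Conf d → Conf d) (a : Conf d → Conf d → ℂ)
    (T : 𝓢(Conf d, ℂ) →L[ℂ] 𝓢(Conf d, ℂ)) : Prop :=
  ∀ (u : 𝓢(Conf d, ℂ)) (x : Conf d),
    IsOscillatingIntegral A (fun x y η => inner ℝ (x - y) η) a u x (T u x)

/-- `T` is the magnetic Fourier integral operator with symbol `a` and generating function `U`, a
continuous linear operator on the Schwartz space:
`(T u)(x) = (2π)^{-d} ∬ e^{i(U(x,η) - ⟨y,η⟩)} ω^A(x,y) a(x,η) u(y) dy dη`. -/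
def IsMagneticFIO (A : Conf d → Conf d) (U : Conf d → Conf d → ℝ) (a : Conf d → Conf d → ℂ)
    (T : 𝓢(Conf d, ℂ) →L[ℂ] 𝓢(Conf d, ℂ)) : Prop :=
  ∀ (u : 𝓢(Conf d, ℂ)) (x : Conf d),
    IsOscillatingIntegral A (fun x y η => U x η - inner ℝ y η) a u x (T u x)

end Operators

section Expansion

variable {d : ℕ}

/-- The matrix `M(x, ξ) = ∫_0^1 (1 - t) B(x + t ∇_ξ d(x, ξ)) dt`. -/
def averagedField (B : Conf d → Matrix (Fin d) (Fin d) ℝ) (U : Conf d → Conf d → ℝ)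
    (x ξ : Conf d) : Matrix (Fin d) (Fin d) ℝ :=
  Matrix.of (fun j k =>
    ∫ t in (0 : ℝ)..1, (1 - t) * B (x + t • gradXi (phaseRemainder U) x ξ) j k)

/-- The non-magnetic part
`c₀ = a(x, ∇_x U) b - i ⟨(∇_ζ a)(x, ∇_x U), ∇_x b⟩ - (i/2) Tr[(∇²_{ζ,ζ} a)(x, ∇_x U) ∇²_{x,x} U] b`
(with the bilinear pairing). -/
def symbolZero (U : Conf d → Conf d → ℝ) (a b : Conf d → Conf d → ℂ) (x ξ : Conf d) : ℂ :=
  a x (gradX U x ξ) * b x ξ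
    - Complex.I * ∑ j, dXi j a x (gradX U x ξ) * dX j b x ξ
    - Complex.I / 2 *
      (∑ j, ∑ k, dXi j (dXi k a) x (gradX U x ξ) * ((dX k (dX j U) x ξ : ℝ) : ℂ)) * b x ξ

/-- The magnetic correction
`e_B = ⟨M(x, ξ) (∇_ζ a)(x, ∇_x U), ∇_ξ d⟩ b` (with the bilinear pairing). -/
def symbolMagnetic (B : Conf d → Matrix (Fin d) (Fin d) ℝ) (U : Conf d → Conf d → ℝ)
    (a b : Conf d → Conf d → ℂ) (x ξ : Conf d) : ℂ :=
  (∑ j, (∑ k, (averagedField B U x ξ j k : ℂ) * dXi k a x (gradX U x ξ)) *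
    ((dXi j (phaseRemainder U) x ξ : ℝ) : ℂ)) * b x ξ

end Expansion

end MagneticFIO

end

noncomputable section

namespace MagneticFIO

open ContinuousLinearMap (fst snd inl inr)
open Complex (exp I)
open EuclideanSpace (single proj)
open Function (HasTemperateGrowth)
open Finset (sum_congr mul_sum sum_mul sum_add_distrib sum_neg_distrib sum_comm sum_le_sum sum_nonneg sum_eq_zero univ mem_univ)

local notation "Ph" d:max => Conf d × Conf d
local notation "Fn" d:max F:max => Conf d → Conf d → F
local notation "Fld" d:max => Conf d → Matrix (Fin d) (Fin d) ℝ
local notation "Sw" d:max => 𝓢(Conf d, ℂ)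
variable {d : ℕ} {T : Type*}

set_option linter.unusedSectionVars false

local notation "𝕀" => Set.Icc (0 : ℝ) 1
local notation "Smooth" f:max => ContDiff ℝ ∞ f
local notation "br" x:max => bracket x
local notation "eI" t:max => exp (I * ((t : ℝ) : ℂ))

lemma one_le_mul {a b : ℝ} (ha : 1 ≤ a) (hb : 1 ≤ b) : 1 ≤ a * b := one_le_mul_of_one_le_of_one_le ha hb

/-- The space of the variables `(z, (w, η))` of an amplitude with parameter `z`. -/
abbrev Amp (Z : Type) (d : ℕ) : Type := Z × (Ph d)

/-- The parameter space of `((x, ξ), p)`. -/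
abbrev Par (d : ℕ) : Type := Ph d × Conf d

local notation "PhAmp" d:max => Amp (Conf d × Conf d) d
local notation "ParAmp" d:max => Amp (Par d) d

section

/-- A distinguished finite family of coordinate directions of a normed space. -/
class Dirs (E : Type*) [NormedAddCommGroup E] [NormedSpace ℝ E] where
  /-- The index type of the directions. -/
  ι : Type
  [fin : Fintype ι]
  /-- The directions. -/
  b : Module.Basis ι ℝ E

attribute [reducible, instance] Dirs.fin

instance instDirsConf (d : ℕ) : Dirs (Conf d) where
  ι := Fin d
  b := (EuclideanSpace.basisFun (Fin d) ℝ).toBasis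

instance instDirsProd (E F : Type*) [NormedAddCommGroup E] [NormedSpace ℝ E]
    [NormedAddCommGroup F] [NormedSpace ℝ F] [Dirs E] [Dirs F] : Dirs (E × F) where
  ι := Dirs.ι E ⊕ Dirs.ι F
  b := Dirs.b.prod Dirs.b

instance instDirsUnit : Dirs PUnit.{1} where
  ι := Empty
  b := Module.Basis.empty _

variable {E E' F G H : Type*} [NormedAddCommGroup E] [NormedSpace ℝ E]
  [NormedAddCommGroup E'] [NormedSpace ℝ E'] [NormedAddCommGroup F] [NormedSpace ℝ F]
  [NormedAddCommGroup G] [NormedSpace ℝ G] [NormedAddCommGroup H] [NormedSpace ℝ H]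

lemma Dirs.finiteDimensional (E : Type*) [NormedAddCommGroup E] [NormedSpace ℝ E] [Dirs E] :
    FiniteDimensional ℝ E := Module.Finite.of_basis (Dirs.b (E := E))

def co [Dirs E] (j : Dirs.ι E) : E →L[ℝ] ℝ :=
  haveI := Dirs.finiteDimensional E
  LinearMap.toContinuousLinearMap (Dirs.b.coord j)

lemma co_apply [Dirs E] (j : Dirs.ι E) (x : E) : co j x = Dirs.b.repr x j := rfl

@[simp] lemma co_inl [Dirs E] [Dirs F] (j : Dirs.ι E) (x : E × F) :
    co (E := E × F) (Sum.inl j) x = co j x.1 := by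
  simp only [co_apply]
  exact Module.Basis.prod_repr_inl _ _ _ _

@[simp] lemma co_inr [Dirs E] [Dirs F] (j : Dirs.ι F) (x : E × F) :
    co (E := E × F) (Sum.inr j) x = co j x.2 := by
  simp only [co_apply]
  exact Module.Basis.prod_repr_inr _ _ _ _

@[simp] lemma co_conf {d : ℕ} (j : Fin d) (x : Conf d) : co (E := Conf d) j x = x j := by
  simp only [co_apply]
  rfl

@[simp] lemma b_inl [Dirs E] [Dirs F] (j : Dirs.ι E) :
    (Dirs.b (E := E × F) (Sum.inl j)) = (Dirs.b j, (0 : F)) := by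
  change (Dirs.b.prod Dirs.b) (Sum.inl j) = _
  rw [Module.Basis.prod_apply]
  simp

@[simp] lemma b_inr [Dirs E] [Dirs F] (j : Dirs.ι F) :
    (Dirs.b (E := E × F) (Sum.inr j)) = ((0 : E), Dirs.b j) := by
  change (Dirs.b.prod Dirs.b) (Sum.inr j) = _
  rw [Module.Basis.prod_apply]
  simp

@[simp] lemma b_conf {d : ℕ} (j : Fin d) : (Dirs.b (E := Conf d) j) = single j (1 : ℝ) := by
  change (EuclideanSpace.basisFun (Fin d) ℝ).toBasis j = _
  rw [OrthonormalBasis.coe_toBasis, EuclideanSpace.basisFun_apply]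

lemma sum_co [Dirs E] (x : E) : ∑ j, co j x • Dirs.b j = x := by
  simp only [co_apply]
  exact Module.Basis.sum_repr _ _

variable [Dirs E] [Dirs E']

def pd (i : Dirs.ι E) (f : E → F) : E → F := fun X => fderiv ℝ f X (Dirs.b i)

notation "pD" => pd

lemma fderiv_eq_sum_pd (f : E → F) (X v : E) : fderiv ℝ f X v = ∑ i, co i v • pd i f X := by
  conv_lhs => rw [← sum_co v]
  simp [map_sum, pd]

lemma smooth_pd {f : E → F} (hf : Smooth f) (i : Dirs.ι E) : Smooth (pd i f) :=
  (hf.fderiv_right (m := ∞) (by simp)).clm_apply contDiff_const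

lemma smooth_diffAt {f : E → F} (hf : Smooth f) (X : E) : DifferentiableAt ℝ f X :=
  (hf.differentiable (by simp)) X

lemma pd_add {f g : E → F} (hf : Smooth f) (hg : Smooth g) (i : Dirs.ι E) :
    pd i (fun X => f X + g X) = fun X => pd i f X + pd i g X := by
  funext X
  simp only [pd]
  rw [fderiv_fun_add (smooth_diffAt hf X) (smooth_diffAt hg X)]
  rfl

lemma pd_clm (L : F →L[ℝ] G) {f : E → F} (hf : Smooth f) (i : Dirs.ι E) :
    pd i (fun X => L (f X)) = fun X => L (pd i f X) := by
  funext X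
  simp only [pd]
  have := (L.hasFDerivAt (x := f X)).comp X (smooth_diffAt hf X).hasFDerivAt
  have h2 : fderiv ℝ (fun X => L (f X)) X = L.comp (fderiv ℝ f X) := this.fderiv
  rw [h2]; rfl

lemma pd_bilin (B : F →L[ℝ] G →L[ℝ] H) {f : E → F} {g : E → G} (hf : Smooth f)
    (hg : Smooth g) (i : Dirs.ι E) :
    pd i (fun X => B (f X) (g X)) = fun X => B (pd i f X) (g X) + B (f X) (pd i g X) := by
  funext X
  simp only [pd]
  have := B.hasFDerivAt_of_bilinear (smooth_diffAt hf X).hasFDerivAt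
    (smooth_diffAt hg X).hasFDerivAt
  rw [this.fderiv]
  simp [add_comm]

lemma pd_comp {f : E' → F} {χ : E → E'} (hf : Smooth f) (hχ : Smooth χ)
    (i : Dirs.ι E) : pd i (fun X => f (χ X)) =
      fun X => ∑ j, pd i (fun Y => co j (χ Y)) X • pd j f (χ X) := by
  funext X
  have h1 : fderiv ℝ (fun X => f (χ X)) X = (fderiv ℝ f (χ X)).comp (fderiv ℝ χ X) :=
    fderiv_comp X (smooth_diffAt hf _) (smooth_diffAt hχ _)
  have h2 : pd i (fun X => f (χ X)) X = fderiv ℝ f (χ X) (pd i χ X) := by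
    simp only [pd]; rw [h1]; rfl
  rw [h2, fderiv_eq_sum_pd]
  refine sum_congr rfl fun j _ => ?_
  rw [pd_clm (co j) hχ i]

lemma pd_comm {f : E → F} (hf : Smooth f) (i j : Dirs.ι E) : pd i (pd j f) = pd j (pd i f) := by
  funext X
  have hd : Differentiable ℝ (fderiv ℝ f) :=
    (hf.fderiv_right (m := ∞) (by simp)).differentiable (by simp)
  have key : ∀ v w : E, fderiv ℝ (fun Y => fderiv ℝ f Y v) X w = fderiv ℝ (fderiv ℝ f) X w v := by
    intro v w
    rw [fderiv_clm_apply (hd X) (differentiableAt_const v)]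
    simp
  change fderiv ℝ (fun Y => fderiv ℝ f Y (Dirs.b j)) X (Dirs.b i) =
    fderiv ℝ (fun Y => fderiv ℝ f Y (Dirs.b i)) X (Dirs.b j)
  rw [key, key]
  have hs : IsSymmSndFDerivAt ℝ f X := by
    apply (hf.contDiffAt).isSymmSndFDerivAt
    rw [minSmoothness_of_isRCLikeNormedField]
    exact WithTop.coe_le_coe.2 (le_top : (2 : ℕ∞) ≤ ⊤)
  exact hs _ _

lemma pd_const (i : Dirs.ι E) (c : F) : pd i (fun _ : E => c) = fun _ => 0 := by
  funext X; simp [pd]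

lemma pd_linear (i : Dirs.ι E) (L : E →L[ℝ] F) : pd i (fun X => L X) = fun _ => L (Dirs.b i) := by
  funext X; simp only [pd]; rw [L.fderiv]

/-- Weights for the derivatives along the coordinate directions. A derivative in direction `i`
is estimated by the weight `wt i` and consumes `cost i` of the available order of differentiation;
estimates are required on `dom`. -/
structure Scale (E : Type*) [NormedAddCommGroup E] [NormedSpace ℝ E] [Dirs E] where
  wt : Dirs.ι E → E → ℝ
  pos : ∀ i X, 0 < wt i X
  cost : Dirs.ι E → ℕ
  dom : Set E

variable {T T' : Type*}

abbrev Est (S : Scale E) (ϖ : T → E → ℝ) (f : T → E → F) : Prop :=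
  ∃ C : ℝ, 0 ≤ C ∧ ∀ t, ∀ X ∈ S.dom, ‖f t X‖ ≤ C * ϖ t X

/-- Weighted bounds, uniform in a family, on the derivatives of order at most `n`
whose cost is at most `k`. -/
def Bd (S : Scale E) : ℕ → ℕ → (T → E → ℝ) → (T → E → F) → Prop
  | 0, _, ϖ, f => Est S ϖ f
  | n + 1, k, ϖ, f => (Est S ϖ f) ∧
      ∀ i, S.cost i ≤ k → Bd S n (k - S.cost i) (fun t X => ϖ t X * S.wt i X) (fun t => pd i (f t))

variable {S : Scale E} {S' : Scale E'} {n k : ℕ} {ϖ ϖ₁ ϖ₂ : T → E → ℝ} {f g : T → E → F}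

lemma Bd.bound (h : Bd S n k ϖ f) : Est S ϖ f := by
  cases n with
  | zero => exact h
  | succ n => exact h.1

lemma Bd.of_succ (h : Bd S (n + 1) k ϖ f) : Bd S n k ϖ f := by
  induction n generalizing k ϖ f with
  | zero => exact h.1
  | succ n ih => exact ⟨h.1, fun i hi => ih (h.2 i hi)⟩

lemma Bd.rescale {S₁ S₂ : Scale E} {k' : ℕ} (h : Bd S₁ n k ϖ₁ f) (hdom : S₂.dom ⊆ S₁.dom)
    (hcost : ∀ i, S₁.cost i ≤ S₂.cost i) (hk : k' ≤ k)
    (hwt : ∀ i, ∃ K : ℝ, 0 ≤ K ∧ ∀ X ∈ S₂.dom, S₁.wt i X ≤ K * S₂.wt i X)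
    (h0 : ∀ t, ∀ X ∈ S₂.dom, 0 ≤ ϖ₂ t X)
    (hϖ : ∃ K : ℝ, 0 ≤ K ∧ ∀ t, ∀ X ∈ S₂.dom, ϖ₁ t X ≤ K * ϖ₂ t X) : Bd S₂ n k' ϖ₂ f := by
  have base : ∀ (ϖ₁ ϖ₂ : T → E → ℝ) (f : T → E → F), (Est S₁ ϖ₁ f) →
      (∃ K : ℝ, 0 ≤ K ∧ ∀ t, ∀ X ∈ S₂.dom, ϖ₁ t X ≤ K * ϖ₂ t X) →
      (Est S₂ ϖ₂ f) := by
    rintro ϖ₁ ϖ₂ f ⟨C, hC, h⟩ ⟨K, hK, h'⟩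
    refine ⟨C * K, by positivity, fun t X hX => (h t X (hdom hX)).trans ?_⟩
    rw [mul_assoc]
    exact mul_le_mul_of_nonneg_left (h' t X hX) hC
  induction n generalizing k k' ϖ₁ ϖ₂ f with
  | zero => exact base _ _ _ h hϖ
  | succ n ih =>
    refine ⟨base _ _ _ h.1 hϖ, fun i hi => ?_⟩
    have hi1 : S₁.cost i ≤ k := ((hcost i).trans hi).trans hk
    refine ih (h.2 i hi1) (by have := hcost i; omega) ?_ ?_
    · exact fun t X hX => mul_nonneg (h0 t X hX) (S₂.pos i X).le
    · obtain ⟨K, hK, hK'⟩ := hϖ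
      obtain ⟨L, hL, hL'⟩ := hwt i
      refine ⟨K * L, by positivity, fun t X hX => ?_⟩
      calc ϖ₁ t X * S₁.wt i X ≤ (K * ϖ₂ t X) * S₁.wt i X :=
            mul_le_mul_of_nonneg_right (hK' t X hX) (S₁.pos i X).le
        _ ≤ (K * ϖ₂ t X) * (L * S₂.wt i X) :=
            mul_le_mul_of_nonneg_left (hL' X hX) (mul_nonneg hK (h0 t X hX))
        _ = _ := by ring

lemma Bd.mono (h : Bd S n k ϖ₁ f)
    (hϖ : ∃ K : ℝ, 0 ≤ K ∧ ∀ t, ∀ X ∈ S.dom, ϖ₁ t X ≤ K * ϖ₂ t X) : Bd S n k ϖ₂ f := by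
  induction n generalizing k ϖ₁ ϖ₂ f with
  | zero =>
    obtain ⟨C, hC, h⟩ := h
    obtain ⟨K, hK, h'⟩ := hϖ
    refine ⟨C * K, by positivity, fun t X hX => (h t X hX).trans ?_⟩
    rw [mul_assoc]
    exact mul_le_mul_of_nonneg_left (h' t X hX) hC
  | succ n ih =>
    obtain ⟨K, hK, h'⟩ := hϖ
    refine ⟨?_, fun i hi => ih (h.2 i hi) ?_⟩
    · obtain ⟨C, hC, h⟩ := h.1
      refine ⟨C * K, by positivity, fun t X hX => (h t X hX).trans ?_⟩
      rw [mul_assoc]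
      exact mul_le_mul_of_nonneg_left (h' t X hX) hC
    · refine ⟨K, hK, fun t X hX => ?_⟩
      rw [← mul_assoc]
      exact mul_le_mul_of_nonneg_right (h' t X hX) (S.pos i X).le

lemma Bd.congr_weight (h : Bd S n k ϖ₁ f) (hϖ : ∀ t, ∀ X ∈ S.dom, ϖ₁ t X = ϖ₂ t X) :
    Bd S n k ϖ₂ f :=
  h.mono ⟨1, zero_le_one, fun t X hX => by rw [hϖ t X hX, one_mul]⟩

lemma Bd.mono_k {k' : ℕ} (h : Bd S n k ϖ f) (hk : k' ≤ k) : Bd S n k' ϖ f := by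
  induction n generalizing k k' ϖ f with
  | zero => exact h
  | succ n ih => exact ⟨h.1, fun i hi => ih (h.2 i (hi.trans hk)) (by omega)⟩

lemma Bd.reindex (h : Bd S n k ϖ f) (r : T' → T) :
    Bd S n k (fun t => ϖ (r t)) (fun t => f (r t)) := by
  induction n generalizing k ϖ f with
  | zero => obtain ⟨C, hC, h⟩ := h; exact ⟨C, hC, fun t => h (r t)⟩
  | succ n ih =>
    refine ⟨?_, fun i hi => ih (h.2 i hi)⟩
    obtain ⟨C, hC, h⟩ := h.1; exact ⟨C, hC, fun t => h (r t)⟩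

lemma Bd.zero (hϖ : ∀ t, ∀ X ∈ S.dom, 0 ≤ ϖ t X) :
    Bd S n k ϖ (fun _ : T => fun _ : E => (0 : F)) := by
  induction n generalizing k ϖ with
  | zero => exact ⟨0, le_rfl, by simp⟩
  | succ n ih =>
    refine ⟨⟨0, le_rfl, by simp⟩, fun i _ => ?_⟩
    simp only [pd_const]
    exact ih fun t X hX => mul_nonneg (hϖ t X hX) (S.pos i X).le

lemma Bd.add (hfs : ∀ t, Smooth (f t)) (hgs : ∀ t, Smooth (g t))
    (hf : Bd S n k ϖ f) (hg : Bd S n k ϖ g) : Bd S n k ϖ (fun t X => f t X + g t X) := by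
  induction n generalizing k ϖ f g with
  | zero =>
    obtain ⟨C, hC, h⟩ := hf
    obtain ⟨K, hK, h'⟩ := hg
    refine ⟨C + K, by positivity, fun t X hX => (norm_add_le _ _).trans ?_⟩
    rw [add_mul]; exact add_le_add (h t X hX) (h' t X hX)
  | succ n ih =>
    refine ⟨?_, fun i hi => ?_⟩
    · obtain ⟨C, hC, h⟩ := hf.1
      obtain ⟨K, hK, h'⟩ := hg.1
      refine ⟨C + K, by positivity, fun t X hX => (norm_add_le _ _).trans ?_⟩
      rw [add_mul]; exact add_le_add (h t X hX) (h' t X hX)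
    · have : (fun t => pd i (fun X => f t X + g t X)) = fun t X => pd i (f t) X + pd i (g t) X := by
        funext t; rw [pd_add (hfs t) (hgs t)]
      rw [this]
      exact ih (fun t => smooth_pd (hfs t) i) (fun t => smooth_pd (hgs t) i) (hf.2 i hi) (hg.2 i hi)

lemma Bd.clm (L : F →L[ℝ] G) (hfs : ∀ t, Smooth (f t)) (hf : Bd S n k ϖ f) :
    Bd S n k ϖ (fun t X => L (f t X)) := by
  have base : ∀ (ϖ : T → E → ℝ) (f : T → E → F), (Est S ϖ f) →
      (∃ C : ℝ, 0 ≤ C ∧ ∀ t, ∀ X ∈ S.dom, ‖L (f t X)‖ ≤ C * ϖ t X) := by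
    rintro ϖ f ⟨C, hC, h⟩
    refine ⟨‖L‖ * C, by positivity, fun t X hX => (L.le_opNorm _).trans ?_⟩
    rw [mul_assoc]
    exact mul_le_mul_of_nonneg_left (h t X hX) (norm_nonneg _)
  induction n generalizing k ϖ f with
  | zero => exact base _ _ hf
  | succ n ih =>
    refine ⟨base _ _ hf.1, fun i hi => ?_⟩
    have : (fun t => pd i (fun X => L (f t X))) = fun t X => L (pd i (f t) X) := by
      funext t; rw [pd_clm L (hfs t)]
    rw [this]
    exact ih (fun t => smooth_pd (hfs t) i) (hf.2 i hi)

lemma Bd.bilin (B : F →L[ℝ] G →L[ℝ] H) {g : T → E → G} (hfs : ∀ t, Smooth (f t))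
    (hgs : ∀ t, Smooth (g t)) (hf : Bd S n k ϖ₁ f) (hg : Bd S n k ϖ₂ g) :
    Bd S n k (fun t X => ϖ₁ t X * ϖ₂ t X) (fun t X => B (f t X) (g t X)) := by
  have base : ∀ (ϖ₁ ϖ₂ : T → E → ℝ) (f : T → E → F) (g : T → E → G), (Est S ϖ₁ f) → (Est S ϖ₂ g) →
      (∃ C : ℝ, 0 ≤ C ∧ ∀ t, ∀ X ∈ S.dom, ‖B (f t X) (g t X)‖ ≤ C * (ϖ₁ t X * ϖ₂ t X)) := by
    rintro ϖ₁ ϖ₂ f g ⟨C, hC, h⟩ ⟨K, hK, h'⟩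
    refine ⟨‖B‖ * C * K, by positivity, fun t X hX => (B.le_opNorm₂ _ _).trans ?_⟩
    calc ‖B‖ * ‖f t X‖ * ‖g t X‖ ≤ ‖B‖ * (C * ϖ₁ t X) * (K * ϖ₂ t X) := by
          have h1 := h t X hX
          have h2 := h' t X hX
          have h3 : 0 ≤ C * ϖ₁ t X := (norm_nonneg _).trans h1
          gcongr
      _ = _ := by ring
  induction n generalizing k ϖ₁ ϖ₂ f g with
  | zero => exact base _ _ _ _ hf hg
  | succ n ih =>
    refine ⟨base _ _ _ _ hf.1 hg.1, fun i hi => ?_⟩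
    have : (fun t => pd i (fun X => B (f t X) (g t X))) =
        fun t X => B (pd i (f t) X) (g t X) + B (f t X) (pd i (g t) X) := by
      funext t; rw [pd_bilin B (hfs t) (hgs t)]
    rw [this]
    have sm : ∀ {F' G' : Type _} [NormedAddCommGroup F'] [NormedSpace ℝ F'] [NormedAddCommGroup G']
        [NormedSpace ℝ G'] (B : F' →L[ℝ] G' →L[ℝ] H) (f : T → E → F') (g : T → E → G'),
        (∀ t, Smooth (f t)) → (∀ t, Smooth (g t)) →
        ∀ t, Smooth (fun X => B (f t X) (g t X)) := by
      intro F' G' _ _ _ _ B f g hf hg t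
      exact (B.contDiff.comp (hf t)).clm_apply (hg t)
    refine Bd.add (sm B _ _ (fun t => smooth_pd (hfs t) i) hgs)
      (sm B _ _ hfs (fun t => smooth_pd (hgs t) i)) ?_ ?_
    · refine (ih (fun t => smooth_pd (hfs t) i) hgs (hf.2 i hi)
        (hg.of_succ.mono_k (Nat.sub_le _ _))).congr_weight ?_
      intros; ring
    · refine (ih hfs (fun t => smooth_pd (hgs t) i) (hf.of_succ.mono_k (Nat.sub_le _ _))
        (hg.2 i hi)).congr_weight ?_
      intros; ring

/-- Smooth families with weighted bounds on all derivatives of cost at most `k`. -/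
structure Sym (S : Scale E) (k : ℕ) (ϖ : T → E → ℝ) (f : T → E → F) : Prop where
  smooth : ∀ t, Smooth (f t)
  bd : ∀ n, Bd S n k ϖ f

namespace Sym

lemma bound (h : Sym S k ϖ f) : Est S ϖ f := (h.bd 0).bound

lemma mono (h : Sym S k ϖ₁ f)
    (hϖ : ∃ K : ℝ, 0 ≤ K ∧ ∀ t, ∀ X ∈ S.dom, ϖ₁ t X ≤ K * ϖ₂ t X) : Sym S k ϖ₂ f :=
  ⟨h.smooth, fun n => (h.bd n).mono hϖ⟩

lemma mono_le (h : Sym S k ϖ₁ f) (hϖ : ∀ t, ∀ X ∈ S.dom, ϖ₁ t X ≤ ϖ₂ t X) : Sym S k ϖ₂ f :=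
  h.mono ⟨1, zero_le_one, fun t X hX => by rw [one_mul]; exact hϖ t X hX⟩

lemma congr_weight (h : Sym S k ϖ₁ f) (hϖ : ∀ t, ∀ X ∈ S.dom, ϖ₁ t X = ϖ₂ t X) :
    Sym S k ϖ₂ f := h.mono_le fun t X hX => (hϖ t X hX).le

lemma mono_k {k' : ℕ} (h : Sym S k ϖ f) (hk : k' ≤ k) : Sym S k' ϖ f :=
  ⟨h.smooth, fun n => (h.bd n).mono_k hk⟩

lemma rescale {S₁ S₂ : Scale E} {k' : ℕ} (h : Sym S₁ k ϖ₁ f) (hdom : S₂.dom ⊆ S₁.dom)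
    (hcost : ∀ i, S₁.cost i ≤ S₂.cost i) (hk : k' ≤ k)
    (hwt : ∀ i, ∃ K : ℝ, 0 ≤ K ∧ ∀ X ∈ S₂.dom, S₁.wt i X ≤ K * S₂.wt i X)
    (h0 : ∀ t, ∀ X ∈ S₂.dom, 0 ≤ ϖ₂ t X)
    (hϖ : ∃ K : ℝ, 0 ≤ K ∧ ∀ t, ∀ X ∈ S₂.dom, ϖ₁ t X ≤ K * ϖ₂ t X) : Sym S₂ k' ϖ₂ f :=
  ⟨h.smooth, fun n => (h.bd n).rescale hdom hcost hk hwt h0 hϖ⟩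

lemma reindex (h : Sym S k ϖ f) (r : T' → T) : Sym S k (fun t => ϖ (r t)) (fun t => f (r t)) :=
  ⟨fun _ => h.smooth _, fun n => (h.bd n).reindex r⟩

lemma zero (hϖ : ∀ t, ∀ X ∈ S.dom, 0 ≤ ϖ t X) : Sym S k ϖ (fun _ : T => fun _ : E => (0 : F)) :=
  ⟨fun _ => contDiff_const, fun _ => Bd.zero hϖ⟩

lemma add (hf : Sym S k ϖ f) (hg : Sym S k ϖ g) : Sym S k ϖ (fun t X => f t X + g t X) :=
  ⟨fun t => (hf.smooth t).add (hg.smooth t), fun n => (hf.bd n).add hf.smooth hg.smooth (hg.bd n)⟩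

lemma clm (hf : Sym S k ϖ f) (L : F →L[ℝ] G) : Sym S k ϖ (fun t X => L (f t X)) :=
  ⟨fun t => L.contDiff.comp (hf.smooth t), fun n => (hf.bd n).clm L hf.smooth⟩

lemma bilin {g : T → E → G} (hf : Sym S k ϖ₁ f) (hg : Sym S k ϖ₂ g) (B : F →L[ℝ] G →L[ℝ] H) :
    Sym S k (fun t X => ϖ₁ t X * ϖ₂ t X) (fun t X => B (f t X) (g t X)) :=
  ⟨fun t => (B.contDiff.comp (hf.smooth t)).clm_apply (hg.smooth t),
    fun n => (hf.bd n).bilin B hf.smooth hg.smooth (hg.bd n)⟩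

lemma mul {f g : T → E → ℂ} (hf : Sym S k ϖ₁ f) (hg : Sym S k ϖ₂ g) :
    Sym S k (fun t X => ϖ₁ t X * ϖ₂ t X) (fun t X => f t X * g t X) :=
  hf.bilin hg (ContinuousLinearMap.mul ℝ ℂ)

lemma mulR {f g : T → E → ℝ} (hf : Sym S k ϖ₁ f) (hg : Sym S k ϖ₂ g) :
    Sym S k (fun t X => ϖ₁ t X * ϖ₂ t X) (fun t X => f t X * g t X) :=
  hf.bilin hg (ContinuousLinearMap.mul ℝ ℝ)

lemma smul {f : T → E → ℝ} {g : T → E → F} (hf : Sym S k ϖ₁ f) (hg : Sym S k ϖ₂ g) :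
    Sym S k (fun t X => ϖ₁ t X * ϖ₂ t X) (fun t X => f t X • g t X) :=
  hf.bilin hg (ContinuousLinearMap.lsmul ℝ ℝ)

lemma neg (hf : Sym S k ϖ f) : Sym S k ϖ (fun t X => -f t X) := hf.clm (-ContinuousLinearMap.id ℝ F)

lemma sub (hf : Sym S k ϖ f) (hg : Sym S k ϖ g) : Sym S k ϖ (fun t X => f t X - g t X) := by
  simpa only [sub_eq_add_neg] using hf.add hg.neg

lemma constMul {f : T → E → ℂ} (hf : Sym S k ϖ f) (c : ℂ) : Sym S k ϖ (fun t X => c * f t X) :=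
  hf.clm (ContinuousLinearMap.mul ℝ ℂ c)

lemma ofReal {f : T → E → ℝ} (hf : Sym S k ϖ f) : Sym S k ϖ (fun t X => (f t X : ℂ)) :=
  hf.clm Complex.ofRealCLM

lemma sum {α : Type*} (s : Finset α) {f : α → T → E → F} (hf : ∀ a ∈ s, Sym S k ϖ (f a))
    (h0 : ∀ t, ∀ X ∈ S.dom, 0 ≤ ϖ t X) : Sym S k ϖ (fun t X => ∑ a ∈ s, f a t X) := by
  classical
  induction s using Finset.induction_on with
  | empty => simpa using Sym.zero h0
  | insert a s ha ih =>
    simp only [Finset.sum_insert ha]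
    exact (hf a (Finset.mem_insert_self a s)).add
      (ih fun b hb => hf b (Finset.mem_insert_of_mem hb))

lemma pd (hf : Sym S k ϖ f) (i : Dirs.ι E) (hi : S.cost i ≤ k) :
    Sym S (k - S.cost i) (fun t X => ϖ t X * S.wt i X) (fun t => pd i (f t)) :=
  ⟨fun t => smooth_pd (hf.smooth t) i, fun n => (hf.bd (n + 1)).2 i hi⟩

lemma const (c : T → F) (hc : ∃ K : ℝ, 0 ≤ K ∧ ∀ t, ∀ X ∈ S.dom, ‖c t‖ ≤ K * ϖ t X)
    (h0 : ∀ t, ∀ X ∈ S.dom, 0 ≤ ϖ t X) : Sym S k ϖ (fun t _ => c t) := by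
  refine ⟨fun _ => contDiff_const, fun n => ?_⟩
  cases n with
  | zero => exact hc
  | succ n =>
    refine ⟨hc, fun i _ => ?_⟩
    simp only [pd_const]
    exact Bd.zero fun t X hX => mul_nonneg (h0 t X hX) (S.pos i X).le

lemma linear (L : T → E →L[ℝ] F) (hc : Est S ϖ (fun t X => L t X))
    (hd : ∀ i, ∃ K : ℝ, 0 ≤ K ∧ ∀ t, ∀ X ∈ S.dom, ‖L t (Dirs.b i)‖ ≤ K * (ϖ t X * S.wt i X))
    (h0 : ∀ t, ∀ X ∈ S.dom, 0 ≤ ϖ t X) : Sym S k ϖ (fun t X => L t X) := by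
  refine ⟨fun t => (L t).contDiff, fun n => ?_⟩
  cases n with
  | zero => exact hc
  | succ n =>
    refine ⟨hc, fun i _ => ?_⟩
    simp only [pd_linear]
    exact (Sym.const (k := k - S.cost i) _ (hd i)
      fun t X hX => mul_nonneg (h0 t X hX) (S.pos i X).le).bd n

lemma comp {f : T → E' → F} {χ : T → E → E'} {ϖ' : T → E' → ℝ} (hf : Sym S' k ϖ' f)
    (hχ : ∀ t, Smooth (χ t)) (hdom : ∀ t, ∀ X ∈ S.dom, χ t X ∈ S'.dom)
    (hcost : ∀ i j, S'.cost j ≤ S.cost i ∨ ∀ t X, pD i (fun Y => co j (χ t Y)) X = 0)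
    (h0 : ∀ t, ∀ X ∈ S'.dom, 0 ≤ ϖ' t X)
    (hc : ∀ i j, ∀ n, Bd S n k (fun t X => S.wt i X / S'.wt j (χ t X))
      (fun t => pD i (fun Y => co j (χ t Y)))) :
    Sym S k (fun t X => ϖ' t (χ t X)) (fun t X => f t (χ t X)) := by
  refine ⟨fun t => (hf.smooth t).comp (hχ t), fun n => ?_⟩
  induction n generalizing k ϖ' f with
  | zero =>
    obtain ⟨C, hC, h⟩ := hf.bound
    exact ⟨C, hC, fun t X hX => h t _ (hdom t X hX)⟩
  | succ n ih =>
    refine ⟨?_, fun i hi => ?_⟩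
    · obtain ⟨C, hC, h⟩ := hf.bound
      exact ⟨C, hC, fun t X hX => h t _ (hdom t X hX)⟩
    have e1 : (fun t => pD i (fun X => f t (χ t X))) = fun t X =>
        ∑ j, pD i (fun Y => co j (χ t Y)) X • pD j (f t) (χ t X) := by
      funext t
      rw [pd_comp (hf.smooth t) (hχ t)]
    rw [e1]
    have hs1 : ∀ j t, Smooth (pD i (fun Y => co j (χ t Y))) := fun j t =>
      smooth_pd ((co j).contDiff.comp (hχ t)) i
    have hs2 : ∀ j t, Smooth (fun X => pD j (f t) (χ t X)) := fun j t =>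
      (smooth_pd (hf.smooth t) j).comp (hχ t)
    have hw0 : ∀ t, ∀ X ∈ S.dom, 0 ≤ ϖ' t (χ t X) * S.wt i X := fun t X hX =>
      mul_nonneg (h0 t _ (hdom t X hX)) (S.pos i X).le
    have key : ∀ j, Bd S n (k - S.cost i) (fun t X => ϖ' t (χ t X) * S.wt i X)
        (fun t X => pD i (fun Y => co j (χ t Y)) X • pD j (f t) (χ t X)) := by
      intro j
      rcases hcost i j with hij | hij
      · have hjk : S'.cost j ≤ k := hij.trans hi
        have h1 := ih ((hf.pd j hjk).mono_k (k' := k - S.cost i) (by omega))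
          (fun t X hX => mul_nonneg (h0 t X hX) (S'.pos j X).le)
          (fun i' j' m => (hc i' j' m).mono_k (Nat.sub_le _ _))
        have h2 := (hc i j n).mono_k (Nat.sub_le k (S.cost i))
        refine ((h2.bilin (ContinuousLinearMap.lsmul ℝ ℝ) (hs1 j) (hs2 j) h1)).congr_weight ?_
        intro t X hX
        have := S'.pos j (χ t X)
        field_simp
      · have : (fun t X => pD i (fun Y => co j (χ t Y)) X •
          pD j (f t) (χ t X)) = fun _ _ => (0 : F) := by
          funext t X; rw [hij t X, zero_smul]
        rw [this]
        exact Bd.zero hw0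
    have : ∀ s : Finset (Dirs.ι E'), Bd S n (k - S.cost i) (fun t X => ϖ' t (χ t X) * S.wt i X)
        (fun t X => ∑ j ∈ s, pD i (fun Y => co j (χ t Y)) X • pD j (f t) (χ t X)) := by
      classical
      intro s
      induction s using Finset.induction_on with
      | empty => simpa using Bd.zero hw0
      | insert a s ha ihs =>
        simp only [Finset.sum_insert ha]
        refine Bd.add (fun t => (hs1 a t).smul (hs2 a t)) (fun t => ?_) (key a) ihs
        exact ContDiff.sum fun j _ => (hs1 j t).smul (hs2 j t)
    exact this univ

lemma cexp {θ : T → E → ℝ} (hθ : ∀ t, Smooth (θ t))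
    (h : ∀ i, ∀ n, Bd S n k (fun _ X => S.wt i X) (fun t => pD i (θ t))) :
    Sym S k (fun _ _ => 1) (fun t X => eI (θ t X)) := by
  have hsm : ∀ t, Smooth (fun X => eI (θ t X)) := fun t =>
    (contDiff_const.mul (Complex.ofRealCLM.contDiff.comp (hθ t))).cexp
  have base : ∃ C : ℝ, 0 ≤ C ∧ ∀ t, ∀ X ∈ S.dom, ‖eI (θ t X)‖ ≤ C * (1 : ℝ) :=
    ⟨1, zero_le_one, fun t X _ => by rw [mul_comm, Complex.norm_exp_ofReal_mul_I]; simp⟩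
  refine ⟨hsm, fun n => ?_⟩
  induction n generalizing k with
  | zero => exact base
  | succ n ih =>
    refine ⟨base, fun i hi => ?_⟩
    have e1 : (fun t => pD i (fun X => eI (θ t X))) = fun t X => (pD i (θ t) X) •
          (I * eI (θ t X)) := by
      funext t X
      have h1 : HasFDerivAt (fun X => I * (θ t X : ℂ))
          (I • (Complex.ofRealCLM.comp (fderiv ℝ (θ t) X))) X :=
        ((Complex.ofRealCLM.hasFDerivAt.comp X (smooth_diffAt (hθ t) X).hasFDerivAt)).const_mul _
      simp only [MagneticFIO.pd]
      rw [h1.cexp.fderiv]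
      simp only [smul_eq_mul, _root_.smul_apply, ContinuousLinearMap.comp_apply,
        Complex.ofRealCLM_apply, Complex.real_smul]
      ring
    rw [e1]
    have h1 := (h i n).mono_k (Nat.sub_le k (S.cost i))
    have h2 := (ih fun j m => (h j m).mono_k (Nat.sub_le k (S.cost i))).clm
      (ContinuousLinearMap.mul ℝ ℂ I) hsm
    refine (h1.bilin (ContinuousLinearMap.lsmul ℝ ℝ) (fun t => smooth_pd (hθ t) i)
      (fun t => contDiff_const.mul (hsm t)) h2).congr_weight ?_
    intros; ring

lemma inv {f : T → E → ℝ} (hf : Sym S k ϖ f) (hpos : ∀ t X, 0 < f t X)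
    (hϖ : ∀ t, ∀ X ∈ S.dom, 0 < ϖ t X)
    (hlow : ∃ K : ℝ, 0 ≤ K ∧ ∀ t, ∀ X ∈ S.dom, ϖ t X ≤ K * f t X) :
    Sym S k (fun t X => (ϖ t X)⁻¹) (fun t X => (f t X)⁻¹) := by
  have hsm : ∀ t, Smooth (fun X => (f t X)⁻¹) := fun t =>
    (hf.smooth t).inv fun X => (hpos t X).ne'
  have base : ∃ C : ℝ, 0 ≤ C ∧ ∀ t, ∀ X ∈ S.dom, ‖(f t X)⁻¹‖ ≤ C * (ϖ t X)⁻¹ := by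
    obtain ⟨K, hK, h⟩ := hlow
    refine ⟨K, hK, fun t X hX => ?_⟩
    have h1 := hpos t X
    have h2 := hϖ t X hX
    rw [norm_inv, Real.norm_of_nonneg h1.le, ← div_eq_mul_inv, inv_eq_one_div, div_le_div_iff₀ h1 h2]
    simpa using h t X hX
  refine ⟨hsm, fun n => ?_⟩
  induction n generalizing k with
  | zero => exact base
  | succ n ih =>
    refine ⟨base, fun i hi => ?_⟩
    have e1 : (fun t => pD i (fun X => (f t X)⁻¹)) =
        fun t X => -((f t X)⁻¹ * ((f t X)⁻¹ * pD i (f t) X)) := by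
      funext t X
      simp only [MagneticFIO.pd]
      have h1 : HasFDerivAt (fun X => (f t X)⁻¹) _ X :=
        (hasDerivAt_inv (hpos t X).ne').comp_hasFDerivAt X
          (smooth_diffAt (hf.smooth t) X).hasFDerivAt
      rw [h1.fderiv]
      simp only [_root_.smul_apply, smul_eq_mul]
      have := (hpos t X).ne'
      field_simp
    rw [e1]
    have h1 := (hf.pd i hi).bd n
    have h2 := ih (hf.mono_k (Nat.sub_le k (S.cost i)))
    have hm := fun t => (hsm t).mul (smooth_pd (hf.smooth t) i)
    have h3 := h2.bilin (ContinuousLinearMap.mul ℝ ℝ) hsm hm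
      (h2.bilin (ContinuousLinearMap.mul ℝ ℝ) hsm (fun t => smooth_pd (hf.smooth t) i) h1)
    refine (h3.clm (-ContinuousLinearMap.id ℝ ℝ) (fun t => (hsm t).mul (hm t))).congr_weight ?_
    intro t X hX
    have := hϖ t X hX
    field_simp

/-- Functions that vanish off the domain of the estimates satisfy them everywhere. -/
lemma of_support {S₁ S₂ : Scale E} (h : Sym S₁ k ϖ f) (hcl : IsClosed S₁.dom)
    (hwt : S₂.wt = S₁.wt) (hcost : S₂.cost = S₁.cost)
    (hz : ∀ t, ∀ X ∉ S₁.dom, f t X = 0) (h0 : ∀ t, ∀ X ∈ S₂.dom, 0 ≤ ϖ t X) :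
    Sym S₂ k ϖ f := by
  refine ⟨h.smooth, fun n => ?_⟩
  have base : ∀ (ϖ : T → E → ℝ) (f : T → E → F), (Est S₁ ϖ f) →
      (∀ t, ∀ X ∉ S₁.dom, f t X = 0) → (∀ t, ∀ X ∈ S₂.dom, 0 ≤ ϖ t X) →
      (Est S₂ ϖ f) := by
    rintro ϖ f ⟨C, hC, h⟩ hz h0
    refine ⟨C, hC, fun t X hX => ?_⟩
    by_cases hX1 : X ∈ S₁.dom
    · exact h t X hX1
    · rw [hz t X hX1, norm_zero]
      exact mul_nonneg hC (h0 t X hX)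
  have h' := h.bd n
  clear h
  induction n generalizing k ϖ f with
  | zero => exact base _ _ h' hz h0
  | succ n ih =>
    refine ⟨base _ _ h'.1 hz h0, fun i hi => ?_⟩
    rw [hcost] at hi ⊢
    rw [hwt]
    refine ih ?_ ?_ (h'.2 i hi)
    · intro t X hX
      have : f t =ᶠ[𝓝 X] fun _ => 0 := by
        filter_upwards [hcl.isOpen_compl.mem_nhds hX] with Y hY using hz t Y hY
      simp only [MagneticFIO.pd]
      rw [this.fderiv_eq]
      simp
    · exact fun t X hX => mul_nonneg (h0 t X hX) (hwt ▸ (S₂.pos i X)).le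

end Sym

end

variable {E E' F : Type*} [NormedAddCommGroup E] [NormedSpace ℝ E] [Dirs E]
  [NormedAddCommGroup E'] [NormedSpace ℝ E'] [Dirs E'] [NormedAddCommGroup F] [NormedSpace ℝ F]
  {S : Scale E} {S' : Scale E'} {A : Conf d → Conf d} {U φ : Fn d ℝ} {B : Fld d} {m m' N : ℝ} {a b : Fn d ℂ}

section

variable {E F : Type} [NormedAddCommGroup E] [NormedSpace ℝ E] [FiniteDimensional ℝ E]
  [NormedAddCommGroup F] [NormedSpace ℝ F]

lemma fderiv_slice {f : ℝ × E → F} (hf : Smooth f) (s : ℝ) (X : E) :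
    HasFDerivAt (fun Y => f (s, Y)) ((fderiv ℝ f (s, X)).comp (inr ℝ ℝ E)) X := by
  have h1 : HasFDerivAt (fun Y : E => (s, Y)) (inr ℝ ℝ E) X := hasFDerivAt_prodMk_right s X
  exact (((hf.differentiable (by simp)) (s, X)).hasFDerivAt).comp X h1

lemma hasFDerivAt_intervalIntegral {f : ℝ × E → F} (hf : Smooth f) (X : E) :
    HasFDerivAt (fun Y => ∫ s in 0..1, f (s, Y))
      (∫ s in 0..1, (fderiv ℝ f (s, X)).comp (inr ℝ ℝ E)) X := by
  have hcd : Continuous fun q : ℝ × E => (fderiv ℝ f q).comp (inr ℝ ℝ E) :=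
    (hf.continuous_fderiv (by simp)).clm_comp continuous_const
  have hK : IsCompact (𝕀 ×ˢ Metric.closedBall X 1) := isCompact_Icc.prod (isCompact_closedBall X 1)
  obtain ⟨C, hC⟩ := hK.exists_bound_of_continuousOn hcd.continuousOn
  refine intervalIntegral.hasFDerivAt_integral_of_dominated_of_fderiv_le
    (F' := fun Y s => (fderiv ℝ f (s, Y)).comp (inr ℝ ℝ E))
    (bound := fun _ => C) (s := Metric.ball X 1) (Metric.ball_mem_nhds X one_pos) ?_ ?_ ?_ ?_ ?_ ?_
  · exact .of_forall fun Y =>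
      (hf.continuous.comp (by fun_prop : Continuous fun s : ℝ => (s, Y))).aestronglyMeasurable
  · exact (hf.continuous.comp (by fun_prop : Continuous fun s : ℝ => (s, X))).intervalIntegrable _ _
  · exact (hcd.comp (by fun_prop : Continuous fun s : ℝ => (s, X))).aestronglyMeasurable
  · refine .of_forall fun s hs Y hY => hC (s, Y) ⟨?_, ?_⟩
    · rw [Set.uIoc_of_le zero_le_one] at hs
      exact ⟨hs.1.le, hs.2⟩
    · exact Metric.ball_subset_closedBall hY
  · exact intervalIntegrable_const
  · exact .of_forall fun s _ Y _ => fderiv_slice hf s Y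

lemma contDiff_intervalIntegral {f : ℝ × E → F} (hf : Smooth f) :
    Smooth (fun Y => ∫ s in 0..1, f (s, Y)) := by
  rw [contDiff_infty]
  intro n
  induction n generalizing F with
  | zero =>
    exact contDiff_zero.2 (continuous_iff_continuousAt.2 fun X =>
      (hasFDerivAt_intervalIntegral hf X).continuousAt)
  | succ n ih =>
    rw [show ((n + 1 : ℕ) : WithTop ℕ∞) = (n : WithTop ℕ∞) + 1 by norm_cast,
      contDiff_succ_iff_fderiv]
    refine ⟨fun X => (hasFDerivAt_intervalIntegral hf X).differentiableAt, by simp, ?_⟩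
    have : fderiv ℝ (fun Y => ∫ s in 0..1, f (s, Y)) = fun X =>
        ∫ s in 0..1, (fderiv ℝ f (s, X)).comp (inr ℝ ℝ E) :=
      funext fun X => (hasFDerivAt_intervalIntegral hf X).fderiv
    rw [this]
    exact ih (f := fun q => (fderiv ℝ f q).comp (inr ℝ ℝ E))
      ((hf.fderiv_right (m := ∞) (by simp)).clm_comp contDiff_const)

end

section

variable {E F : Type} [NormedAddCommGroup E] [NormedSpace ℝ E] [Dirs E]
  [NormedAddCommGroup F] [NormedSpace ℝ F] {S : Scale E} {k : ℕ}

lemma pd_slice {f : ℝ × E → F} (hf : Smooth f) (i : Dirs.ι E) (s : ℝ) (X : E) :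
    pd i (fun Y => f (s, Y)) X = fderiv ℝ f (s, X) (0, Dirs.b i) := by
  have := Dirs.finiteDimensional E
  simp only [pd]
  rw [(fderiv_slice hf s X).fderiv]
  simp

lemma smooth_pd_slice {f : ℝ × E → F} (hf : Smooth f) (i : Dirs.ι E) :
    Smooth (fun q : ℝ × E => pd i (fun Y => f (q.1, Y)) q.2) := by
  have : (fun q : ℝ × E => pd i (fun Y => f (q.1, Y)) q.2) =
      fun q => fderiv ℝ f q (0, Dirs.b i) := by
    funext q; rw [pd_slice hf]
  rw [this]
  exact (hf.fderiv_right (m := ∞) (by simp)).clm_apply contDiff_const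

lemma pd_intervalIntegral [CompleteSpace F] {f : ℝ × E → F} (hf : Smooth f) (i : Dirs.ι E) :
    pd i (fun Y => ∫ s in 0..1, f (s, Y)) = fun X => ∫ s in 0..1, pd i (fun Y => f (s, Y)) X := by
  have := Dirs.finiteDimensional E
  funext X
  simp only [pd]
  rw [(hasFDerivAt_intervalIntegral hf X).fderiv]
  have hcd : Continuous fun s : ℝ => (fderiv ℝ f (s, X)).comp (inr ℝ ℝ E) :=
    ((hf.continuous_fderiv (by simp)).comp
      (by fun_prop : Continuous fun s : ℝ => (s, X))).clm_comp continuous_const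
  rw [ContinuousLinearMap.intervalIntegral_apply (hcd.intervalIntegrable _ _)]
  refine intervalIntegral.integral_congr fun s _ => ?_
  rw [(fderiv_slice hf s X).fderiv]

lemma Bd.integral [CompleteSpace F] {n : ℕ} {ϖ : T → E → ℝ} {f : T → ℝ → E → F}
    (hs : ∀ t, Smooth (fun q : ℝ × E => f t q.1 q.2))
    (hf : Bd S n k (fun (q : T × 𝕀) X => ϖ q.1 X) (fun q => f q.1 q.2)) :
    Bd S n k ϖ (fun t X => ∫ s in 0..1, f t s X) := by
  have base : ∀ (ϖ : T → E → ℝ) (f : T → ℝ → E → F), (∃ C : ℝ, 0 ≤ C ∧ ∀ t : T × 𝕀, ∀ X ∈ S.dom,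
        ‖f t.1 t.2 X‖ ≤ C * ϖ t.1 X) →
      (∃ C : ℝ, 0 ≤ C ∧ ∀ t, ∀ X ∈ S.dom, ‖∫ s in 0..1, f t s X‖ ≤ C * ϖ t X) := by
    rintro ϖ f ⟨C, hC, h⟩
    refine ⟨C, hC, fun t X hX => ?_⟩
    have := intervalIntegral.norm_integral_le_of_norm_le_const (a := (0 : ℝ)) (b := 1)
      (f := fun s => f t s X) (C := C * ϖ t X) ?_
    · simpa using this
    · intro s hs
      rw [Set.uIoc_of_le zero_le_one] at hs
      exact h (t, ⟨s, hs.1.le, hs.2⟩) X hX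
  induction n generalizing k ϖ f with
  | zero => exact base _ _ hf
  | succ n ih =>
    refine ⟨base _ _ hf.1, fun i hi => ?_⟩
    have : (fun t => pd i (fun X => ∫ s in 0..1, f t s X)) =
        fun t X => ∫ s in 0..1, pd i (f t s) X := by
      funext t
      exact pd_intervalIntegral (hs t) i
    rw [this]
    exact ih (f := fun t s => pd i (f t s)) (fun t => smooth_pd_slice (hs t) i) (hf.2 i hi)

lemma Sym.integral [CompleteSpace F] {ϖ : T → E → ℝ} {f : T → ℝ → E → F}
    (hs : ∀ t, Smooth (fun q : ℝ × E => f t q.1 q.2))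
    (hf : Sym S k (fun (q : T × 𝕀) X => ϖ q.1 X) (fun q => f q.1 q.2)) :
    Sym S k ϖ (fun t X => ∫ s in 0..1, f t s X) :=
  haveI := Dirs.finiteDimensional E
  ⟨fun t => contDiff_intervalIntegral (hs t), fun n => (hf.bd n).integral hs⟩

lemma Bd.of_iteratedFDeriv {n K : ℕ} {ϖ : T → E → ℝ} {f : T → E → F}
    (hwt : ∀ i X, S.wt i X = 1) (hs : ∀ t, Smooth (f t))
    (hK : n ≤ K ∨ ((∀ i, 1 ≤ S.cost i) ∧ k ≤ K))
    (h : ∀ m ≤ K, ∃ C : ℝ, 0 ≤ C ∧ ∀ t, ∀ X ∈ S.dom, ‖iteratedFDeriv ℝ m (f t) X‖ ≤ C * ϖ t X) :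
    Bd S n k ϖ f := by
  have base : Est S ϖ f := by
    simpa using h 0 (Nat.zero_le _)
  induction n generalizing k K f with
  | zero => exact base
  | succ n ih =>
    refine ⟨base, fun i hi => ?_⟩
    have hK1 : 1 ≤ K := by
      rcases hK with h1 | ⟨h1, h2⟩
      · omega
      · exact ((h1 i).trans hi).trans h2
    have h' : ∀ m ≤ K - 1, ∃ C : ℝ, 0 ≤ C ∧ ∀ t, ∀ X ∈ S.dom,
        ‖iteratedFDeriv ℝ m (pd i (f t)) X‖ ≤ C * ϖ t X := by
      intro m hm
      obtain ⟨C, hC, hb⟩ := h (m + 1) (by omega)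
      refine ⟨‖Dirs.b i‖ * C, by positivity, fun t X hX => ?_⟩
      have h1 := (ContinuousLinearMap.apply ℝ F (Dirs.b i)).norm_iteratedFDeriv_comp_left
        (f := fderiv ℝ (f t)) (x := X) (N := ∞) (n := m)
        ((hs t).fderiv_right (m := ∞) (by simp)).contDiffAt (by exact_mod_cast le_top)
      have h2 : ‖ContinuousLinearMap.apply ℝ F (Dirs.b i)‖ ≤ ‖Dirs.b i‖ := by
        refine ContinuousLinearMap.opNorm_le_bound _ (norm_nonneg _) fun L => ?_
        rw [ContinuousLinearMap.apply_apply, mul_comm]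
        exact L.le_opNorm _
      rw [norm_iteratedFDeriv_fderiv] at h1
      calc _ ≤ _ := h1
        _ ≤ ‖Dirs.b i‖ * (C * ϖ t X) := by
          gcongr
          exact hb t X hX
        _ = _ := by ring
    refine (ih (k := k - S.cost i) (K := K - 1) (fun t => smooth_pd (hs t) i) ?_ h' ?_).congr_weight
      (ϖ₁ := ϖ) fun t X _ => by rw [hwt, mul_one]
    · rcases hK with h1 | ⟨h1, h2⟩
      · left; omega
      · right; exact ⟨h1, by have := h1 i; omega⟩
    · simpa using h' 0 (Nat.zero_le _)

lemma Bd.iteratedFDeriv_le {n m : ℕ} {ϖ : T → E → ℝ} {f : T → E → F}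
    (hwt : ∀ i X, S.wt i X = 1) (hs : ∀ t, Smooth (f t)) (hcost : ∀ i, S.cost i ≤ 1)
    (hf : Bd S n k ϖ f) (hmn : m ≤ n) (hmk : m ≤ k ∨ ∀ i, S.cost i = 0) :
    ∃ C : ℝ, 0 ≤ C ∧ ∀ t, ∀ X ∈ S.dom, ‖iteratedFDeriv ℝ m (f t) X‖ ≤ C * ϖ t X := by
  induction m generalizing n k f with
  | zero => simpa using hf.bound
  | succ m ih =>
    obtain ⟨n, rfl⟩ : ∃ n', n = n' + 1 := ⟨n - 1, by omega⟩
    have hk1 : ∀ i, S.cost i ≤ k := by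
      intro i
      rcases hmk with h | h
      · exact (hcost i).trans (by omega)
      · rw [h i]; exact Nat.zero_le _
    have h1 : ∀ i, ∃ C : ℝ, 0 ≤ C ∧ ∀ t, ∀ X ∈ S.dom,
        ‖iteratedFDeriv ℝ m (pd i (f t)) X‖ ≤ C * ϖ t X := by
      intro i
      refine ih (k := k - S.cost i) (fun t => smooth_pd (hs t) i)
        ((hf.2 i (hk1 i)).congr_weight fun t X _ => by rw [hwt, mul_one]) (by omega) ?_
      rcases hmk with h | h
      · left; have := hcost i; omega
      · right; exact h
    choose C hC hb using h1
    set L : Dirs.ι E → F →L[ℝ] (E →L[ℝ] F) := fun i =>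
      ContinuousLinearMap.smulRightL ℝ E F (co i) with hL
    refine ⟨∑ i, ‖L i‖ * C i, sum_nonneg fun i _ => mul_nonneg (norm_nonneg (L i)) (hC i),
      fun t X hX => ?_⟩
    rw [← norm_iteratedFDeriv_fderiv]
    have e1 : fderiv ℝ (f t) = fun X => ∑ i, L i (pd i (f t) X) := by
      funext X
      ext v
      rw [fderiv_eq_sum_pd]
      simp [hL]
    have hsm : ∀ i, Smooth (fun X => L i (pd i (f t) X)) := fun i =>
      (L i).contDiff.comp (smooth_pd (hs t) i)
    have hm : (m : WithTop ℕ∞) ≤ ∞ := by exact_mod_cast le_top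
    rw [e1, iteratedFDeriv_sum fun i _ => ((hsm i).of_le hm)]
    rw [Finset.sum_apply, sum_mul]
    refine (norm_sum_le _ _).trans (sum_le_sum fun i _ => ?_)
    rw [mul_assoc]
    exact ((L i).norm_iteratedFDeriv_comp_left (smooth_pd (hs t) i).contDiffAt hm).trans
      (mul_le_mul_of_nonneg_left (hb i t X hX) (norm_nonneg _))

end

lemma br_sq (ξ : Conf d) : br ξ ^ 2 = 1 + ‖ξ‖ ^ 2 := by
  rw [bracket, Real.sq_sqrt (by positivity)]

lemma one_le_br (ξ : Conf d) : 1 ≤ br ξ := by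
  rw [bracket, Real.one_le_sqrt]; nlinarith [sq_nonneg ‖ξ‖]

lemma br_pos (ξ : Conf d) : 0 < br ξ := lt_of_lt_of_le one_pos (one_le_br ξ)

lemma br_rpow_pos {d : ℕ} (x : Conf d) (m : ℝ) : 0 < br x ^ m := Real.rpow_pos_of_pos (br_pos _) _

lemma br_rpow_mono (x : Conf d) {m m' : ℝ} (h : m ≤ m') : br x ^ m ≤ br x ^ m' :=
  Real.rpow_le_rpow_of_exponent_le (one_le_br _) h

lemma norm_le_br (ξ : Conf d) : ‖ξ‖ ≤ br ξ := by
  rw [bracket]; exact Real.le_sqrt_of_sq_le (by linarith)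

lemma abs_coord_le_br (ξ : Conf d) (j : Fin d) : |ξ j| ≤ br ξ :=
  (PiLp.norm_apply_le ξ j).trans (norm_le_br ξ)

lemma br_le_one_add (ξ : Conf d) : br ξ ≤ 1 + ‖ξ‖ := by
  rw [bracket, Real.sqrt_le_left (by positivity)]; nlinarith [norm_nonneg ξ]

lemma br_add_le (x y : Conf d) : br (x + y) ≤ 2 * br x * br y := by
  have h1 := br_le_one_add (x + y)
  have h2 := norm_add_le x y
  have h3 := norm_le_br x
  have h4 := norm_le_br y
  nlinarith [one_le_br x, one_le_br y, br_sq x, br_sq y, norm_nonneg x, norm_nonneg y,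
    mul_nonneg (sub_nonneg.2 (one_le_br x)) (sub_nonneg.2 (one_le_br y)), sq_nonneg (‖x‖ - ‖y‖),
    abs_le_of_sq_le_sq' (show (1 + ‖x‖ + ‖y‖) ^ 2 ≤ (2 * br x * br y) ^ 2 by
      rw [mul_pow, mul_pow, br_sq, br_sq]
      nlinarith [sq_nonneg (‖x‖ - ‖y‖), sq_nonneg (‖x‖ * ‖y‖ - 1), sq_nonneg (‖x‖-1), sq_nonneg (‖y‖-1), mul_nonneg (norm_nonneg x) (norm_nonneg y), sq_nonneg (‖x‖ * ‖y‖)]) (by positivity [br_pos x, br_pos y])]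

lemma continuous_br : Continuous (bracket (d := d)) := by
  unfold bracket; fun_prop

lemma br_smul_le (x : Conf d) {t : ℝ} (h0 : 0 ≤ t) (h1 : t ≤ 1) : br (t • x) ≤ br x := by
  rw [bracket, bracket]
  apply Real.sqrt_le_sqrt
  rw [norm_smul, Real.norm_of_nonneg h0, mul_pow]
  nlinarith [sq_nonneg ‖x‖, mul_le_one₀ h1 h0 h1]

lemma br_neg (x : Conf d) : br (-x) = br x := by simp [bracket]

/-- Peetre's inequality. -/
lemma br_add_rpow_le (x y : Conf d) (m : ℝ) : br (x + y) ^ m ≤ 2 ^ |m| * br x ^ m * br y ^ |m| := by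
  have hx := br_pos x
  have hy := br_pos y
  have hxy := br_pos (x + y)
  rcases le_total 0 m with hm | hm
  · rw [abs_of_nonneg hm, ← Real.mul_rpow (by norm_num) hx.le,
      ← Real.mul_rpow (by positivity) hy.le]
    exact Real.rpow_le_rpow hxy.le (br_add_le x y) hm
  · rw [abs_of_nonpos hm]
    have h := br_add_le (x + y) (-y)
    rw [add_neg_cancel_right, br_neg] at h
    have h2 := Real.rpow_le_rpow hx.le h (neg_nonneg.2 hm)
    rw [Real.mul_rpow (by positivity) hy.le, Real.mul_rpow (by norm_num) hxy.le] at h2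
    have e1 : br (x + y) ^ (-m) * br (x + y) ^ m = 1 := by
      rw [← Real.rpow_add hxy]; simp
    have e2 : br x ^ (-m) * br x ^ m = 1 := by rw [← Real.rpow_add hx]; simp
    have p1 : 0 < br (x + y) ^ m := Real.rpow_pos_of_pos hxy _
    have p2 : 0 < br x ^ m := Real.rpow_pos_of_pos hx _
    calc br (x + y) ^ m = (br x ^ (-m)) * (br (x + y) ^ m * br x ^ m) := by
          linear_combination (-(br (x + y) ^ m)) * e2
      _ ≤ (2 ^ (-m) * br (x + y) ^ (-m) * br y ^ (-m)) * (br (x + y) ^ m * br x ^ m) := by gcongr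
      _ = _ := by linear_combination (2 ^ (-m) * br y ^ (-m) * br x ^ m) * e1

def unc (f : Fn d F) : Ph d → F := fun p => f p.1 p.2

lemma unc_dX {f : Fn d F} (hf : Smooth (unc f)) (j : Fin d) :
    unc (dX j f) = pd (E := Ph d) (Sum.inl j) (unc f) := by
  funext p
  have h1 : HasFDerivAt (fun y : Conf d => (y, p.2)) (inl ℝ _ _) p.1 :=
    hasFDerivAt_prodMk_left p.1 p.2
  have h2 := ((smooth_diffAt hf p).hasFDerivAt).comp p.1 h1
  change fderiv ℝ (fun y => f y p.2) p.1 _ = _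
  have h3 : fderiv ℝ (fun y => f y p.2) p.1 = _ := h2.fderiv
  rw [h3]
  simp [pd]

lemma unc_dXi {f : Fn d F} (hf : Smooth (unc f)) (j : Fin d) :
    unc (dXi j f) = pd (E := Ph d) (Sum.inr j) (unc f) := by
  funext p
  have h1 : HasFDerivAt (fun y : Conf d => (p.1, y)) (inr ℝ _ _) p.2 :=
    hasFDerivAt_prodMk_right p.1 p.2
  have h2 := ((smooth_diffAt hf p).hasFDerivAt).comp p.2 h1
  change fderiv ℝ (fun y => f p.1 y) p.2 _ = _
  have h3 : fderiv ℝ (fun y => f p.1 y) p.2 = _ := h2.fderiv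
  rw [h3]
  simp [pd]

lemma smooth_dX {f : Fn d F} (hf : Smooth (unc f)) (j : Fin d) :
    Smooth (unc (dX j f)) := by rw [unc_dX hf]; exact smooth_pd hf _

lemma smooth_dXi {f : Fn d F} (hf : Smooth (unc f)) (j : Fin d) :
    Smooth (unc (dXi j f)) := by rw [unc_dXi hf]; exact smooth_pd hf _

lemma unc_injective {f g : Fn d F} (h : unc f = unc g) : f = g := by
  funext x ξ; exact congrFun h (x, ξ)

lemma dXi_dX {f : Fn d F} (hf : Smooth (unc f)) (i j : Fin d) :
    dXi j (dX i f) = dX i (dXi j f) := by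
  apply unc_injective
  rw [unc_dXi (smooth_dX hf i), unc_dX (smooth_dXi hf j), unc_dX hf, unc_dXi hf, pd_comm hf]

lemma smooth_mixedPartial {f : Fn d F} (hf : Smooth (unc f))
    (I J : List (Fin d)) : Smooth (unc (mixedPartial I J f)) := by
  induction I with
  | nil =>
    induction J with
    | nil => exact hf
    | cons j J ih => exact smooth_dXi ih j
  | cons i I ih => exact smooth_dX ih i

lemma dXi_mixedPartial {f : Fn d F} (hf : Smooth (unc f)) (I J : List (Fin d)) (j : Fin d) :
    dXi j (mixedPartial I J f) = mixedPartial I (j :: J) f := by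
  induction I with
  | nil => rfl
  | cons i I ih =>
    change dXi j (dX i (mixedPartial I J f)) = dX i (mixedPartial I (j :: J) f)
    rw [dXi_dX (smooth_mixedPartial hf I J), ih]

def symScale (d : ℕ) : Scale (Ph d) where
  wt := Sum.elim (fun _ _ => 1) (fun _ X => (br X.2)⁻¹)
  pos := by
    rintro (i | i) X
    · exact one_pos
    · exact inv_pos.2 (br_pos _)
  cost := fun _ => 0
  dom := Set.univ

lemma IsSymbol.bd {f : Fn d F} (hf : IsSymbol m f) (n k : ℕ)
    (I J : List (Fin d)) : Bd (symScale d) n k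
      (fun _ X => br X.2 ^ (m - J.length)) (fun _ : T => unc (mixedPartial I J f)) := by
  have base : ∀ I J, ∃ C : ℝ, 0 ≤ C ∧ ∀ t : T, ∀ X ∈ (symScale d).dom,
      ‖unc (mixedPartial I J f) X‖ ≤ C * br X.2 ^ (m - J.length) := by
    intro I J
    obtain ⟨C, hC⟩ := hf.bounded I J
    refine ⟨|C|, abs_nonneg _, fun _ X _ => ?_⟩
    have h1 := hC X.1 X.2
    have h2 := br_pos X.2
    have h3 : br X.2 ^ (m - J.length) * br X.2 ^ ((J.length : ℝ) - m) = 1 := by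
      rw [← Real.rpow_add h2]; simp
    have h4 : 0 < br X.2 ^ (m - J.length) := Real.rpow_pos_of_pos h2 _
    calc ‖unc (mixedPartial I J f) X‖ = br X.2 ^ (m - J.length) *
          (br X.2 ^ ((J.length : ℝ) - m) * ‖mixedPartial I J f X.1 X.2‖) := by
            rw [← mul_assoc, h3, one_mul]; rfl
      _ ≤ br X.2 ^ (m - J.length) * |C| :=
          mul_le_mul_of_nonneg_left (h1.trans (le_abs_self C)) h4.le
      _ = _ := mul_comm _ _
  have hs : Smooth (unc f) := hf.smooth
  induction n generalizing k I J with
  | zero => exact base I J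
  | succ n ih =>
    refine ⟨base I J, ?_⟩
    rintro (i | j) _
    · change Bd (symScale d) n _ _
        (fun _ : T => pd (E := Ph d) (Sum.inl i) (unc (mixedPartial I J f)))
      rw [← unc_dX (smooth_mixedPartial hs I J)]
      refine (ih (k - (symScale d).cost (Sum.inl i)) (i :: I) J).congr_weight fun t X _ => ?_
      simp [symScale]
    · change Bd (symScale d) n _ _
        (fun _ : T => pd (E := Ph d) (Sum.inr j) (unc (mixedPartial I J f)))
      rw [← unc_dXi (smooth_mixedPartial hs I J), dXi_mixedPartial hs]
      refine (ih (k - (symScale d).cost (Sum.inr j)) I (j :: J)).congr_weight fun t X _ => ?_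
      change _ = br X.2 ^ (m - J.length) * (br X.2)⁻¹
      rw [← Real.rpow_neg_one, ← Real.rpow_add (br_pos _)]
      congr 1
      push_cast [List.length_cons]
      ring

lemma IsSymbol.sym {f : Fn d F} (hf : IsSymbol m f) (k : ℕ) :
    Sym (symScale d) k (fun _ X => br X.2 ^ m) (fun _ : T => unc f) :=
  ⟨fun _ => hf.smooth, fun n => by simpa [mixedPartial] using hf.bd n k [] []⟩

lemma Sym.isSymbol {f : Fn d F} (t₀ : T)
    (hf : Sym (symScale d) 0 (fun _ X => br X.2 ^ m) (fun _ : T => unc f)) : IsSymbol m f := by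
  have hs : Smooth (unc f) := hf.smooth t₀
  refine ⟨hs, fun I J => ?_⟩
  have h : Sym (symScale d) 0 (fun _ X => br X.2 ^ (m - J.length))
      (fun _ : T => unc (mixedPartial I J f)) := by
    induction I with
    | nil =>
      induction J with
      | nil => simpa [mixedPartial] using hf
      | cons j J ih =>
        change Sym (symScale d) 0 _ (fun _ : T => unc (dXi j (mixedPartial [] J f)))
        rw [unc_dXi (smooth_mixedPartial hs [] J)]
        refine (ih.pd (Sum.inr j) le_rfl).congr_weight fun t X _ => ?_
        change br X.2 ^ (m - J.length) * (br X.2)⁻¹ = _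
        rw [← Real.rpow_neg_one, ← Real.rpow_add (br_pos _)]
        congr 1
        push_cast [List.length_cons]
        ring
    | cons i I ih =>
      change Sym (symScale d) 0 _ (fun _ : T => unc (dX i (mixedPartial I J f)))
      rw [unc_dX (smooth_mixedPartial hs I J)]
      refine (ih.pd (Sum.inl i) le_rfl).congr_weight fun t X _ => ?_
      simp [symScale]
  obtain ⟨C, hC, hb⟩ := h.bound
  refine ⟨C, fun x ξ => ?_⟩
  have h1 := hb t₀ (x, ξ) (Set.mem_univ _)
  have h2 := br_pos ξ
  have h3 : br ξ ^ ((J.length : ℝ) - m) * br ξ ^ (m - J.length) = 1 := by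
    rw [← Real.rpow_add h2]; simp
  have h4 : 0 < br ξ ^ ((J.length : ℝ) - m) := Real.rpow_pos_of_pos h2 _
  calc br ξ ^ ((J.length : ℝ) - m) * ‖mixedPartial I J f x ξ‖
      ≤ br ξ ^ ((J.length : ℝ) - m) * (C * br ξ ^ (m - J.length)) :=
        mul_le_mul_of_nonneg_left h1 h4.le
    _ = C := by linear_combination C * h3

section

variable {Z : Type} [NormedAddCommGroup Z] [NormedSpace ℝ Z] [Dirs Z]

abbrev wd (Z : Type) [NormedAddCommGroup Z] [NormedSpace ℝ Z] [Dirs Z] (j : Fin d) :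
    Dirs.ι (Amp Z d) := Sum.inr (Sum.inl j)

abbrev ed (Z : Type) [NormedAddCommGroup Z] [NormedSpace ℝ Z] [Dirs Z] (j : Fin d) :
    Dirs.ι (Amp Z d) := Sum.inr (Sum.inr j)

abbrev zd (d : ℕ) (i : Dirs.ι Z) : Dirs.ι (Amp Z d) := Sum.inl i

/-- The kernel `e^{-i⟨w, η⟩}`. -/
def ee (q : Ph d) : ℂ := exp (-I * (inner ℝ q.1 q.2 : ℝ))

lemma norm_ee (q : Ph d) : ‖ee q‖ = 1 := by
  rw [ee, show -I * ((inner ℝ q.1 q.2 : ℝ) : ℂ) = ((-inner ℝ q.1 q.2 : ℝ) : ℂ) * I by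
    push_cast; ring, Complex.norm_exp_ofReal_mul_I]

lemma smooth_ee : Smooth (ee (d := d)) := by
  unfold ee
  exact (contDiff_const.mul (Complex.ofRealCLM.contDiff.comp
    (contDiff_fst.inner ℝ contDiff_snd))).cexp

/-- The weight `ϖ₀(z) ⟨w⟩^r ⟨η⟩^s`. -/
def wgt (ϖ₀ : Z → ℝ) (r s : ℝ) (X : Amp Z d) : ℝ := ϖ₀ X.1 * br X.2.1 ^ r * br X.2.2 ^ s

/-- Data for the scales to which oscillatory integration applies. -/
structure OscData (Z : Type) [NormedAddCommGroup Z] [NormedSpace ℝ Z] [Dirs Z] where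
  /-- the parameter weight of `w`-derivatives -/
  v : Z → ℝ
  one_le_v : ∀ z, 1 ≤ v z
  /-- the weights of the parameter derivatives -/
  g : Dirs.ι Z → Z → ℝ
  g_pos : ∀ i z, 0 < g i z
  a : ℕ
  /-- the cost of `z`- and `w`-derivatives -/
  c : ℕ
  D : Set Z

variable (O : OscData Z)

/-- Scales in which `η`-derivatives have weight one. -/
def OscData.scale (d : ℕ) : Scale (Amp Z d) where
  wt := Sum.elim (fun i X => O.g i X.1 * (br X.2.1 * br X.2.2) ^ O.a)
    (Sum.elim (fun _ X => O.v X.1 * br X.2.1 ^ O.a) (fun _ _ => 1))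
  pos := by
    rintro (i | i | i) X
    · exact mul_pos (O.g_pos i _) (pow_pos (mul_pos (br_pos _) (br_pos _)) _)
    · exact mul_pos (one_pos.trans_le (O.one_le_v _)) (pow_pos (br_pos _) _)
    · exact one_pos
  cost := Sum.elim (fun _ => O.c) (Sum.elim (fun _ => O.c) (fun _ => 0))
  dom := {X | X.1 ∈ O.D}

notation:max "SW" O:max d:max k:max w:max r:max s:max => Sym (OscData.scale O d) k (fun _ => wgt w r s)

lemma OscData.wt_z (i : Dirs.ι Z) (X : Amp Z d) : (O.scale d).wt (zd d i) X =
    O.g i X.1 * (br X.2.1 * br X.2.2) ^ O.a := rfl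
lemma OscData.wt_w (j : Fin d) (X : Amp Z d) : (O.scale d).wt (wd Z j) X =
    O.v X.1 * br X.2.1 ^ O.a := rfl
lemma OscData.wt_e (j : Fin d) (X : Amp Z d) : (O.scale d).wt (ed Z j) X = 1 := rfl

lemma OscData.one_le_wt_w (j : Fin d) (X : Amp Z d) : 1 ≤ (O.scale d).wt (wd Z j) X := by
  rw [O.wt_w]
  exact one_le_mul (O.one_le_v _) (one_le_pow₀ (one_le_br _))

lemma continuous_coord (j : Fin d) : Continuous fun x : Conf d => x j := by fun_prop

def wL (Z : Type) [NormedAddCommGroup Z] [NormedSpace ℝ Z] (j : Fin d) : Amp Z d →L[ℝ] ℝ :=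
  (proj j).comp ((fst ℝ _ _).comp (snd ℝ Z (Ph d)))

def eL (Z : Type) [NormedAddCommGroup Z] [NormedSpace ℝ Z] (j : Fin d) : Amp Z d →L[ℝ] ℝ :=
  (proj j).comp ((snd ℝ _ _).comp (snd ℝ Z (Ph d)))

@[simp] lemma wL_apply (j : Fin d) (X : Amp Z d) : wL Z j X = X.2.1 j := rfl
@[simp] lemma eL_apply (j : Fin d) (X : Amp Z d) : eL Z j X = X.2.2 j := rfl

lemma abs_single_le (i j : Fin d) : |(single i (1 : ℝ) : Conf d) j| ≤ 1 := by
  simp only [PiLp.single_apply]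
  split_ifs <;> simp

lemma sym_w (k : ℕ) (j : Fin d) : Sym (O.scale d) k (fun _ X => br X.2.1)
    (fun (_ : T) X => X.2.1 j) := by
  refine Sym.linear (fun _ => wL Z j) ⟨1, zero_le_one, fun _ X _ => ?_⟩ ?_
    fun _ X _ => (br_pos _).le
  · rw [one_mul]; exact abs_coord_le_br _ j
  · rintro (i | i | i)
    · refine ⟨0, le_rfl, fun t X _ => ?_⟩
      simp [wL]
    · refine ⟨1, zero_le_one, fun t X _ => ?_⟩
      have h1 := O.one_le_wt_w i X
      have h2 := one_le_br X.2.1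
      have h3 : ‖wL Z j (Dirs.b (wd Z i) : Amp Z d)‖ ≤ 1 := by
        simpa [wL] using abs_single_le i j
      rw [one_mul]
      exact h3.trans (one_le_mul h2 h1)
    · refine ⟨0, le_rfl, fun t X _ => ?_⟩
      simp [wL]

lemma sym_e (k : ℕ) (j : Fin d) : Sym (O.scale d) k (fun _ X => br X.2.2)
    (fun (_ : T) X => X.2.2 j) := by
  refine Sym.linear (fun _ => eL Z j) ⟨1, zero_le_one, fun _ X _ => ?_⟩ ?_
    fun _ X _ => (br_pos _).le
  · rw [one_mul]; exact abs_coord_le_br _ j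
  · rintro (i | i | i)
    · refine ⟨0, le_rfl, fun t X _ => ?_⟩
      simp [eL]
    · refine ⟨0, le_rfl, fun t X _ => ?_⟩
      simp [eL]
    · refine ⟨1, zero_le_one, fun t X _ => ?_⟩
      have h2 := one_le_br X.2.2
      have h3 : ‖eL Z j (Dirs.b (ed Z i) : Amp Z d)‖ ≤ 1 := by
        simpa [eL] using abs_single_le i j
      rw [one_mul]
      exact h3.trans (one_le_mul h2 (O.wt_e i X).ge)

lemma one_add_sq_ne (x : Conf d) : 1 + ‖x‖ ^ 2 ≠ 0 := by positivity

lemma norm_sq_eq (x : Conf d) : ‖x‖ ^ 2 = ∑ j, x j * x j := by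
  rw [EuclideanSpace.norm_sq_eq]
  exact sum_congr rfl fun j _ => by rw [Real.norm_eq_abs, sq_abs, sq]

lemma sym_one_add_sq {E : Type} [NormedAddCommGroup E] [NormedSpace ℝ E] [Dirs E] {S : Scale E}
    {k : ℕ} {x : T → E → Conf d}
    (hx : ∀ j, Sym S k (fun t X => br (x t X)) (fun t X => x t X j)) :
    Sym S k (fun t X => br (x t X) ^ 2) (fun t X => 1 + ‖x t X‖ ^ 2) := by
  have h1 : Sym S k (fun t X => br (x t X) ^ 2) (fun (_ : T) (_ : E) => (1 : ℝ)) :=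
    Sym.const (fun _ => 1) ⟨1, zero_le_one, fun t X _ => by
      rw [norm_one, one_mul]; exact one_le_pow₀ (one_le_br _)⟩ fun t X _ => sq_nonneg _
  simp only [norm_sq_eq]
  refine h1.add (Sym.sum _ (fun j _ => ?_) fun t X _ => sq_nonneg _)
  exact ((hx j).mulR (hx j)).congr_weight fun t X _ => (sq _).symm

lemma sym_inv_one_add_sq {E : Type} [NormedAddCommGroup E] [NormedSpace ℝ E] [Dirs E] {S : Scale E}
    {k : ℕ} {x : T → E → Conf d}
    (hx : ∀ j, Sym S k (fun t X => br (x t X)) (fun t X => x t X j)) :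
    Sym S k (fun t X => br (x t X) ^ (-2 : ℝ)) (fun t X => (1 + ‖x t X‖ ^ 2)⁻¹) := by
  refine ((sym_one_add_sq hx).inv (fun t X => by positivity)
    (fun t X _ => pow_pos (br_pos _) 2) ⟨1, zero_le_one, fun t X _ => by rw [one_mul, br_sq]⟩
    ).congr_weight fun t X _ => ?_
  rw [Real.rpow_neg (br_pos _).le]
  norm_cast

/-- The transpose of `⟨η⟩⁻²(1 - Δ_w)`, which fixes `e^{-i⟨w, η⟩}`. -/
def regW (f : Amp Z d → ℂ) : Amp Z d → ℂ := fun X =>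
  ((1 + ‖X.2.2‖ ^ 2)⁻¹ : ℝ) • (f X - ∑ j, pd (wd Z j) (pd (wd Z j) f) X)

/-- The transpose of `⟨w⟩⁻²(1 - Δ_η)`, which fixes `e^{-i⟨w, η⟩}`. -/
def regE (f : Amp Z d → ℂ) : Amp Z d → ℂ := fun X =>
  ((1 + ‖X.2.1‖ ^ 2)⁻¹ : ℝ) • (f X - ∑ j, pd (ed Z j) (pd (ed Z j) f) X)

variable {O} {k : ℕ} {ϖ₀ : Z → ℝ} {r s : ℝ} {f : T → Amp Z d → ℂ}

lemma wgt_nonneg (h0 : ∀ z, 0 ≤ ϖ₀ z) (X : Amp Z d) : 0 ≤ wgt ϖ₀ r s X :=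
  mul_nonneg (mul_nonneg (h0 _) (br_rpow_pos _ _).le) (br_rpow_pos _ _).le

lemma wgt_mono (h0 : ∀ z, 0 ≤ ϖ₀ z) {r' s' : ℝ} (hr : r ≤ r') (hs : s ≤ s') (X : Amp Z d) :
    wgt ϖ₀ r s X ≤ wgt ϖ₀ r' s' X := by
  unfold wgt
  have h1 := br_rpow_mono X.2.1 hr
  have h2 := br_rpow_mono X.2.2 hs
  have h3 : 0 < br X.2.1 ^ r := br_rpow_pos _ _
  have h4 : 0 < br X.2.2 ^ s := br_rpow_pos _ _
  have h5 := h0 X.1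
  have h6 : 0 < br X.2.1 ^ r' := br_rpow_pos _ _
  gcongr

lemma Sym.regW (hf : SW O d k ϖ₀ r s f) (h0 : ∀ z, 0 ≤ ϖ₀ z)
    (hk : 2 * O.c ≤ k) : SW O d (k - 2 * O.c) (fun z => ϖ₀ z * O.v z ^ 2) (r + 2 * O.a) (s - 2) (fun t => regW (f t)) := by
  have h0' : ∀ z, 0 ≤ ϖ₀ z * O.v z ^ 2 := fun z => mul_nonneg (h0 z) (sq_nonneg _)
  have hf1 : SW O d (k - 2 * O.c) (fun z => ϖ₀ z * O.v z ^ 2) (r + 2 * O.a) s f := by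
    refine (hf.mono_k (Nat.sub_le _ _)).mono_le fun t X _ => ?_
    refine (wgt_mono h0 (r' := r + 2 * O.a) (s' := s) (by simp) le_rfl X).trans ?_
    unfold wgt
    have h3 : 0 < br X.2.1 ^ (r + 2 * O.a) := br_rpow_pos _ _
    have h4 : 0 < br X.2.2 ^ s := br_rpow_pos _ _
    have h5 := le_mul_of_one_le_right (h0 X.1) (one_le_pow₀ (n := 2) (O.one_le_v X.1))
    gcongr
  have hf2 : ∀ j, SW O d (k - 2 * O.c) (fun z => ϖ₀ z * O.v z ^ 2) (r + 2 * O.a) s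
      (fun t => pD (wd Z j) (pD (wd Z j) (f t))) := by
    intro j
    have e : (O.scale d).cost (wd Z j) = O.c := rfl
    have h1 := (hf.pd (wd Z j) (by rw [e]; omega)).pd (wd Z j) (by rw [e]; omega)
    rw [e] at h1
    refine (h1.mono_k (k' := k - 2 * O.c) (by omega)).congr_weight fun t X _ => ?_
    rw [O.wt_w]
    unfold wgt
    rw [Real.rpow_add (br_pos _), show (2 * (O.a : ℝ)) = ((2 * O.a : ℕ) : ℝ) by push_cast; ring,
      Real.rpow_natCast, mul_comm 2 O.a, pow_mul]
    ring
  have hsum := hf1.sub (Sym.sum univ (fun j _ => hf2 j) fun t X _ => wgt_nonneg h0' X)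
  refine ((sym_inv_one_add_sq (sym_e O (k - 2 * O.c))).smul hsum).congr_weight fun t X _ => ?_
  unfold wgt
  rw [show s - 2 = -2 + s by ring, Real.rpow_add (br_pos X.2.2)]
  ring

lemma Sym.regE (hf : SW O d k ϖ₀ r s f) (h0 : ∀ z, 0 ≤ ϖ₀ z) :
    SW O d k ϖ₀ (r - 2) s (fun t => regE (f t)) := by
  have hf2 : ∀ j, SW O d k ϖ₀ r s (fun t => pD (ed Z j) (pD (ed Z j) (f t))) := by
    intro j
    refine ((hf.pd (ed Z j) (Nat.zero_le _)).pd (ed Z j) (Nat.zero_le _)).congr_weight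
      fun t X _ => ?_
    rw [O.wt_e]; ring
  have hsum := hf.sub (Sym.sum univ (fun j _ => hf2 j) fun t X _ => wgt_nonneg h0 X)
  refine ((sym_inv_one_add_sq (sym_w O k)).smul hsum).congr_weight fun t X _ => ?_
  unfold wgt
  rw [show r - 2 = -2 + r by ring, Real.rpow_add (br_pos X.2.1)]
  ring

lemma Sym.regW_iterate (hf : SW O d k ϖ₀ r s f) (h0 : ∀ z, 0 ≤ ϖ₀ z)
    (M : ℕ) (hk : M * (2 * O.c) ≤ k) : SW O d (k - M * (2 * O.c)) (fun z => ϖ₀ z * O.v z ^ (2 * M)) (r + M * (2 * O.a)) (s - 2 * M)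
      (fun t => MagneticFIO.regW^[M] (f t)) := by
  induction M with
  | zero => simpa using hf
  | succ M ih =>
    have hk' : M * (2 * O.c) + 2 * O.c ≤ k := by rw [← Nat.succ_mul]; exact hk
    have h1 := (ih (by omega)).regW (fun z => mul_nonneg (h0 z)
      (pow_nonneg (zero_le_one.trans (O.one_le_v z)) _)) (by omega)
    simp only [Function.iterate_succ', Function.comp]
    refine (h1.mono_k (k' := k - (M + 1) * (2 * O.c)) (by rw [Nat.succ_mul]; omega)).congr_weight
      fun t X _ => ?_
    unfold wgt
    push_cast
    ring_nf

lemma Sym.regE_iterate (hf : SW O d k ϖ₀ r s f) (h0 : ∀ z, 0 ≤ ϖ₀ z)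
    (N : ℕ) : SW O d k ϖ₀ (r - 2 * N) s (fun t => MagneticFIO.regE^[N] (f t)) := by
  induction N with
  | zero => simpa using hf
  | succ N ih =>
    simp only [Function.iterate_succ', Function.comp]
    refine (ih.regE h0).congr_weight fun t X _ => ?_
    unfold wgt
    push_cast
    ring_nf

lemma Sym.reg (hf : SW O d k ϖ₀ r s f) (h0 : ∀ z, 0 ≤ ϖ₀ z)
    (M N : ℕ) (hk : M * (2 * O.c) ≤ k) : SW O d (k - M * (2 * O.c)) (fun z => ϖ₀ z * O.v z ^ (2 * M)) (r + M * (2 * O.a) - 2 * N) (s - 2 * M)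
      (fun t => MagneticFIO.regE^[N] (MagneticFIO.regW^[M] (f t))) :=
  (hf.regW_iterate h0 M hk).regE_iterate (fun z => mul_nonneg (h0 z)
      (pow_nonneg (zero_le_one.trans (O.one_le_v z)) _)) N

/-- The scale of bounded derivatives at the parameter `z`. -/
def flat (z : Z) : OscData Z where
  v := fun _ => 1
  one_le_v := fun _ => le_rfl
  g := fun _ _ => 1
  g_pos := fun _ _ => one_pos
  a := 0
  c := 0
  D := {z}

/-- Integrability at the parameter `z`, with all derivatives. -/
def Fast (z : Z) (f : Amp Z d → ℂ) : Prop :=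
  Sym ((flat z).scale d) 0 (fun _ : Unit => wgt (fun _ => 1) (-(d + 1)) (-(d + 1))) (fun _ => f)

lemma integrable_br {s : ℝ} (hs : s ≤ -(d + 1)) : Integrable (fun x : Conf d => br x ^ s) := by
  have h := integrable_rpow_neg_one_add_norm_sq (E := Conf d) (μ := volume) (r := -s) (by
    rw [finrank_euclideanSpace, Fintype.card_fin]; linarith)
  refine h.congr (.of_forall fun x => ?_)
  change (1 + ‖x‖ ^ 2) ^ (-(-s) / 2) = br x ^ s
  rw [bracket, Real.sqrt_eq_rpow, ← Real.rpow_mul (by positivity)]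
  congr 1; ring

lemma integrable_wgt {r s : ℝ} (hr : r ≤ -(d + 1)) (hs : s ≤ -(d + 1)) (z : Z) :
    Integrable (fun q : Ph d => wgt ϖ₀ r s (z, q)) := by
  have h := ((integrable_br hr).mul_prod (integrable_br hs)).const_mul (ϖ₀ z)
  refine h.congr (.of_forall fun q => ?_)
  simp only [wgt]
  ring

lemma Fast.smooth {z : Z} {f : Amp Z d → ℂ} (h : Fast z f) : Smooth f := Sym.smooth h ()

lemma Fast.integrable {z : Z} {f : Amp Z d → ℂ} (h : Fast z f) :
    Integrable (fun q => f (z, q)) := by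
  obtain ⟨C, hC, hb⟩ := h.bound
  refine Integrable.mono' ((integrable_wgt (ϖ₀ := fun _ => 1) le_rfl le_rfl z).const_mul C)
    (h.smooth.continuous.comp (by fun_prop)).aestronglyMeasurable
    (.of_forall fun q => hb () (z, q) rfl)

lemma Fast.pd {z : Z} {f : Amp Z d → ℂ} (h : Fast z f) (i : Dirs.ι (Amp Z d)) :
    Fast z (pd i f) := by
  have h0 : ((flat z).scale d).cost i = 0 := by rcases i with i | i | i <;> rfl
  refine ((Sym.pd h i h0.le).mono_k (Nat.zero_le _)).congr_weight fun t X _ => ?_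
  have : ((flat z).scale d).wt i X = 1 := by
    rcases i with i | i | i <;> simp [OscData.scale, flat]
  rw [this, mul_one]

lemma Fast.regW {z : Z} {f : Amp Z d → ℂ} (h : Fast z f) : Fast z (regW f) := by
  refine (Sym.regW h (fun _ => zero_le_one) (le_of_eq rfl)).mono_le fun t X _ => ?_
  simp only [flat, one_pow, mul_one, Nat.cast_zero, mul_zero, add_zero]
  exact wgt_mono (fun _ => zero_le_one) le_rfl (by linarith) X

lemma Fast.regE {z : Z} {f : Amp Z d → ℂ} (h : Fast z f) : Fast z (regE f) :=
  (Sym.regE h (fun _ => zero_le_one)).mono_le fun t X _ =>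
    wgt_mono (fun _ => zero_le_one) (by linarith) le_rfl X

lemma fderiv_amp_slice {f : Amp Z d → ℂ} (hf : Smooth f) (z : Z) (q : Ph d) :
    HasFDerivAt (fun q => f (z, q)) ((fderiv ℝ f (z, q)).comp (inr ℝ Z (Ph d))) q :=
  (smooth_diffAt hf (z, q)).hasFDerivAt.comp q (hasFDerivAt_prodMk_right z q)

lemma pd_w_slice {f : Amp Z d → ℂ} (hf : Smooth f) (z : Z) (q : Ph d) (j : Fin d) :
    fderiv ℝ (fun q => f (z, q)) q (single j 1, 0) = pd (wd Z j) f (z, q) := by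
  rw [(fderiv_amp_slice hf z q).fderiv]
  simp [pd]

lemma pd_e_slice {f : Amp Z d → ℂ} (hf : Smooth f) (z : Z) (q : Ph d) (j : Fin d) :
    fderiv ℝ (fun q => f (z, q)) q (0, single j 1) = pd (ed Z j) f (z, q) := by
  rw [(fderiv_amp_slice hf z q).fderiv]
  simp [pd]

lemma fderiv_ee (q v : Ph d) : fderiv ℝ ee q v =
    -I * ((inner ℝ q.1 v.2 + inner ℝ v.1 q.2 : ℝ) : ℂ) * ee q := by
  have h1 : HasFDerivAt (fun q : Ph d => (inner ℝ q.1 q.2 : ℝ)) _ q :=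
    (hasFDerivAt_fst (p := q)).inner ℝ (hasFDerivAt_snd (p := q))
  have h2 := ((Complex.ofRealCLM.hasFDerivAt (x := (inner ℝ q.1 q.2 : ℝ))).comp q h1).const_mul (-I)
  have h3 : fderiv ℝ ee q = _ := h2.cexp.fderiv
  rw [h3]
  simp [ee]
  ring

/-- Integration by parts against `e^{-i⟨w, η⟩}` and a factor annihilated by the derivative. -/
lemma integral_ee_mul_fderiv {h g : Ph d → ℂ} {v : Ph d}
    (hh : Smooth h) (hv : ∀ q, fderiv ℝ h q v = 0) (hg : Smooth g)
    (i1 : Integrable fun q => h q * g q) (i2 : Integrable fun q => h q * fderiv ℝ g q v)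
    (i3 : Integrable fun q =>
      ((inner ℝ q.1 v.2 + inner ℝ v.1 q.2 : ℝ) : ℂ) * (h q * g q)) :
    ∫ q, ee q * (h q * fderiv ℝ g q v) =
      ∫ q, ee q * (I * (((inner ℝ q.1 v.2 + inner ℝ v.1 q.2 : ℝ) : ℂ) * (h q * g q))) := by
  have hee : ∀ {F : Ph d → ℂ}, Integrable F → Integrable fun q => ee q * F q := by
    intro F hF
    refine hF.bdd_mul (c := 1) smooth_ee.continuous.aestronglyMeasurable ?_
    exact .of_forall fun q => (norm_ee q).le
  have hd : ∀ q, fderiv ℝ (fun q => ee q * h q) q v =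
      -I * ((inner ℝ q.1 v.2 + inner ℝ v.1 q.2 : ℝ) : ℂ) * (ee q * h q) := by
    intro q
    have h1 : HasFDerivAt (fun q => ee q * h q) _ q :=
      (smooth_diffAt smooth_ee q).hasFDerivAt.mul (smooth_diffAt hh q).hasFDerivAt
    rw [h1.fderiv]
    simp only [_root_.add_apply, _root_.smul_apply, smul_eq_mul, hv, fderiv_ee]
    ring
  have : (volume : Measure (Ph d)).IsAddHaarMeasure := by
    rw [Measure.volume_eq_prod]; infer_instance
  have key := integral_bilinear_fderiv_right_eq_neg_left_of_integrable (μ := volume)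
    (B := ContinuousLinearMap.mul ℝ ℂ) (f := fun q => ee q * h q) (g := g) (v := v) ?_ ?_ ?_
    (fun q _ => smooth_diffAt (smooth_ee.mul hh) q) (fun q _ => smooth_diffAt hg q)
  · simp only [ContinuousLinearMap.mul_apply', mul_assoc] at key
    rw [key, ← integral_neg]
    refine integral_congr_ae (.of_forall fun q => ?_)
    simp only [ContinuousLinearMap.mul_apply', hd]
    ring
  · refine ((hee i3).const_mul (-I)).congr (.of_forall fun q => ?_)
    simp only [ContinuousLinearMap.mul_apply', hd]
    ring
  · simpa only [ContinuousLinearMap.mul_apply', mul_assoc] using hee i2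
  · simpa only [ContinuousLinearMap.mul_apply', mul_assoc] using hee i1

lemma integrable_mul_bdd {F h : Ph d → ℂ} (hF : Integrable F) (hh : Continuous h) {C : ℝ}
    (hb : ∀ q, ‖h q‖ ≤ C) : Integrable fun q => h q * F q :=
  hF.bdd_mul hh.aestronglyMeasurable (.of_forall hb)

lemma integrable_ee_mul {F : Ph d → ℂ} (hF : Integrable F) : Integrable fun q => ee q * F q :=
  integrable_mul_bdd hF smooth_ee.continuous fun q => (norm_ee q).le

lemma coord_sq_le (x : Conf d) (j : Fin d) : x j * x j ≤ ‖x‖ ^ 2 := by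
  rw [norm_sq_eq]
  exact Finset.single_le_sum (f := fun j => x j * x j) (fun j _ => mul_self_nonneg _) (mem_univ j)

lemma jap_bounds (x : Conf d) (j : Fin d) : |(1 + ‖x‖ ^ 2)⁻¹| ≤ 1 ∧
    |x j * (1 + ‖x‖ ^ 2)⁻¹| ≤ 1 ∧ |x j * (x j * (1 + ‖x‖ ^ 2)⁻¹)| ≤ 1 := by
  have h := coord_sq_le x j
  have hp : 0 < 1 + ‖x‖ ^ 2 := by positivity
  have hi : 0 < (1 + ‖x‖ ^ 2)⁻¹ := inv_pos.2 hp
  refine ⟨?_, ?_, ?_⟩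
  · rw [abs_of_pos hi]; exact inv_le_one_of_one_le₀ (by nlinarith [sq_nonneg ‖x‖])
  · rw [abs_mul, abs_of_pos hi, ← div_eq_mul_inv, div_le_one hp]
    nlinarith [abs_nonneg (x j), sq_abs (x j), sq_nonneg (|x j| - 1)]
  · rw [← mul_assoc, abs_mul, abs_of_pos hi, ← div_eq_mul_inv, div_le_one hp,
      abs_of_nonneg (mul_self_nonneg _)]
    linarith

/-- Double integration by parts in one coordinate. -/
lemma integral_ee_second {x : Ph d → Conf d} {v : Ph d} {j : Fin d} (hx : Smooth x)
    (hxv : ∀ q (F : Conf d → ℂ), Smooth F → fderiv ℝ (fun q => F (x q)) q v = 0)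
    (hin : ∀ q : Ph d, inner ℝ q.1 v.2 + inner ℝ v.1 q.2 = x q j)
    {g : Ph d → ℂ} (hg : Smooth g) (i0 : Integrable g)
    (i1 : Integrable fun q => fderiv ℝ g q v)
    (i2 : Integrable fun q => fderiv ℝ (fun q => fderiv ℝ g q v) q v) :
    ∫ q, ee q * (((1 + ‖x q‖ ^ 2)⁻¹ : ℝ) * fderiv ℝ (fun q => fderiv ℝ g q v) q v) =
      -∫ q, ee q * (((x q j * x q j * (1 + ‖x q‖ ^ 2)⁻¹ : ℝ)) * g q) := by
  have hs1 : Smooth (fun y : Conf d => (((1 + ‖y‖ ^ 2)⁻¹ : ℝ) : ℂ)) :=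
    Complex.ofRealCLM.contDiff.comp
      ((contDiff_const.add (contDiff_norm_sq ℝ)).inv fun y => by positivity)
  have hs0 : Smooth (fun y : Conf d => ((y j : ℝ) : ℂ)) :=
    Complex.ofRealCLM.contDiff.comp (proj (𝕜 := ℝ) j).contDiff
  have hs2 : Smooth (fun y : Conf d => ((y j : ℝ) : ℂ) * (((1 + ‖y‖ ^ 2)⁻¹ : ℝ) : ℂ)) := hs0.mul hs1
  have hg1 : Smooth (fun q => fderiv ℝ g q v) :=
    (hg.fderiv_right (m := ∞) (by simp)).clm_apply contDiff_const
  have b1 : ∀ q, ‖(((1 + ‖x q‖ ^ 2)⁻¹ : ℝ) : ℂ)‖ ≤ 1 := fun q => by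
    rw [Complex.norm_real]; exact (jap_bounds (x q) j).1
  have b2 : ∀ q, ‖((x q j : ℝ) : ℂ) * (((1 + ‖x q‖ ^ 2)⁻¹ : ℝ) : ℂ)‖ ≤ 1 := fun q => by
    rw [← Complex.ofReal_mul, Complex.norm_real]; exact (jap_bounds (x q) j).2.1
  have b3 : ∀ q, ‖((x q j : ℝ) : ℂ) * (((x q j : ℝ) : ℂ) * (((1 + ‖x q‖ ^ 2)⁻¹ : ℝ) : ℂ))‖ ≤ 1 :=
    fun q => by
      rw [← Complex.ofReal_mul, ← Complex.ofReal_mul, Complex.norm_real]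
      exact (jap_bounds (x q) j).2.2
  have c1 := (hs1.comp hx).continuous
  have c0 := (hs0.comp hx).continuous
  have c2 := c0.mul c1
  have s1 := integral_ee_mul_fderiv (hs1.comp hx) (fun q => hxv q _ hs1) hg1
    (integrable_mul_bdd i1 c1 b1) (integrable_mul_bdd i2 c1 b1)
    ((integrable_mul_bdd i1 c2 b2).congr (.of_forall fun q => by
      simp only [hin, Function.comp, Pi.mul_apply]; ring))
  have s2 := integral_ee_mul_fderiv (hs2.comp hx) (fun q => hxv q _ hs2) hg
    (integrable_mul_bdd i0 c2 b2) (integrable_mul_bdd i1 c2 b2)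
    ((integrable_mul_bdd i0 (c0.mul c2) b3).congr (.of_forall fun q => by
      simp only [hin, Function.comp, Pi.mul_apply]; ring))
  simp only [Function.comp, hin] at s1 s2
  have e1 : ∀ q, ee q * (I * (((x q j : ℝ) : ℂ) * ((((1 + ‖x q‖ ^ 2)⁻¹ : ℝ) : ℂ) *
      fderiv ℝ g q v))) = I * (ee q * (((x q j : ℝ) : ℂ) *
        (((1 + ‖x q‖ ^ 2)⁻¹ : ℝ) : ℂ) * fderiv ℝ g q v)) := fun q => by ring
  rw [s1]
  simp only [e1]
  rw [integral_const_mul, s2, ← integral_const_mul, ← integral_neg]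
  refine integral_congr_ae (.of_forall fun q => ?_)
  simp only
  push_cast
  linear_combination (ee q * (x q j : ℂ) * (x q j : ℂ) * (1 + (‖x q‖ : ℂ) ^ 2)⁻¹ * g q) * Complex.I_mul_I

/-- The operators `regW`, `regE` do not change integrals against `e^{-i⟨w, η⟩}`. -/
lemma integral_ee_reg {x : Ph d → Conf d} {v : Fin d → Ph d} (hx : Smooth x)
    (hxv : ∀ j q (F : Conf d → ℂ), Smooth F → fderiv ℝ (fun q => F (x q)) q (v j) = 0)
    (hin : ∀ j (q : Ph d), inner ℝ q.1 (v j).2 + inner ℝ (v j).1 q.2 = x q j)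
    {g : Ph d → ℂ} (hg : Smooth g) (i0 : Integrable g)
    (i1 : ∀ j, Integrable fun q => fderiv ℝ g q (v j))
    (i2 : ∀ j, Integrable fun q => fderiv ℝ (fun q => fderiv ℝ g q (v j)) q (v j)) :
    ∫ q, ee q * (((1 + ‖x q‖ ^ 2)⁻¹ : ℝ) •
      (g q - ∑ j, fderiv ℝ (fun q => fderiv ℝ g q (v j)) q (v j))) = ∫ q, ee q * g q := by
  have hc : Continuous fun q => (((1 + ‖x q‖ ^ 2)⁻¹ : ℝ) : ℂ) :=
    Complex.continuous_ofReal.comp (((contDiff_const.add ((contDiff_norm_sq ℝ).comp hx)).inv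
      fun y => one_add_sq_ne (x y)).continuous (n := ∞) (𝕜 := ℝ))
  have hcj : ∀ j, Continuous fun q => ((x q j * x q j * (1 + ‖x q‖ ^ 2)⁻¹ : ℝ) : ℂ) := by
    intro j
    have : Continuous fun q => x q j := (continuous_coord j).comp hx.continuous
    have h2 : Continuous fun q => (1 + ‖x q‖ ^ 2)⁻¹ := ((contDiff_const.add
      ((contDiff_norm_sq ℝ).comp hx)).inv fun y => one_add_sq_ne (x y)).continuous (n := ∞) (𝕜 := ℝ)
    exact Complex.continuous_ofReal.comp ((this.mul this).mul h2)
  have b1 : ∀ q, ‖(((1 + ‖x q‖ ^ 2)⁻¹ : ℝ) : ℂ)‖ ≤ 1 := fun q => by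
    rw [Complex.norm_real, Real.norm_eq_abs, abs_of_pos (by positivity)]
    exact inv_le_one_of_one_le₀ (by nlinarith [sq_nonneg ‖x q‖])
  have b3 : ∀ j q, ‖((x q j * x q j * (1 + ‖x q‖ ^ 2)⁻¹ : ℝ) : ℂ)‖ ≤ 1 := fun j q => by
    rw [Complex.norm_real, mul_assoc]; exact (jap_bounds (x q) j).2.2
  have I0 := integrable_ee_mul (integrable_mul_bdd i0 hc b1)
  have I2 := fun j => integrable_ee_mul (integrable_mul_bdd (i2 j) hc b1)
  have I3 := fun j => integrable_ee_mul (integrable_mul_bdd i0 (hcj j) (b3 j))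
  have e1 : ∀ q, ee q * (((1 + ‖x q‖ ^ 2)⁻¹ : ℝ) •
      (g q - ∑ j, fderiv ℝ (fun q => fderiv ℝ g q (v j)) q (v j))) =
      ee q * ((((1 + ‖x q‖ ^ 2)⁻¹ : ℝ) : ℂ) * g q) - ∑ j, ee q * ((((1 + ‖x q‖ ^ 2)⁻¹ : ℝ) : ℂ) *
        fderiv ℝ (fun q => fderiv ℝ g q (v j)) q (v j)) := by
    intro q
    rw [Complex.real_smul, mul_sub, mul_sub, mul_sum, mul_sum]
  simp only [e1]
  rw [integral_sub I0 (integrable_finsetSum _ fun j _ => I2 j),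
    integral_finsetSum _ fun j _ => I2 j]
  have e2 : ∀ j, ∫ q, ee q * ((((1 + ‖x q‖ ^ 2)⁻¹ : ℝ) : ℂ) *
      fderiv ℝ (fun q => fderiv ℝ g q (v j)) q (v j)) =
      -∫ q, ee q * (((x q j * x q j * (1 + ‖x q‖ ^ 2)⁻¹ : ℝ)) * g q) := fun j =>
    integral_ee_second hx (hxv j) (hin j) hg i0 (i1 j) (i2 j)
  simp only [e2]
  rw [sum_neg_distrib, sub_neg_eq_add, ← integral_finsetSum _ fun j _ => I3 j,
    ← integral_add I0 (integrable_finsetSum _ fun j _ => I3 j)]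
  refine integral_congr_ae (.of_forall fun q => ?_)
  simp only
  have e3 : ∑ j, ee q * (((x q j * x q j * (1 + ‖x q‖ ^ 2)⁻¹ : ℝ) : ℂ) * g q) =
      ((‖x q‖ ^ 2 * (1 + ‖x q‖ ^ 2)⁻¹ : ℝ) : ℂ) * (ee q * g q) := by
    rw [norm_sq_eq (x q), sum_mul, Complex.ofReal_sum, sum_mul]
    exact sum_congr rfl fun j _ => by ring
  rw [e3]
  have e4 : (((1 + ‖x q‖ ^ 2)⁻¹ : ℝ) : ℂ) + ((‖x q‖ ^ 2 * (1 + ‖x q‖ ^ 2)⁻¹ : ℝ) : ℂ) = 1 := by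
    rw [← Complex.ofReal_add]
    have : (1 + ‖x q‖ ^ 2)⁻¹ + ‖x q‖ ^ 2 * (1 + ‖x q‖ ^ 2)⁻¹ = 1 := by
      have : (1 + ‖x q‖ ^ 2) ≠ 0 := by positivity
      field_simp
    rw [this, Complex.ofReal_one]
  linear_combination (ee q * g q) * e4

end

variable {Z : Type} [NormedAddCommGroup Z] [NormedSpace ℝ Z] [Dirs Z]
  {O : OscData Z} {k K : ℕ} {ϖ₀ : Z → ℝ} {r s μ : ℝ}

lemma Sym.compLin {f : T → E' → F} {ϖ' : T → E' → ℝ} (hf : Sym S' k ϖ' f) (L : T → E →L[ℝ] E')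
    (hdom : ∀ t, ∀ X ∈ S.dom, L t X ∈ S'.dom) (h0 : ∀ t, ∀ X ∈ S'.dom, 0 ≤ ϖ' t X)
    (hc : ∀ i j, (S'.cost j ≤ S.cost i ∧ ∃ K : ℝ, 0 ≤ K ∧ ∀ t, ∀ X ∈ S.dom,
      |co j (L t (Dirs.b i))| * S'.wt j (L t X) ≤ K * S.wt i X) ∨
      ∀ t, co j (L t (Dirs.b i)) = 0) :
    Sym S k (fun t X => ϖ' t (L t X)) (fun t X => f t (L t X)) := by
  have hp : ∀ i j t, pD i (fun Y => co j (L t Y)) = fun _ => co j (L t (Dirs.b i)) :=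
    fun i j t => pd_linear i ((co j).comp (L t))
  refine hf.comp (fun t => (L t).contDiff) hdom (fun i j => ?_) h0 (fun i j n => ?_)
  · rcases hc i j with h | h
    · exact Or.inl h.1
    · right; intro t X; rw [hp]; exact h t
  · simp only [hp]
    have hq : ∀ t, ∀ X ∈ S.dom, 0 ≤ S.wt i X / S'.wt j (L t X) := fun t X _ =>
      div_nonneg (S.pos _ _).le (S'.pos _ _).le
    rcases hc i j with ⟨-, K, hK, h⟩ | h
    · refine (Sym.const _ ⟨K, hK, fun t X hX => ?_⟩ hq).bd n
      rw [← mul_div_assoc, le_div_iff₀ (S'.pos _ _)]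
      exact h t X hX
    · simp only [h]
      exact Bd.zero hq

/-- A smooth cut-off function equal to one on the unit ball. -/
def cut {d : ℕ} : Conf d → ℝ := (⟨1, 2, one_pos, one_lt_two⟩ : ContDiffBump (0 : Conf d))

lemma smooth_cut : Smooth (cut (d := d)) := ContDiffBump.contDiff _

lemma cut_eq_one {x : Conf d} (hx : ‖x‖ ≤ 1) : cut x = 1 :=
  ContDiffBump.one_of_mem_closedBall _ (by simpa using hx)

lemma cut_eq_zero {x : Conf d} (hx : 2 ≤ ‖x‖) : cut x = 0 :=
  ContDiffBump.zero_of_le_dist _ (by simpa using hx)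

lemma cut_zero : cut (0 : Conf d) = 1 := cut_eq_one (by simp)

lemma cut_compact : HasCompactSupport (cut (d := d)) := ContDiffBump.hasCompactSupport _

def unitScale (E : Type*) [NormedAddCommGroup E] [NormedSpace ℝ E] [Dirs E] : Scale E where
  wt := fun _ _ => 1
  pos := fun _ _ => one_pos
  cost := fun _ => 0
  dom := Set.univ

lemma sym_of_compact {E F : Type} [NormedAddCommGroup E] [NormedSpace ℝ E] [Dirs E]
    [NormedAddCommGroup F] [NormedSpace ℝ F] {T : Type*} {ψ : E → F} (hψ : Smooth ψ)
    (hc : HasCompactSupport ψ) (k : ℕ) :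
    Sym (unitScale E) k (fun _ _ => 1) (fun _ : T => ψ) := by
  refine ⟨fun _ => hψ, fun n => ?_⟩
  refine Bd.of_iteratedFDeriv (K := n) (fun _ _ => rfl) (fun _ => hψ) (Or.inl le_rfl) fun m _ => ?_
  have hcont : Continuous (iteratedFDeriv ℝ m ψ) :=
    hψ.continuous_iteratedFDeriv (by exact_mod_cast le_top)
  obtain ⟨C, hC⟩ := hcont.bounded_above_of_compact_support (hc.iteratedFDeriv (𝕜 := ℝ) m)
  exact ⟨|C|, abs_nonneg _, fun _ X _ => by rw [mul_one]; exact (hC X).trans (le_abs_self C)⟩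

lemma Fast.integral_regW {z : Z} {f : Amp Z d → ℂ} (h : Fast z f) :
    ∫ q, ee q * MagneticFIO.regW f (z, q) = ∫ q, ee q * f (z, q) := by
  have hs := h.smooth
  have e1 : ∀ j q, fderiv ℝ (fun q => fderiv ℝ (fun q => f (z, q)) q
      (single j (1 : ℝ), (0 : Conf d))) q (single j 1, 0) =
      pD (wd Z j) (pD (wd Z j) f) (z, q) := by
    intro j q
    have : (fun q => fderiv ℝ (fun q => f (z, q)) q (single j (1 : ℝ), (0 : Conf d))) =
        fun q => pD (wd Z j) f (z, q) := funext fun q => pd_w_slice hs z q j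
    rw [this]
    exact pd_w_slice (smooth_pd hs _) z q j
  have key := integral_ee_reg (x := Prod.snd)
    (v := fun j : Fin d => (single j (1 : ℝ), (0 : Conf d)))
    (g := fun q => f (z, q)) contDiff_snd ?_ ?_ (hs.comp (contDiff_const.prodMk contDiff_id))
    h.integrable ?_ ?_
  · simp only [e1] at key
    exact key
  · intro j q F hF
    have h1 : HasFDerivAt (fun q : Ph d => F q.2) _ q :=
      (smooth_diffAt hF q.2).hasFDerivAt.comp q hasFDerivAt_snd
    rw [h1.fderiv]; simp
  · intro j q
    simp [EuclideanSpace.inner_single_left]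
  · intro j
    simp only [pd_w_slice hs]
    exact (h.pd _).integrable
  · intro j
    simp only [e1]
    exact ((h.pd _).pd _).integrable

lemma Fast.integral_regE {z : Z} {f : Amp Z d → ℂ} (h : Fast z f) :
    ∫ q, ee q * MagneticFIO.regE f (z, q) = ∫ q, ee q * f (z, q) := by
  have hs := h.smooth
  have e1 : ∀ j q, fderiv ℝ (fun q => fderiv ℝ (fun q => f (z, q)) q
      ((0 : Conf d), single j (1 : ℝ))) q (0, single j 1) =
      pD (ed Z j) (pD (ed Z j) f) (z, q) := by
    intro j q
    have : (fun q => fderiv ℝ (fun q => f (z, q)) q ((0 : Conf d), single j (1 : ℝ))) =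
        fun q => pD (ed Z j) f (z, q) := funext fun q => pd_e_slice hs z q j
    rw [this]
    exact pd_e_slice (smooth_pd hs _) z q j
  have key := integral_ee_reg (x := Prod.fst)
    (v := fun j : Fin d => ((0 : Conf d), single j (1 : ℝ)))
    (g := fun q => f (z, q)) contDiff_fst ?_ ?_ (hs.comp (contDiff_const.prodMk contDiff_id))
    h.integrable ?_ ?_
  · simp only [e1] at key
    exact key
  · intro j q F hF
    have h1 : HasFDerivAt (fun q : Ph d => F q.1) _ q :=
      (smooth_diffAt hF q.1).hasFDerivAt.comp q hasFDerivAt_fst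
    rw [h1.fderiv]; simp
  · intro j q
    simp [EuclideanSpace.inner_single_right]
  · intro j
    simp only [pd_e_slice hs]
    exact (h.pd _).integrable
  · intro j
    simp only [e1]
    exact ((h.pd _).pd _).integrable

/-- The regularized oscillatory integral. -/
def oscM (M N : ℕ) (f : Amp Z d → ℂ) (z : Z) : ℂ := ∫ q, ee q * (regE^[N] (regW^[M] f)) (z, q)

lemma Fast.regW_iterate {z : Z} {f : Amp Z d → ℂ} (h : Fast z f) (M : ℕ) :
    Fast z (MagneticFIO.regW^[M] f) := by
  induction M with
  | zero => exact h
  | succ M ih => rw [Function.iterate_succ', Function.comp]; exact ih.regW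

lemma Fast.regE_iterate {z : Z} {f : Amp Z d → ℂ} (h : Fast z f) (M : ℕ) :
    Fast z (MagneticFIO.regE^[M] f) := by
  induction M with
  | zero => exact h
  | succ M ih => rw [Function.iterate_succ', Function.comp]; exact ih.regE

lemma Fast.oscM_eq {z : Z} {f : Amp Z d → ℂ} (h : Fast z f) (M N : ℕ) :
    oscM M N f z = ∫ q, ee q * f (z, q) := by
  have h1 : ∀ M, ∫ q, ee q * (MagneticFIO.regW^[M] f) (z, q) = ∫ q, ee q * f (z, q) := by
    intro M
    induction M with
    | zero => rfl
    | succ M ih =>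
      rw [Function.iterate_succ', Function.comp, (h.regW_iterate M).integral_regW, ih]
  have h2 : ∀ N, ∫ q, ee q * (MagneticFIO.regE^[N] (MagneticFIO.regW^[M] f)) (z, q) =
      ∫ q, ee q * (MagneticFIO.regW^[M] f) (z, q) := by
    intro N
    induction N with
    | zero => rfl
    | succ N ih =>
      rw [Function.iterate_succ', Function.comp,
        ((h.regW_iterate M).regE_iterate N).integral_regE, ih]
  rw [oscM, h2, h1]

lemma smooth_inv_one_add_sq {E : Type*} [NormedAddCommGroup E] [NormedSpace ℝ E]
    {x : E → Conf d} (hx : Smooth x) : Smooth (fun y => (1 + ‖x y‖ ^ 2)⁻¹) :=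
  (contDiff_const.add ((contDiff_norm_sq ℝ).comp hx)).inv fun y => one_add_sq_ne (x y)

lemma smooth_regW {G : ℝ → Amp Z d → ℂ} (hG : Smooth (fun p : ℝ × Amp Z d => G p.1 p.2)) :
    Smooth (fun p : ℝ × Amp Z d => regW (G p.1) p.2) := by
  have h1 : ∀ j, Smooth (fun p : ℝ × Amp Z d => pd (wd Z j) (pd (wd Z j) (G p.1)) p.2) :=
    fun j => smooth_pd_slice (f := fun p : ℝ × Amp Z d => pd (wd Z j) (G p.1) p.2)
      (smooth_pd_slice hG (wd Z j)) (wd Z j)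
  unfold regW
  exact (smooth_inv_one_add_sq (x := fun p : ℝ × Amp Z d => p.2.2.2) (by fun_prop)).smul
    (hG.sub (ContDiff.sum fun j _ => h1 j))

lemma smooth_regE {G : ℝ → Amp Z d → ℂ} (hG : Smooth (fun p : ℝ × Amp Z d => G p.1 p.2)) :
    Smooth (fun p : ℝ × Amp Z d => regE (G p.1) p.2) := by
  have h1 : ∀ j, Smooth (fun p : ℝ × Amp Z d => pd (ed Z j) (pd (ed Z j) (G p.1)) p.2) :=
    fun j => smooth_pd_slice (f := fun p : ℝ × Amp Z d => pd (ed Z j) (G p.1) p.2)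
      (smooth_pd_slice hG (ed Z j)) (ed Z j)
  unfold regE
  exact (smooth_inv_one_add_sq (x := fun p : ℝ × Amp Z d => p.2.2.1) (by fun_prop)).smul
    (hG.sub (ContDiff.sum fun j _ => h1 j))

lemma smooth_reg {G : ℝ → Amp Z d → ℂ} (hG : Smooth (fun p : ℝ × Amp Z d => G p.1 p.2)) (M N : ℕ) :
    Smooth (fun p : ℝ × Amp Z d => (regE^[N] (regW^[M] (G p.1))) p.2) := by
  have h1 : Smooth (fun p : ℝ × Amp Z d => (regW^[M] (G p.1)) p.2) := by
    induction M with
    | zero => exact hG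
    | succ M ih =>
      simp only [Function.iterate_succ', Function.comp]
      exact smooth_regW (G := fun ε => regW^[M] (G ε)) ih
  induction N with
  | zero => exact h1
  | succ N ih =>
    simp only [Function.iterate_succ', Function.comp]
    exact smooth_regE (G := fun ε => regE^[N] (regW^[M] (G ε))) ih

/-- The bound on regularized oscillatory integrals. -/
lemma norm_oscM_le {f : T → Amp Z d → ℂ} (hf : SW O d k ϖ₀ r s f)
    (h0 : ∀ z, 0 ≤ ϖ₀ z) {M N : ℕ} (hk : M * (2 * O.c) ≤ k) (hM : s - 2 * M ≤ -(d + 1))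
    (hN : r + M * (2 * O.a) - 2 * N ≤ -(d + 1)) :
    ∃ C : ℝ, 0 ≤ C ∧ ∀ t, ∀ z ∈ O.D, ‖oscM M N (f t) z‖ ≤ C * (ϖ₀ z * O.v z ^ (2 * M)) := by
  obtain ⟨C, hC, hb⟩ := (hf.reg h0 M N hk).bound
  have hI : 0 ≤ ∫ q : Ph d, br q.1 ^ (-(d + 1) : ℝ) * br q.2 ^ (-(d + 1) : ℝ) :=
    integral_nonneg fun q => mul_nonneg (br_rpow_pos _ _).le (br_rpow_pos _ _).le
  refine ⟨C * ∫ q : Ph d, br q.1 ^ (-(d + 1) : ℝ) * br q.2 ^ (-(d + 1) : ℝ),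
    mul_nonneg hC hI, fun t z hz => ?_⟩
  have h0' : ∀ z, 0 ≤ ϖ₀ z * O.v z ^ (2 * M) := fun z =>
    mul_nonneg (h0 z) (pow_nonneg (zero_le_one.trans (O.one_le_v z)) _)
  have h1 := norm_integral_le_of_norm_le (f := fun q => ee q *
      (MagneticFIO.regE^[N] (MagneticFIO.regW^[M] (f t))) (z, q))
    ((integrable_wgt (Z := Z) (ϖ₀ := fun z => ϖ₀ z * O.v z ^ (2 * M))
      (r := -(d + 1)) (s := -(d + 1)) (d := d) le_rfl le_rfl z).const_mul C)
    (.of_forall fun q => by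
      rw [norm_mul, norm_ee, one_mul]
      exact (hb t (z, q) hz).trans (mul_le_mul_of_nonneg_left (wgt_mono h0' hN hM _) hC))
  refine h1.trans (le_of_eq ?_)
  simp only [wgt]
  rw [← integral_const_mul, ← integral_mul_const]
  refine integral_congr_ae (.of_forall fun q => ?_)
  simp only
  ring

/-- Continuous dependence of regularized oscillatory integrals on parameters. -/
lemma tendsto_oscM {G : ℝ → Amp Z d → ℂ} (hG : Smooth (fun p : ℝ × Amp Z d => G p.1 p.2))
    (hf : SW O d k ϖ₀ r s (fun ε : 𝕀 => G ε))
    (h0 : ∀ z, 0 ≤ ϖ₀ z) {M N : ℕ} (hk : M * (2 * O.c) ≤ k) (hM : s - 2 * M ≤ -(d + 1))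
    (hN : r + M * (2 * O.a) - 2 * N ≤ -(d + 1)) {z : Z} (hz : z ∈ O.D) :
    Tendsto (fun ε => oscM M N (G ε) z) (𝓝[>] 0) (𝓝 (oscM M N (G 0) z)) := by
  obtain ⟨C, hC, hb⟩ := (hf.reg h0 M N hk).bound
  have h0' : ∀ z, 0 ≤ ϖ₀ z * O.v z ^ (2 * M) := fun z =>
    mul_nonneg (h0 z) (pow_nonneg (zero_le_one.trans (O.one_le_v z)) _)
  have hev : ∀ᶠ ε in 𝓝[>] (0 : ℝ), 0 < ε ∧ ε ≤ 1 := by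
    filter_upwards [Ioc_mem_nhdsGT (zero_lt_one' ℝ)] with ε hε using hε
  have hsm := smooth_reg hG M N
  refine tendsto_integral_filter_of_dominated_convergence
    (fun q => C * wgt (fun z => ϖ₀ z * O.v z ^ (2 * M)) (-(d + 1)) (-(d + 1)) (z, q)) ?_ ?_ ?_ ?_
  · refine .of_forall fun ε => Continuous.aestronglyMeasurable ?_
    exact smooth_ee.continuous.mul (hsm.continuous.comp (by fun_prop :
      Continuous fun q : Ph d => (ε, ((z, q) : Amp Z d))))
  · filter_upwards [hev] with ε hε
    refine .of_forall fun q => ?_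
    rw [norm_mul, norm_ee, one_mul]
    exact (hb ⟨ε, hε.1.le, hε.2⟩ (z, q) hz).trans
      (mul_le_mul_of_nonneg_left (wgt_mono h0' hN hM _) hC)
  · exact (integrable_wgt le_rfl le_rfl z).const_mul C
  · refine .of_forall fun q => Tendsto.const_mul _ ?_
    have hc : Continuous fun ε : ℝ => (regE^[N] (regW^[M] (G ε))) ((z, q) : Amp Z d) :=
      hsm.continuous.comp (by fun_prop : Continuous fun ε : ℝ => (ε, ((z, q) : Amp Z d)))
    exact (hc.tendsto 0).mono_left nhdsWithin_le_nhds

/-- Passage to the limit in families of oscillatory integrals. -/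
lemma tendsto_integral_oscM {G : ℝ → Amp Z d → ℂ} (hG : Smooth (fun p : ℝ × Amp Z d => G p.1 p.2))
    (hf : SW O d k ϖ₀ r s (fun ε : 𝕀 => G ε))
    (h0 : ∀ z, 0 ≤ ϖ₀ z) {M N : ℕ} (hk : M * (2 * O.c) ≤ k) (hM : s - 2 * M ≤ -(d + 1))
    (hN : r + M * (2 * O.a) - 2 * N ≤ -(d + 1)) {z : Z} (hz : z ∈ O.D)
    (hfast : ∀ ε, 0 < ε → ε ≤ 1 → Fast z (G ε)) :
    Tendsto (fun ε => ∫ q, ee q * G ε (z, q)) (𝓝[>] 0) (𝓝 (oscM M N (G 0) z)) := by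
  refine (tendsto_oscM hG hf h0 hk hM hN hz).congr' ?_
  filter_upwards [Ioc_mem_nhdsGT (zero_lt_one' ℝ)] with ε hε
  exact (hfast ε hε.1 hε.2).oscM_eq M N

/-- Amplitudes with compact support in `(w, η)`. -/
lemma fast_of_support {f : Amp Z d → ℂ} (hf : Smooth f) {R : ℝ} {N : Set Z}
    (hN : IsOpen N) {z : Z} (hz : z ∈ N)
    (hR : ∀ X : Amp Z d, X.1 ∈ N → (R < ‖X.2.1‖ ∨ R < ‖X.2.2‖) → f X = 0) : Fast z f := by
  refine ⟨fun _ => hf, fun n => ?_⟩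
  have base : ∀ f : Amp Z d → ℂ, Smooth f →
      (∀ X : Amp Z d, X.1 ∈ N → (R < ‖X.2.1‖ ∨ R < ‖X.2.2‖) → f X = 0) →
      ∃ C : ℝ, 0 ≤ C ∧ ∀ _ : Unit, ∀ X ∈ ((flat z).scale d).dom,
        ‖f X‖ ≤ C * wgt (fun _ => 1) (-(d + 1)) (-(d + 1)) X := by
    intro f hf hR
    have hK : IsCompact (Metric.closedBall (0 : Conf d) R ×ˢ Metric.closedBall (0 : Conf d) R) :=
      (isCompact_closedBall 0 R).prod (isCompact_closedBall 0 R)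
    have hcont : Continuous fun q : Ph d =>
        (br q.1 ^ ((d : ℝ) + 1) * br q.2 ^ ((d : ℝ) + 1)) • f (z, q) := by
      have hb : Continuous (bracket (d := d)) := continuous_br
      refine Continuous.smul (f := fun q : Ph d =>
        br q.1 ^ ((d : ℝ) + 1) * br q.2 ^ ((d : ℝ) + 1)) ?_ (hf.continuous.comp
        (by fun_prop : Continuous fun q : Ph d => ((z, q) : Amp Z d)))
      exact ((hb.comp continuous_fst).rpow_const fun q => Or.inl (br_pos _).ne').mul
        ((hb.comp continuous_snd).rpow_const fun q => Or.inl (br_pos _).ne')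
    obtain ⟨C, hC⟩ := hK.exists_bound_of_continuousOn hcont.continuousOn
    refine ⟨|C|, abs_nonneg _, fun _ X hX => ?_⟩
    obtain ⟨z', q⟩ := X
    obtain rfl : z' = z := hX
    by_cases hq : R < ‖q.1‖ ∨ R < ‖q.2‖
    · rw [hR (z', q) hz hq, norm_zero]
      exact mul_nonneg (abs_nonneg _) (wgt_nonneg (fun _ => zero_le_one) _)
    · push Not at hq
      have h1 := hC q ⟨by simpa using hq.1, by simpa using hq.2⟩
      rw [norm_smul, Real.norm_of_nonneg (mul_nonneg (br_rpow_pos _ _).le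
        (br_rpow_pos _ _).le)] at h1
      have h2 : 0 < br q.1 ^ ((d : ℝ) + 1) := br_rpow_pos _ _
      have h3 : 0 < br q.2 ^ ((d : ℝ) + 1) := br_rpow_pos _ _
      simp only [wgt, one_mul]
      rw [Real.rpow_neg (br_pos _).le, Real.rpow_neg (br_pos _).le, ← mul_inv, ← div_eq_mul_inv,
        le_div_iff₀ (mul_pos h2 h3), mul_comm]
      exact h1.trans (le_abs_self C)
  induction n generalizing f with
  | zero => exact base f hf hR
  | succ n ih =>
    refine ⟨base f hf hR, fun i hi => ?_⟩
    have h0 : ((flat z).scale d).cost i = 0 := by rcases i with i | i | i <;> rfl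
    refine ((ih (f := pd i f) (smooth_pd hf i) ?_).mono_k (k' := 0 - ((flat z).scale d).cost i)
      (by omega)).congr_weight fun t X _ => ?_
    · intro X hXN hX
      have ho : IsOpen {X : Amp Z d | X.1 ∈ N ∧ (R < ‖X.2.1‖ ∨ R < ‖X.2.2‖)} :=
        (hN.preimage continuous_fst).inter <| (isOpen_lt (g := fun X : Amp Z d => ‖X.2.1‖) continuous_const (by fun_prop)).union
          (isOpen_lt (g := fun X : Amp Z d => ‖X.2.2‖) continuous_const (by fun_prop))
      have : f =ᶠ[𝓝 X] fun _ => 0 := by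
        filter_upwards [ho.mem_nhds ⟨hXN, hX⟩] with Y hY using hR Y hY.1 hY.2
      simp only [pd]
      rw [this.fderiv_eq]; simp
    · have : ((flat z).scale d).wt i X = 1 := by
        rcases i with i | i | i <;> simp [OscData.scale, flat]
      rw [this, mul_one]

def wM (Z : Type) [NormedAddCommGroup Z] [NormedSpace ℝ Z] (d : ℕ) : Amp Z d →L[ℝ] Conf d :=
  (fst ℝ _ _).comp (snd ℝ Z (Ph d))

def eM (Z : Type) [NormedAddCommGroup Z] [NormedSpace ℝ Z] (d : ℕ) : Amp Z d →L[ℝ] Conf d :=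
  (snd ℝ _ _).comp (snd ℝ Z (Ph d))

@[simp] lemma wM_apply (X : Amp Z d) : wM Z d X = X.2.1 := rfl
@[simp] lemma eM_apply (X : Amp Z d) : eM Z d X = X.2.2 := rfl

lemma sym_cut_w {ψ : Conf d → ℂ} (hψ : Smooth ψ) (hc : HasCompactSupport ψ) (O : OscData Z)
    (k : ℕ) : Sym (O.scale d) k (fun _ _ => 1) (fun (ε : 𝕀) X => ψ ((ε : ℝ) • X.2.1)) := by
  refine (sym_of_compact (T := 𝕀) hψ hc k).compLin (fun ε => (ε : ℝ) • wM Z d)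
    (fun _ _ _ => Set.mem_univ _) (fun _ _ _ => zero_le_one) ?_
  rintro (i | i | i) j
  · right; intro t; simp
  · left
    refine ⟨Nat.zero_le _, 1, zero_le_one, fun t X _ => ?_⟩
    have h1 := O.one_le_wt_w i X
    have h2 : |(t : ℝ) * (single i (1 : ℝ) : Conf d) j| ≤ 1 := by
      rw [abs_mul, abs_of_nonneg t.2.1]
      exact mul_le_one₀ t.2.2 (abs_nonneg _) (abs_single_le _ _)
    simp only [unitScale, mul_one, one_mul]
    refine le_trans ?_ (h2.trans h1)
    simp
  · right; intro t; simp

lemma sym_cut_e {ψ : Conf d → ℂ} (hψ : Smooth ψ) (hc : HasCompactSupport ψ) (O : OscData Z)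
    (k : ℕ) : Sym (O.scale d) k (fun _ _ => 1) (fun (ε : 𝕀) X => ψ ((ε : ℝ) • X.2.2)) := by
  refine (sym_of_compact (T := 𝕀) hψ hc k).compLin (fun ε => (ε : ℝ) • eM Z d)
    (fun _ _ _ => Set.mem_univ _) (fun _ _ _ => zero_le_one) ?_
  rintro (i | i | i) j
  · right; intro t; simp
  · right; intro t; simp
  · left
    refine ⟨Nat.zero_le _, 1, zero_le_one, fun t X _ => ?_⟩
    have h2 : |(t : ℝ) * (single i (1 : ℝ) : Conf d) j| ≤ 1 := by
      rw [abs_mul, abs_of_nonneg t.2.1]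
      exact mul_le_one₀ t.2.2 (abs_nonneg _) (abs_single_le _ _)
    simp only [unitScale, mul_one, one_mul]
    refine le_trans ?_ (h2.trans (O.wt_e i X).ge)
    simp

def ccut (x : Conf d) : ℂ := cut x

lemma smooth_ccut : Smooth (ccut (d := d)) := Complex.ofRealCLM.contDiff.comp smooth_cut

lemma ccut_compact : HasCompactSupport (ccut (d := d)) :=
  cut_compact.comp_left (g := fun x : ℝ => (x : ℂ)) Complex.ofReal_zero

lemma ccut_eq_zero {x : Conf d} (hx : 2 ≤ ‖x‖) : ccut x = 0 := by
  rw [ccut, cut_eq_zero hx, Complex.ofReal_zero]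

lemma ccut_zero : ccut (0 : Conf d) = 1 := by rw [ccut, cut_zero, Complex.ofReal_one]

def cd (d : ℕ) : ℂ := (((2 * Real.pi) ^ d : ℝ) : ℂ)⁻¹

/-- The oscillatory integral `(2π)^{-d} ∬ e^{-i⟨w, η⟩} f(w, η) dw dη`. -/
def osc (f : Ph d → ℂ) : ℂ := cd d * limUnder (𝓝[>] (0 : ℝ))
    (fun ε => ∫ q, ee q * (ccut (ε • q.1) * ccut (ε • q.2) * f q))

lemma fast_of_cut {ψ₁ ψ₂ : Conf d → ℂ} (h1 : Smooth ψ₁) (c1 : HasCompactSupport ψ₁)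
    (h2 : Smooth ψ₂) (c2 : HasCompactSupport ψ₂) {f : Amp Z d → ℂ} (hf : Smooth f)
    {ε : ℝ} (hε : 0 < ε) (z : Z) : Fast z (fun X => ψ₁ (ε • X.2.1) * ψ₂ (ε • X.2.2) * f X) := by
  obtain ⟨R, hR⟩ := c1.isBounded.subset_closedBall (0 : Conf d)
  obtain ⟨R', hR'⟩ := c2.isBounded.subset_closedBall (0 : Conf d)
  refine fast_of_support (R := max R R' / ε) ?_ isOpen_univ (Set.mem_univ z) ?_
  · have e1 : Smooth fun X : Amp Z d => ψ₁ (ε • X.2.1) := h1.comp (by fun_prop)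
    have e2 : Smooth fun X : Amp Z d => ψ₂ (ε • X.2.2) := h2.comp (by fun_prop)
    exact (e1.mul e2).mul hf
  · rintro X - (hX | hX)
    · have : ψ₁ (ε • X.2.1) = 0 := by
        apply image_eq_zero_of_notMem_tsupport
        intro hmem
        have := hR hmem
        rw [mem_closedBall_zero_iff, norm_smul, Real.norm_of_nonneg hε.le] at this
        rw [div_lt_iff₀ hε] at hX
        linarith [le_max_left R R']
      rw [this]; ring
    · have : ψ₂ (ε • X.2.2) = 0 := by
        apply image_eq_zero_of_notMem_tsupport
        intro hmem
        have := hR' hmem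
        rw [mem_closedBall_zero_iff, norm_smul, Real.norm_of_nonneg hε.le] at this
        rw [div_lt_iff₀ hε] at hX
        linarith [le_max_right R R']
      rw [this]; ring

lemma sym_cut_mul {ψ₁ ψ₂ : Conf d → ℂ} (h1 : Smooth ψ₁) (c1 : HasCompactSupport ψ₁)
    (h2 : Smooth ψ₂) (c2 : HasCompactSupport ψ₂) {ϖ : Amp Z d → ℝ}
    {f : 𝕀 → Amp Z d → ℂ}
    (hf : Sym (O.scale d) k (fun _ => ϖ) f) : Sym (O.scale d) k (fun _ => ϖ)
      (fun (ε : 𝕀) X => ψ₁ ((ε : ℝ) • X.2.1) * ψ₂ ((ε : ℝ) • X.2.2) * f ε X) := by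
  refine (((sym_cut_w h1 c1 O k).mul (sym_cut_e h2 c2 O k)).mul hf).congr_weight fun t X _ => ?_
  ring

lemma smooth_cut_mul {ψ₁ ψ₂ : Conf d → ℂ} (h1 : Smooth ψ₁) (h2 : Smooth ψ₂)
    {G : ℝ → Amp Z d → ℂ} (hG : Smooth (fun p : ℝ × Amp Z d => G p.1 p.2)) :
    Smooth (fun p : ℝ × Amp Z d => ψ₁ (p.1 • p.2.2.1) * ψ₂ (p.1 • p.2.2.2) * G p.1 p.2) := by
  have e1 : Smooth fun p : ℝ × Amp Z d => ψ₁ (p.1 • p.2.2.1) := h1.comp (by fun_prop)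
  have e2 : Smooth fun p : ℝ × Amp Z d => ψ₂ (p.1 • p.2.2.2) := h2.comp (by fun_prop)
  exact (e1.mul e2).mul hG

/-- The oscillatory integral equals its regularizations. -/
lemma osc_eq_oscM {f : Amp Z d → ℂ} (hf : SW O d k ϖ₀ r s (fun _ : Unit => f))
    (h0 : ∀ z, 0 ≤ ϖ₀ z) {M N : ℕ} (hk : M * (2 * O.c) ≤ k) (hM : s - 2 * M ≤ -(d + 1))
    (hN : r + M * (2 * O.a) - 2 * N ≤ -(d + 1)) {z : Z} (hz : z ∈ O.D) :
    osc (fun q => f (z, q)) = cd d * oscM M N f z := by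
  have hs := hf.smooth ()
  have := tendsto_integral_oscM (G := fun ε X => ccut (ε • X.2.1) * ccut (ε • X.2.2) * f X)
    (smooth_cut_mul (G := fun _ => f) smooth_ccut smooth_ccut (hs.comp contDiff_snd))
    (sym_cut_mul smooth_ccut ccut_compact smooth_ccut ccut_compact
      (hf.reindex (fun _ : 𝕀 => ()))) h0 hk hM hN hz
    (fun ε hε _ => fast_of_cut smooth_ccut ccut_compact smooth_ccut ccut_compact hs hε z)
  rw [osc, this.limUnder_eq]
  simp only [zero_smul, ccut_zero, one_mul]

lemma exists_nat_two_mul (x y : ℝ) : ∃ N : ℕ, x - 2 * N ≤ y := by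
  obtain ⟨N, hN⟩ := exists_nat_ge ((x - y) / 2)
  exact ⟨N, by linarith⟩

/-- Convergence of families of oscillatory integrals. -/
lemma tendsto_osc {G : ℝ → Amp Z d → ℂ} (hG : Smooth (fun p : ℝ × Amp Z d => G p.1 p.2))
    (hf : SW O d k ϖ₀ r s (fun ε : 𝕀 => G ε))
    (h0 : ∀ z, 0 ≤ ϖ₀ z) (M : ℕ) (hk : M * (2 * O.c) ≤ k) (hM : s - 2 * M ≤ -(d + 1))
    {z : Z} (hz : z ∈ O.D)
    (hfast : ∀ ε, 0 < ε → ε ≤ 1 → Fast z (G ε)) :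
    Tendsto (fun ε => cd d * ∫ q, ee q * G ε (z, q)) (𝓝[>] 0) (𝓝 (osc fun q => G 0 (z, q))) := by
  obtain ⟨N, hN⟩ := exists_nat_two_mul (r + M * (2 * O.a)) (-(d + 1))
  rw [osc_eq_oscM (hf.reindex (fun _ : Unit => (⟨0, le_rfl, zero_le_one⟩ : 𝕀))) h0 hk hM hN hz]
  exact (tendsto_integral_oscM hG hf h0 hk hM hN hz hfast).const_mul _

lemma norm_osc_le {f : T → Amp Z d → ℂ} (hf : SW O d k ϖ₀ r s f)
    (h0 : ∀ z, 0 ≤ ϖ₀ z) {M : ℕ} (hk : M * (2 * O.c) ≤ k) (hM : s - 2 * M ≤ -(d + 1)) :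
    ∃ C : ℝ, 0 ≤ C ∧ ∀ t, ∀ z ∈ O.D,
      ‖osc (fun q => f t (z, q))‖ ≤ C * (ϖ₀ z * O.v z ^ (2 * M)) := by
  obtain ⟨N, hN⟩ := exists_nat_two_mul (r + M * (2 * O.a)) (-(d + 1))
  obtain ⟨C, hC, h⟩ := norm_oscM_le hf h0 hk hM hN
  refine ⟨‖cd d‖ * C, by positivity, fun t z hz => ?_⟩
  rw [osc_eq_oscM (hf.reindex (fun _ : Unit => t)) h0 hk hM hN hz, norm_mul, mul_assoc]
  exact mul_le_mul_of_nonneg_left (h t z hz) (norm_nonneg _)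

/-- Integrals of rapidly decaying amplitudes are oscillatory integrals. -/
lemma Fast.osc_eq {z : Z} {f : Amp Z d → ℂ} (h : Fast z f) :
    osc (fun q => f (z, q)) = cd d * ∫ q, ee q * f (z, q) := by
  have h1 := osc_eq_oscM (O := flat z) (k := 0) (M := 0) (N := 0) h (fun _ => zero_le_one)
    (by simp) (by simp) (by simp) (z := z) rfl
  rw [h1, h.oscM_eq]

lemma fderiv_snd_comp {E F G : Type*} [NormedAddCommGroup E] [NormedSpace ℝ E]
    [NormedAddCommGroup F] [NormedSpace ℝ F] [NormedAddCommGroup G] [NormedSpace ℝ G]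
    {c : F → G} (hc : Smooth c) (X : E × F) (v : E) :
    fderiv ℝ (fun X : E × F => c X.2) X (v, 0) = 0 := by
  have h : HasFDerivAt (fun X : E × F => c X.2) _ X :=
    ((hc.differentiable (by simp)) X.2).hasFDerivAt.comp X hasFDerivAt_snd
  rw [h.fderiv]; simp

lemma sum_dirs {E F G : Type*} [NormedAddCommGroup E] [NormedSpace ℝ E] [Dirs E]
    [NormedAddCommGroup F] [NormedSpace ℝ F] [Dirs F] [AddCommMonoid G] (f : Dirs.ι (E × F) → G) :
    ∑ i, f i = ∑ i : Dirs.ι E, f (Sum.inl i) + ∑ i : Dirs.ι F, f (Sum.inr i) :=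
  Fintype.sum_sum_type f

lemma pd_sub {f g : E → F} (hf : Smooth f) (hg : Smooth g) (i : Dirs.ι E) :
    pd i (fun X => f X - g X) = fun X => pd i f X - pd i g X := by
  funext X
  simp only [pd]
  rw [fderiv_fun_sub (smooth_diffAt hf X) (smooth_diffAt hg X)]
  rfl

lemma pd_sum {α E F : Type*} [NormedAddCommGroup E] [NormedSpace ℝ E] [Dirs E]
    [NormedAddCommGroup F] [NormedSpace ℝ F] (s : Finset α) {f : α → E → F}
    (hf : ∀ a ∈ s, Smooth (f a)) (i : Dirs.ι E) :
    pd i (fun X => ∑ a ∈ s, f a X) = fun X => ∑ a ∈ s, pd i (f a) X := by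
  funext X
  simp only [pd]
  rw [fderiv_fun_sum fun a ha => smooth_diffAt (hf a ha) X]
  simp

lemma pd_z_smul {c : Ph d → ℝ} (hc : Smooth c) {f : Amp Z d → ℂ} (hf : Smooth f) (i : Dirs.ι Z) :
    pd (zd d i) (fun X => c X.2 • f X) = fun X => c X.2 • pd (zd d i) f X := by
  have h := pd_bilin (ContinuousLinearMap.lsmul ℝ ℝ (E := ℂ)) (f := fun X : Amp Z d => c X.2)
    (hc.comp contDiff_snd) hf (zd d i)
  have h0 : pd (zd d i) (fun X : Amp Z d => c X.2) = fun _ => 0 := by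
    funext X
    simpa [pd] using fderiv_snd_comp hc X (Dirs.b i)
  simp only [h0, ContinuousLinearMap.lsmul_apply, zero_smul, zero_add] at h
  exact h

lemma smooth_regW_one {f : Amp Z d → ℂ} (hf : Smooth f) : Smooth (regW f) := by
  unfold regW
  exact (smooth_inv_one_add_sq (x := fun X : Amp Z d => X.2.2) (by fun_prop)).smul
    (hf.sub (ContDiff.sum fun j _ => smooth_pd (smooth_pd hf _) _))

lemma smooth_regE_one {f : Amp Z d → ℂ} (hf : Smooth f) : Smooth (regE f) := by
  unfold regE
  exact (smooth_inv_one_add_sq (x := fun X : Amp Z d => X.2.1) (by fun_prop)).smul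
    (hf.sub (ContDiff.sum fun j _ => smooth_pd (smooth_pd hf _) _))

lemma pd_regW {f : Amp Z d → ℂ} (hf : Smooth f) (i : Dirs.ι Z) :
    pd (zd d i) (regW f) = regW (pd (zd d i) f) := by
  have h2 : ∀ j, Smooth (pd (wd Z j) (pd (wd Z j) f)) := fun j =>
    smooth_pd (smooth_pd hf _) _
  unfold regW
  rw [pd_z_smul (c := fun q => (1 + ‖q.2‖ ^ 2)⁻¹)
    (smooth_inv_one_add_sq (x := fun q : Ph d => q.2) contDiff_snd)
    (hf.sub (ContDiff.sum fun j _ => h2 j)), pd_sub hf (ContDiff.sum fun j _ => h2 j),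
    pd_sum _ fun j _ => h2 j]
  simp only [pd_comm (smooth_pd hf _) (zd d i), pd_comm hf (zd d i)]

lemma pd_regE {f : Amp Z d → ℂ} (hf : Smooth f) (i : Dirs.ι Z) :
    pd (zd d i) (regE f) = regE (pd (zd d i) f) := by
  have h2 : ∀ j, Smooth (pd (ed Z j) (pd (ed Z j) f)) := fun j =>
    smooth_pd (smooth_pd hf _) _
  unfold regE
  rw [pd_z_smul (c := fun q => (1 + ‖q.1‖ ^ 2)⁻¹)
    (smooth_inv_one_add_sq (x := fun q : Ph d => q.1) contDiff_fst)
    (hf.sub (ContDiff.sum fun j _ => h2 j)), pd_sub hf (ContDiff.sum fun j _ => h2 j),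
    pd_sum _ fun j _ => h2 j]
  simp only [pd_comm (smooth_pd hf _) (zd d i), pd_comm hf (zd d i)]

lemma pd_reg {f : Amp Z d → ℂ} (hf : Smooth f) (i : Dirs.ι Z) (M N : ℕ) :
    Smooth (regE^[N] (regW^[M] f)) ∧
    pd (zd d i) (regE^[N] (regW^[M] f)) = regE^[N] (regW^[M] (pd (zd d i) f)) := by
  have h1 : Smooth (regW^[M] f) ∧ pd (zd d i) (regW^[M] f) = regW^[M] (pd (zd d i) f) := by
    induction M with
    | zero => exact ⟨hf, rfl⟩
    | succ M ih =>
      simp only [Function.iterate_succ', Function.comp]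
      exact ⟨smooth_regW_one ih.1, by rw [pd_regW ih.1, ih.2]⟩
  induction N with
  | zero => exact h1
  | succ N ih =>
    simp only [Function.iterate_succ', Function.comp]
    exact ⟨smooth_regE_one ih.1, by rw [pd_regE ih.1, ih.2]⟩

lemma wgt_mul_wt_z (i : Dirs.ι Z) (X : Amp Z d) : wgt ϖ₀ r s X * (O.scale d).wt (zd d i) X =
    wgt (fun z => ϖ₀ z * O.g i z) (r + O.a) (s + O.a) X := by
  rw [O.wt_z]
  unfold wgt
  rw [Real.rpow_add (br_pos _), Real.rpow_add (br_pos _), Real.rpow_natCast, Real.rpow_natCast,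
    mul_pow]
  ring

lemma Sym.pd_z {f : T → Amp Z d → ℂ} (hf : SW O d k ϖ₀ r s f)
    (i : Dirs.ι Z) (hk : O.c ≤ k) : SW O d (k - O.c) (fun z => ϖ₀ z * O.g i z) (r + O.a) (s + O.a) (fun t => pD (zd d i) (f t)) :=
  (hf.pd (zd d i) hk).congr_weight fun _ X _ => wgt_mul_wt_z i X

/-- Full parameter domain and continuous weights. -/
structure OscData.Regular (O : OscData Z) : Prop where
  dom : O.D = Set.univ
  v : Continuous O.v
  g : ∀ i, Continuous (O.g i)

lemma OscData.Regular.mem (hO : O.Regular) (z : Z) : z ∈ O.D := by rw [hO.dom]; trivial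

/-- Differentiation of oscillatory integrals with respect to parameters. -/
lemma hasFDerivAt_osc (hO : O.Regular) {f : Amp Z d → ℂ} (hf : SW O d k ϖ₀ r s (fun _ : Unit => f))
    (h0 : ∀ z, 0 ≤ ϖ₀ z) (hc : Continuous ϖ₀) {M : ℕ} (hM : s - 2 * M ≤ -(d + 1))
    (hk : (2 * (M + O.a) + 1) * O.c ≤ k) (z : Z) :
    HasFDerivAt (fun z => osc fun q => f (z, q))
      (∑ i, (co i).smulRight (osc fun q => pd (zd d i) f (z, q))) z := by
  have hs := hf.smooth ()
  obtain ⟨N, hN⟩ := exists_nat_two_mul (r + (M + O.a : ℕ) * (2 * O.a) + O.a) (-(d + 1))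
  set M' := M + O.a with hM'
  have ha : (0 : ℝ) ≤ O.a := Nat.cast_nonneg _
  have hM1 : s + O.a - 2 * M' ≤ -(d + 1) := by rw [hM']; push_cast; linarith
  have hM0 : s - 2 * M' ≤ -(d + 1) := by linarith
  have hN0 : r + M' * (2 * O.a) - 2 * N ≤ -(d + 1) := by linarith
  have hN1 : r + O.a + M' * (2 * O.a) - 2 * N ≤ -(d + 1) := by linarith
  have hk' : M' * (2 * O.c) + O.c ≤ k := by
    refine le_trans (le_of_eq ?_) hk
    ring
  have hc0 : O.c ≤ k := by omega
  set h := regE^[N] (regW^[M'] f) with hh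
  have hsm : Smooth h := smooth_reg (G := fun _ => f) (hs.comp contDiff_snd) M' N |>.comp
    (contDiff_const (c := (0 : ℝ)) |>.prodMk contDiff_id)
  have e0 : ∀ z, osc (fun q => f (z, q)) = cd d * ∫ q, ee q * h (z, q) := fun z =>
    osc_eq_oscM hf h0 (by omega) hM0 hN0 (hO.mem z)
  have e1 : ∀ i z, osc (fun q => pd (zd d i) f (z, q)) = cd d * ∫ q, ee q * pd (zd d i) h (z, q) := by
    intro i z
    rw [hh, (pd_reg hs i M' N).2]
    exact osc_eq_oscM (hf.pd_z i hc0) (fun z => mul_nonneg (h0 z) (O.g_pos i z).le) (by omega)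
      hM1 hN1 (hO.mem z)
  have hS := hf.reg h0 M' N (by omega)
  have h1 : ∀ z, 0 ≤ ϖ₀ z * O.v z ^ (2 * M') := fun z =>
    mul_nonneg (h0 z) (pow_nonneg (zero_le_one.trans (O.one_le_v z)) _)
  obtain ⟨C, hC, hb⟩ := hS.bound
  have hb1 := fun i => (hS.pd_z i (by omega)).bound
  choose C1 hC1 hb1 using hb1
  set W : Z → Ph d → ℝ := fun z q => wgt (fun _ => 1) (-(d + 1)) (-(d + 1)) (z, q) with hW
  have hWpos : ∀ z q, 0 ≤ W z q := fun z q => wgt_nonneg (fun _ => zero_le_one) _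
  have hWi : ∀ z, Integrable (W z) := fun z => integrable_wgt le_rfl le_rfl z
  have split : ∀ (ϖ : Z → ℝ) (z : Z) (q : Ph d),
      wgt ϖ (-(d + 1)) (-(d + 1)) (z, q) = ϖ z * W z q := fun ϖ z q => by
    simp only [hW, wgt]; ring
  have hb' : ∀ z q, ‖h (z, q)‖ ≤ C * (ϖ₀ z * O.v z ^ (2 * M') * W z q) := fun z q =>
    (hb () (z, q) (hO.mem z)).trans (mul_le_mul_of_nonneg_left
      ((wgt_mono h1 hN0 hM0 _).trans (split _ z q).le) hC)
  have hb1' : ∀ i z q, ‖pd (zd d i) h (z, q)‖ ≤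
      C1 i * (ϖ₀ z * O.v z ^ (2 * M') * O.g i z * W z q) := fun i z q =>
    (hb1 i () (z, q) (hO.mem z)).trans (mul_le_mul_of_nonneg_left
      ((wgt_mono (fun z => mul_nonneg (h1 z) (O.g_pos i z).le) (by linarith) (by linarith) _).trans
      (split _ z q).le) (hC1 i))
  set K : Z → ℝ := fun z => ∑ i, ‖co (E := Z) i‖ * (C1 i * (ϖ₀ z * O.v z ^ (2 * M') * O.g i z)) with hK
  have hKc : Continuous K := by
    refine continuous_finsetSum _ fun i _ => ?_
    exact continuous_const.mul (continuous_const.mul ((hc.mul (hO.v.pow _)).mul (hO.g i)))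
  have hmeas : ∀ (g : Amp Z d → ℂ), Smooth g → ∀ z,
      AEStronglyMeasurable (fun q => ee q * g (z, q)) volume := fun g hg z =>
    (smooth_ee.continuous.mul (hg.continuous.comp (by fun_prop))).aestronglyMeasurable
  have key := hasFDerivAt_integral_of_dominated_of_fderiv_le (𝕜 := ℝ) (μ := volume)
    (F := fun z (q : Ph d) => ee q * h (z, q))
    (F' := fun z q => ∑ i, (co i).smulRight (ee q * pd (zd d i) h (z, q)))
    (x₀ := z) (s := {z' | K z' < K z + 1}) (bound := fun q => (K z + 1) * W z q)
    ((isOpen_lt hKc continuous_const).mem_nhds (by simp))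
    (.of_forall fun z => hmeas h hsm z) ?_ ?_ ?_ ((hWi z).const_mul _) ?_
  · have hi : ∀ i, Integrable fun q => ee q * pd (zd d i) h (z, q) := by
      intro i
      refine Integrable.mono' ((hWi z).const_mul (C1 i * (ϖ₀ z * O.v z ^ (2 * M') * O.g i z)))
        (hmeas _ (smooth_pd hsm _) z) (.of_forall fun q => ?_)
      rw [norm_mul, norm_ee, one_mul]
      exact (hb1' i z q).trans (le_of_eq (by ring))
    have e2 : ∀ i, ∫ q, (co i).smulRight (ee q * pd (zd d i) h (z, q)) =
        (co i).smulRight (∫ q, ee q * pd (zd d i) h (z, q)) := fun i =>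
      ((ContinuousLinearMap.smulRightL ℝ Z ℂ (co i)).integral_comp_comm (hi i))
    have hi' : ∀ i, Integrable fun q => (co i).smulRight (ee q * pd (zd d i) h (z, q)) := fun i =>
      (ContinuousLinearMap.smulRightL ℝ Z ℂ (co i)).integrable_comp (hi i)
    rw [integral_finsetSum _ fun i _ => hi' i] at key
    simp only [e2] at key
    have key2 := key.const_mul (cd d)
    simp only [← e0] at key2
    refine key2.congr_fderiv ?_
    rw [Finset.smul_sum]
    refine sum_congr rfl fun i _ => ?_
    rw [e1]
    ext v
    simp [mul_left_comm]
  · refine Integrable.mono' ((hWi z).const_mul (C * (ϖ₀ z * O.v z ^ (2 * M')))) (hmeas h hsm z)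
      (.of_forall fun q => ?_)
    rw [norm_mul, norm_ee, one_mul]
    exact (hb' z q).trans (le_of_eq (by ring))
  · refine Continuous.aestronglyMeasurable (continuous_finsetSum _ fun i _ => ?_)
    exact (ContinuousLinearMap.smulRightL ℝ Z ℂ (co i)).continuous.comp
      (smooth_ee.continuous.mul ((smooth_pd hsm _).continuous.comp (by fun_prop)))
  · refine .of_forall fun q z' hz' => ?_
    have hle : ∑ i, ‖co (E := Z) i‖ * (C1 i * (ϖ₀ z' * O.v z' ^ (2 * M') * O.g i z' * W z' q)) =
        K z' * W z q := by
      rw [hK, sum_mul]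
      exact sum_congr rfl fun i _ => by simp only [hW, wgt]; ring
    refine (norm_sum_le _ _).trans (le_trans (sum_le_sum fun i _ => ?_)
      (hle.le.trans (mul_le_mul_of_nonneg_right (le_of_lt hz') (hWpos z q))))
    rw [ContinuousLinearMap.norm_smulRight_apply, norm_mul, norm_ee, one_mul]
    exact mul_le_mul_of_nonneg_left (hb1' i z' q) (norm_nonneg _)
  · refine .of_forall fun q z' _ => ?_
    have h2 : HasFDerivAt (fun z' => h (z', q)) _ z' :=
      (smooth_diffAt hsm (z', q)).hasFDerivAt.comp z' (hasFDerivAt_prodMk_left z' q)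
    refine (h2.const_mul (ee q)).congr_fderiv ?_
    ext v
    simp only [_root_.sum_apply, ContinuousLinearMap.smulRight_apply, _root_.smul_apply,
      ContinuousLinearMap.comp_apply, ContinuousLinearMap.inl_apply, smul_eq_mul]
    rw [fderiv_eq_sum_pd, sum_dirs]
    simp [mul_sum, mul_left_comm]

/-- The scale of an oscillatory integral as a function of its parameters. -/
def OscData.out (O : OscData Z) : Scale Z where
  wt := fun i z => O.g i z * O.v z ^ (2 * O.a)
  pos := fun i z => mul_pos (O.g_pos i z) (pow_pos (one_pos.trans_le (O.one_le_v z)) _)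
  cost := fun _ => 0
  dom := Set.univ

lemma pd_osc (hO : O.Regular) {f : Amp Z d → ℂ} (hf : SW O d k ϖ₀ r s (fun _ : Unit => f))
    (h0 : ∀ z, 0 ≤ ϖ₀ z) (hc : Continuous ϖ₀) {M : ℕ} (hM : s - 2 * M ≤ -(d + 1))
    (hk : (2 * (M + O.a) + 1) * O.c ≤ k) (i : Dirs.ι Z) :
    pd i (fun z => osc fun q => f (z, q)) = fun z => osc fun q => pd (zd d i) f (z, q) := by
  classical
  funext z
  rw [pd, (hasFDerivAt_osc hO hf h0 hc hM hk z).fderiv]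
  simp [co_apply, Finsupp.single_apply]

/-- Regularity of oscillatory integrals in their parameters. -/
lemma contDiff_bd_osc (hO : O.Regular) (n : ℕ) {k : ℕ} {ϖ₀ : Z → ℝ} {r s : ℝ} {f : T → Amp Z d → ℂ}
    (hf : SW O d k ϖ₀ r s f)
    (h0 : ∀ z, 0 ≤ ϖ₀ z) (hc : Continuous ϖ₀) {M : ℕ} (hM : s - 2 * M ≤ -(d + 1))
    (hk : (2 * (M + n * O.a) + n) * O.c ≤ k) :
    (∀ t, ContDiff ℝ n (fun z => osc fun q => f t (z, q))) ∧
    Bd O.out n 0 (fun _ z => ϖ₀ z * O.v z ^ (2 * M)) (fun t z => osc fun q => f t (z, q)) := by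
  induction n generalizing k ϖ₀ r s f M with
  | zero =>
    obtain ⟨C, hC, h⟩ := norm_osc_le hf h0 (M := M) (by
      refine le_trans (le_of_eq ?_) hk; ring) hM
    refine ⟨fun t => ?_, C, hC, fun t z _ => h t z (hO.mem z)⟩
    rw [Nat.cast_zero, contDiff_zero]
    obtain ⟨N, hN⟩ := exists_nat_two_mul (r + M * (2 * O.a)) (-(d + 1))
    have e0 : ∀ z, osc (fun q => f t (z, q)) = cd d * oscM M N (f t) z := fun z =>
      osc_eq_oscM (hf.reindex (fun _ : Unit => t)) h0 (by refine le_trans (le_of_eq ?_) hk; ring)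
        hM hN (hO.mem z)
    simp only [e0]
    refine continuous_const.mul ?_
    have hS := (hf.reindex (fun _ : Unit => t)).reg h0 M N
      (by refine le_trans (le_of_eq ?_) hk; ring)
    obtain ⟨C', hC', hb⟩ := hS.bound
    rw [continuous_iff_continuousAt]
    intro z
    have h1 : ∀ z, 0 ≤ ϖ₀ z * O.v z ^ (2 * M) := fun z =>
      mul_nonneg (h0 z) (pow_nonneg (zero_le_one.trans (O.one_le_v z)) _)
    have hKc : Continuous fun z => ϖ₀ z * O.v z ^ (2 * M) := hc.mul (hO.v.pow _)
    refine continuousAt_of_dominated (bound := fun q => C' * ((ϖ₀ z * O.v z ^ (2 * M) + 1) *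
      wgt (fun _ => 1) (-(d + 1)) (-(d + 1)) (z, q))) ?_ ?_ ?_ ?_
    · exact .of_forall fun z => (smooth_ee.continuous.mul
        ((hS.smooth ()).continuous.comp (by fun_prop))).aestronglyMeasurable
    · filter_upwards [(isOpen_lt hKc continuous_const).mem_nhds
        (show ϖ₀ z * O.v z ^ (2 * M) < ϖ₀ z * O.v z ^ (2 * M) + 1 by simp)] with z' hz'
      refine .of_forall fun q => ?_
      rw [norm_mul, norm_ee, one_mul]
      refine (hb () (z', q) (hO.mem z')).trans (mul_le_mul_of_nonneg_left ?_ hC')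
      refine (wgt_mono h1 hN hM _).trans ?_
      refine le_trans (le_of_eq ?_) (mul_le_mul_of_nonneg_right (le_of_lt hz')
        (wgt_nonneg (fun _ => zero_le_one) _))
      simp only [wgt]; ring
    · exact ((integrable_wgt le_rfl le_rfl z).const_mul _).const_mul _
    · exact .of_forall fun q => (continuous_const.mul
        ((hS.smooth ()).continuous.comp (by fun_prop : Continuous fun z : Z =>
          ((z, q) : Amp Z d)))).continuousAt
  | succ n ih =>
    have hk1 : (2 * (M + O.a) + 1) * O.c ≤ k := by
      refine le_trans (Nat.mul_le_mul_right _ ?_) hk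
      have : O.a ≤ (n + 1) * O.a := Nat.le_mul_of_pos_left _ n.succ_pos
      omega
    have hk2 : (2 * (M + O.a + n * O.a) + n) * O.c ≤ k - O.c := by
      refine Nat.le_sub_of_add_le (le_trans (le_of_eq ?_) hk)
      ring
    have hk3 : O.c ≤ k := le_trans (by
      rw [add_mul, one_mul]; exact Nat.le_add_left _ _) hk1
    have ha : (0 : ℝ) ≤ O.a := Nat.cast_nonneg _
    have hM1 : s + O.a - 2 * (M + O.a : ℕ) ≤ -(d + 1) := by push_cast; linarith
    have hpd : ∀ i t, pd i (fun z => osc fun q => f t (z, q)) =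
        fun z => osc fun q => pd (zd d i) (f t) (z, q) := fun i t =>
      pd_osc hO (hf.reindex (fun _ : Unit => t)) h0 hc hM hk1 i
    have ih' := fun i => ih (hf.pd_z i hk3) (fun z => mul_nonneg (h0 z) (O.g_pos i z).le)
      (hc.mul (hO.g i)) hM1 hk2
    refine ⟨fun t => ?_, ?_, fun i _ => ?_⟩
    · have hD := hasFDerivAt_osc hO (hf.reindex (fun _ : Unit => t)) h0 hc hM hk1
      rw [Nat.cast_succ, contDiff_succ_iff_fderiv]
      refine ⟨fun z => (hD z).differentiableAt, fun h => absurd h (by simp), ?_⟩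
      rw [show fderiv ℝ (fun z => osc fun q => f t (z, q)) = fun z =>
        ∑ i, (co i).smulRight (osc fun q => pd (zd d i) (f t) (z, q)) from
          funext fun z => (hD z).fderiv]
      refine ContDiff.sum fun i _ => ?_
      exact (ContinuousLinearMap.smulRightL ℝ Z ℂ (co i)).contDiff.comp ((ih' i).1 t)
    · obtain ⟨C, hC, h⟩ := norm_osc_le hf h0 (M := M) (by
        refine le_trans ?_ hk1
        rw [show M * (2 * O.c) = (2 * M) * O.c by ring]
        exact Nat.mul_le_mul_right _ (by omega)) hM
      exact ⟨C, hC, fun t z _ => h t z (hO.mem z)⟩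
    · simp only [hpd]
      refine ((ih' i).2.mono_k (Nat.zero_le _)).congr_weight fun t z _ => ?_
      simp only [OscData.out]
      ring

lemma Sym.osc (hO : O.Regular) (hO0 : O.c = 0) {f : T → Amp Z d → ℂ} (hf : SW O d k ϖ₀ r s f)
    (h0 : ∀ z, 0 ≤ ϖ₀ z) (hc : Continuous ϖ₀) {M : ℕ} (hM : s - 2 * M ≤ -(d + 1)) :
    Sym O.out 0 (fun _ z => ϖ₀ z * O.v z ^ (2 * M)) (fun t z => osc fun q => f t (z, q)) :=
  ⟨fun t => contDiff_infty.2 fun n => (contDiff_bd_osc hO n hf h0 hc hM (by simp [hO0])).1 t,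
    fun n => (contDiff_bd_osc hO n hf h0 hc hM (by simp [hO0])).2⟩

section

def dilation (d : ℕ) {c : ℝ} (hc : c ≠ 0) : Conf d ≃L[ℝ] Conf d :=
  ContinuousLinearEquiv.smulLeft (Units.mk0 c hc)

lemma two_pi_inv_ne : (2 * Real.pi)⁻¹ ≠ 0 := inv_ne_zero (by positivity)

open scoped FourierTransform in
/-- The Fourier transform `ĝ(ξ) = ∫ e^{-i⟨y, ξ⟩} g(y) dy`. -/
def hat (g : Sw d) : Sw d :=
  SchwartzMap.compCLMOfContinuousLinearEquiv ℂ (dilation d two_pi_inv_ne) (𝓕 g)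

open scoped FourierTransform in
lemma hat_apply (g : Sw d) (ξ : Conf d) : hat g ξ = ∫ y, ee (y, ξ) * g y := by
  have h : hat g ξ = 𝓕 (g : Conf d → ℂ) ((2 * Real.pi)⁻¹ • ξ) := rfl
  rw [h, Real.fourier_eq']
  refine integral_congr_ae (.of_forall fun y => ?_)
  simp only [ee, smul_eq_mul, inner_smul_right]
  congr 2
  rw [← mul_assoc, show -2 * Real.pi * (2 * Real.pi)⁻¹ = -1 by field_simp]
  push_cast; ring

open scoped FourierTransform in
lemma hat_inversion (g : Sw d) (z : Conf d) : g z = cd d * ∫ ξ, ee (z, -ξ) * hat g ξ := by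
  have h1 : (𝓕⁻ (𝓕 g) : Sw d) z = g z := by rw [FourierTransform.fourierInv_fourier_eq]
  rw [← h1, SchwartzMap.fourierInv_coe, Real.fourierInv_eq']
  have h2 := Measure.integral_comp_smul (volume : Measure (Conf d))
    (fun v => exp (((2 * Real.pi * inner ℝ v z : ℝ) : ℂ) * I) • (𝓕 g) v)
    (2 * Real.pi)⁻¹
  have h3 : (fun ξ => ee (z, -ξ) * hat g ξ) = fun ξ : Conf d => exp (((2 * Real.pi *
      inner ℝ ((2 * Real.pi)⁻¹ • ξ) z : ℝ) : ℂ) * I) • (𝓕 g) ((2 * Real.pi)⁻¹ • ξ) := by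
    funext ξ
    have : hat g ξ = (𝓕 g) ((2 * Real.pi)⁻¹ • ξ) := rfl
    rw [this, smul_eq_mul, ee, inner_smul_left, real_inner_comm]
    congr 2
    simp only [inner_neg_left]
    rw [show (2 * Real.pi * ((starRingEnd ℝ) (2 * Real.pi)⁻¹ * inner ℝ ξ z)) = inner ℝ ξ z by
      simp; field_simp]
    push_cast; ring
  rw [h3, h2, finrank_euclideanSpace, Fintype.card_fin]
  rw [abs_of_pos (by positivity), cd, Complex.real_smul]
  rw [← mul_assoc, inv_pow, inv_inv, inv_mul_cancel₀, one_mul]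
  · exact_mod_cast (by positivity : (2 * Real.pi) ^ d ≠ 0)

lemma hat_decay (g : Sw d) (N : ℕ) : ∃ C : ℝ, 0 ≤ C ∧ ∀ ξ, br ξ ^ N * ‖hat g ξ‖ ≤ C := by
  obtain ⟨C, -, hC⟩ := (hat g).decay 0 0
  obtain ⟨C', -, hC'⟩ := (hat g).decay N 0
  refine ⟨|2 ^ N * (C + C')|, abs_nonneg _, fun ξ => le_trans ?_ (le_abs_self _)⟩
  have h1 : br ξ ^ N ≤ 2 ^ N * (1 + ‖ξ‖ ^ N) := by
    refine (pow_le_pow_left₀ (br_pos _).le (br_le_one_add ξ) N).trans ?_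
    rcases le_total ‖ξ‖ 1 with h | h
    · calc (1 + ‖ξ‖) ^ N ≤ 2 ^ N := by gcongr; linarith
        _ ≤ 2 ^ N * (1 + ‖ξ‖ ^ N) := le_mul_of_one_le_right (by positivity)
          (by linarith [pow_nonneg (norm_nonneg ξ) N])
    · calc (1 + ‖ξ‖) ^ N ≤ (2 * ‖ξ‖) ^ N := by gcongr; linarith
        _ = 2 ^ N * ‖ξ‖ ^ N := by rw [mul_pow]
        _ ≤ 2 ^ N * (1 + ‖ξ‖ ^ N) := by gcongr; linarith
  have h2 := hC ξ
  have h3 := hC' ξ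
  simp only [pow_zero, one_mul, norm_iteratedFDeriv_zero] at h2 h3
  calc br ξ ^ N * ‖hat g ξ‖ ≤ 2 ^ N * (1 + ‖ξ‖ ^ N) * ‖hat g ξ‖ := by gcongr
    _ = 2 ^ N * (‖hat g ξ‖ + ‖ξ‖ ^ N * ‖hat g ξ‖) := by ring
    _ ≤ 2 ^ N * (C + C') := by gcongr

/-- A polynomially bounded function is integrable against a Fourier transform. -/
lemma exists_hat_bound (g : Sw d) (m : ℝ) : ∃ C : ℝ, 0 ≤ C ∧
    ∀ ξ, br ξ ^ m * ‖hat g ξ‖ ≤ C * br ξ ^ (-(d + 1) : ℝ) := by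
  obtain ⟨N, hN⟩ := exists_nat_ge (m + (d + 1))
  obtain ⟨C, hC, h⟩ := hat_decay g N
  refine ⟨C, hC, fun ξ => ?_⟩
  have h1 : br ξ ^ m ≤ br ξ ^ N * br ξ ^ (-(d + 1) : ℝ) := by
    rw [← Real.rpow_natCast, ← Real.rpow_add (br_pos _)]
    exact br_rpow_mono _ (by linarith)
  have h2 : 0 < br ξ ^ (-(d + 1) : ℝ) := br_rpow_pos _ _
  calc br ξ ^ m * ‖hat g ξ‖ ≤ br ξ ^ N * br ξ ^ (-(d + 1) : ℝ) * ‖hat g ξ‖ := by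
        gcongr
    _ = (br ξ ^ N * ‖hat g ξ‖) * br ξ ^ (-(d + 1) : ℝ) := by ring
    _ ≤ C * br ξ ^ (-(d + 1) : ℝ) := by gcongr; exact h ξ

end

section

/-- The scale of polynomially growing derivatives at the parameter `z`. -/
def pt (z : Z) (a : ℕ) : OscData Z where
  v := fun _ => 1
  one_le_v := fun _ => le_rfl
  g := fun _ _ => 1
  g_pos := fun _ _ => one_pos
  a := a
  c := 0
  D := {z}

/-- Amplitudes that admit an oscillatory integral at the parameter `z`. -/
def Osc (z : Z) (f : Amp Z d → ℂ) : Prop :=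
  ∃ (a : ℕ) (r s : ℝ), SW (pt z a) d 0 (fun _ => 1) r s (fun _ : Unit => f)

lemma Sym.toOsc {f : T → Amp Z d → ℂ} (hf : SW O d k ϖ₀ r s f) (hc : O.c = 0)
    (h0 : ∀ z, 0 ≤ ϖ₀ z) {z : Z} (hz : z ∈ O.D) (t : T) : Osc z (f t) := by
  refine ⟨O.a, r, s, (hf.reindex (fun _ : Unit => t)).rescale ?_ ?_ (Nat.zero_le _) ?_ ?_ ?_⟩
  · intro X hX
    have : X.1 = z := hX
    change X.1 ∈ O.D
    rwa [this]
  · rintro (i | i | i) <;> simp [OscData.scale, hc]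
  · rintro (i | i | i)
    · refine ⟨O.g i z, (O.g_pos i z).le, fun X hX => ?_⟩
      have : X.1 = z := hX
      simp [OscData.scale, pt, this]
    · refine ⟨O.v z, zero_le_one.trans (O.one_le_v z), fun X hX => ?_⟩
      have : X.1 = z := hX
      simp [OscData.scale, pt, this]
    · exact ⟨1, zero_le_one, fun X _ => by simp [OscData.scale]⟩
  · exact fun t X _ => wgt_nonneg (fun _ => zero_le_one) X
  · refine ⟨ϖ₀ z, h0 z, fun t X hX => ?_⟩
    have : X.1 = z := hX
    simp [wgt, this, mul_assoc]

lemma pt_mono {z : Z} {a a' : ℕ} (h : a ≤ a') {f : T → Amp Z d → ℂ} {r r' s s' : ℝ} (hr : r ≤ r')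
    (hs : s ≤ s') (hf : SW (pt z a) d 0 (fun _ => 1) r s f) :
    SW (pt z a') d 0 (fun _ => 1) r' s' f := by
  refine hf.rescale le_rfl ?_ le_rfl ?_ ?_ ?_
  · rintro (i | i | i) <;> exact le_rfl
  · rintro (i | i | i) <;> refine ⟨1, zero_le_one, fun X hX => ?_⟩ <;>
      simp only [OscData.scale, pt, Sum.elim_inl, Sum.elim_inr, one_mul, le_refl]
    · exact pow_le_pow_right₀ (one_le_mul (one_le_br _) (one_le_br _)) h
    · exact pow_le_pow_right₀ (one_le_br _) h
  · exact fun t X _ => wgt_nonneg (fun _ => zero_le_one) X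
  · exact ⟨1, zero_le_one, fun t X _ => by
      rw [one_mul]; exact wgt_mono (fun _ => zero_le_one) hr hs X⟩

lemma wgt_mul_wgt {r s r' s' : ℝ} (X : Amp Z d) : wgt (fun _ => 1) r s X * wgt (fun _ => 1) r' s' X =
    wgt (fun _ => 1) (r + r') (s + s') X := by
  unfold wgt
  rw [Real.rpow_add (br_pos _), Real.rpow_add (br_pos _)]
  ring

namespace Osc

variable {z : Z} {f g : Amp Z d → ℂ}

lemma smooth (h : Osc z f) : Smooth f := by
  obtain ⟨a, r, s, h⟩ := h
  exact h.smooth ()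

lemma add (hf : Osc z f) (hg : Osc z g) : Osc z (fun X => f X + g X) := by
  obtain ⟨a, r, s, hf⟩ := hf
  obtain ⟨a', r', s', hg⟩ := hg
  exact ⟨max a a', max r r', max s s', (pt_mono (le_max_left _ _) (le_max_left _ _)
    (le_max_left _ _) hf).add (pt_mono (le_max_right _ _) (le_max_right _ _) (le_max_right _ _) hg)⟩

lemma mul (hf : Osc z f) (hg : Osc z g) : Osc z (fun X => f X * g X) := by
  obtain ⟨a, r, s, hf⟩ := hf
  obtain ⟨a', r', s', hg⟩ := hg
  exact ⟨max a a', _, _, ((pt_mono (le_max_left _ _) le_rfl le_rfl hf).mul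
    (pt_mono (le_max_right _ _) le_rfl le_rfl hg)).congr_weight fun _ X _ => wgt_mul_wgt X⟩

lemma const (c : ℂ) : Osc z (fun _ : Amp Z d => c) :=
  ⟨0, 0, 0, Sym.const (fun _ => c) ⟨‖c‖, norm_nonneg _, fun _ X _ => by simp [wgt]⟩
    fun _ X _ => wgt_nonneg (fun _ => zero_le_one) X⟩

lemma const_mul (c : ℂ) (hf : Osc z f) : Osc z (fun X => c * f X) := (const c).mul hf

lemma sum {α : Type*} (A : Finset α) {f : α → Amp Z d → ℂ} (hf : ∀ a ∈ A, Osc z (f a)) :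
    Osc z (fun X => ∑ a ∈ A, f a X) := by
  classical
  induction A using Finset.induction_on with
  | empty => simpa using const 0
  | insert a A ha ih =>
    simp only [Finset.sum_insert ha]
    exact (hf a (Finset.mem_insert_self _ _)).add
      (ih fun b hb => hf b (Finset.mem_insert_of_mem hb))

lemma coord_e (j : Fin d) : Osc z (fun X : Amp Z d => (X.2.2 j : ℂ)) :=
  ⟨0, 0, 1, (sym_e (pt z 0) 0 j).ofReal.congr_weight fun _ X _ => by simp [wgt]⟩

lemma pd_w (hf : Osc z f) (j : Fin d) : Osc z (pd (wd Z j) f) := by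
  obtain ⟨a, r, s, hf⟩ := hf
  refine ⟨a, r + a, s, (hf.pd (wd Z j) (Nat.zero_le _)).congr_weight fun _ X _ => ?_⟩
  rw [OscData.wt_w]
  simp only [wgt, pt]
  rw [Real.rpow_add (br_pos _), Real.rpow_natCast]
  ring

lemma tendsto_cut (hf : Osc z f) {ψ₁ ψ₂ : Conf d → ℂ} (h1 : Smooth ψ₁)
    (c1 : HasCompactSupport ψ₁) (h2 : Smooth ψ₂) (c2 : HasCompactSupport ψ₂) :
    Tendsto (fun ε : ℝ => cd d * ∫ q, ee q * (ψ₁ (ε • q.1) * ψ₂ (ε • q.2) * f (z, q))) (𝓝[>] 0)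
      (𝓝 (osc fun q => ψ₁ 0 * ψ₂ 0 * f (z, q))) := by
  obtain ⟨a, r, s, hf⟩ := hf
  obtain ⟨M, hM⟩ := exists_nat_two_mul s (-(d + 1))
  have := tendsto_osc (O := pt z a) (k := 0) (ϖ₀ := fun _ => 1) (r := r) (s := s)
    (G := fun ε X => ψ₁ (ε • X.2.1) * ψ₂ (ε • X.2.2) * f X)
    (smooth_cut_mul (G := fun _ => f) h1 h2 ((hf.smooth ()).comp contDiff_snd))
    (sym_cut_mul h1 c1 h2 c2 (hf.reindex (fun _ : 𝕀 => ())))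
    (fun _ => zero_le_one) M (le_of_eq rfl) hM (z := z) rfl
    (fun ε hε _ => fast_of_cut h1 c1 h2 c2 (hf.smooth ()) hε z)
  simpa only [zero_smul] using this

lemma tendsto_ccut (hf : Osc z f) :
    Tendsto (fun ε : ℝ => cd d * ∫ q, ee q * (ccut (ε • q.1) * ccut (ε • q.2) * f (z, q))) (𝓝[>] 0)
      (𝓝 (osc fun q => f (z, q))) := by
  simpa only [ccut_zero, one_mul] using
    hf.tendsto_cut smooth_ccut ccut_compact smooth_ccut ccut_compact

lemma integrable_cut (hf : Osc z f) {ψ₁ ψ₂ : Conf d → ℂ} (h1 : Smooth ψ₁)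
    (c1 : HasCompactSupport ψ₁) (h2 : Smooth ψ₂) (c2 : HasCompactSupport ψ₂) {ε : ℝ}
    (hε : 0 < ε) : Integrable fun q => ee q * (ψ₁ (ε • q.1) * ψ₂ (ε • q.2) * f (z, q)) :=
  integrable_ee_mul (fast_of_cut h1 c1 h2 c2 hf.smooth hε z).integrable

lemma osc_add (hf : Osc z f) (hg : Osc z g) :
    osc (fun q => f (z, q) + g (z, q)) = osc (fun q => f (z, q)) + osc (fun q => g (z, q)) := by
  refine tendsto_nhds_unique ((hf.add hg).tendsto_ccut) ((hf.tendsto_ccut.add hg.tendsto_ccut).congr' ?_)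
  filter_upwards [self_mem_nhdsWithin] with ε hε
  rw [← mul_add, ← integral_add (hf.integrable_cut smooth_ccut ccut_compact smooth_ccut ccut_compact hε)
    (hg.integrable_cut smooth_ccut ccut_compact smooth_ccut ccut_compact hε)]
  simp only [mul_add]

lemma osc_const_mul (c : ℂ) (hf : Osc z f) :
    osc (fun q => c * f (z, q)) = c * osc (fun q => f (z, q)) := by
  refine tendsto_nhds_unique ((hf.const_mul c).tendsto_ccut) ((hf.tendsto_ccut.const_mul c).congr' ?_)
  filter_upwards with ε
  rw [mul_left_comm, ← integral_const_mul]
  congr 2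
  funext q
  ring

lemma osc_sum {α : Type*} (A : Finset α) {f : α → Amp Z d → ℂ} (hf : ∀ a ∈ A, Osc z (f a)) :
    osc (fun q => ∑ a ∈ A, f a (z, q)) = ∑ a ∈ A, osc (fun q => f a (z, q)) := by
  classical
  induction A using Finset.induction_on with
  | empty =>
    have := osc_const_mul (z := z) (d := d) 0 (const 0)
    simpa using this
  | insert a A ha ih =>
    have h2 : ∀ b ∈ A, Osc z (f b) := fun b hb => hf b (Finset.mem_insert_of_mem hb)
    simp only [Finset.sum_insert ha]
    rw [osc_add (hf a (Finset.mem_insert_self _ _)) (sum A h2), ih h2]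

lemma integral_pd_w (hf : Fast z f) (j : Fin d) (h : Integrable fun q => (q.2 j : ℂ) * f (z, q)) :
    ∫ q, ee q * pd (wd Z j) f (z, q) = ∫ q, ee q * (I * ((q.2 j : ℂ) * f (z, q))) := by
  have := integral_ee_mul_fderiv (h := fun _ => 1) (g := fun q => f (z, q))
    (v := (single j (1 : ℝ), (0 : Conf d))) contDiff_const (by simp)
    (hf.smooth.comp (contDiff_const.prodMk contDiff_id)) (by simpa using hf.integrable)
    (by simpa only [one_mul, pd_w_slice hf.smooth] using (hf.pd _).integrable)
    (by simpa [EuclideanSpace.inner_single_left] using h)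
  simpa [pd_w_slice hf.smooth, EuclideanSpace.inner_single_left] using this

lemma smooth_pd_ccut (j : Fin d) : Smooth (pd (E := Conf d) j ccut) := smooth_pd smooth_ccut _

lemma compact_pd_ccut (j : Fin d) : HasCompactSupport (pd (E := Conf d) j ccut) :=
  ccut_compact.fderiv_apply (𝕜 := ℝ) _

lemma pd_cut_comp (L : Amp Z d →L[ℝ] Conf d) (i : Dirs.ι (Amp Z d)) (j : Fin d)
    (hL : L (Dirs.b i) = single j 1) (ε : ℝ) :
    pd i (fun X => ccut (ε • L X)) = fun X => (ε : ℂ) * pd (E := Conf d) j ccut (ε • L X) := by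
  funext X
  have h1 : HasFDerivAt (fun X => ccut (ε • L X)) _ X :=
    HasFDerivAt.comp (g := ccut) X (smooth_diffAt smooth_ccut ((ε • L) X)).hasFDerivAt
      (ε • L).hasFDerivAt
  rw [pd, h1.fderiv]
  simp [pd, hL]

lemma pd_cut_comp_zero (L : Amp Z d →L[ℝ] Conf d) (i : Dirs.ι (Amp Z d))
    (hL : L (Dirs.b i) = 0) (ε : ℝ) : pd i (fun X => ccut (ε • L X)) = fun _ => 0 := by
  funext X
  have h1 : HasFDerivAt (fun X => ccut (ε • L X)) _ X :=
    HasFDerivAt.comp (g := ccut) X (smooth_diffAt smooth_ccut ((ε • L) X)).hasFDerivAt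
      (ε • L).hasFDerivAt
  rw [pd, h1.fderiv]
  simp [hL]

lemma pd_mul {f g : E → ℂ} (hf : Smooth f) (hg : Smooth g) (i : Dirs.ι E) :
    pd i (fun X => f X * g X) = fun X => pd i f X * g X + f X * pd i g X :=
  pd_bilin (ContinuousLinearMap.mul ℝ ℂ) hf hg i

/-- Integration by parts in `w`. -/
lemma osc_pd_w (hf : Osc z f) (j : Fin d) : osc (fun q => pd (wd Z j) f (z, q)) =
    osc (fun q => I * ((q.2 j : ℂ) * f (z, q))) := by
  have hη := (coord_e (z := z) j).mul hf
  have t1 := (hf.pd_w j).tendsto_ccut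
  have t2 := (hη.const_mul I).tendsto_ccut
  have t3 := hf.tendsto_cut (smooth_pd_ccut j) (compact_pd_ccut j) smooth_ccut ccut_compact
  have t0 : Tendsto (fun ε : ℝ => (ε : ℂ)) (𝓝[>] 0) (𝓝 0) :=
    ((Complex.continuous_ofReal.tendsto 0).mono_left nhdsWithin_le_nhds)
  have t4 := t2.sub (t0.mul t3)
  rw [zero_mul, sub_zero] at t4
  refine tendsto_nhds_unique t1 (t4.congr' ?_)
  filter_upwards [self_mem_nhdsWithin] with ε hε
  have hs := hf.smooth
  have e1 : Smooth fun X : Amp Z d => ccut (ε • X.2.1) := smooth_ccut.comp (by fun_prop)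
  have e2 : Smooth fun X : Amp Z d => ccut (ε • X.2.2) := smooth_ccut.comp (by fun_prop)
  have key := integral_pd_w (fast_of_cut smooth_ccut ccut_compact smooth_ccut ccut_compact hs hε z) j
    ((fast_of_cut smooth_ccut ccut_compact smooth_ccut ccut_compact hη.smooth hε z).integrable.congr
      (.of_forall fun q => by simp only; ring))
  have hpd : pd (wd Z j) (fun X => ccut (ε • X.2.1) * ccut (ε • X.2.2) * f X) = fun X =>
      (ε : ℂ) * (pd (E := Conf d) j ccut (ε • X.2.1) * ccut (ε • X.2.2) * f X) +
      ccut (ε • X.2.1) * ccut (ε • X.2.2) * pd (wd Z j) f X := by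
    have p1 := pd_cut_comp (wM Z d) (wd Z j) j (by simp) ε
    have p2 := pd_cut_comp_zero (eM Z d) (wd Z j) (by simp) ε
    simp only [wM_apply, eM_apply] at p1 p2
    rw [pd_mul (e1.mul e2) hs, pd_mul e1 e2, p1, p2]
    funext X
    ring
  rw [hpd] at key
  simp only [mul_add] at key
  rw [integral_add] at key
  · have h5 : ∫ q, ee q * ((ε : ℂ) * (pd (E := Conf d) j ccut (ε • q.1) * ccut (ε • q.2) * f (z, q))) =
        (ε : ℂ) * ∫ q, ee q * (pd (E := Conf d) j ccut (ε • q.1) * ccut (ε • q.2) * f (z, q)) := by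
      rw [← integral_const_mul]; congr 1; funext q; ring
    rw [h5] at key
    have h6 : ∫ q, ee q * (ccut (ε • q.1) * ccut (ε • q.2) * (I * ((q.2 j : ℂ) * f (z, q)))) =
        ∫ q, ee q * (I * ((q.2 j : ℂ) * (ccut (ε • q.1) * ccut (ε • q.2) * f (z, q)))) := by
      congr 1; funext q; ring
    rw [h6, ← key]
    ring
  · refine ((hf.integrable_cut (smooth_pd_ccut j) (compact_pd_ccut j) smooth_ccut ccut_compact
      hε).const_mul (ε : ℂ)).congr (.of_forall fun q => ?_)
    simp only; ring
  · exact (hf.pd_w j).integrable_cut smooth_ccut ccut_compact smooth_ccut ccut_compact hε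

lemma osc_coord_e_mul (hf : Osc z f) (j : Fin d) : osc (fun q => (q.2 j : ℂ) * f (z, q)) =
    osc (fun q => -I * pd (wd Z j) f (z, q)) := by
  rw [osc_const_mul _ (hf.pd_w j), hf.osc_pd_w j, osc_const_mul _ ((coord_e j).mul hf), ← mul_assoc]
  simp

/-- Fubini for products. -/
lemma integral_ee_mul_prod (g : Sw d) {h : Conf d → ℂ} (hh : Integrable h) :
    ∫ q : Ph d, ee q * (g q.1 * h q.2) = ∫ η, hat g η * h η := by
  have hi : Integrable (fun q : Ph d => ee q * (g q.1 * h q.2)) :=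
    integrable_ee_mul (g.integrable.mul_prod hh)
  rw [Measure.volume_eq_prod] at hi ⊢
  rw [integral_prod_symm _ hi]
  refine integral_congr_ae (.of_forall fun η => ?_)
  simp only [hat_apply]
  rw [← integral_mul_const]
  congr 1; funext y; ring

lemma cut_w {ψ : Conf d → ℂ} (hψ : Smooth ψ) (hc : HasCompactSupport ψ) {δ : ℝ}
    (h0 : 0 ≤ δ) (h1 : δ ≤ 1) : Osc z (fun X : Amp Z d => ψ (δ • X.2.1)) :=
  ⟨0, 0, 0, ((sym_cut_w hψ hc (pt z 0) 0).reindex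
    (fun _ : Unit => (⟨δ, h0, h1⟩ : 𝕀))).congr_weight fun _ X _ => by simp [wgt]⟩

/-- The oscillatory integral of a compactly supported function of `w`. -/
lemma osc_compact {g : Conf d → ℂ} (hg : Smooth g) (hc : HasCompactSupport g) :
    osc (fun q => g q.1) = g 0 := by
  have hO : Osc (0 : PUnit.{1}) (fun X : Amp PUnit.{1} d => g X.2.1) := by
    simpa only [one_smul] using cut_w (z := (0 : PUnit.{1})) hg hc zero_le_one le_rfl
  set G : Sw d := hc.toSchwartzMap hg with hG
  have hGe : ∀ w, G w = g w := fun w => rfl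
  have h0 := hat_inversion G 0
  rw [hGe] at h0
  have h1 : ∀ ξ : Conf d, ee ((0 : Conf d), -ξ) = 1 := fun ξ => by simp [ee]
  simp only [h1, one_mul] at h0
  rw [h0]
  refine tendsto_nhds_unique hO.tendsto_ccut ?_
  refine Tendsto.const_mul _ ?_
  have hcb : ∀ x : Conf d, ‖ccut x‖ ≤ 1 := fun x => by
    rw [ccut, Complex.norm_real, Real.norm_of_nonneg (show 0 ≤ cut x from ContDiffBump.nonneg _)]
    exact ContDiffBump.le_one _
  have h2 : Tendsto (fun ε : ℝ => ∫ η, hat G η * ccut (ε • η)) (𝓝[>] 0) (𝓝 (∫ η, hat G η)) := by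
    refine tendsto_integral_filter_of_dominated_convergence (fun η => ‖hat G η‖) ?_ ?_
      (hat G).integrable.norm ?_
    · exact .of_forall fun ε => ((hat G).continuous.mul
        (smooth_ccut.continuous.comp (by fun_prop))).aestronglyMeasurable
    · refine .of_forall fun ε => .of_forall fun η => ?_
      rw [norm_mul]
      exact mul_le_of_le_one_right (norm_nonneg _) (hcb _)
    · refine .of_forall fun η => ?_
      have h3 : Continuous fun ε : ℝ => hat G η * ccut (ε • η) :=
        continuous_const.mul (smooth_ccut.continuous.comp (by fun_prop))
      have h4 := h3.tendsto 0
      simp only [zero_smul, ccut_zero, mul_one] at h4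
      exact h4.mono_left nhdsWithin_le_nhds
  refine h2.congr' ?_
  obtain ⟨R, hR⟩ := hc.isBounded.subset_closedBall (0 : Conf d)
  have hR' : (0 : ℝ) < (|R| + 1)⁻¹ := by positivity
  filter_upwards [Ioo_mem_nhdsGT hR'] with ε hε
  have hi : Integrable fun η : Conf d => ccut (ε • η) :=
    (smooth_ccut.continuous.comp (by fun_prop)).integrable_of_hasCompactSupport
      (ccut_compact.comp_smul hε.1.ne')
  rw [← integral_ee_mul_prod G hi]
  congr 1
  funext q
  have : ccut (ε • q.1) * g q.1 = g q.1 := by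
    by_cases hq : q.1 ∈ tsupport g
    · have h5 := hR hq
      rw [mem_closedBall_zero_iff] at h5
      have h6 : ‖ε • q.1‖ ≤ 1 := by
        rw [norm_smul, Real.norm_of_nonneg hε.1.le]
        calc ε * ‖q.1‖ ≤ (|R| + 1)⁻¹ * (|R| + 1) := by
              have := le_abs_self R
              have h8 := hε.2.le
              have h9 := hε.1.le
              gcongr; linarith
          _ = 1 := inv_mul_cancel₀ (by positivity)
      rw [ccut, cut_eq_one h6, Complex.ofReal_one, one_mul]
    · rw [image_eq_zero_of_notMem_tsupport hq, mul_zero]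
  rw [hGe]
  calc ee q * (g q.1 * ccut (ε • q.2)) = ee q * ((ccut (ε • q.1) * g q.1) * ccut (ε • q.2)) := by
        rw [this]
    _ = _ := by ring

/-- The oscillatory integral of a function that does not depend on `η`. -/
lemma osc_of_indep (hf : Osc z f) (h : ∀ w η, f (z, (w, η)) = f (z, (w, 0))) :
    osc (fun q => f (z, q)) = f (z, 0) := by
  have hs := hf.smooth
  have e1 : ∀ δ : ℝ, 0 < δ → δ ≤ 1 → osc (fun q => ccut (δ • q.1) * f (z, q)) = f (z, 0) := by
    intro δ h0 h1
    have h2 : (fun q : Ph d => ccut (δ • q.1) * f (z, q)) =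
        fun q => (fun w => ccut (δ • w) * f (z, (w, 0))) q.1 := by
      funext q
      simp only
      rw [← h q.1 q.2]
    have h3 := osc_compact (g := fun w : Conf d => ccut (δ • w) * f (z, (w, 0)))
      ((smooth_ccut.comp (by fun_prop)).mul (hs.comp (by fun_prop)))
      ((ccut_compact.comp_smul h0.ne').mul_right)
    rw [h2, h3, smul_zero, ccut_zero, one_mul]
    rfl
  obtain ⟨a, r, s, hf⟩ := hf
  obtain ⟨M, hM⟩ := exists_nat_two_mul s (-(d + 1))
  obtain ⟨N, hN⟩ := exists_nat_two_mul (r + M * (2 * a)) (-(d + 1))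
  have hG : Smooth (fun p : ℝ × Amp Z d => ccut (p.1 • p.2.2.1) * f p.2) :=
    (smooth_ccut.comp (by fun_prop)).mul (hs.comp contDiff_snd)
  have hS : SW (pt z a) d 0 (fun _ => 1) r s (fun (ε : 𝕀) X => ccut ((ε : ℝ) • X.2.1) * f X) :=
    ((sym_cut_w smooth_ccut ccut_compact (pt z a) 0).mul
      (hf.reindex (fun _ : 𝕀 => ()))).congr_weight fun _ X _ => one_mul _
  have key := (tendsto_oscM (G := fun δ X => ccut (δ • X.2.1) * f X) hG hS (fun _ => zero_le_one)
    (M := M) (N := N) (le_of_eq rfl) hM hN (z := z) rfl).const_mul (cd d)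
  simp only [zero_smul, ccut_zero, one_mul] at key
  rw [← osc_eq_oscM hf (fun _ => zero_le_one) (M := M) (N := N) (le_of_eq rfl) hM hN (z := z) rfl]
    at key
  refine tendsto_nhds_unique key ?_
  refine tendsto_const_nhds.congr' ?_
  filter_upwards [Ioc_mem_nhdsGT (zero_lt_one' ℝ)] with δ hδ
  rw [← e1 δ hδ.1 hδ.2]
  exact osc_eq_oscM (hS.reindex (fun _ : Unit => (⟨δ, hδ.1.le, hδ.2⟩ : 𝕀)))
    (fun _ => zero_le_one) (M := M) (N := N) (le_of_eq rfl) hM hN (z := z) rfl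

end Osc

end

section

/-- The scale in which an `η`-derivative gains `min(1, μ(z)⟨η⟩^κ)`. -/
def OscData.fine (O : OscData Z) (μ : Z → ℝ) (hμ : ∀ z, 0 < μ z) (κ : ℕ) (d : ℕ) :
    Scale (Amp Z d) where
  wt := Sum.elim (fun i X => O.g i X.1 * (br X.2.1 * br X.2.2) ^ O.a)
    (Sum.elim (fun _ X => O.v X.1 * br X.2.1 ^ O.a) (fun _ X => min 1 (μ X.1 * br X.2.2 ^ κ)))
  pos := by
    rintro (i | i | i) X
    · exact mul_pos (O.g_pos i _) (pow_pos (mul_pos (br_pos _) (br_pos _)) _)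
    · exact mul_pos (one_pos.trans_le (O.one_le_v _)) (pow_pos (br_pos _) _)
    · exact lt_min one_pos (mul_pos (hμ _) (pow_pos (br_pos _) _))
  cost := Sum.elim (fun _ => O.c) (Sum.elim (fun _ => O.c) (fun _ => 0))
  dom := {X | X.1 ∈ O.D}

variable {μ : Z → ℝ} {hμ : ∀ z, 0 < μ z} {κ : ℕ}

lemma Sym.coarse {ϖ : T → Amp Z d → ℝ} {f : T → Amp Z d → ℂ} (hf : Sym (O.fine μ hμ κ d) k ϖ f)
    (h0 : ∀ t, ∀ X ∈ (O.scale d).dom, 0 ≤ ϖ t X) : Sym (O.scale d) k ϖ f := by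
  refine hf.rescale le_rfl ?_ le_rfl ?_ h0 ⟨1, zero_le_one, fun t X _ => by rw [one_mul]⟩
  · rintro (i | i | i) <;> exact le_rfl
  · rintro (i | i | i) <;> refine ⟨1, zero_le_one, fun X hX => ?_⟩ <;> rw [one_mul]
    · exact le_rfl
    · exact le_rfl
    · exact min_le_left _ _

def scaleE (Z : Type) [NormedAddCommGroup Z] [NormedSpace ℝ Z] (d : ℕ) (t : ℝ) :
    Amp Z d →L[ℝ] Amp Z d :=
  (fst ℝ _ _).prod ((wM Z d).prod (t • eM Z d))

@[simp] lemma scaleE_apply (t : ℝ) (X : Amp Z d) : scaleE Z d t X = (X.1, (X.2.1, t • X.2.2)) := rfl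

/-- The mean of `∂_{η_j} f` over the segment from `(w, 0)` to `(w, η)`. -/
def avgE (j : Fin d) (f : Amp Z d → ℂ) (X : Amp Z d) : ℂ :=
  ∫ t in 0..1, pd (ed Z j) f (scaleE Z d t X)

/-- The Taylor remainder operator of oscillatory integration. -/
def tay (f : Amp Z d → ℂ) (X : Amp Z d) : ℂ := ∑ j, -I * pd (wd Z j) (avgE j f) X

lemma co_b [DecidableEq (Dirs.ι E)]
    (i j : Dirs.ι E) : co j (Dirs.b i : E) = if i = j then 1 else 0 := by
  rw [co_apply, Module.Basis.repr_self, Finsupp.single_apply]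

lemma co_wd (j : Fin d) (X : Amp Z d) : co (E := Amp Z d) (wd Z j) X = X.2.1 j := by
  exact (co_inr (E := Z) (F := Ph d) (Sum.inl j) X).trans
    ((co_inl (E := Conf d) (F := Conf d) j X.2).trans (co_conf j X.2.1))

lemma co_ed (j : Fin d) (X : Amp Z d) : co (E := Amp Z d) (ed Z j) X = X.2.2 j := by
  exact (co_inr (E := Z) (F := Ph d) (Sum.inr j) X).trans
    ((co_inr (E := Conf d) (F := Conf d) j X.2).trans (co_conf j X.2.2))

lemma fderiv_amp (f : Amp Z d → F)
    (X Y : Amp Z d) : fderiv ℝ f X Y = ∑ i : Dirs.ι Z, co i Y.1 • pd (zd d i) f X +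
      (∑ j, Y.2.1 j • pd (wd Z j) f X + ∑ j, Y.2.2 j • pd (ed Z j) f X) := by
  have h : ∑ i : Dirs.ι (Ph d), co (E := Amp Z d) (Sum.inr i) Y • pd (Sum.inr i) f X =
      ∑ j, Y.2.1 j • pd (wd Z j) f X + ∑ j, Y.2.2 j • pd (ed Z j) f X := by
    rw [sum_dirs]
    rfl
  rw [fderiv_eq_sum_pd, sum_dirs, h]
  simp

lemma Sym.comp_scaleE {ϖ : Amp Z d → ℝ} {f : T → Amp Z d → ℂ}
    (hf : Sym (O.fine μ hμ κ d) k (fun _ => ϖ) f) (h0 : ∀ X ∈ (O.scale d).dom, 0 ≤ ϖ X)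
    (hm : ∀ X, ∀ t ∈ 𝕀, ϖ (scaleE Z d t X) ≤ ϖ X) :
    Sym (O.fine μ hμ κ d) k (fun _ => ϖ) (fun (q : T × 𝕀) X => f q.1 (scaleE Z d q.2 X)) := by
  classical
  have hbr : ∀ (x : Conf d) (t : 𝕀), br ((t : ℝ) • x) ≤ br x := fun x t => br_smul_le x t.2.1 t.2.2
  refine ((hf.reindex (fun q : T × 𝕀 => q.1)).compLin
    (fun q => scaleE Z d q.2) (fun _ X hX => hX) (fun _ X hX => h0 X hX) ?_).mono_le
    fun q X _ => hm X q.2 q.2.2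
  rintro (i | i | i) (j | j | j)
  · by_cases h : i = j
    · subst h
      left
      refine ⟨le_rfl, 1, zero_le_one, fun q X _ => ?_⟩
      have h1 := hbr X.2.2 q.2
      have h2 := (br_pos X.2.1).le
      have h3 := (O.g_pos i X.1).le
      have h4 := (br_pos ((q.2 : ℝ) • X.2.2)).le
      simp only [OscData.fine, Sum.elim_inl, scaleE_apply, co_inl, b_inl, co_b, if_true, abs_one,
        one_mul]
      gcongr
    · right; intro q; simp [co_b, h]
  · right; intro q; exact (co_wd j _).trans (by simp)
  · right; intro q; exact (co_ed j _).trans (by simp)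
  · right; intro q; simp
  · by_cases h : i = j
    · subst h
      left
      refine ⟨le_rfl, 1, zero_le_one, fun q X _ => ?_⟩
      refine le_of_eq ?_
      congr 1
      exact (congrArg _ (co_wd i _)).trans (by simp)
    · right; intro q
      exact (co_wd j _).trans (by simp [Ne.symm h])
  · right; intro q; exact (co_ed j _).trans (by simp)
  · right; intro q; simp
  · right; intro q; exact (co_wd j _).trans (by simp)
  · by_cases h : i = j
    · subst h
      left
      refine ⟨le_rfl, 1, zero_le_one, fun q X _ => ?_⟩
      have h1 := hbr X.2.2 q.2
      have h3 := (hμ X.1).le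
      have h4 := (br_pos ((q.2 : ℝ) • X.2.2)).le
      have h5 : |co (E := Amp Z d) (ed Z i) (scaleE Z d q.2 (Dirs.b (ed Z i)))| ≤ 1 := by
        rw [co_ed]
        simpa [abs_of_nonneg q.2.2.1] using q.2.2.2
      simp only [OscData.fine, Sum.elim_inr, scaleE_apply]
      refine mul_le_mul h5 ?_ (le_min zero_le_one (by positivity)) zero_le_one
      gcongr
    · right; intro q
      exact (co_ed j _).trans (by simp [Ne.symm h])

lemma smooth_avgE_aux {f : Amp Z d → ℂ} (hf : Smooth f) (j : Fin d) :
    Smooth (fun q : ℝ × Amp Z d => pd (ed Z j) f (scaleE Z d q.1 q.2)) := by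
  simp only [scaleE_apply]
  exact (smooth_pd hf _).comp (by fun_prop)

lemma smooth_avgE {f : Amp Z d → ℂ} (hf : Smooth f) (j : Fin d) : Smooth (avgE j f) := by
  have := Dirs.finiteDimensional Z
  exact contDiff_intervalIntegral (smooth_avgE_aux hf j)

/-- The weight of an `η`-derivative. -/
def gain (μ : Z → ℝ) (κ : ℕ) (X : Amp Z d) : ℝ := min 1 (μ X.1 * br X.2.2 ^ κ)

lemma gain_nonneg (hμ : ∀ z, 0 < μ z) (X : Amp Z d) : 0 ≤ gain μ κ X :=
  le_min zero_le_one (mul_nonneg (hμ _).le (pow_nonneg (br_pos _).le _))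

lemma gain_scaleE (hμ : ∀ z, 0 < μ z) (X : Amp Z d) {t : ℝ} (ht : t ∈ 𝕀) :
    gain μ κ (scaleE Z d t X) ≤ gain μ κ X := by
  have h1 := br_smul_le X.2.2 ht.1 ht.2
  have h3 := (hμ X.1).le
  have h4 := (br_pos (t • X.2.2)).le
  simp only [gain, scaleE_apply]
  gcongr

lemma Sym.avgE {ϖ : Amp Z d → ℝ} {f : T → Amp Z d → ℂ}
    (hf : Sym (O.fine μ hμ κ d) k (fun _ => ϖ) f) (h0 : ∀ X, 0 ≤ ϖ X)
    (hm : ∀ X, ∀ t ∈ 𝕀, ϖ (scaleE Z d t X) ≤ ϖ X) (j : Fin d) :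
    Sym (O.fine μ hμ κ d) k (fun _ X => ϖ X * gain μ κ X) (fun t => avgE j (f t)) := by
  refine Sym.integral (f := fun t s X => pD (ed Z j) (f t) (scaleE Z d s X))
    (fun t => smooth_avgE_aux (hf.smooth t) j) ?_
  have h1 := hf.pd (ed Z j) (Nat.zero_le _)
  refine Sym.comp_scaleE (f := fun t => pD (ed Z j) (f t))
    (h1.mono_k (k' := k) (le_of_eq rfl)) (fun X _ => mul_nonneg (h0 X) (gain_nonneg hμ X))
    fun X t ht => ?_
  exact mul_le_mul (hm X t ht) (gain_scaleE hμ X ht) (gain_nonneg hμ _) (h0 X)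

lemma Sym.tay {ϖ : Amp Z d → ℝ} {f : T → Amp Z d → ℂ}
    (hf : Sym (O.fine μ hμ κ d) k (fun _ => ϖ) f) (h0 : ∀ X, 0 ≤ ϖ X)
    (hm : ∀ X, ∀ t ∈ 𝕀, ϖ (scaleE Z d t X) ≤ ϖ X) (hk : O.c ≤ k) :
    Sym (O.fine μ hμ κ d) (k - O.c)
      (fun _ X => ϖ X * gain μ κ X * (O.v X.1 * br X.2.1 ^ O.a)) (fun t => tay (f t)) := by
  refine Sym.sum univ (fun j _ => ?_) fun _ X _ => mul_nonneg (mul_nonneg (h0 X)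
    (gain_nonneg hμ X)) (mul_nonneg (zero_le_one.trans (O.one_le_v _)) (pow_nonneg (br_pos _).le _))
  exact ((hf.avgE h0 hm j).pd (wd Z j) hk).constMul (-I)

lemma wgt_scaleE (h0 : ∀ z, 0 ≤ ϖ₀ z) (hs : 0 ≤ s) (X : Amp Z d) {t : ℝ}
    (ht : t ∈ 𝕀) : wgt ϖ₀ r s (scaleE Z d t X) ≤ wgt ϖ₀ r s X := by
  have h1 := Real.rpow_le_rpow (br_pos _).le (br_smul_le X.2.2 ht.1 ht.2) hs
  have h2 := h0 X.1
  have h3 : 0 < br X.2.1 ^ r := br_rpow_pos _ _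
  simp only [wgt, scaleE_apply]
  gcongr

lemma avgE_spec {f : Amp Z d → ℂ} (hf : Smooth f) (z : Z) (w η : Conf d) :
    f (z, (w, η)) = f (z, (w, 0)) + ∑ j, (η j : ℂ) * avgE j f (z, (w, η)) := by
  have hsm : ∀ j, Continuous fun t : ℝ => pd (ed Z j) f (scaleE Z d t (z, (w, η))) := fun j =>
    (smooth_avgE_aux hf j).continuous.comp (by fun_prop : Continuous fun t : ℝ =>
      (t, ((z, (w, η)) : Amp Z d)))
  have hd : ∀ t : ℝ, HasDerivAt (fun t : ℝ => f (z, (w, t • η)))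
      (∑ j, (η j : ℂ) * pd (ed Z j) f (scaleE Z d t (z, (w, η)))) t := by
    intro t
    have h1 : HasDerivAt (fun t : ℝ => ((z, (w, t • η)) : Amp Z d)) (0, (0, η)) t := by
      refine (hasDerivAt_const t z).prodMk ((hasDerivAt_const t w).prodMk ?_)
      simpa using (hasDerivAt_id t).smul_const η
    have h2 := (smooth_diffAt hf (z, (w, t • η))).hasFDerivAt.comp_hasDerivAt t h1
    refine h2.congr_deriv ?_
    rw [fderiv_amp]
    simp
  have hc : ∀ j, Continuous fun t : ℝ => (η j : ℂ) * pd (ed Z j) f (scaleE Z d t (z, (w, η))) :=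
    fun j => continuous_const.mul (hsm j)
  have key := intervalIntegral.integral_eq_sub_of_hasDerivAt (a := 0) (b := 1)
    (fun t _ => hd t) ((continuous_finsetSum _ fun j _ => hc j).intervalIntegrable _ _)
  simp only [one_smul, zero_smul] at key
  rw [eq_comm, ← eq_sub_iff_add_eq', ← key,
    intervalIntegral.integral_finsetSum fun j _ => (hc j).intervalIntegrable _ _]
  refine sum_congr rfl fun j _ => ?_
  rw [avgE, intervalIntegral.integral_const_mul]

lemma Osc.avgE {z : Z} {f : Amp Z d → ℂ} (hf : Osc z f) (j : Fin d) : Osc z (avgE j f) := by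
  obtain ⟨a, r, s, hf⟩ := hf
  have h1 := pt_mono (le_refl a) (le_refl r) (le_max_left s 0) hf
  have h2 : Sym ((pt z a).fine (fun _ => 1) (fun _ => one_pos) 0 d) 0
      (fun _ => wgt (fun _ => 1) r (max s 0)) (fun _ : Unit => f) := by
    refine h1.rescale le_rfl ?_ le_rfl ?_ (fun _ X _ => wgt_nonneg (fun _ => zero_le_one) X)
      ⟨1, zero_le_one, fun t X _ => by rw [one_mul]⟩
    · rintro (i | i | i) <;> exact le_rfl
    · rintro (i | i | i) <;> refine ⟨1, zero_le_one, fun X hX => ?_⟩ <;> rw [one_mul]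
      · exact le_rfl
      · exact le_rfl
      · simp [OscData.fine, OscData.scale]
  refine ⟨a, r, max s 0, ((h2.avgE (wgt_nonneg fun _ => zero_le_one)
    (fun X t ht => wgt_scaleE (fun _ => zero_le_one) (le_max_right _ _) X ht) j).coarse
    (fun _ X _ => mul_nonneg (wgt_nonneg (fun _ => zero_le_one) X)
      (gain_nonneg (fun _ => one_pos) X))).congr_weight fun _ X _ => ?_⟩
  simp [gain]

/-- First order expansion of an oscillatory integral. -/
lemma Osc.osc_eq_add_tay {z : Z} {f : Amp Z d → ℂ} (hf : Osc z f) :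
    osc (fun q => f (z, q)) = f (z, 0) + osc (fun q => MagneticFIO.tay f (z, q)) := by
  have hs := hf.smooth
  have h1 : ∀ j, Osc z (fun X : Amp Z d => (X.2.2 j : ℂ) * MagneticFIO.avgE j f X) := fun j =>
    (Osc.coord_e j).mul (hf.avgE j)
  set S : Amp Z d → ℂ := fun X => ∑ j, (X.2.2 j : ℂ) * MagneticFIO.avgE j f X with hS
  have hSo : Osc z S := Osc.sum _ fun j _ => h1 j
  have hg : Osc z (fun X => f X + (-1) * S X) := hf.add (hSo.const_mul (-1))
  have e1 : ∀ X : Amp Z d, f X + (-1) * S X = f (X.1, (X.2.1, 0)) := by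
    intro X
    obtain ⟨z, w, η⟩ := X
    rw [avgE_spec hs z w η, hS]
    ring
  have e2 : osc (fun q => f (z, q) + (-1) * S (z, q)) = f (z, 0) := by
    rw [hg.osc_of_indep fun w η => by rw [e1, e1], e1]
    rfl
  have e3 : osc (fun q => f (z, q)) = osc (fun q => f (z, q) + (-1) * S (z, q)) +
      osc (fun q => S (z, q)) := by
    rw [← hg.osc_add hSo]
    congr 1
    funext q
    ring
  rw [e3, e2]
  congr 1
  rw [Osc.osc_sum (z := z) (f := fun j X => (X.2.2 j : ℂ) * MagneticFIO.avgE j f X) _ fun j _ => h1 j]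
  unfold MagneticFIO.tay
  rw [Osc.osc_sum (z := z) (f := fun j X => -I * pD (wd Z j)
    (MagneticFIO.avgE j f) X) _ fun j _ => ((hf.avgE j).pd_w j).const_mul _]
  exact sum_congr rfl fun j _ => (hf.avgE j).osc_coord_e_mul j

end

lemma temperate_segment (hA : HasTemperateGrowth A) : HasTemperateGrowth
      (fun X : Ph d => ∫ s in 0..1, A ((1 - s) • X.1 + s • X.2)) := by
  have hs : ContDiff ℝ ∞ (fun q : ℝ × (Ph d) => A ((1 - q.1) • q.2.1 + q.1 • q.2.2)) :=
    hA.1.comp (by fun_prop)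
  have := Dirs.finiteDimensional (Ph d)
  have hs' := contDiff_intervalIntegral hs
  refine ⟨hs', fun n => ?_⟩
  obtain ⟨k, C, hC, h⟩ := hA.norm_iteratedFDeriv_le_uniform n
  have hB : Bd (unitScale (Ph d)) n 0 (fun (_ : Unit × 𝕀) X => (1 + ‖X‖) ^ k)
      (fun q X => A ((1 - (q.2 : ℝ)) • X.1 + (q.2 : ℝ) • X.2)) := by
    refine Bd.of_iteratedFDeriv (K := n) (fun _ _ => rfl)
      (fun q => hA.1.comp (by fun_prop)) (Or.inl le_rfl) fun m hm => ⟨C, hC, fun q X _ => ?_⟩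
    obtain ⟨s, hs0, hs1⟩ := q.2
    let L : Ph d →L[ℝ] Conf d := (1 - s) • fst ℝ _ _ + s • snd ℝ _ _
    have hL : ‖L‖ ≤ 1 := by
      refine L.opNorm_le_bound zero_le_one fun Y => ?_
      calc ‖(1 - s) • Y.1 + s • Y.2‖ ≤ ‖(1 - s) • Y.1‖ + ‖s • Y.2‖ := norm_add_le _ _
        _ = (1 - s) * ‖Y.1‖ + s * ‖Y.2‖ := by
          rw [norm_smul, norm_smul, Real.norm_of_nonneg hs0, Real.norm_of_nonneg (by linarith)]
        _ ≤ (1 - s) * ‖Y‖ + s * ‖Y‖ := by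
          have h1 : 0 ≤ 1 - s := by linarith
          gcongr
          · exact norm_fst_le Y
          · exact norm_snd_le Y
        _ = 1 * ‖Y‖ := by ring
    have hLX : ‖L X‖ ≤ ‖X‖ := by simpa using L.le_of_opNorm_le hL X
    change ‖iteratedFDeriv ℝ m (A ∘ L) X‖ ≤ _
    rw [L.iteratedFDeriv_comp_right hA.1 X (mod_cast le_top)]
    refine (ContinuousMultilinearMap.norm_compContinuousLinearMap_le _ _).trans ?_
    have h1 : ∏ _i : Fin m, ‖L‖ ≤ 1 := Finset.prod_le_one (fun _ _ => norm_nonneg _) fun _ _ => hL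
    calc _ ≤ ‖iteratedFDeriv ℝ m A (L X)‖ * 1 := by gcongr
      _ ≤ C * (1 + ‖L X‖) ^ k := by rw [mul_one]; exact h m hm _
      _ ≤ C * (1 + ‖X‖) ^ k := by gcongr
  obtain ⟨C', -, h'⟩ := Bd.iteratedFDeriv_le (fun _ _ => rfl) (fun _ : Unit => hs')
    (fun _ => Nat.zero_le _) (Bd.integral (T := Unit) (ϖ := fun _ X => (1 + ‖X‖) ^ k) (fun _ => hs) hB) le_rfl
    (Or.inr fun i => show (unitScale (Ph d)).cost i = 0 from rfl)
  exact ⟨k, C', fun X => h' () X trivial⟩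

lemma temperate_cexp : HasTemperateGrowth (fun t : ℝ => exp (-I * (t : ℂ))) := by
  have hd : ∀ t : ℝ, HasDerivAt (fun t : ℝ => exp (-I * (t : ℂ)))
      (-I * exp (-I * (t : ℂ))) t := fun t => by
    have := ((Complex.ofRealCLM.hasDerivAt (x := t)).const_mul (-I)).cexp
    refine this.congr_deriv ?_
    simp [mul_comm]
  have hi : ∀ n : ℕ, iteratedDeriv n (fun t : ℝ => exp (-I * (t : ℂ))) =
      fun t : ℝ => (-I) ^ n * exp (-I * (t : ℂ)) := by
    intro n
    induction n with
    | zero => simp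
    | succ n ih =>
      rw [iteratedDeriv_succ, ih]
      funext t
      rw [((hd t).const_mul _).deriv]
      ring
  refine ⟨(contDiff_const.mul Complex.ofRealCLM.contDiff).cexp, fun n => ⟨0, 1, fun t => ?_⟩⟩
  rw [norm_iteratedFDeriv_eq_norm_iteratedDeriv, hi]
  have : ‖exp (-I * (t : ℂ))‖ = 1 := by
    rw [Complex.norm_exp]; simp
  rw [norm_mul, this]
  simp

lemma temperate_magPhase (hA : HasTemperateGrowth A) :
    HasTemperateGrowth (fun X : Ph d => magPhase A X.1 X.2) := by
  have h1 : HasTemperateGrowth (fun X : Ph d => X.1 - X.2) := (fst ℝ (Conf d) (Conf d) -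
      snd ℝ (Conf d) (Conf d)).hasTemperateGrowth
  have h2 := (innerSL ℝ (E := Conf d)).bilinear_hasTemperateGrowth h1 (temperate_segment hA)
  exact temperate_cexp.comp h2.fun_neg

def magMul (A : Conf d → Conf d) (x : Conf d) (u : Sw d) : Sw d :=
  SchwartzMap.smulLeftCLM ℂ (fun y => magPhase A x y) u

lemma temperate_slice (hA : HasTemperateGrowth A) (x : Conf d) :
    HasTemperateGrowth (fun y => magPhase A x y) := by
  have h : HasTemperateGrowth (fun y : Conf d => (x, y)) := by
    have h1 := (inr ℝ (Conf d) (Conf d)).hasTemperateGrowth.fun_add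
      (HasTemperateGrowth.const ((x, 0) : Ph d))
    have h2 : (fun y : Conf d => (x, y)) = fun y => inr ℝ (Conf d) (Conf d) y + (x, 0) := by
      funext y; simp
    rw [h2]; exact h1
  exact HasTemperateGrowth.comp (g := fun X : Ph d => magPhase A X.1 X.2)
    (f := fun y : Conf d => (x, y)) (temperate_magPhase hA) h

lemma magMul_apply (hA : HasTemperateGrowth A) (x : Conf d)
    (u : Sw d) (y : Conf d) : magMul A x u y = magPhase A x y * u y :=
  SchwartzMap.smulLeftCLM_apply_apply (temperate_slice hA x) u y

lemma circulation_eq (A : Conf d → Conf d) (hA : Continuous A) (x y : Conf d) :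
    circulation A x y = ∫ s in 0..1, inner ℝ (y - x) (A (x + s • (y - x))) := by
  have hc : Continuous fun s : ℝ => A ((1 - s) • x + s • y) := hA.comp (by fun_prop)
  have h : ∫ s in 0..1, inner ℝ (x - y) (A ((1 - s) • x + s • y)) =
      inner ℝ (x - y) (∫ s in 0..1, A ((1 - s) • x + s • y)) :=
    ((innerSL ℝ (E := Conf d)) (x - y)).intervalIntegral_comp_comm
      (hc.intervalIntegrable (μ := volume) 0 1)
  rw [circulation, ← h, ← intervalIntegral.integral_neg]
  refine intervalIntegral.integral_congr fun s _ => ?_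
  rw [← inner_neg_left, neg_sub]
  congr 2
  module

lemma circulation_symm (A : Conf d → Conf d) (x y : Conf d) :
    circulation A y x = -circulation A x y := by
  have h := intervalIntegral.integral_comp_sub_left (a := 0) (b := 1)
    (fun s : ℝ => A ((1 - s) • x + s • y)) 1
  simp only [sub_self, sub_zero, sub_sub_cancel] at h
  rw [circulation, circulation, ← h, ← neg_sub x y, inner_neg_left]
  congr 4
  funext s
  rw [add_comm]

/-- The coefficients `∫_0^1 ∫_0^1 λ B_{jk}(x + (1 - λ) r + λ s p) ds dλ` of the flux through a
triangle with edges `p`, `r` at `x`. -/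
def fluxCoeff (B : Fld d) (j k : Fin d) (X : Conf d × (Ph d)) : ℝ := ∫ l in 0..1, ∫ s in 0..1,
    l * B (X.1 + ((1 - l) • X.2.2 + (l * s) • X.2.1)) j k

/-- The flux of `B` through the triangle with vertices `x`, `x + p`, `x + r`. -/
def flux (B : Fld d) (X : Conf d × (Ph d)) : ℝ := ∑ j, ∑ k, X.2.1 j * X.2.2 k * fluxCoeff B j k X

/-- `e^{-i flux}`. -/
def fluxPhase (B : Fld d) (X : Conf d × (Ph d)) : ℂ := exp (I * (-flux B X : ℝ))

lemma field_bilin (hA : IsVectorPotential A B) (x p r : Conf d) : ∑ j, ∑ k, p j * r k * B x j k =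
      inner ℝ r (fderiv ℝ A x p) - inner ℝ p (fderiv ℝ A x r) := by
  have hd : DifferentiableAt ℝ A x := hA.temperate.1.differentiable (by simp) x
  have hco : ∀ (k : Fin d) (v : Conf d), fderiv ℝ (fun y => A y k) x v = fderiv ℝ A x v k := by
    intro k v
    have h1 := ((proj k : Conf d →L[ℝ] ℝ).hasFDerivAt (x := A x)).comp x hd.hasFDerivAt
    have h2 : fderiv ℝ (fun y => A y k) x = (proj k : Conf d →L[ℝ] ℝ).comp
      (fderiv ℝ A x) := h1.fderiv
    rw [h2]; rfl
  have key : ∀ p r : Conf d, inner ℝ r (fderiv ℝ A x p) =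
      ∑ j, ∑ k, p j * r k * fderiv ℝ (fun y => A y k) x (single j 1) := by
    intro p r
    rw [fderiv_eq_sum_pd A x p, inner_sum]
    refine sum_congr rfl fun j _ => ?_
    rw [inner_smul_right, PiLp.inner_apply, mul_sum]
    refine sum_congr rfl fun k _ => ?_
    rw [hco, pd, b_conf]
    simp only [co_conf, RCLike.inner_apply, conj_trivial]
    ring
  rw [key p r, key r p, sum_comm (f := fun j k => r j * p k * _), ← Finset.sum_sub_distrib]
  refine sum_congr rfl fun j _ => ?_
  rw [← Finset.sum_sub_distrib]
  refine sum_congr rfl fun k _ => ?_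
  rw [hA.d_eq]
  ring

lemma sum_mul_double {α : Type*} (S : Finset α) (c : α → ℝ) {f : α → ℝ → ℝ → ℝ}
    (hf : ∀ a ∈ S, Continuous fun q : ℝ × ℝ => f a q.1 q.2) :
    ∑ a ∈ S, c a * (∫ l in 0..1, ∫ s in 0..1, f a l s) =
      ∫ l in 0..1, ∫ s in 0..1, ∑ a ∈ S, c a * f a l s := by
  have h1 : ∀ l, ∫ s in 0..1, ∑ a ∈ S, c a * f a l s = ∑ a ∈ S, c a * ∫ s in 0..1, f a l s := by
    intro l
    rw [intervalIntegral.integral_finsetSum]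
    · exact sum_congr rfl fun a _ => intervalIntegral.integral_const_mul _ _
    · exact fun a ha => (continuous_const.mul ((hf a ha).comp
        (by fun_prop : Continuous fun s : ℝ => (l, s)))).intervalIntegrable 0 1
  rw [intervalIntegral.integral_congr fun l _ => h1 l, intervalIntegral.integral_finsetSum]
  · exact sum_congr rfl fun a _ => (intervalIntegral.integral_const_mul _ _).symm
  · exact fun a ha => (continuous_const.mul
      (intervalIntegral.continuous_parametric_intervalIntegral_of_continuous' (hf a ha) 0 1)
      ).intervalIntegrable 0 1

/-- Stokes' theorem for triangles. -/
lemma circulation_triangle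
    (hA : IsVectorPotential A B) (hB : ∀ j k, Continuous fun x => B x j k) (x p r : Conf d) :
    circulation A x (x + p) - circulation A (x + r) (x + p) + circulation A (x + r) x =
      flux B (x, (p, r)) := by
  have hAs := hA.temperate.1
  have hAc : Continuous A := hAs.continuous
  have hdA : Continuous (fderiv ℝ A) := hAs.continuous_fderiv (by simp)
  set γ : ℝ → ℝ → Conf d := fun l s => x + ((1 - l) • r + (l * s) • p) with hγ
  have hγc : Continuous fun q : ℝ × ℝ => γ q.1 q.2 := by rw [hγ]; fun_prop
  -- the two one-parameter derivatives
  have h1 : ∀ l s : ℝ, HasDerivAt (fun l => l * inner ℝ p (A (γ l s)))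
      (inner ℝ p (A (γ l s)) + l * inner ℝ p (fderiv ℝ A (γ l s) (-r + s • p))) l := by
    intro l s
    have hg : HasDerivAt (fun l => γ l s) (-r + s • p) l := by
      have : HasDerivAt (fun l : ℝ => x + ((1 - l) • r + (l * s) • p))
        ((0 - 1 : ℝ) • r + (1 * s) • p) l :=
        ((((hasDerivAt_const l (1 : ℝ)).sub (hasDerivAt_id l)).smul_const r).add
          (((hasDerivAt_id l).mul_const s).smul_const p)).const_add x
      refine this.congr_deriv (by simp)
    have hA1 := ((hAs.differentiable (by simp)) (γ l s)).hasFDerivAt.comp_hasDerivAt l hg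
    have hi := ((innerSL ℝ (E := Conf d)) p).hasFDerivAt.comp_hasDerivAt l hA1
    have := (hasDerivAt_id l).mul hi
    refine this.congr_deriv ?_
    simp
  have h2 : ∀ l s : ℝ, HasDerivAt (fun s => inner ℝ (-r + s • p) (A (γ l s)))
      (inner ℝ p (A (γ l s)) + l * inner ℝ (-r + s • p) (fderiv ℝ A (γ l s) p)) s := by
    intro l s
    have hg : HasDerivAt (fun s => γ l s) (l • p) s := by
      have : HasDerivAt (fun s : ℝ => x + ((1 - l) • r + (l * s) • p)) ((l * 1) • p) s :=
        ((((hasDerivAt_id s).const_mul l).smul_const p).const_add _).const_add x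
      exact this.congr_deriv (by simp)
    have hA1 := ((hAs.differentiable (by simp)) (γ l s)).hasFDerivAt.comp_hasDerivAt s hg
    have hv : HasDerivAt (fun s : ℝ => -r + s • p) p s := by
      have := ((hasDerivAt_id s).smul_const p).const_add (-r)
      exact this.congr_deriv (by simp)
    have := hv.inner ℝ hA1
    refine this.congr_deriv ?_
    simp [inner_smul_right, add_comm]
  have c1 : Continuous fun q : ℝ × ℝ =>
      inner ℝ p (A (γ q.1 q.2)) + q.1 * inner ℝ p (fderiv ℝ A (γ q.1 q.2) (-r + q.2 • p)) :=
    (continuous_const.inner (hAc.comp hγc)).add (continuous_fst.mul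
      (continuous_const.inner ((hdA.comp hγc).clm_apply (by fun_prop))))
  have c2 : Continuous fun q : ℝ × ℝ =>
      inner ℝ p (A (γ q.1 q.2)) + q.1 * inner ℝ (-r + q.2 • p) (fderiv ℝ A (γ q.1 q.2) p) := by
    refine (continuous_const.inner (hAc.comp hγc)).add (continuous_fst.mul
      (Continuous.inner (by fun_prop) ((hdA.comp hγc).clm_apply continuous_const)))
  have e1 : ∀ s : ℝ, ∫ l in 0..1, (inner ℝ p (A (γ l s)) +
      l * inner ℝ p (fderiv ℝ A (γ l s) (-r + s • p))) = inner ℝ p (A (x + s • p)) := by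
    intro s
    rw [intervalIntegral.integral_eq_sub_of_hasDerivAt (fun l _ => h1 l s)
      ((c1.comp (by fun_prop : Continuous fun l : ℝ => (l, s))).intervalIntegrable 0 1)]
    simp [hγ]
  have e2 : ∀ l : ℝ, ∫ s in 0..1, (inner ℝ p (A (γ l s)) +
      l * inner ℝ (-r + s • p) (fderiv ℝ A (γ l s) p)) =
      inner ℝ (p - r) (A (x + r + l • (p - r))) - inner ℝ (-r) (A (x + r + l • (-r))) := by
    intro l
    rw [intervalIntegral.integral_eq_sub_of_hasDerivAt (fun s _ => h2 l s)
      ((c2.comp (by fun_prop : Continuous fun s : ℝ => (l, s))).intervalIntegrable 0 1)]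
    have a1 : γ l 1 = x + r + l • (p - r) := by rw [hγ]; module
    have a2 : γ l 0 = x + r + l • (-r) := by rw [hγ]; module
    rw [a1, a2]
    congr 2
    · module
    · module

  have hF : flux B (x, (p, r)) = ∫ l in 0..1, ∫ s in 0..1,
      ((inner ℝ p (A (γ l s)) + l * inner ℝ p (fderiv ℝ A (γ l s) (-r + s • p))) -
        (inner ℝ p (A (γ l s)) + l * inner ℝ (-r + s • p) (fderiv ℝ A (γ l s) p))) := by
    have hcB : ∀ j k, Continuous fun q : ℝ × ℝ => q.1 * B (γ q.1 q.2) j k := fun j k =>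
      continuous_fst.mul ((hB j k).comp hγc)
    simp only [flux, fluxCoeff]
    have hj : ∀ j, ∑ k, p j * r k * (∫ l in 0..1, ∫ s in 0..1, l * B (γ l s) j k) =
        ∫ l in 0..1, ∫ s in 0..1, ∑ k, p j * r k * (l * B (γ l s) j k) := fun j =>
      sum_mul_double _ _ fun k _ => hcB j k
    rw [sum_congr rfl fun j _ => hj j]
    have := sum_mul_double univ (fun _ : Fin d => (1 : ℝ))
      (f := fun j l s => ∑ k, p j * r k * (l * B (γ l s) j k)) fun j _ =>
        continuous_finsetSum _ fun k _ => continuous_const.mul (hcB j k)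
    simp only [one_mul] at this
    rw [this]
    congr 1; funext l; congr 1; funext s
    have h3 := field_bilin hA (γ l s) p r
    have h4 : ∑ j, ∑ k, p j * r k * (l * B (γ l s) j k) =
        l * ∑ j, ∑ k, p j * r k * B (γ l s) j k := by
      rw [mul_sum]
      refine sum_congr rfl fun j _ => ?_
      rw [mul_sum]
      exact sum_congr rfl fun k _ => by ring
    rw [h4, h3]
    simp only [map_add, map_neg, map_smul, inner_add_left, inner_add_right, inner_neg_left,
      inner_neg_right, inner_smul_left, inner_smul_right, conj_trivial]
    ring
  have hI : ∀ f : ℝ × ℝ → ℝ, Continuous f → ∀ l : ℝ,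
      IntervalIntegrable (fun s => f (l, s)) volume 0 1 := fun f hf l =>
    (hf.comp (by fun_prop : Continuous fun s : ℝ => (l, s))).intervalIntegrable 0 1
  have hI2 : ∀ f : ℝ × ℝ → ℝ, Continuous f →
      IntervalIntegrable (fun l => ∫ s in 0..1, f (l, s)) volume 0 1 := fun f hf =>
    (intervalIntegral.continuous_parametric_intervalIntegral_of_continuous'
      (f := fun l s => f (l, s)) hf 0 1).intervalIntegrable 0 1
  rw [hF, intervalIntegral.integral_congr fun l _ =>
    intervalIntegral.integral_sub (hI _ c1 l) (hI _ c2 l),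
    intervalIntegral.integral_sub (hI2 _ c1) (hI2 _ c2)]
  rw [intervalIntegral_intervalIntegral_swap (F := fun l s => inner ℝ p (A (γ l s)) +
    l * inner ℝ p (fderiv ℝ A (γ l s) (-r + s • p)))]
  · rw [intervalIntegral.integral_congr fun s _ => e1 s,
      intervalIntegral.integral_congr fun l _ => e2 l, intervalIntegral.integral_sub,
      circulation_eq A hAc, circulation_eq A hAc, circulation_eq A hAc]
    · simp only [add_sub_cancel_left, add_sub_add_left_eq_sub, sub_add_cancel_left]
      ring
    · exact (Continuous.inner (by fun_prop) (hAc.comp (by fun_prop))).intervalIntegrable 0 1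
    · exact (Continuous.inner (by fun_prop) (hAc.comp (by fun_prop))).intervalIntegrable 0 1
  · rw [Set.uIoc_of_le zero_le_one]
    exact (c1.continuousOn.integrableOn_compact (isCompact_Icc.prod isCompact_Icc)).mono_set
      (Set.prod_mono Set.Ioc_subset_Icc_self Set.Ioc_subset_Icc_self)

lemma continuous_field (hB : IsMagneticField B)
    (j k : Fin d) : Continuous fun x => B x j k := (hB.smooth j k).continuous

lemma magPhase_mul (hA : IsVectorPotential A B) (hB : IsMagneticField B) (x p r : Conf d) :
    magPhase A x (x + p) * magPhase A (x + p) (x + r) =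
      fluxPhase B (x, (p, r)) * magPhase A x (x + r) := by
  have h := circulation_triangle hA (continuous_field hB) x p r
  have h1 := circulation_symm A (x + r) (x + p)
  have h2 := circulation_symm A x (x + r)
  simp only [magPhase, fluxPhase]
  rw [← Complex.exp_add, ← Complex.exp_add, ← h, h1, h2]
  congr 1
  push_cast
  ring

lemma sym_field (hB : IsMagneticField B) (j k : Fin d) (K : ℕ) :
    Sym (unitScale (Conf d)) K (fun _ _ => 1) (fun (_ : T) x => B x j k) := by
  refine ⟨fun _ => hB.smooth j k, fun n => Bd.of_iteratedFDeriv (K := n) (fun _ _ => rfl)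
    (fun _ => hB.smooth j k) (Or.inl le_rfl) fun m _ => ?_⟩
  obtain ⟨C, hC⟩ := hB.bounded j k m
  exact ⟨C, (norm_nonneg _).trans (hC 0), fun _ X _ => by rw [mul_one]; exact hC X⟩

def fluxMap (d : ℕ) (l s : ℝ) : Conf d × (Ph d) →L[ℝ] Conf d := fst ℝ _ _ +
    ((1 - l) • (snd ℝ _ _).comp (snd ℝ _ _) + (l * s) • (fst ℝ _ _).comp (snd ℝ _ _))

lemma smooth_flux_integrand (hB : IsMagneticField B)
    (j k : Fin d) : Smooth (fun q : ℝ × (ℝ × (Conf d × (Ph d))) =>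
      q.2.1 * B (q.2.2.1 + ((1 - q.2.1) • q.2.2.2.2 + (q.2.1 * q.1) • q.2.2.2.1)) j k) := by
  have h : Smooth (fun q : ℝ × (ℝ × (Conf d × (Ph d))) =>
      q.2.2.1 + ((1 - q.2.1) • q.2.2.2.2 + (q.2.1 * q.1) • q.2.2.2.1)) := by fun_prop
  exact (by fun_prop : Smooth fun q : ℝ × (ℝ × (Conf d × (Ph d))) =>
    q.2.1).mul ((hB.smooth j k).comp h)

lemma sym_fluxCoeff (hB : IsMagneticField B) (j k : Fin d) (K : ℕ) :
    Sym (unitScale (Conf d × (Ph d))) K (fun _ _ => 1) (fun (_ : T) X => fluxCoeff B j k X) := by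
  have hsm := smooth_flux_integrand hB j k
  refine Sym.integral (ϖ := fun (_ : T) _ => (1 : ℝ)) (f := fun _ l (X : Conf d × (Ph d)) =>
    ∫ s in 0..1, l * B (X.1 + ((1 - l) • X.2.2 + (l * s) • X.2.1)) j k) (fun _ =>
    have := Dirs.finiteDimensional (Conf d × (Ph d))
    contDiff_intervalIntegral (E := ℝ × (Conf d × (Ph d))) hsm) ?_
  refine Sym.integral (T := T × 𝕀) (ϖ := fun _ _ => (1 : ℝ))
    (f := fun t s (X : Conf d × (Ph d)) => (t.2 : ℝ) *
      B (X.1 + ((1 - (t.2 : ℝ)) • X.2.2 + ((t.2 : ℝ) * s) • X.2.1)) j k)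
    (fun t => hsm.comp (by fun_prop :
      Smooth fun q : ℝ × (Conf d × (Ph d)) => (q.1, ((t.2 : ℝ), q.2)))) ?_
  have h1 := (sym_field hB j k K).compLin (S := unitScale (Conf d × (Ph d)))
    (fun t : (T × 𝕀) × 𝕀 => fluxMap d t.1.2 t.2)
    (fun _ _ _ => trivial) (fun _ _ _ => zero_le_one) fun i j' => Or.inl ⟨le_rfl, ?_⟩
  · have h2 : Sym (unitScale (Conf d × (Ph d))) K (fun _ _ => (1 : ℝ))
        (fun (t : (T × 𝕀) × 𝕀) _ => (t.1.2 : ℝ)) :=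
      Sym.const _ ⟨1, zero_le_one, fun t _ _ => by
        rw [Real.norm_of_nonneg t.1.2.2.1]; simpa using t.1.2.2.2⟩ fun _ _ _ => zero_le_one
    exact (h2.mulR h1).congr_weight fun _ _ _ => one_mul 1
  · refine ⟨‖co (E := Conf d) j'‖ * (3 * ‖(Dirs.b i : Conf d × (Ph d))‖), by positivity,
      fun t X _ => ?_⟩
    simp only [unitScale, mul_one]
    obtain ⟨⟨-, l, hl0, hl1⟩, s, hs0, hs1⟩ := t
    refine ((co j').le_opNorm _).trans ?_
    gcongr
    set Y : Conf d × (Ph d) := Dirs.b i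
    have a1 : ‖Y.1‖ ≤ ‖Y‖ := norm_fst_le Y
    have a2 : ‖Y.2.2‖ ≤ ‖Y‖ := (norm_snd_le Y.2).trans (norm_snd_le Y)
    have a3 : ‖Y.2.1‖ ≤ ‖Y‖ := (norm_fst_le Y.2).trans (norm_snd_le Y)
    have h0 : 0 ≤ 1 - l := by linarith
    have hls : l * s ≤ 1 := mul_le_one₀ hl1 hs0 hs1
    calc ‖Y.1 + ((1 - l) • Y.2.2 + (l * s) • Y.2.1)‖
        ≤ ‖Y.1‖ + (‖(1 - l) • Y.2.2‖ + ‖(l * s) • Y.2.1‖) :=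
          (norm_add_le _ _).trans (add_le_add_right (norm_add_le _ _) _)
      _ = ‖Y.1‖ + ((1 - l) * ‖Y.2.2‖ + (l * s) * ‖Y.2.1‖) := by
          rw [norm_smul, norm_smul, Real.norm_of_nonneg h0, Real.norm_of_nonneg (by positivity)]
      _ ≤ ‖Y‖ + (1 * ‖Y‖ + 1 * ‖Y‖) := by gcongr; linarith
      _ = 3 * ‖Y‖ := by ring

def fluxScale (d : ℕ) : Scale (Conf d × (Ph d)) where
  wt := fun _ X => br X.2.1 * br X.2.2
  pos := fun _ _ => mul_pos (br_pos _) (br_pos _)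
  cost := fun _ => 0
  dom := Set.univ

lemma sym_clm (L : E →L[ℝ] ℝ) {w : E → ℝ} (hw : ∀ X, 1 ≤ w X) (hL : ∀ X, |L X| ≤ w X) (K : ℕ) :
    Sym (unitScale E) K (fun _ X => w X) (fun (_ : T) X => L X) := by
  refine Sym.linear (fun _ => L) ⟨1, zero_le_one, fun _ X _ => by rw [one_mul]; exact hL X⟩
    (fun i => ⟨‖L (Dirs.b i)‖, norm_nonneg _, fun _ X _ => ?_⟩)
    fun _ X _ => zero_le_one.trans (hw X)
  simp only [unitScale, mul_one]
  exact le_mul_of_one_le_right (norm_nonneg _) (hw X)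

lemma sym_flux (hB : IsMagneticField B) (K : ℕ) : Sym (unitScale (Conf d × (Ph d))) K
      (fun _ X => br X.2.1 * br X.2.2) (fun (_ : T) X => flux B X) := by
  have h0 : ∀ X : Conf d × (Ph d), 0 ≤ br X.2.1 * br X.2.2 := fun X =>
    mul_nonneg (br_pos _).le (br_pos _).le
  refine Sym.sum _ (fun j _ => Sym.sum _ (fun k _ => ?_) fun _ X _ => h0 X) fun _ X _ => h0 X
  have hp := sym_clm (T := T) ((proj j : Conf d →L[ℝ] ℝ).comp ((fst ℝ _ _).comp
      (snd ℝ (Conf d) (Ph d))))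
    (w := fun X => br X.2.1) (fun X => one_le_br _) (fun X => abs_coord_le_br X.2.1 j) K
  have hr := sym_clm (T := T) ((proj k : Conf d →L[ℝ] ℝ).comp ((snd ℝ _ _).comp
      (snd ℝ (Conf d) (Ph d))))
    (w := fun X => br X.2.2) (fun X => one_le_br _) (fun X => abs_coord_le_br X.2.2 k) K
  exact ((hp.mulR hr).mulR (sym_fluxCoeff hB j k K)).congr_weight fun _ _ _ => mul_one _

lemma sym_fluxPhase (hB : IsMagneticField B)
    (K : ℕ) : Sym (fluxScale d) K (fun _ _ => 1) (fun (_ : T) X => fluxPhase B X) := by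
  have hs := (sym_flux (T := T) hB K).neg
  refine Sym.cexp (θ := fun _ X => -flux B X) hs.smooth fun i n => ?_
  have h1 : 1 ≤ fun X : Conf d × (Ph d) => br X.2.1 * br X.2.2 := fun X =>
    one_le_mul (one_le_br _) (one_le_br _)
  exact (((hs.pd i (Nat.zero_le _)).bd n).rescale (S₂ := fluxScale d) (fun _ _ => trivial)
    (fun _ => le_rfl) le_rfl (fun j => ⟨1, zero_le_one, fun X _ => by
      rw [one_mul]; exact h1 X⟩) (fun _ X _ => (zero_le_one.trans (h1 X)))
    ⟨1, zero_le_one, fun _ X _ => by simp [unitScale, fluxScale]⟩)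

lemma fluxPhase_zero (B : Fld d) (x r : Conf d) :
    fluxPhase B (x, (0, r)) = 1 := by simp [fluxPhase, flux]

/-- The derivative of the phase factor in the direction `p_j` at `p = 0`. -/
lemma pd_fluxPhase_zero (hB : IsMagneticField B) (x r : Conf d) (j : Fin d) :
    fderiv ℝ (fun p => fluxPhase B (x, (p, r))) 0 (single j 1) =
      -I * ((∑ k, (∫ t in 0..1, (1 - t) * B (x + t • r) j k) * r k : ℝ) : ℂ) := by
  have hQ : ∀ i k, Smooth fun p : Conf d => fluxCoeff B i k (x, (p, r)) := fun i k =>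
    ((sym_fluxCoeff (T := Unit) hB i k 0).smooth ()).comp (by fun_prop)
  have hq0 : ∀ k, fluxCoeff B j k (x, (0, r)) = ∫ t in 0..1, (1 - t) * B (x + t • r) j k := by
    intro k
    have h := intervalIntegral.integral_comp_sub_left (a := 0) (b := 1)
      (fun t : ℝ => (1 - t) * B (x + t • r) j k) 1
    simp only [sub_self, sub_zero, sub_sub_cancel] at h
    rw [← h]
    simp [fluxCoeff]
  have hterm : ∀ i k, HasFDerivAt (fun p : Conf d => p i * r k * fluxCoeff B i k (x, (p, r)))
      ((r k * fluxCoeff B i k (x, (0, r))) • (proj i : Conf d →L[ℝ] ℝ)) 0 := by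
    intro i k
    have h1 := ((proj i : Conf d →L[ℝ] ℝ).hasFDerivAt (x := (0 : Conf d))).mul_const (r k)
    have h2 := h1.mul (smooth_diffAt (hQ i k) 0).hasFDerivAt
    refine h2.congr_fderiv ?_
    ext v
    simp
    ring
  have hflux : HasFDerivAt (fun p : Conf d => flux B (x, (p, r)))
      (∑ i, ∑ k, (r k * fluxCoeff B i k (x, (0, r))) • (proj i : Conf d →L[ℝ] ℝ)) 0 := by
    have := HasFDerivAt.fun_sum (u := univ) fun i (_ : i ∈ univ) =>
      HasFDerivAt.fun_sum (u := univ) fun k (_ : k ∈ univ) => hterm i k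
    exact this
  have hexp := ((Complex.ofRealCLM.hasFDerivAt.comp (0 : Conf d) hflux.neg).const_mul I).cexp
  have hf : HasFDerivAt (fun p => fluxPhase B (x, (p, r))) _ (0 : Conf d) := hexp
  rw [hf.fderiv]
  have hv : ∀ i : Fin d, (proj i : Conf d →L[ℝ] ℝ)
      (single j 1) = if i = j then 1 else 0 := fun i => by simp
  have hF0 : flux B (x, (0, r)) = 0 := by simp [flux]
  simp [hF0, hq0, mul_comm]

lemma Sym.compAff {f : T → E' → F} {ϖ' : T → E' → ℝ} (hf : Sym S' k ϖ' f) (v : T → E')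
    (L : T → E →L[ℝ] E')
    (hdom : ∀ t, ∀ X ∈ S.dom, v t + L t X ∈ S'.dom) (h0 : ∀ t, ∀ X ∈ S'.dom, 0 ≤ ϖ' t X)
    (hc : ∀ i j, (S'.cost j ≤ S.cost i ∧ ∃ K : ℝ, 0 ≤ K ∧ ∀ t, ∀ X ∈ S.dom,
      |co j (L t (Dirs.b i))| * S'.wt j (v t + L t X) ≤ K * S.wt i X) ∨
      ∀ t, co j (L t (Dirs.b i)) = 0) :
    Sym S k (fun t X => ϖ' t (v t + L t X)) (fun t X => f t (v t + L t X)) := by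
  have hp : ∀ i j t, pD i (fun Y => co j (v t + L t Y)) = fun _ => co j (L t (Dirs.b i)) := by
    intro i j t
    have h := pd_linear i ((co j).comp (L t))
    funext X
    refine Eq.trans ?_ (congrFun h X)
    simp only [MagneticFIO.pd, map_add, ContinuousLinearMap.comp_apply]
    rw [fderiv_const_add]
  refine hf.comp (fun t => contDiff_const.add (L t).contDiff) hdom (fun i j => ?_) h0
    (fun i j n => ?_)
  · rcases hc i j with h | h
    · exact Or.inl h.1
    · right; intro t X; rw [hp]; exact h t
  · simp only [hp]
    have hq : ∀ t, ∀ X ∈ S.dom, 0 ≤ S.wt i X / S'.wt j (v t + L t X) := fun t X _ =>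
      div_nonneg (S.pos _ _).le (S'.pos _ _).le
    rcases hc i j with ⟨-, K, hK, h⟩ | h
    · refine (Sym.const _ ⟨K, hK, fun t X hX => ?_⟩ hq).bd n
      rw [← mul_div_assoc, le_div_iff₀ (S'.pos _ _)]
      exact h t X hX
    · simp only [h]
      exact Bd.zero hq

lemma pd_comp_clm (L : E →L[ℝ] E') {g : E' → F} (hg : Smooth g) (i : Dirs.ι E) (X : E) :
    pd i (fun X => g (L X)) X = fderiv ℝ g (L X) (L (Dirs.b i)) := by
  have h := (smooth_diffAt hg (L X)).hasFDerivAt.comp X L.hasFDerivAt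
  have h2 : fderiv ℝ (fun X => g (L X)) X = (fderiv ℝ g (L X)).comp L := h.fderiv
  rw [pd, h2]; rfl

lemma Osc.slice {z : Z} {f : Amp Z d → ℂ} (hf : Osc z f) :
    Osc PUnit.unit.{1} (fun X : Amp PUnit.{1} d => f (z, X.2)) := by
  obtain ⟨a, r, s, hf⟩ := hf
  refine ⟨a, r, s, ?_⟩
  have := hf.compAff (S := (pt PUnit.unit.{1} a).scale d) (fun _ => ((z, 0) : Amp Z d))
    (fun _ => (inr ℝ Z (Ph d)).comp (snd ℝ PUnit.{1} (Ph d)))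
    (fun _ X _ => by simp [pt, OscData.scale]) (fun _ X _ => wgt_nonneg (fun _ => zero_le_one) X) ?_
  · have e : ∀ X : Amp PUnit.{1} d, ((z, 0) : Amp Z d) + ((inr ℝ Z (Ph d)).comp
      (snd ℝ PUnit.{1} (Ph d))) X = (z, X.2) := fun X => by simp
    simp only [e] at this
    exact this
  · rintro (i | i) (j | j)
    · exact i.elim
    · exact i.elim
    · right; intro t
      rw [co_inl, b_inr]; simp
    · left
      refine ⟨by rcases j with j | j <;> exact Nat.zero_le _,
        |co j (Dirs.b i : Ph d)|, abs_nonneg _, fun t X _ => ?_⟩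
      rw [co_inr, b_inr]
      by_cases hij : co j (Dirs.b i : Ph d) = 0
      · simp [hij]
      · classical
        have hij' : i = j := by
          by_contra h
          exact hij (by rw [co_b, if_neg h])
        subst hij'
        rcases i with i | i <;> simp [OscData.scale, pt]

lemma sym_schwartz (g : Sw d) (r : ℝ) (k : ℕ) :
    Sym (unitScale (Conf d)) k (fun _ w => br w ^ r) (fun (_ : T) w => g w) := by
  refine ⟨fun _ => g.smooth ⊤, fun n => Bd.of_iteratedFDeriv (K := n) (fun _ _ => rfl)
    (fun _ => g.smooth ⊤) (Or.inl le_rfl) fun m hm => ?_⟩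
  obtain ⟨N, hN⟩ := exists_nat_ge (-r)
  have h := fun x => SchwartzMap.one_add_le_sup_seminorm_apply (𝕜 := ℂ) (m := (N, m)) le_rfl le_rfl g x
  set C := 2 ^ N * (Finset.Iic (N, m)).sup (fun m => SchwartzMap.seminorm ℂ m.1 m.2) g
  refine ⟨C, (by positivity : (0 : ℝ) ≤ _).trans (h 0), fun _ w _ => ?_⟩
  have hb := br_pos w
  have h1 : br w ^ (-r) ≤ (1 + ‖w‖) ^ N := by
    calc br w ^ (-r) ≤ br w ^ (N : ℝ) :=
          br_rpow_mono w hN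
      _ = br w ^ N := Real.rpow_natCast _ _
      _ ≤ _ := pow_le_pow_left₀ hb.le (br_le_one_add w) _
  have h2 : 0 < br w ^ r := Real.rpow_pos_of_pos hb _
  have h3 : br w ^ r * br w ^ (-r) = 1 := by rw [← Real.rpow_add hb]; simp
  calc ‖iteratedFDeriv ℝ m (fun w => g w) w‖
      = br w ^ r * (br w ^ (-r) * ‖iteratedFDeriv ℝ m g w‖) := by
        rw [← mul_assoc, h3, one_mul]
    _ ≤ br w ^ r * ((1 + ‖w‖) ^ N * ‖iteratedFDeriv ℝ m g w‖) := by gcongr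
    _ ≤ br w ^ r * C := by gcongr; exact h w
    _ = _ := mul_comm _ _

lemma sym_schwartz_w (O : OscData Z) (g : Sw d) (r : ℝ) (k : ℕ) :
    SW O d k (fun _ => 1) r 0 (fun (_ : T) X => g X.2.1) := by
  refine ((sym_schwartz g r k).compLin (S := O.scale d) (fun _ : T => wM Z d)
    (fun _ _ _ => trivial) (fun _ _ _ => (br_rpow_pos _ _).le) ?_).congr_weight
    fun _ X _ => by simp [wgt]
  rintro (i | i | i) j
  · right; intro t; rw [b_inl]; simp
  · left
    refine ⟨Nat.zero_le _, |co j (wM Z d (Dirs.b (wd Z i)))|, abs_nonneg _, fun t X _ => ?_⟩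
    exact mul_le_mul_of_nonneg_left (O.one_le_wt_w i X) (abs_nonneg _)
  · right; intro t; rw [b_inr, b_inr]; simp

lemma sym_schwartz_e (O : OscData Z) (g : Sw d) (s : ℝ) (k : ℕ) :
    SW O d k (fun _ => 1) 0 s (fun (_ : T) X => g X.2.2) := by
  refine ((sym_schwartz g s k).compLin (S := O.scale d) (fun _ : T => eM Z d)
    (fun _ _ _ => trivial) (fun _ _ _ => (br_rpow_pos _ _).le) ?_).congr_weight
    fun _ X _ => by simp [wgt]
  rintro (i | i | i) j
  · right; intro t; rw [b_inl]; simp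
  · right; intro t; rw [b_inr, b_inl]; simp
  · left
    exact ⟨Nat.zero_le _, |co j (eM Z d (Dirs.b (ed Z i)))|, abs_nonneg _, fun t X _ => le_rfl⟩

lemma fast_schwartz (z : Z) (g h : Sw d) : Fast z (fun X : Amp Z d => h X.2.2 * g X.2.1) :=
  ((sym_schwartz_e (flat z) h (-(d + 1)) 0).mul (sym_schwartz_w (flat z) g (-(d + 1)) 0)).congr_weight
    fun _ X _ => by simp [wgt, mul_comm]

/-- Cut-offs disappear in the limit. -/
lemma tendsto_cutoff_integral {F : Conf d → ℂ} (hF : Integrable F) {χ : Conf d → ℂ}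
    (hχ : Continuous χ) (hc : HasCompactSupport χ) :
    Tendsto (fun ε : ℝ => ∫ η, χ (ε • η) * F η) (𝓝[>] 0) (𝓝 (∫ η, χ 0 * F η)) := by
  obtain ⟨C, hC⟩ := hχ.bounded_above_of_compact_support hc
  refine tendsto_integral_filter_of_dominated_convergence (fun η => C * ‖F η‖) ?_ ?_
    (hF.norm.const_mul C) ?_
  · exact .of_forall fun ε =>
      ((hχ.comp (continuous_const_smul ε)).aestronglyMeasurable).mul hF.aestronglyMeasurable
  · refine .of_forall fun ε => .of_forall fun η => ?_
    rw [norm_mul]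
    gcongr
    exact hC _
  · refine .of_forall fun η => ?_
    have : Continuous fun ε : ℝ => χ (ε • η) * F η :=
      (hχ.comp (continuous_id.smul continuous_const)).mul continuous_const
    simpa using (this.tendsto 0).mono_left nhdsWithin_le_nhds

lemma integrable_hat_mul (g : Sw d) {φ : Conf d → ℂ} (hφ : Continuous φ) {C s : ℝ}
    (hb : ∀ η, ‖φ η‖ ≤ C * br η ^ s) : Integrable fun η => hat g η * φ η := by
  obtain ⟨K, hK, h⟩ := exists_hat_bound g s
  refine ((integrable_br (s := -(d + 1)) le_rfl).const_mul (|C| * K)).mono'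
    ((hat g).continuous.mul hφ).aestronglyMeasurable (.of_forall fun η => ?_)
  have hp : 0 < br η ^ s := br_rpow_pos _ _
  calc ‖hat g η * φ η‖ ≤ ‖hat g η‖ * (|C| * br η ^ s) := by
        rw [norm_mul]
        gcongr
        exact (hb η).trans (by gcongr; exact le_abs_self C)
    _ = |C| * (br η ^ s * ‖hat g η‖) := by ring
    _ ≤ |C| * (K * br η ^ (-(d + 1) : ℝ)) := mul_le_mul_of_nonneg_left (h η) (abs_nonneg _)
    _ = _ := by ring

lemma Osc.bound_e {z : Z} {φ : Conf d → ℂ} (hφ : Osc z (fun X : Amp Z d => φ X.2.2)) :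
    Smooth φ ∧ ∃ C s : ℝ, ∀ η, ‖φ η‖ ≤ C * br η ^ s := by
  obtain ⟨a, r, s, h⟩ := hφ
  constructor
  · exact (h.smooth ()).comp (by fun_prop : Smooth fun η : Conf d => ((z, (0, η)) : Amp Z d))
  · obtain ⟨C, hC, hb⟩ := h.bound
    refine ⟨C, s, fun η => (hb () (z, (0, η)) rfl).trans (le_of_eq ?_)⟩
    simp [wgt, bracket]

/-- Oscillatory integrals of `g(w) φ(η)` with a Schwartz function `g`. -/
lemma Osc.osc_schwartz {z : Z} (g : Sw d) {φ : Conf d → ℂ}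
    (hφ : Osc z (fun X : Amp Z d => φ X.2.2)) :
    osc (fun q => φ q.2 * g q.1) = cd d * ∫ η, hat g η * φ η := by
  obtain ⟨hsm, C, s', hb⟩ := hφ.bound_e
  obtain ⟨a, r, s, h⟩ := hφ
  obtain ⟨M, hM⟩ := exists_nat_two_mul s (-(d + 1))
  have hcut := fun ε : ℝ => hsm.continuous
  have hG : SW (pt z a) d 0 (fun _ => 1) r s
      (fun (ε : 𝕀) X => ccut ((ε : ℝ) • X.2.2) * (φ X.2.2 * g X.2.1)) := by
    refine ((sym_cut_e smooth_ccut ccut_compact (pt z a) 0).mul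
      ((h.reindex fun _ : 𝕀 => ()).mul (sym_schwartz_w (pt z a) g 0 0))).congr_weight
      fun _ X _ => by simp [wgt]
  have hfast : ∀ ε : ℝ, 0 < ε → ε ≤ 1 →
      Fast z (fun X : Amp Z d => ccut (ε • X.2.2) * (φ X.2.2 * g X.2.1)) := by
    intro ε hε _
    have hsm2 : Smooth fun η : Conf d => ccut (ε • η) * φ η :=
      (smooth_ccut.comp (contDiff_const_smul ε)).mul hsm
    have hcs : HasCompactSupport fun η : Conf d => ccut (ε • η) * φ η :=
      (ccut_compact.comp_smul hε.ne').mul_right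
    have := fast_schwartz z g (hcs.toSchwartzMap hsm2)
    refine (funext fun X => ?_ : (fun X : Amp Z d => ccut (ε • X.2.2) * (φ X.2.2 * g X.2.1)) = _) ▸ this
    exact (mul_assoc _ _ _).symm
  have h1 := tendsto_osc (O := pt z a) (z := z) (M := M)
    (G := fun ε X => ccut (ε • X.2.2) * (φ X.2.2 * g X.2.1))
    ((smooth_ccut.comp (by fun_prop)).mul
      ((hsm.comp (by fun_prop)).mul ((g.smooth ⊤).comp (by fun_prop)))) hG
    (fun _ => zero_le_one) (le_of_eq rfl) hM rfl hfast
  have hi := integrable_hat_mul g hsm.continuous hb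
  have h2 := (tendsto_cutoff_integral hi (smooth_ccut (d := d)).continuous ccut_compact).const_mul
    (cd d)
  simp only [zero_smul, ccut_zero, one_mul] at h1 h2
  refine tendsto_nhds_unique h1 (h2.congr' ?_)
  filter_upwards [self_mem_nhdsWithin] with ε hε
  have hcs : HasCompactSupport fun η : Conf d => ccut (ε • η) * φ η :=
    (ccut_compact.comp_smul (ne_of_gt hε)).mul_right
  have hint : Integrable fun η : Conf d => ccut (ε • η) * φ η :=
    ((smooth_ccut.continuous.comp (continuous_const_smul ε)).mul
      hsm.continuous).integrable_of_hasCompactSupport hcs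
  have h3 := integral_ee_mul_prod g hint
  congr 1
  calc ∫ η, ccut (ε • η) * (hat g η * φ η) = ∫ η, hat g η * (ccut (ε • η) * φ η) := by
        congr 1; funext η; ring
    _ = _ := h3.symm
    _ = _ := by congr 1; funext q; ring

/-- The value at `x` of the magnetic Fourier integral operator applied to `u`. -/
def fioValue (A : Conf d → Conf d) (U : Fn d ℝ) (b : Fn d ℂ) (u : Sw d) (x : Conf d) : ℂ :=
  cd d * ∫ η, hat (magMul A x u) η * (eI (U x η) * b x η)

lemma norm_cexp_I (t : ℝ) : ‖eI t‖ = 1 := by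
  rw [Complex.norm_exp]; simp

lemma IsSymbol.continuous_slice (hb : IsSymbol m b) (x : Conf d) : Continuous (b x) :=
  hb.smooth.continuous.comp (by fun_prop : Continuous fun η : Conf d => (x, η))

lemma IsSymbol.norm_le (hb : IsSymbol m b) : ∃ C : ℝ, 0 ≤ C ∧ ∀ x η, ‖b x η‖ ≤ C * br η ^ m := by
  obtain ⟨C, hC, h⟩ := (hb.sym (T := Unit) 0).bound
  exact ⟨C, hC, fun x η => h () (x, η) trivial⟩

lemma IsGeneratingPhase.continuous_slice (hU : IsGeneratingPhase U)
    (x : Conf d) : Continuous (U x) :=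
  hU.smooth.continuous.comp (by fun_prop : Continuous fun η : Conf d => (x, η))

lemma integrable_fioValue (hU : IsGeneratingPhase U) (hb : IsSymbol m b) (g : Sw d) (x : Conf d) :
    Integrable fun η => hat g η * (eI (U x η) * b x η) := by
  obtain ⟨C, -, hC⟩ := hb.norm_le
  refine integrable_hat_mul g (C := C) (s := m) ?_ fun η => ?_
  · exact (Complex.continuous_exp.comp (continuous_const.mul
      (Complex.continuous_ofReal.comp (hU.continuous_slice x)))).mul (hb.continuous_slice x)
  · rw [norm_mul, norm_cexp_I, one_mul]; exact hC x η

lemma isOscillatingIntegral_fioValue (hA : HasTemperateGrowth A) (hU : IsGeneratingPhase U)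
    (hb : IsSymbol m b) (u : Sw d) (x : Conf d) :
    IsOscillatingIntegral A (fun x y η => U x η - inner ℝ y η) b u x (fioValue A U b u x) := by
  intro χ hχ hc hχ1
  have hχc : Continuous fun η => (χ η : ℂ) := Complex.continuous_ofReal.comp hχ.continuous
  have hcc : HasCompactSupport fun η => (χ η : ℂ) := hc.comp_left Complex.ofReal_zero
  have h := (tendsto_cutoff_integral (integrable_fioValue hU hb (magMul A x u) x) hχc
    hcc).const_mul (cd d)
  simp only [hχ1 0 (by simp), Complex.ofReal_one, one_mul] at h
  refine h.congr' ?_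
  filter_upwards [self_mem_nhdsWithin] with ε hε
  have hE : Continuous fun η => eI (U x η) := Complex.continuous_exp.comp (continuous_const.mul
      (Complex.continuous_ofReal.comp (hU.continuous_slice x)))
  have hint : Integrable fun η : Conf d =>
      (χ (ε • η) : ℂ) * (eI (U x η) * b x η) :=
    ((hχc.comp (continuous_const_smul ε)).mul
      (hE.mul (hb.continuous_slice x))).integrable_of_hasCompactSupport
      ((hcc.comp_smul (ne_of_gt hε)).mul_right)
  have h3 := Osc.integral_ee_mul_prod (magMul A x u) hint
  rw [regularizedIntegral, cd]
  congr 1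
  calc ∫ η, (χ (ε • η) : ℂ) * (hat (magMul A x u) η *
        (eI (U x η) * b x η)) =
      ∫ η, hat (magMul A x u) η * ((χ (ε • η) : ℂ) * (eI (U x η) * b x η)) := by
        congr 1; funext η; ring
    _ = _ := h3.symm
    _ = _ := by
      congr 1; funext p
      rw [magMul_apply hA, ee]
      have : eI (U x p.2 - inner ℝ p.1 p.2) = exp (-I * ((inner ℝ p.1 p.2 : ℝ) : ℂ)) *
            eI (U x p.2) := by
        rw [← Complex.exp_add]; congr 1; push_cast; ring
      rw [this]
      ring

def fioData (d c : ℕ) : OscData (Conf d) where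
  v := fun _ => 1
  one_le_v := fun _ => le_rfl
  g := fun _ _ => 1
  g_pos := fun _ _ => one_pos
  a := 1
  c := c
  D := Set.univ

lemma regular_fioData {c : ℕ} : (fioData d c).Regular := ⟨rfl, continuous_const, fun _ => continuous_const⟩

def xeM (d : ℕ) : Amp (Conf d) d →L[ℝ] Ph d := (fst ℝ _ _).prod (eM (Conf d) d)

@[simp] lemma xeM_apply (X : Amp (Conf d) d) : xeM d X = (X.1, X.2.2) := rfl

lemma xeM_zd (i : Fin d) : xeM d (Dirs.b (zd d (i : Dirs.ι (Conf d)))) =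
    Dirs.b (E := Ph d) (Sum.inl i) := by
  rw [b_inl, b_inl]; rfl

lemma xeM_wd (i : Fin d) : xeM d (Dirs.b (wd (Conf d) i)) = 0 := by
  rw [b_inr, b_inl]; rfl

lemma xeM_ed (i : Fin d) : xeM d (Dirs.b (ed (Conf d) i)) = Dirs.b (E := Ph d) (Sum.inr i) := by
  rw [b_inr, b_inr]; rfl

lemma IsSymbol.sym_amp {f : Fn d F} (hf : IsSymbol m f) (c k : ℕ) :
    SW (fioData d c) d k (fun _ => 1) 0 m (fun (_ : T) X => f X.1 X.2.2) := by
  have hbr : ∀ X : Amp (Conf d) d, 1 ≤ br X.2.1 * br X.2.2 := fun X =>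
    one_le_mul (one_le_br _) (one_le_br _)
  refine ((hf.sym k).compLin (S := (fioData d c).scale d) (fun _ : T => xeM d)
    (fun _ _ _ => trivial) (fun _ _ _ => (br_rpow_pos _ _).le) ?_).congr_weight
    fun _ X _ => by simp [wgt]
  have hw : ∀ (j : Dirs.ι (Ph d)) (X : Ph d), (symScale d).wt j X ≤ 1 := by
    rintro (j | j) X
    · exact le_rfl
    · exact inv_le_one_of_one_le₀ (one_le_br _)
  have key : ∀ (i : Dirs.ι (Amp (Conf d) d)) (j : Dirs.ι (Ph d)),
      (∀ X, 1 ≤ ((fioData d c).scale d).wt i X) →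
      ∃ K : ℝ, 0 ≤ K ∧ ∀ t : T, ∀ X ∈ ((fioData d c).scale d).dom,
      |co j (xeM d (Dirs.b i))| * (symScale d).wt j (xeM d X) ≤
        K * ((fioData d c).scale d).wt i X := fun i j h =>
    ⟨_, abs_nonneg _, fun t X _ => mul_le_mul_of_nonneg_left ((hw j _).trans (h X)) (abs_nonneg _)⟩
  rintro (i | i | i) j
  · exact Or.inl ⟨Nat.zero_le _, key _ j fun X => by
      change (1 : ℝ) ≤ 1 * (br X.2.1 * br X.2.2) ^ 1
      simpa using hbr X⟩
  · exact Or.inr fun t => by rw [xeM_wd, map_zero]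
  · exact Or.inl ⟨Nat.zero_le _, key _ j fun X => le_rfl⟩

lemma IsGeneratingPhase.sym_cexp (hU : IsGeneratingPhase U) (c k : ℕ) :
    Sym ((fioData d c).scale d) k (fun _ _ => 1)
      (fun (_ : T) X => eI (phaseRemainder U X.1 X.2.2)) := by
  have hs : Smooth (unc (phaseRemainder U)) := hU.remainder.smooth
  refine Sym.cexp (θ := fun (_ : T) (X : Amp (Conf d) d) => phaseRemainder U X.1 X.2.2)
    (fun _ => hs.comp (xeM d).contDiff) fun i n => ?_
  have hpd : ∀ i, pd i (fun X : Amp (Conf d) d => phaseRemainder U X.1 X.2.2) =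
      fun X => fderiv ℝ (unc (phaseRemainder U)) (xeM d X) (xeM d (Dirs.b i)) := fun i =>
    funext fun X => pd_comp_clm (xeM d) hs i X
  rcases i with i | i | i
  · have e : pd (zd d i) (fun X : Amp (Conf d) d => phaseRemainder U X.1 X.2.2) =
        fun X => dX i (phaseRemainder U) X.1 X.2.2 := by
      rw [hpd]; funext X; rw [xeM_zd]
      exact (congrFun (unc_dX hs i) (xeM d X)).symm
    rw [show (fun _ : T => pd (Sum.inl i) fun X : Amp (Conf d) d => phaseRemainder U X.1 X.2.2) =
      fun _ X => dX i (phaseRemainder U) X.1 X.2.2 from funext fun _ => e]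
    refine (((hU.remainder.dX_symbol i).sym_amp c k).mono_le fun _ X _ => ?_).bd n
    change wgt (fun _ => 1) 0 1 X ≤ 1 * (br X.2.1 * br X.2.2) ^ 1
    have := mul_le_mul_of_nonneg_right (one_le_br X.2.1) (br_pos X.2.2).le
    simpa [wgt] using this
  · rw [show (fun _ : T => pd (Sum.inr (Sum.inl i)) fun X : Amp (Conf d) d =>
      phaseRemainder U X.1 X.2.2) = fun _ _ => 0 from funext fun _ => by
        rw [hpd]; funext X; rw [xeM_wd, map_zero]]
    exact Bd.zero fun _ X _ => (((fioData d c).scale d).pos _ X).le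
  · have e : pd (ed (Conf d) i) (fun X : Amp (Conf d) d => phaseRemainder U X.1 X.2.2) =
        fun X => dXi i (phaseRemainder U) X.1 X.2.2 := by
      rw [hpd]; funext X; rw [xeM_ed]
      exact (congrFun (unc_dXi hs i) (xeM d X)).symm
    rw [show (fun _ : T => pd (Sum.inr (Sum.inr i)) fun X : Amp (Conf d) d =>
      phaseRemainder U X.1 X.2.2) = fun _ X => dXi i (phaseRemainder U) X.1 X.2.2 from
        funext fun _ => e]
    refine (((hU.remainder.dXi_symbol i).sym_amp c k).mono_le fun _ X _ => ?_).bd n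
    change wgt (fun _ => 1) 0 0 X ≤ 1
    simp [wgt]

def costScale (d : ℕ) : Scale (Ph d) where
  wt := fun _ _ => 1
  pos := fun _ _ => one_pos
  cost := fun _ => 1
  dom := Set.univ

/-- Test functions normalized with respect to finitely many seminorms. -/
abbrev Unitary (d : ℕ) (L k : ℕ) : Type :=
  {u : Sw d // (Finset.Iic (L, k)).sup (schwartzSeminormFamily ℂ (Conf d) ℂ) u ≤ 1}

def addM (d : ℕ) : Ph d →L[ℝ] Conf d := fst ℝ _ _ + snd ℝ _ _

lemma norm_addM_le : ‖addM d‖ ≤ 2 := by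
  refine (addM d).opNorm_le_bound zero_le_two fun Y => ?_
  calc ‖Y.1 + Y.2‖ ≤ ‖Y.1‖ + ‖Y.2‖ := norm_add_le _ _
    _ ≤ ‖Y‖ + ‖Y‖ := add_le_add (norm_fst_le Y) (norm_snd_le Y)
    _ = 2 * ‖Y‖ := by ring

lemma sym_unitary (L k : ℕ) : Sym (costScale d) k (fun _ X => br (X.1 + X.2) ^ (-(L : ℝ)))
    (fun (u : Unitary d L k) X => u.1 (X.1 + X.2)) := by
  have hsm : ∀ u : Unitary d L k, Smooth fun X : Ph d => u.1 (X.1 + X.2) :=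
    fun u => (u.1.smooth ⊤).comp (addM d).contDiff
  refine ⟨hsm, fun n => Bd.of_iteratedFDeriv (K := k) (fun _ _ => rfl) hsm
    (Or.inr ⟨fun _ => le_rfl, le_rfl⟩) fun m hm => ⟨2 ^ L * 2 ^ m, by positivity, fun u X _ => ?_⟩⟩
  have h := SchwartzMap.one_add_le_sup_seminorm_apply (𝕜 := ℂ) (m := (L, k)) le_rfl hm u.1
    (X.1 + X.2)
  have h1 : (1 + ‖X.1 + X.2‖) ^ L * ‖iteratedFDeriv ℝ m u.1 (X.1 + X.2)‖ ≤ 2 ^ L * 1 :=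
    h.trans (mul_le_mul_of_nonneg_left u.2 (by positivity))
  change ‖iteratedFDeriv ℝ m (u.1 ∘ addM d) X‖ ≤ _
  rw [(addM d).iteratedFDeriv_comp_right (u.1.smooth ⊤) X (mod_cast le_top)]
  refine (ContinuousMultilinearMap.norm_compContinuousLinearMap_le _ _).trans ?_
  have h2 : ∏ _i : Fin m, ‖addM d‖ ≤ 2 ^ m := by
    rw [Finset.prod_const, Finset.card_univ, Fintype.card_fin]
    exact pow_le_pow_left₀ (norm_nonneg _) norm_addM_le m
  have hb := br_pos (X.1 + X.2)
  have h3 : br (X.1 + X.2) ^ L * ‖iteratedFDeriv ℝ m u.1 (X.1 + X.2)‖ ≤ 2 ^ L := by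
    refine le_trans ?_ (h1.trans_eq (mul_one _))
    gcongr
    exact br_le_one_add _
  have h4 : ‖iteratedFDeriv ℝ m u.1 (X.1 + X.2)‖ ≤ 2 ^ L * br (X.1 + X.2) ^ (-(L : ℝ)) := by
    rw [Real.rpow_neg hb.le, Real.rpow_natCast, ← div_eq_mul_inv, le_div_iff₀ (by positivity),
      mul_comm]
    exact h3
  calc _ ≤ (2 ^ L * br (X.1 + X.2) ^ (-(L : ℝ))) * 2 ^ m := by
        gcongr
        exact h4
    _ = _ := by ring

lemma sym_magTranslate (hA : HasTemperateGrowth A) (k : ℕ) :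
    ∃ N : ℕ, Sym (costScale d) k (fun _ X => (1 + ‖X‖) ^ N)
      (fun (_ : T) X => magPhase A X.1 (X.1 + X.2)) := by
  have ht : HasTemperateGrowth (fun X : Ph d => magPhase A X.1 (X.1 + X.2)) :=
    HasTemperateGrowth.comp (g := fun X : Ph d => magPhase A X.1 X.2)
      (f := (fst ℝ (Conf d) (Conf d)).prod (addM d)) (temperate_magPhase hA)
      (ContinuousLinearMap.hasTemperateGrowth _)
  obtain ⟨N, C, hC, h⟩ := ht.norm_iteratedFDeriv_le_uniform k
  exact ⟨N, fun _ => ht.1, fun n => Bd.of_iteratedFDeriv (K := k) (fun _ _ => rfl) (fun _ => ht.1)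
    (Or.inr ⟨fun _ => le_rfl, le_rfl⟩) fun m hm => ⟨C, hC, fun _ X _ => h m hm X⟩⟩

lemma sym_magTest (hA : HasTemperateGrowth A) (k L : ℕ) :
    ∃ (L' : ℕ) (r : ℝ), SW (fioData d 1) d k (fun x => br x ^ (-(L : ℝ))) r 0
      (fun (u : Unitary d L' k) X => magPhase A X.1 (X.1 + X.2.1) * u.1 (X.1 + X.2.1)) := by
  obtain ⟨N, hN⟩ := sym_magTranslate (T := Unit) hA k
  refine ⟨L + N, N + (L + N), ?_⟩
  have h := (hN.reindex fun _ : Unitary d (L + N) k => ()).mul (sym_unitary (d := d) (L + N) k)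
  have h2 : Sym (costScale d) k (fun _ X => br X.1 ^ (-(L : ℝ)) * br X.2 ^ ((N : ℝ) + (L + N)))
      (fun (u : Unitary d (L + N) k) X =>
        magPhase A X.1 (X.1 + X.2) * u.1 (X.1 + X.2)) := by
    refine h.mono ⟨4 ^ N * 2 ^ (L + N), by positivity, fun u X _ => ?_⟩
    have h1 := br_add_rpow_le X.1 X.2 (-((L + N : ℕ) : ℝ))
    have b1 := one_le_br X.1
    have b2 := one_le_br X.2
    have b1' := br_pos X.1
    have b2' := br_pos X.2
    rw [abs_neg, Nat.abs_cast, Real.rpow_natCast 2] at h1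
    have h3 : (1 + ‖X‖) ^ N ≤ 4 ^ N * (br X.1 ^ (N : ℝ) * br X.2 ^ (N : ℝ)) := by
      rw [Real.rpow_natCast, Real.rpow_natCast, ← mul_pow, ← mul_pow]
      refine pow_le_pow_left₀ (by positivity) ?_ N
      have e1 : ‖X‖ ≤ ‖X.1‖ + ‖X.2‖ :=
        max_le (le_add_of_nonneg_right (norm_nonneg _)) (le_add_of_nonneg_left (norm_nonneg _))
      have e2 := norm_le_br X.1
      have e3 := norm_le_br X.2
      nlinarith
    have r1 : br X.1 ^ (-(L : ℝ)) = br X.1 ^ (N : ℝ) * br X.1 ^ (-((L + N : ℕ) : ℝ)) := by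
      rw [← Real.rpow_add b1']; congr 1; push_cast; ring
    have r2 : br X.2 ^ ((N : ℝ) + (L + N)) = br X.2 ^ (N : ℝ) * br X.2 ^ (((L + N : ℕ) : ℝ)) := by
      rw [← Real.rpow_add b2']; congr 1; push_cast; ring
    rw [r1, r2]
    calc _ ≤ (4 ^ N * (br X.1 ^ (N : ℝ) * br X.2 ^ (N : ℝ))) *
          (2 ^ (L + N) * br X.1 ^ (-((L + N : ℕ) : ℝ)) * br X.2 ^ ((L + N : ℕ) : ℝ)) := by
          gcongr
          exact (br_rpow_pos _ _).le
      _ = _ := by ring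
  refine (h2.compLin (S := (fioData d 1).scale d) (fun _ => (fst ℝ _ _).prod (wM (Conf d) d))
    (fun _ _ _ => trivial) (fun _ X _ => mul_nonneg (br_rpow_pos _ _).le
      (br_rpow_pos _ _).le) ?_).congr_weight fun _ X _ => by simp [wgt]
  have hbr : ∀ X : Amp (Conf d) d, 1 ≤ br X.2.1 * br X.2.2 := fun X =>
    one_le_mul (one_le_br _) (one_le_br _)
  rintro (i | i | i) j
  · refine Or.inl ⟨le_rfl, _, abs_nonneg _, fun t X _ => mul_le_mul_of_nonneg_left ?_ (abs_nonneg _)⟩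
    change (1 : ℝ) ≤ 1 * (br X.2.1 * br X.2.2) ^ 1
    simpa using hbr X
  · refine Or.inl ⟨le_rfl, _, abs_nonneg _, fun t X _ => mul_le_mul_of_nonneg_left ?_ (abs_nonneg _)⟩
    exact (fioData d 1).one_le_wt_w i X
  · refine Or.inr fun t => ?_
    rw [b_inr, b_inr]
    exact map_zero _

/-- The amplitude of a magnetic Fourier integral operator. -/
def fioAmp (A : Conf d → Conf d) (U : Fn d ℝ) (b : Fn d ℂ) (u : Sw d) (X : Amp (Conf d) d) : ℂ :=
  (eI (phaseRemainder U X.1 X.2.2) * b X.1 X.2.2) * (magPhase A X.1 (X.1 + X.2.1) * u (X.1 + X.2.1))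

lemma hat_translate (g : Sw d) (x η : Conf d) :
    hat (SchwartzMap.compSubConstCLM ℂ (-x) g) η = ee (x, -η) * hat g η := by
  rw [hat_apply, hat_apply, ← integral_const_mul]
  rw [← integral_add_right_eq_self (fun y => ee (x, -η) * (ee (y, η) * g y)) x]
  congr 1; funext y
  rw [SchwartzMap.compSubConstCLM_apply, sub_neg_eq_add, ← mul_assoc]
  congr 1
  rw [ee, ee, ee, ← Complex.exp_add]
  congr 1
  simp only [inner_add_left, inner_neg_right]
  push_cast
  ring

lemma osc_fioSlice (hU : IsGeneratingPhase U) (hb : IsSymbol m b)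
    (x : Conf d) : Osc PUnit.unit.{1} (fun X : Amp PUnit.{1} d =>
      eI (phaseRemainder U x X.2.2) * b x X.2.2) := by
  refine Osc.slice (z := x) (f := fun X : Amp (Conf d) d =>
    eI (phaseRemainder U X.1 X.2.2) * b X.1 X.2.2) ?_
  have h := ((hU.sym_cexp (T := Unit) 0 0).mul (hb.sym_amp 0 0)).congr_weight
    (ϖ₂ := fun _ => wgt (fun _ => 1) 0 m) fun _ X _ => one_mul _
  exact h.toOsc rfl (fun _ => zero_le_one) (Set.mem_univ x) ()

lemma fioValue_eq_osc (hA : HasTemperateGrowth A) (hU : IsGeneratingPhase U)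
    (hb : IsSymbol m b) (u : Sw d) (x : Conf d) :
    fioValue A U b u x = osc (fun q => fioAmp A U b u (x, q)) := by
  have h := (osc_fioSlice hU hb x).osc_schwartz (SchwartzMap.compSubConstCLM ℂ (-x) (magMul A x u))
    (φ := fun η => eI (phaseRemainder U x η) * b x η)
  have h2 : (fun q : Ph d => fioAmp A U b u (x, q)) = fun q =>
      (eI (phaseRemainder U x q.2) * b x q.2) *
        (SchwartzMap.compSubConstCLM ℂ (-x) (magMul A x u)) q.1 := by
    funext q
    rw [SchwartzMap.compSubConstCLM_apply, magMul_apply hA, fioAmp, sub_neg_eq_add, add_comm q.1]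
  rw [h2, h, fioValue]
  congr 2; funext η
  rw [hat_translate, ee]
  have : eI (U x η) = exp (-I * ((inner ℝ x (-η) : ℝ) : ℂ)) * eI (phaseRemainder U x η) := by
    rw [← Complex.exp_add, phaseRemainder, inner_neg_right]; congr 1; push_cast; ring
  simp only
  rw [this]
  ring

lemma fioValue_add (hU : IsGeneratingPhase U) (hb : IsSymbol m b) (u v : Sw d) (x : Conf d) :
    fioValue A U b (u + v) x = fioValue A U b u x + fioValue A U b v x := by
  have hadd : hat (magMul A x (u + v)) = hat (magMul A x u) + hat (magMul A x v) := by
    simp only [hat, magMul, map_add, FourierTransform.fourier_add]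
  rw [fioValue, hadd, fioValue, fioValue, ← mul_add, ← integral_add
    (integrable_fioValue hU hb _ x) (integrable_fioValue hU hb _ x)]
  congr 2; funext η
  rw [_root_.add_apply, add_mul]

lemma fioValue_smul (c : ℂ) (u : Sw d) (x : Conf d) :
    fioValue A U b (c • u) x = c * fioValue A U b u x := by
  have hsm : hat (magMul A x (c • u)) = c • hat (magMul A x u) := by
    simp only [hat, magMul, map_smul, FourierTransform.fourier_smul]
  rw [fioValue, hsm, fioValue, mul_left_comm c, ← integral_const_mul c]
  congr 2; funext η
  rw [_root_.smul_apply, smul_eq_mul, mul_assoc]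

/-- Normalization of a test function. -/
lemma exists_unitary {L k : ℕ} (u : Sw d) {c : ℝ}
    (hc : (Finset.Iic (L, k)).sup (schwartzSeminormFamily ℂ (Conf d) ℂ) u < c) :
    ∃ v : Unitary d L k, u = (c : ℂ) • v.1 := by
  have hc0 : 0 < c := (apply_nonneg _ u).trans_lt hc
  refine ⟨⟨(c : ℂ)⁻¹ • u, ?_⟩, ?_⟩
  · rw [map_smul_eq_mul, norm_inv, Complex.norm_real, Real.norm_of_nonneg hc0.le,
      inv_mul_le_iff₀ hc0, mul_one]
    exact hc.le
  · change u = (c : ℂ) • (c : ℂ)⁻¹ • u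
    rw [smul_inv_smul₀ (Complex.ofReal_ne_zero.2 hc0.ne')]

lemma bd_fioValue (hA : HasTemperateGrowth A) (hU : IsGeneratingPhase U)
    (hb : IsSymbol m b) (L n : ℕ) : ∃ L' k : ℕ,
      (∀ u : Unitary d L' k, ContDiff ℝ n (fioValue A U b u.1)) ∧
      Bd (fioData d 1).out n 0 (fun _ x => br x ^ (-(L : ℝ)))
        (fun u : Unitary d L' k => fioValue A U b u.1) := by
  obtain ⟨M, hM⟩ := exists_nat_two_mul m (-(d + 1))
  set k := (2 * (M + n * 1) + n) * 1 with hk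
  obtain ⟨L', r, hT⟩ := sym_magTest hA k L
  have hamp : SW (fioData d 1) d k (fun x => br x ^ (-(L : ℝ))) r m
      (fun (u : Unitary d L' k) X => fioAmp A U b u.1 X) := by
    refine (((hU.sym_cexp 1 k).mul (hb.sym_amp 1 k)).mul hT).congr_weight fun _ X _ => ?_
    simp only [wgt, Real.rpow_zero]
    ring
  have h0 : ∀ x : Conf d, 0 ≤ br x ^ (-(L : ℝ)) := fun x =>
    (br_rpow_pos _ _).le
  have hcont : Continuous fun x : Conf d => br x ^ (-(L : ℝ)) :=
    continuous_br.rpow_const fun x => Or.inl (br_pos _).ne'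
  obtain ⟨hsm, hbd⟩ := contDiff_bd_osc regular_fioData n hamp h0 hcont hM (le_of_eq hk.symm)
  have he : ∀ u : Unitary d L' k, (fun x => osc fun q => fioAmp A U b u.1 (x, q)) =
      fioValue A U b u.1 := fun u => funext fun x => (fioValue_eq_osc hA hU hb u.1 x).symm
  refine ⟨L', k, fun u => he u ▸ hsm u, ?_⟩
  have he2 : (fun (u : Unitary d L' k) x => osc fun q => fioAmp A U b u.1 (x, q)) =
      fun u => fioValue A U b u.1 := funext he
  rw [he2] at hbd
  exact hbd.congr_weight fun _ x _ => by simp [fioData]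

lemma fioValue_smul_fun (c : ℂ) (u : Sw d) : fioValue A U b (c • u) = c • fioValue A U b u :=
  funext fun x => fioValue_smul c u x

lemma contDiff_fioValue (hA : HasTemperateGrowth A) (hU : IsGeneratingPhase U)
    (hb : IsSymbol m b) (u : Sw d) : Smooth (fioValue A U b u) := by
  refine contDiff_infty.2 fun n => ?_
  obtain ⟨L', k, h, -⟩ := bd_fioValue hA hU hb 0 n
  obtain ⟨c, hc⟩ := exists_gt ((Finset.Iic (L', k)).sup (schwartzSeminormFamily ℂ (Conf d) ℂ) u)
  obtain ⟨v, rfl⟩ := exists_unitary u hc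
  rw [fioValue_smul_fun]
  exact (contDiff_const_smul (c : ℂ)).comp (h v)

lemma le_mul_of_forall_gt {y K q : ℝ} (hK : 0 < K) (h : ∀ c, q < c → y ≤ K * c) : y ≤ K * q := by
  refine le_of_forall_gt_imp_ge_of_dense fun e he => ?_
  have := h (e / K) (by rw [lt_div_iff₀ hK, mul_comm]; exact he)
  rwa [mul_div_cancel₀ _ hK.ne'] at this

lemma scaled_bound {L n : ℕ} {C c : ℝ} (hc : 0 ≤ c) {v : Sw d} {x : Conf d}
    (h : ‖iteratedFDeriv ℝ n (fioValue A U b v) x‖ ≤ C * br x ^ (-(L : ℝ)))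
    (hs : Smooth (fioValue A U b v)) :
    ‖x‖ ^ L * ‖iteratedFDeriv ℝ n (fioValue A U b ((c : ℂ) • v)) x‖ ≤ (C + 1) * c := by
  have hsm : ContDiffAt ℝ n (fioValue A U b v) x := (hs.of_le (mod_cast le_top)).contDiffAt
  have hx := br_pos x
  rw [fioValue_smul_fun, iteratedFDeriv_const_smul_apply hsm, norm_smul, Complex.norm_real,
    Real.norm_of_nonneg hc]
  rw [Real.rpow_neg hx.le, Real.rpow_natCast] at h
  have h2 : ‖x‖ ^ L ≤ br x ^ L := pow_le_pow_left₀ (norm_nonneg _) (norm_le_br x) L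
  have hp : 0 < br x ^ L := by positivity
  calc ‖x‖ ^ L * (c * ‖iteratedFDeriv ℝ n (fioValue A U b v) x‖)
      ≤ br x ^ L * (c * (C * (br x ^ L)⁻¹)) := by gcongr
    _ = C * c := by field_simp
    _ ≤ (C + 1) * c := by gcongr; linarith

lemma fio_bound (hA : HasTemperateGrowth A) (hU : IsGeneratingPhase U)
    (hb : IsSymbol m b) (L n : ℕ) : ∃ (s : Finset (ℕ × ℕ)) (C : ℝ), 0 ≤ C ∧
      ∀ (u : Sw d) x, ‖x‖ ^ L * ‖iteratedFDeriv ℝ n (fioValue A U b u) x‖ ≤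
        C * s.sup (schwartzSeminormFamily ℂ (Conf d) ℂ) u := by
  obtain ⟨L', k, -, h⟩ := bd_fioValue hA hU hb L n
  have hwt : ∀ i x, (fioData d 1).out.wt i x = 1 := fun i x => by simp [OscData.out, fioData]
  have hcost : ∀ i, (fioData d 1).out.cost i = 0 := fun _ => rfl
  have hs : ∀ u : Unitary d L' k, Smooth (fioValue A U b u.1) := fun u =>
    contDiff_fioValue hA hU hb u.1
  obtain ⟨C, hC, hb'⟩ := Bd.iteratedFDeriv_le hwt hs (fun i => (hcost i).trans_le zero_le_one) h
    (le_refl n) (Or.inr hcost)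
  have key : ∀ (u : Sw d) (x : Conf d) (c : ℝ),
      (Finset.Iic (L', k)).sup (schwartzSeminormFamily ℂ (Conf d) ℂ) u < c →
      ‖x‖ ^ L * ‖iteratedFDeriv ℝ n (fioValue A U b u) x‖ ≤ (C + 1) * c := by
    intro u x c hc
    have hc0 : 0 ≤ c := (apply_nonneg _ u).trans hc.le
    obtain ⟨v, hv⟩ := exists_unitary u hc
    rw [hv]
    exact scaled_bound hc0 (hb' v x trivial) (contDiff_fioValue hA hU hb v.1)
  exact ⟨Finset.Iic (L', k), C + 1, add_nonneg hC zero_le_one, fun u x =>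
    le_mul_of_forall_gt (add_pos_of_nonneg_of_pos hC one_pos) (key u x)⟩

/-- The magnetic Fourier integral operator as a continuous operator on the Schwartz space. -/
def fioOp (hA : HasTemperateGrowth A) (hU : IsGeneratingPhase U)
    (hb : IsSymbol m b) : Sw d →L[ℂ] Sw d :=
  SchwartzMap.mkCLM (fun u => fioValue A U b u) (fioValue_add hU hb)
    (fun c u x => fioValue_smul c u x) (contDiff_fioValue hA hU hb)
    (fun n => fio_bound hA hU hb n.1 n.2)

lemma isMagneticFIO_fioOp (hA : HasTemperateGrowth A) (hU : IsGeneratingPhase U)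
    (hb : IsSymbol m b) : IsMagneticFIO A U b (fioOp hA hU hb) :=
  fun u x => isOscillatingIntegral_fioValue hA hU hb u x

/-- The generating function of the identity. -/
def idPhase (d : ℕ) (x η : Conf d) : ℝ := inner ℝ x η

lemma isSymbol_zero (m : ℝ) : IsSymbol m (fun (_ _ : Conf d) => (0 : F)) :=
  Sym.isSymbol () (Sym.zero fun _ X _ => (Real.rpow_pos_of_pos (br_pos X.2) m).le)

lemma isGeneratingPhase_idPhase : IsGeneratingPhase (idPhase d) := by
  have hr : phaseRemainder (idPhase d) = fun _ _ => 0 := by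
    funext x η; simp [phaseRemainder, idPhase]
  have hX : ∀ j : Fin d, dX j (fun (_ _ : Conf d) => (0 : ℝ)) = fun _ _ => 0 := fun j => by
    funext x η; simp [dX]
  have hXi : ∀ j : Fin d, dXi j (fun (_ _ : Conf d) => (0 : ℝ)) = fun _ _ => 0 := fun j => by
    funext x η; simp [dXi]
  refine ⟨contDiff_fst.inner ℝ contDiff_snd, ?_, 0, le_rfl, zero_lt_one, fun x η => ?_⟩
  · rw [hr]
    exact ⟨contDiff_const, fun j => by rw [hX]; exact isSymbol_zero 1,
      fun j => by rw [hXi]; exact isSymbol_zero 0⟩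
  · rw [hr]
    have : mixedHessian (fun (_ _ : Conf d) => (0 : ℝ)) x η = 0 := by
      ext j k
      simp only [mixedHessian, hXi, hX, Matrix.of_apply, Matrix.zero_apply]
    rw [this, map_zero, norm_zero]

lemma isMagneticPsiDO_fioOp (hA : HasTemperateGrowth A) {a : Fn d ℂ} (ha : IsSymbol m a) :
    IsMagneticPsiDO A a (fioOp hA isGeneratingPhase_idPhase ha) := by
  intro u x
  have h := isOscillatingIntegral_fioValue hA isGeneratingPhase_idPhase ha u x
  have e : (fun x y η : Conf d => idPhase d x η - inner ℝ y η) = fun x y η => inner ℝ (x - y) η := by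
    funext x y η; rw [inner_sub_left, idPhase]
  rw [e] at h
  exact h

/-- Weights for amplitudes depending on `((x, ξ), p)`. -/
def stepData (d : ℕ) (θ : ℝ) (e a : ℕ) : OscData (Par d) where
  v := fun z => br z.2 ^ e
  one_le_v := fun z => one_le_pow₀ (one_le_br _)
  g := Sum.elim (Sum.elim (fun _ z => br z.2 ^ e)
    (fun _ z => br z.1.2 ^ (-θ) * br z.2 ^ e)) (fun _ z => br z.2 ^ e)
  g_pos := by
    have h : ∀ z : Par d, 0 < br z.2 ^ e := fun z => pow_pos (br_pos _) _
    rintro ((i | i) | i) z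
    · exact h z
    · exact mul_pos (br_rpow_pos _ _) (h z)
    · exact h z
  a := a
  c := 0
  D := Set.univ

lemma regular_stepData (θ : ℝ) (e a : ℕ) : (stepData d θ e a).Regular := by
  have h : Continuous fun z : Par d => br z.2 ^ e := (continuous_br.comp continuous_snd).pow e
  refine ⟨rfl, h, ?_⟩
  rintro ((i | i) | i)
  · exact h
  · exact ((continuous_br.comp (continuous_snd.comp continuous_fst)).rpow_const
      fun z => Or.inl (br_pos _).ne').mul h
  · exact h

lemma stepData_wt_mono {θ θ' : ℝ} {e e' a a' : ℕ} (hθ : θ' ≤ θ) (he : e ≤ e') (ha : a ≤ a')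
    (i : Dirs.ι (ParAmp d)) (X : ParAmp d) :
    ((stepData d θ e a).scale d).wt i X ≤ ((stepData d θ' e' a').scale d).wt i X := by
  have h1 : br X.1.2 ^ e ≤ br X.1.2 ^ e' := pow_le_pow_right₀ (one_le_br _) he
  have h2 : (br X.2.1 * br X.2.2) ^ a ≤ (br X.2.1 * br X.2.2) ^ a' :=
    pow_le_pow_right₀ (one_le_mul (one_le_br _) (one_le_br _)) ha
  have h3 : br X.2.1 ^ a ≤ br X.2.1 ^ a' := pow_le_pow_right₀ (one_le_br _) ha
  have h4 : br X.1.1.2 ^ (-θ) ≤ br X.1.1.2 ^ (-θ') := br_rpow_mono _ (by linarith)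
  have p1 := (pow_pos (br_pos X.1.2) e').le
  have p2 := (br_rpow_pos X.1.1.2 (-θ')).le
  have p3 := (pow_pos (mul_pos (br_pos X.2.1) (br_pos X.2.2)) a).le
  have p4 := (pow_pos (br_pos X.2.1) a).le
  have p5 := (pow_pos (br_pos X.1.2) e).le
  rcases i with ((i | i) | i) | i | i
  · exact mul_le_mul h1 h2 p3 p1
  · exact mul_le_mul (mul_le_mul h4 h1 p5 p2) h2 p3 (mul_nonneg p2 p1)
  · exact mul_le_mul h1 h2 p3 p1
  · exact mul_le_mul h1 h3 p4 p1
  · exact le_rfl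

lemma Sym.stepData_mono {θ θ' : ℝ} {e e' a a' k : ℕ} {ϖ : T → ParAmp d → ℝ} {f : T → ParAmp d → F}
    (hf : Sym ((stepData d θ e a).scale d) k ϖ f) (h0 : ∀ t X, 0 ≤ ϖ t X) (hθ : θ' ≤ θ)
    (he : e ≤ e') (ha : a ≤ a') : Sym ((stepData d θ' e' a').scale d) k ϖ f := by
  refine hf.rescale le_rfl ?_ le_rfl
    (fun i => ⟨1, zero_le_one, fun X _ => by rw [one_mul]; exact stepData_wt_mono hθ he ha i X⟩)
    (fun t X _ => h0 t X) ⟨1, zero_le_one, fun t X _ => by rw [one_mul]⟩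
  rintro (i | i | i) <;> exact le_rfl

lemma br_inv_add_le (ξ σ : Conf d) {t : ℝ} (h0 : 0 ≤ t) (h1 : t ≤ 1) :
    (br (ξ + t • σ))⁻¹ ≤ 2 * ((br ξ)⁻¹ * br σ) := by
  have h := br_add_le (ξ + t • σ) (-(t • σ))
  rw [br_neg, add_neg_cancel_right] at h
  have h2 := br_smul_le σ h0 h1
  have p1 := br_pos ξ
  have p2 := br_pos (ξ + t • σ)
  have p3 := br_pos σ
  have h3 : br ξ ≤ 2 * br (ξ + t • σ) * br σ :=
    h.trans (mul_le_mul_of_nonneg_left h2 (by positivity))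
  rw [inv_le_iff_one_le_mul₀ p2]
  have : 2 * ((br ξ)⁻¹ * br σ) * br (ξ + t • σ) =
      (2 * br (ξ + t • σ) * br σ) / br ξ := by field_simp
  rw [this, le_div_iff₀ p1]
  linarith

def yM (d : ℕ) (t : ℝ) : ParAmp d →L[ℝ] Ph d :=
  (((fst ℝ (Conf d) (Conf d)).comp (fst ℝ _ (Conf d)) +
    snd ℝ (Ph d) (Conf d)).comp (fst ℝ _ _)).prod
  (((snd ℝ (Conf d) (Conf d)).comp (fst ℝ _ (Conf d))).comp (fst ℝ _ _) + t • eM (Par d) d)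

@[simp] lemma yM_apply (t : ℝ) (X : ParAmp d) :
    yM d t X = (X.1.1.1 + X.1.2, X.1.1.2 + t • X.2.2) := rfl

lemma IsSymbol.sym_step {m : ℝ} {f : Fn d F} (hf : IsSymbol m f) {a : ℕ} (τ : T → 𝕀)
    (ha : 1 ≤ a ∨ ∀ t, (τ t : ℝ) = 0) (k : ℕ) :
    Sym ((stepData d 1 0 a).scale d) k (fun _ => wgt (fun z => br z.1.2 ^ m) 0 |m|)
      (fun t X => f (X.1.1.1 + X.1.2) (X.1.1.2 + (τ t : ℝ) • X.2.2)) := by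
  refine ((hf.sym k).compLin (S := (stepData d 1 0 a).scale d) (fun t => yM d (τ t))
    (fun _ _ _ => trivial) (fun _ _ _ => (br_rpow_pos _ _).le) ?_).mono
    ⟨2 ^ |m|, by positivity, fun t X _ => ?_⟩
  · have hbr : ∀ X : ParAmp d, 1 ≤ (br X.2.1 * br X.2.2) ^ a := fun X =>
      one_le_pow₀ (one_le_mul (one_le_br _) (one_le_br _))
    have hw1 : ∀ (j : Dirs.ι (Ph d)) (X : Ph d), (symScale d).wt j X ≤ 1 := by
      rintro (j | j) X
      · exact le_rfl
      · exact inv_le_one_of_one_le₀ (one_le_br _)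
    have key : ∀ i : Dirs.ι (ParAmp d),
        (∀ X, 1 ≤ ((stepData d 1 0 a).scale d).wt i X) → ∀ j, ∀ K : ℝ, 0 ≤ K →
        (∀ t, |co j (yM d (τ t) (Dirs.b i))| ≤ K) →
        (symScale d).cost j ≤ ((stepData d 1 0 a).scale d).cost i ∧
        ∃ K : ℝ, 0 ≤ K ∧ ∀ t, ∀ X ∈ ((stepData d 1 0 a).scale d).dom,
        |co j (yM d (τ t) (Dirs.b i))| * (symScale d).wt j (yM d (τ t) X) ≤
          K * ((stepData d 1 0 a).scale d).wt i X := fun i h j K hK hb =>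
      ⟨Nat.zero_le _, K, hK, fun t X _ => mul_le_mul (hb t)
        ((hw1 j _).trans (h X)) ((symScale d).pos _ _).le hK⟩
    rintro (((i | i) | i) | i | i) j
    · refine Or.inl (key _ (fun X => ?_) j _ (abs_nonneg (co j (yM d 0 (Dirs.b
        (Sum.inl (Sum.inl (Sum.inl i)) : Dirs.ι (ParAmp d)))))) fun t => le_of_eq ?_)
      · change (1 : ℝ) ≤ br X.1.2 ^ 0 * _
        rw [pow_zero, one_mul]; exact hbr X
      · simp
    · rcases j with j | j
      · right; intro t; simp
      · refine Or.inl ⟨Nat.zero_le _, 2 * |(single i (1 : ℝ) : Conf d) j|,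
          by positivity, fun t X _ => ?_⟩
        have e1 : (symScale d).wt (Sum.inr j) (yM d (τ t) X) ≤
            2 * ((stepData d 1 0 a).scale d).wt (Sum.inl (Sum.inl (Sum.inr i))) X := by
          change (br (X.1.1.2 + (τ t : ℝ) • X.2.2))⁻¹ ≤ 2 * (br X.1.1.2 ^ (-1 : ℝ) * br X.1.2 ^ 0 *
              (br X.2.1 * br X.2.2) ^ a)
          rw [Real.rpow_neg_one, pow_zero, mul_one]
          have p1 := inv_pos.2 (br_pos X.1.1.2)
          rcases ha with ha | ha
          · refine (br_inv_add_le _ _ (τ t).2.1 (τ t).2.2).trans ?_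
            have h1 : br X.2.2 ≤ br X.2.1 * br X.2.2 :=
              le_mul_of_one_le_left (br_pos _).le (one_le_br _)
            have h2 : br X.2.1 * br X.2.2 ≤ (br X.2.1 * br X.2.2) ^ a :=
              le_self_pow₀ (one_le_mul (one_le_br _) (one_le_br _)) (by omega)
            gcongr
            exact h1.trans h2
          · rw [ha t, zero_smul, add_zero]
            nlinarith [hbr X]
        rw [mul_right_comm]
        refine le_trans (le_of_eq ?_) (mul_le_mul_of_nonneg_right e1
          (abs_nonneg ((single i (1 : ℝ) : Conf d) j)))
        rw [mul_comm]
        simp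
    · refine Or.inl (key _ (fun X => ?_) j _ (abs_nonneg (co j (yM d 0 (Dirs.b
        (Sum.inl (Sum.inr i) : Dirs.ι (ParAmp d)))))) fun t => le_of_eq ?_)
      · change (1 : ℝ) ≤ br X.1.2 ^ 0 * _
        rw [pow_zero, one_mul]; exact hbr X
      · simp
    · right; intro t; simp [Prod.mk_zero_zero]
    · refine Or.inl (key _ (fun X => le_rfl) j |co j (yM d 1 (Dirs.b (Sum.inr (Sum.inr i) :
        Dirs.ι (ParAmp d))))| (abs_nonneg _) fun t => ?_)
      rcases j with j | j
      · simp
      · have h1 := (τ t).2.1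
        have h2 := (τ t).2.2
        by_cases hij : j = i <;> simp [hij, abs_of_nonneg h1, h2]
  · change br (X.1.1.2 + (τ t : ℝ) • X.2.2) ^ m ≤ _
    refine (br_add_rpow_le _ _ _).trans ?_
    have h1 : br ((τ t : ℝ) • X.2.2) ^ |m| ≤ br X.2.2 ^ |m| :=
      Real.rpow_le_rpow (br_pos _).le (br_smul_le _ (τ t).2.1 (τ t).2.2) (abs_nonneg _)
    have h2 := (br_rpow_pos X.1.1.2 m).le
    rw [wgt, Real.rpow_zero, mul_one, mul_assoc]
    gcongr

lemma segment_formula {f : Fn d ℝ} (hf : Smooth (unc f)) (x ξ σ : Conf d) :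
    f x (ξ + σ) - f x ξ = ∑ k, σ k * ∫ t in 0..1, dXi k f x (ξ + t • σ) := by
  have hs : Smooth (f x) := hf.comp (contDiff_const.prodMk contDiff_id)
  have hd : ∀ t : ℝ, HasDerivAt (fun t : ℝ => f x (ξ + t • σ))
      (∑ k, σ k * dXi k f x (ξ + t • σ)) t := fun t => by
    have h1 : HasDerivAt (fun t : ℝ => ξ + t • σ) σ t := by
      simpa using ((hasDerivAt_id t).smul_const σ).const_add ξ
    refine ((smooth_diffAt hs _).hasFDerivAt.comp_hasDerivAt t h1).congr_deriv ?_
    rw [fderiv_eq_sum_pd]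
    exact sum_congr rfl fun k _ => by simp [pd, dXi]
  have hc : ∀ k, Continuous fun t : ℝ => dXi k f x (ξ + t • σ) := fun k =>
    (smooth_dXi hf k).continuous.comp (by fun_prop : Continuous fun t : ℝ => (x, ξ + t • σ))
  have h2 := intervalIntegral.integral_eq_sub_of_hasDerivAt (a := 0) (b := 1) (fun t _ => hd t)
    (Continuous.intervalIntegrable (continuous_finsetSum _ fun k _ =>
      continuous_const.mul (hc k)) _ _)
  rw [one_smul, zero_smul, add_zero] at h2
  have h3 : ∀ k, Continuous fun t : ℝ => σ k * dXi k f x (ξ + t • σ) := fun k =>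
    continuous_const.mul (hc k)
  rw [← h2, intervalIntegral.integral_finsetSum fun k _ => (h3 k).intervalIntegrable _ _]
  exact sum_congr rfl fun k _ => intervalIntegral.integral_const_mul _ _

/-- The second order increment `φ(y, ξ + σ) - φ(y, ξ) - ⟨σ, ∇_ξ φ(y, ξ)⟩` at `y = x + p`. -/
def incr (φ : Fn d ℝ) (X : ParAmp d) : ℝ :=
  φ (X.1.1.1 + X.1.2) (X.1.1.2 + X.2.2) - φ (X.1.1.1 + X.1.2) X.1.1.2 -
    ∑ k, X.2.2 k * dXi k φ (X.1.1.1 + X.1.2) X.1.1.2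

lemma smooth_yM {f : Fn d F} (hf : Smooth (unc f)) : Smooth (fun q : ℝ × ParAmp d =>
      f (q.2.1.1.1 + q.2.1.2) (q.2.1.1.2 + q.1 • q.2.2.2)) :=
  hf.comp (by fun_prop : Smooth (fun q : ℝ × ParAmp d =>
    (q.2.1.1.1 + q.2.1.2, q.2.1.1.2 + q.1 • q.2.2.2)))

lemma smooth_yM_one {f : Fn d F} (hf : Smooth (unc f)) : Smooth (fun X : ParAmp d =>
      f (X.1.1.1 + X.1.2) (X.1.1.2 + X.2.2)) :=
  hf.comp (by fun_prop : Smooth (fun X : ParAmp d =>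
    (X.1.1.1 + X.1.2, X.1.1.2 + X.2.2)))

lemma smooth_yM_zero {f : Fn d F} (hf : Smooth (unc f)) : Smooth (fun X : ParAmp d =>
      f (X.1.1.1 + X.1.2) X.1.1.2) :=
  hf.comp (by fun_prop : Smooth (fun X : ParAmp d => (X.1.1.1 + X.1.2, X.1.1.2)))

lemma smooth_incr (hφ : Smooth (unc φ)) : Smooth (incr φ) :=
  ((smooth_yM_one hφ).sub (smooth_yM_zero hφ)).sub (ContDiff.sum fun k _ =>
    (eL (Par d) k).contDiff.mul (smooth_yM_zero (smooth_dXi hφ k)))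

lemma wgt_const {r s : ℝ} {Z : Type} (X : Amp Z d) :
    wgt (fun _ => 1) r s X = br X.2.1 ^ r * br X.2.2 ^ s := by rw [wgt, one_mul]

/-- The average `∫₀¹ ψ(y, ξ + tσ) dt` of a symbol. -/
lemma IsSymbol.sym_avg {ψ : Fn d ℝ} (hψ : IsSymbol m ψ) (k : ℕ) :
    Sym ((stepData d 1 0 1).scale d) k (fun _ => wgt (fun z => br z.1.2 ^ m) 0 |m|)
      (fun (_ : T) X => ∫ t in 0..1, ψ (X.1.1.1 + X.1.2) (X.1.1.2 + t • X.2.2)) := by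
  have h1 := smooth_yM hψ.smooth
  have h2 := hψ.sym_step (a := 1) (fun q : T × 𝕀 => q.2) (Or.inl le_rfl) k
  have h3 := Sym.integral (T := T) (ϖ := fun _ => wgt (fun z => br z.1.2 ^ m) 0 |m|)
    (f := fun _ t X => ψ (X.1.1.1 + X.1.2) (X.1.1.2 + t • X.2.2))
    (S := (stepData d 1 0 1).scale d) (k := k)
    (fun _ => h1)
  exact h3 h2

lemma sym_sum_coord {ψ : Fin d → Fn d ℝ} (hψ : ∀ k, IsSymbol m (ψ k))
    (K : ℕ) : SW (stepData d 1 0 1) d K (fun z => br z.1.2 ^ m) 0 (|m| + 1)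
      (fun (_ : T) X => ∑ k, X.2.2 k *
        ∫ t in 0..1, ψ k (X.1.1.1 + X.1.2) (X.1.1.2 + t • X.2.2)) := by
  refine Sym.sum _ (fun k _ => ((sym_e (stepData d 1 0 1) K k).mulR
    ((hψ k).sym_avg K)).congr_weight fun _ X _ => ?_)
    fun _ X _ => wgt_nonneg (fun z => (br_rpow_pos _ _).le) X
  rw [wgt, wgt, Real.rpow_add (br_pos _), Real.rpow_one]
  ring

lemma pd_yM {f : Fn d F} (hf : Smooth (unc f)) (j : Fin d) :
    pd (ed (Par d) j) (fun X : ParAmp d => f (X.1.1.1 + X.1.2) (X.1.1.2 + X.2.2)) =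
      (fun X => dXi j f (X.1.1.1 + X.1.2) (X.1.1.2 + X.2.2)) ∧
    pd (wd (Par d) j) (fun X : ParAmp d => f (X.1.1.1 + X.1.2) (X.1.1.2 + X.2.2)) = (fun _ => 0) ∧
    pd (ed (Par d) j) (fun X : ParAmp d => f (X.1.1.1 + X.1.2) X.1.1.2) = (fun _ => 0) ∧
    pd (wd (Par d) j) (fun X : ParAmp d => f (X.1.1.1 + X.1.2) X.1.1.2) = (fun _ => 0) := by
  have h1 : (fun X : ParAmp d => f (X.1.1.1 + X.1.2) (X.1.1.2 + X.2.2)) =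
      fun X => unc f (yM d 1 X) := by funext X; simp [unc]
  have h0 : (fun X : ParAmp d => f (X.1.1.1 + X.1.2) X.1.1.2) =
      fun X => unc f (yM d 0 X) := by funext X; simp [unc]
  rw [h1, h0]
  refine ⟨?_, ?_, ?_, ?_⟩ <;> funext X <;> rw [pd_comp_clm _ hf]
  · rw [show yM d 1 (Dirs.b (ed (Par d) j)) = Dirs.b (E := Ph d) (Sum.inr j) by simp]
    have := congrFun (unc_dXi hf j) (yM d 1 X)
    rw [pd] at this
    rw [← this]
    simp [unc]
  all_goals simp [Prod.mk_zero_zero]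

lemma pd_e_incr (hφ : Smooth (unc φ)) (j : Fin d) : pd (ed (Par d) j) (incr φ) = fun X : ParAmp d =>
      dXi j φ (X.1.1.1 + X.1.2) (X.1.1.2 + X.2.2) - dXi j φ (X.1.1.1 + X.1.2) X.1.1.2 := by
  have s1 := smooth_yM_one hφ
  have s0 := smooth_yM_zero hφ
  have s2 : ∀ k, Smooth (fun X : ParAmp d =>
      X.2.2 k * dXi k φ (X.1.1.1 + X.1.2) X.1.1.2) := fun k =>
    (eL (Par d) k).contDiff.mul (smooth_yM_zero (smooth_dXi hφ k))
  have e1 := pd_sub (s1.sub s0) (ContDiff.sum fun k (_ : k ∈ univ) => s2 k) (ed (Par d) j)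
  refine e1.trans ?_
  rw [pd_sub s1 s0, (pd_yM hφ j).1, (pd_yM hφ j).2.2.1, pd_sum _ fun k _ => s2 k]
  funext X
  have e2 : ∀ k, pd (ed (Par d) j) (fun X : ParAmp d =>
      X.2.2 k * dXi k φ (X.1.1.1 + X.1.2) X.1.1.2) X =
      (single j (1 : ℝ) : Conf d) k * dXi k φ (X.1.1.1 + X.1.2) X.1.1.2 := by
    intro k
    refine (congrFun (pd_bilin (ContinuousLinearMap.mul ℝ ℝ) (eL (Par d) k).contDiff
      (smooth_yM_zero (smooth_dXi hφ k)) (ed (Par d) j)) X).trans ?_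
    rw [(pd_yM (smooth_dXi hφ k) j).2.2.1, pd_linear]
    simp
  beta_reduce
  rw [sum_congr rfl fun k _ => e2 k]
  simp

lemma pd_w_incr (hφ : Smooth (unc φ)) (j : Fin d) : pd (wd (Par d) j) (incr φ) = fun _ => 0 := by
  have s1 := smooth_yM_one hφ
  have s0 := smooth_yM_zero hφ
  have s2 : ∀ k, Smooth (fun X : ParAmp d =>
      X.2.2 k * dXi k φ (X.1.1.1 + X.1.2) X.1.1.2) := fun k =>
    (eL (Par d) k).contDiff.mul (smooth_yM_zero (smooth_dXi hφ k))
  have e1 := pd_sub (s1.sub s0) (ContDiff.sum fun k (_ : k ∈ univ) => s2 k) (wd (Par d) j)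
  refine e1.trans ?_
  rw [pd_sub s1 s0, (pd_yM hφ j).2.1, (pd_yM hφ j).2.2.2, pd_sum _ fun k _ => s2 k]
  funext X
  have e2 : ∀ k, pd (wd (Par d) j) (fun X : ParAmp d =>
      X.2.2 k * dXi k φ (X.1.1.1 + X.1.2) X.1.1.2) X = 0 := by
    intro k
    refine (congrFun (pd_bilin (ContinuousLinearMap.mul ℝ ℝ) (eL (Par d) k).contDiff
      (smooth_yM_zero (smooth_dXi hφ k)) (wd (Par d) j)) X).trans ?_
    rw [(pd_yM (smooth_dXi hφ k) j).2.2.2, pd_linear]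
    simp
  beta_reduce
  rw [sum_congr rfl fun k _ => e2 k]
  simp

lemma sym_incr (hφ : Smooth (unc φ)) (h : ∀ j, IsSymbol 0 (dXi j φ)) (K : ℕ) :
    SW (stepData d 1 0 1) d K (fun _ => 1) 0 1 (fun _ : T => incr φ) := by
  have e : incr φ = fun X => ∑ k, X.2.2 k *
      (∫ t in 0..1, dXi k φ (X.1.1.1 + X.1.2) (X.1.1.2 + t • X.2.2)) -
      ∑ k, X.2.2 k * dXi k φ (X.1.1.1 + X.1.2) X.1.1.2 := by
    funext X
    rw [incr, segment_formula hφ]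
  rw [e]
  have h1 := sym_sum_coord (T := T) h K
  have h2 := Sym.sum univ (fun k _ => ((sym_e (T := T) (stepData d 1 0 1) K k).mulR
    ((h k).sym_step (a := 1) (fun _ : T => ⟨0, by simp⟩) (Or.inl le_rfl) K)).mono_le
    (ϖ₂ := fun _ => wgt (fun z => br z.1.2 ^ (0 : ℝ)) 0 (|(0 : ℝ)| + 1))
    fun _ X _ => by simp [wgt, mul_comm]) fun _ X _ => wgt_nonneg (fun z => (br_rpow_pos _ _).le) X
  refine (h1.sub (T := T) ?_).congr_weight fun _ X _ => by simp [wgt]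
  simpa using h2

lemma sym_pd_e_incr (hφ : Smooth (unc φ)) (h : ∀ j, IsSymbol 0 (dXi j φ)) (j : Fin d) (K : ℕ) :
    Sym ((stepData d 1 0 1).scale d) K (fun _ _ => 1) (fun _ : T => pd (ed (Par d) j) (incr φ)) ∧
    SW (stepData d 1 0 1) d K (fun z => br z.1.2 ^ (-1 : ℝ)) 0 2
      (fun _ : T => pd (ed (Par d) j) (incr φ)) := by
  rw [pd_e_incr hφ]
  constructor
  · have h1 := (h j).sym_step (a := 1) (fun _ : T => ⟨1, by simp⟩) (Or.inl le_rfl) K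
    have h2 := (h j).sym_step (a := 1) (fun _ : T => ⟨0, by simp⟩) (Or.inl le_rfl) K
    refine Sym.congr_weight (ϖ₁ := fun _ => wgt (fun z => br z.1.2 ^ (0 : ℝ)) 0 |0|) ?_
      fun _ X _ => by simp [wgt]
    simpa using h1.sub h2
  · have h3 : ∀ k, IsSymbol (-1) (dXi k (dXi j φ)) := fun k =>
      Sym.isSymbol () <| by
        rw [unc_dXi (h j).smooth]
        refine (((h j).sym (T := Unit) 0).pd (Sum.inr k) le_rfl).congr_weight fun _ X _ => ?_
        rw [Real.rpow_zero, one_mul, Real.rpow_neg_one]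
        rfl
    refine Sym.congr_weight (ϖ₁ := fun _ => wgt (fun z => br z.1.2 ^ (-1 : ℝ)) 0 (|-1| + 1)) ?_
      fun _ X _ => by norm_num
    have h4 := sym_sum_coord (T := T) h3 K
    have e : ∀ X : ParAmp d, dXi j φ (X.1.1.1 + X.1.2) (X.1.1.2 + X.2.2) -
        dXi j φ (X.1.1.1 + X.1.2) X.1.1.2 = ∑ k, X.2.2 k *
        ∫ t in 0..1, dXi k (dXi j φ) (X.1.1.1 + X.1.2) (X.1.1.2 + t • X.2.2) := fun X =>
      segment_formula (smooth_dXi hφ j) _ _ _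
    simpa only [e] using h4

lemma sym_cexp_incr (hφ : Smooth (unc φ)) (h : ∀ j, IsSymbol 0 (dXi j φ)) (K : ℕ) :
    Sym ((stepData d 1 0 2).scale d) K (fun _ _ => 1) (fun (_ : T) X => eI (incr φ X)) := by
  refine Sym.cexp (θ := fun (_ : T) => incr φ) (fun _ => smooth_incr hφ) fun i n => ?_
  rcases i with i | i | i
  · refine ((((sym_incr hφ h K).pd (Sum.inl i) (Nat.zero_le _)).bd n).rescale
      (S₂ := (stepData d 1 0 2).scale d) le_rfl ?_ le_rfl
      (fun i => ⟨1, zero_le_one, fun X _ => by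
        rw [one_mul]; exact stepData_wt_mono le_rfl le_rfl one_le_two i X⟩)
      (fun t X _ => (Scale.pos _ _ _).le) ⟨1, zero_le_one, fun _ X _ => ?_⟩)
    · rintro (i | i | i) <;> exact le_rfl
    · rw [one_mul, wgt_const, Real.rpow_zero, one_mul, Real.rpow_one]
      refine (mul_comm _ _).trans_le ?_
      refine le_trans (b := ((stepData d 1 0 1).g i X.1) * (br X.2.1 * br X.2.2) ^ 1 *
        (br X.2.1 * br X.2.2)) ?_ (le_of_eq ?_)
      · exact mul_le_mul_of_nonneg_left (le_mul_of_one_le_left (br_pos _).le (one_le_br _))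
          (Scale.pos ((stepData d 1 0 1).scale d) (Sum.inl i) X).le
      · rw [pow_one, mul_assoc, ← sq]
        rfl
  · rw [show (fun _ : T => pd (Sum.inr (Sum.inl i)) (incr φ)) = fun _ _ => 0 from
      funext fun _ => pd_w_incr hφ i]
    exact Bd.zero fun _ _ _ => (Scale.pos _ _ _).le
  · exact (((sym_pd_e_incr (T := T) hφ h i K).1.stepData_mono (fun _ _ => zero_le_one) le_rfl le_rfl
      one_le_two).bd n)

/-- The Taylor remainder inherits the bounds of the `η`-derivatives. -/
lemma Sym.tay_of_pd {f : T → Amp Z d → ℂ} (hf : ∀ t, Smooth (f t))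
    (h : ∀ j, SW O d k ϖ₀ r s (fun t => pD (ed Z j) (f t)))
    (h0 : ∀ z, 0 ≤ ϖ₀ z) (hs : 0 ≤ s) (hk : O.c ≤ k) :
    SW O d (k - O.c) (fun z => ϖ₀ z * O.v z) (r + O.a) s (fun t => MagneticFIO.tay (f t)) := by
  have h1 : ∀ j, Sym (O.fine (fun _ => 1) (fun _ => one_pos) 0 d) k
      (fun _ => wgt ϖ₀ r s) (fun t => pD (ed Z j) (f t)) := by
    intro j
    refine (h j).rescale le_rfl ?_ le_rfl ?_ (fun _ X _ => wgt_nonneg h0 X)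
      ⟨1, zero_le_one, fun t X _ => by rw [one_mul]⟩
    · rintro (i | i | i) <;> exact le_rfl
    · rintro (i | i | i) <;> refine ⟨1, zero_le_one, fun X hX => ?_⟩ <;> rw [one_mul]
      · exact le_rfl
      · exact le_rfl
      · simp [OscData.fine, OscData.scale]
  have h2 : ∀ j, Sym (O.fine (fun _ => 1) (fun _ => one_pos) 0 d) k
      (fun _ => wgt ϖ₀ r s) (fun t => MagneticFIO.avgE j (f t)) := by
    intro j
    have h3 := (h1 j).comp_scaleE (fun X _ => wgt_nonneg h0 X) (fun X t ht => wgt_scaleE h0 hs X ht)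
    have h4 := Sym.integral (T := T) (ϖ := fun _ => wgt ϖ₀ r s)
      (f := fun t τ X => pD (ed Z j) (f t) (scaleE Z d τ X))
      (S := O.fine (fun _ => 1) (fun _ => one_pos) 0 d) (k := k)
      (fun t => smooth_avgE_aux (hf t) j)
    exact h4 h3
  have h3 : ∀ j, SW O d k ϖ₀ r s (fun t => MagneticFIO.avgE j (f t)) :=
    fun j => (h2 j).coarse fun _ X _ => wgt_nonneg h0 X
  refine Sym.sum univ (fun j _ => ?_) fun _ X _ => wgt_nonneg
    (fun z => mul_nonneg (h0 z) (zero_le_one.trans (O.one_le_v z))) X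
  refine (((h3 j).pd (wd Z j) hk).constMul (-I)).congr_weight fun _ X _ => ?_
  rw [OscData.wt_w, wgt, wgt, Real.rpow_add_natCast (br_pos _).ne']
  ring

lemma Osc.osc_of_indep_w {z : Z} {f : Amp Z d → ℂ} (hf : Osc z f)
    (h : ∀ w η, f (z, (w, η)) = f (z, (0, η))) : osc (fun q => f (z, q)) = f (z, 0) := by
  have hs := hf.smooth
  have h1 : ∀ j w η, pd (ed Z j) f (z, (w, η)) = pd (ed Z j) f (z, (0, η)) := by
    intro j w η
    rw [← pd_e_slice hs, ← pd_e_slice hs,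
      show (fun q => f (z, q)) = fun q : Ph d => f (z, (0, q.2)) from funext fun q => h q.1 q.2]
    have hc : Smooth fun η : Conf d => f (z, (0, η)) := hs.comp (by fun_prop)
    have h2 : ∀ q : Ph d, HasFDerivAt (fun q : Ph d => f (z, (0, q.2)))
        ((fderiv ℝ (fun η => f (z, (0, η))) q.2).comp (snd ℝ _ _)) q := fun q =>
      (smooth_diffAt hc q.2).hasFDerivAt.comp q hasFDerivAt_snd
    rw [(h2 _).fderiv, (h2 _).fderiv]
  have h3 : ∀ j q, pd (wd Z j) (MagneticFIO.avgE j f) (z, q) = 0 := by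
    intro j q
    have hc := smooth_avgE hs j
    rw [← pd_w_slice hc, show (fun q => MagneticFIO.avgE j f (z, q)) =
      fun q : Ph d => MagneticFIO.avgE j f (z, (0, q.2)) from funext fun q => by
        simp only [MagneticFIO.avgE, scaleE_apply, h1 j q.1]]
    exact fderiv_snd_comp (c := fun η : Conf d => MagneticFIO.avgE j f (z, (0, η)))
      (hc.comp (by fun_prop)) q _
  rw [hf.osc_eq_add_tay]
  have h4 : ∀ q, MagneticFIO.tay f (z, q) = 0 := fun q => by
    simp only [MagneticFIO.tay, h3, mul_zero, Finset.sum_const_zero]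
  have h5 : Osc z (fun _ : Amp Z d => (0 : ℂ)) := Osc.const 0
  simp only [h4]
  rw [h5.osc_of_indep fun _ _ => rfl, add_zero]

/-- Functions of the amplitude variables with slowly varying derivatives, independent of `σ`. -/
structure Slow (c : ParAmp d → ℝ) : Prop where
  smooth : Smooth c
  bd : ∀ i k, Sym ((stepData d 1 0 0).scale d) k
    (fun _ X => ((stepData d 1 0 0).scale d).wt i X) (fun _ : Unit => pd i c)
  ed_eq : ∀ j, pd (ed (Par d) j) c = fun _ => 0

lemma Slow.add {c c' : ParAmp d → ℝ} (h : Slow c) (h' : Slow c') : Slow (fun X => c X + c' X) := by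
  refine ⟨h.smooth.add h'.smooth, fun i k => ?_, fun j => ?_⟩
  · rw [pd_add h.smooth h'.smooth]
    exact (h.bd i k).add (h'.bd i k)
  · rw [pd_add h.smooth h'.smooth, h.ed_eq, h'.ed_eq]
    simp

lemma slow_linear (L : ParAmp d →L[ℝ] ℝ)
    (h1 : ∀ i : Fin d, L (Dirs.b (Sum.inl (Sum.inl (Sum.inr i)) : Dirs.ι (ParAmp d))) = 0)
    (h2 : ∀ i : Fin d, L (Dirs.b (ed (Par d) i)) = 0) : Slow (fun X => L X) := by
  refine ⟨L.contDiff, fun i k => ?_, fun j => ?_⟩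
  · rw [pd_linear]
    refine Sym.const _ ⟨|L (Dirs.b i)|, abs_nonneg _, fun _ X _ => ?_⟩
      (fun _ X _ => (Scale.pos _ _ _).le)
    rcases i with ((i | i) | i) | i | i
    · simp [stepData, OscData.scale]
    · rw [show L (Dirs.b (Sum.inl (Sum.inl (Sum.inr i)) : Dirs.ι (ParAmp d))) = 0 from h1 i]
      simp
    · simp [stepData, OscData.scale]
    · simp [stepData, OscData.scale]
    · simp [stepData, OscData.scale]
  · rw [pd_linear, h2]

lemma slow_symbol {ψ : Fn d ℝ} (hψ : IsSymbol 0 ψ) :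
    Slow (fun X => ψ (X.1.1.1 + X.1.2) X.1.1.2) := by
  refine ⟨smooth_yM_zero hψ.smooth, fun i k => ?_, fun j => (pd_yM hψ.smooth j).2.2.1⟩
  have h := (hψ.sym_step (a := 0) (fun _ : Unit => ⟨0, by simp⟩) (Or.inr fun _ => rfl) k).pd i
    (by rcases i with i | i | i <;> exact Nat.zero_le _)
  refine ((by simpa using h : Sym _ _ _ (fun _ : Unit => pd i (fun X : ParAmp d =>
    ψ (X.1.1.1 + X.1.2) X.1.1.2))).mono_k ?_).congr_weight fun _ X _ => by simp [wgt]
  rcases i with i | i | i <;> exact le_rfl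

/-- The arguments `(x, (p, p + q + ∇_ξ φ(x + p, ξ)))` of the magnetic flux. -/
def fluxArg (φ : Fn d ℝ) (X : ParAmp d) : Conf d × (Ph d) :=
  (X.1.1.1, (X.1.2, X.1.2 + X.2.1 + gradXi φ (X.1.1.1 + X.1.2) X.1.1.2))

lemma slow_x (j : Fin d) : Slow (fun X : ParAmp d => X.1.1.1 j) :=
  slow_linear ((proj j).comp ((fst ℝ _ _).comp ((fst ℝ _ _).comp (fst ℝ _ _))))
    (fun i => by simp) (fun i => by simp)

lemma slow_p (j : Fin d) : Slow (fun X : ParAmp d => X.1.2 j) :=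
  slow_linear ((proj j).comp ((snd ℝ _ _).comp (fst ℝ _ _))) (fun i => by simp) (fun i => by simp)

lemma slow_q (j : Fin d) : Slow (fun X : ParAmp d => X.2.1 j) :=
  slow_linear (wL (Par d) j) (fun i => by simp) (fun i => by simp)

lemma slow_fluxArg (hφ : IsSymbolPlus φ) (j : Dirs.ι (Conf d × (Ph d))) :
    Slow (fun X => co j (fluxArg φ X)) := by
  rcases j with j | j | j
  · simpa [fluxArg] using slow_x j
  · refine cast (congrArg Slow ?_) (slow_p j)
    funext X
    exact ((co_inr (E := Conf d) (F := Ph d) _ (fluxArg φ X)).trans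
      ((co_inl _ _).trans (co_conf j _))).symm
  · refine cast (congrArg Slow ?_) (((slow_p j).add (slow_q j)).add (slow_symbol (hφ.dXi_symbol j)))
    funext X
    exact ((co_inr (E := Conf d) (F := Ph d) _ (fluxArg φ X)).trans
      ((co_inr (E := Conf d) (F := Conf d) _ _).trans (co_conf j _))).symm

lemma smooth_fluxArg (hφ : IsSymbolPlus φ) : Smooth (fluxArg φ) := by
  have h : Smooth (fun X : ParAmp d => gradXi φ (X.1.1.1 + X.1.2) X.1.1.2) :=
    contDiff_euclidean.2 fun j => smooth_yM_zero (smooth_dXi hφ.smooth j)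
  unfold fluxArg
  fun_prop

lemma norm_le_sum_coord (v : Conf d) : ‖v‖ ≤ ∑ j, |v j| := by
  conv_lhs => rw [← sum_co v]
  refine (norm_sum_le _ _).trans (sum_le_sum fun j _ => ?_)
  rw [norm_smul]
  simp

lemma exists_br_gradXi_le (hφ : IsSymbolPlus φ) :
    ∃ C : ℝ, 1 ≤ C ∧ ∀ y ξ, br (gradXi φ y ξ) ≤ C := by
  choose C hC using fun j => (hφ.dXi_symbol j).bounded [] []
  have h : ∀ y ξ, br (gradXi φ y ξ) ≤ 1 + ∑ j, C j := fun y ξ =>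
    (br_le_one_add _).trans (add_le_add le_rfl ((norm_le_sum_coord _).trans
      (sum_le_sum fun j _ => by simpa [gradXi, mixedPartial] using hC j y ξ)))
  exact ⟨_, (one_le_br _).trans (h 0 0), h⟩

lemma exists_br_fluxArg_le (hφ : IsSymbolPlus φ) : ∃ C : ℝ, 0 ≤ C ∧ ∀ X : ParAmp d,
    br (fluxArg φ X).2.1 * br (fluxArg φ X).2.2 ≤ C * (br X.1.2 ^ 2 * br X.2.1) := by
  obtain ⟨C, hC, h⟩ := exists_br_gradXi_le hφ
  refine ⟨4 * C, by linarith, fun X => ?_⟩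
  have h1 := br_add_le (X.1.2 + X.2.1) (gradXi φ (X.1.1.1 + X.1.2) X.1.1.2)
  have h2 := br_add_le X.1.2 X.2.1
  have h3 := h (X.1.1.1 + X.1.2) X.1.1.2
  have p1 := br_pos X.1.2
  have p2 := br_pos X.2.1
  have p3 := br_pos (X.1.2 + X.2.1)
  have p4 := br_pos (gradXi φ (X.1.1.1 + X.1.2) X.1.1.2)
  have h4 : br (X.1.2 + X.2.1 + gradXi φ (X.1.1.1 + X.1.2) X.1.1.2) ≤
      2 * (2 * br X.1.2 * br X.2.1) * C := h1.trans (by gcongr)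
  calc _ ≤ br X.1.2 * (2 * (2 * br X.1.2 * br X.2.1) * C) :=
        mul_le_mul_of_nonneg_left h4 p1.le
    _ = _ := by ring

/-- The scale `stepData 1 2 1` dominates `stepData 1 0 0` by the factor `⟨p⟩²⟨q⟩`, except in the
directions of `σ`. -/
lemma wt_mul_le (i : Dirs.ι (ParAmp d)) (hi : ∀ j, i ≠ ed (Par d) j) (X : ParAmp d) :
    ((stepData d 1 0 0).scale d).wt i X * (br X.1.2 ^ 2 * br X.2.1) ≤
      ((stepData d 1 2 1).scale d).wt i X := by
  have p1 := br_pos X.1.2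
  have p2 := br_pos X.2.1
  have h1 : br X.2.1 ≤ (br X.2.1 * br X.2.2) ^ 1 := by
    rw [pow_one]; exact le_mul_of_one_le_right p2.le (one_le_br _)
  have p3 := br_rpow_pos X.1.1.2 (-1)
  rcases i with ((i | i) | i) | i | i
  · change br X.1.2 ^ 0 * (br X.2.1 * br X.2.2) ^ 0 * _ ≤ br X.1.2 ^ 2 * _
    simp only [pow_zero, one_mul]
    gcongr
    exact h1
  · change br X.1.1.2 ^ (-1 : ℝ) * br X.1.2 ^ 0 * (br X.2.1 * br X.2.2) ^ 0 * _
      ≤ br X.1.1.2 ^ (-1 : ℝ) * br X.1.2 ^ 2 * _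
    simp only [pow_zero, mul_one]
    rw [mul_assoc]
    gcongr
    exact h1
  · change br X.1.2 ^ 0 * (br X.2.1 * br X.2.2) ^ 0 * _ ≤ br X.1.2 ^ 2 * _
    simp only [pow_zero, one_mul]
    gcongr
    exact h1
  · change br X.1.2 ^ 0 * br X.2.1 ^ 0 * _ ≤ br X.1.2 ^ 2 * br X.2.1 ^ 1
    simp
  · exact absurd rfl (hi i)

lemma sym_fluxAmp (hB : IsMagneticField B)
    (hφ : IsSymbolPlus φ) (k : ℕ) : Sym ((stepData d 1 2 1).scale d) k (fun _ _ => 1)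
      (fun (_ : T) X => fluxPhase B (fluxArg φ X)) := by
  obtain ⟨C, hC, hb⟩ := exists_br_fluxArg_le hφ
  refine (sym_fluxPhase hB (T := T) k).comp (χ := fun _ => fluxArg φ)
    (fun _ => smooth_fluxArg hφ) (fun _ _ _ => trivial) (fun _ _ => Or.inl (Nat.zero_le _))
    (fun _ _ _ => zero_le_one) fun i j n => ?_
  have hp : ∀ X, 0 < br (fluxArg φ X).2.1 * br (fluxArg φ X).2.2 := fun X =>
    mul_pos (br_pos _) (br_pos _)
  have hpos : ∀ X, 0 ≤ ((stepData d 1 2 1).scale d).wt i X / (fluxScale d).wt j (fluxArg φ X) :=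
    fun X => div_nonneg (Scale.pos _ _ _).le (Scale.pos _ _ _).le
  by_cases hi : ∃ l, i = ed (Par d) l
  · obtain ⟨l, rfl⟩ := hi
    rw [show (fun _ : T => pd (ed (Par d) l) fun X => co j (fluxArg φ X)) = fun _ _ => 0 from
      funext fun _ => (slow_fluxArg hφ j).ed_eq l]
    exact Bd.zero fun _ X _ => hpos X
  · refine ((((slow_fluxArg hφ j).bd i k).bd n).reindex (fun _ : T => ())).rescale
      (S₂ := (stepData d 1 2 1).scale d) le_rfl ?_ le_rfl (fun l => ⟨1, zero_le_one, fun X _ => by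
        rw [one_mul]; exact stepData_wt_mono le_rfl (by norm_num) (by norm_num) l X⟩)
      (fun _ X _ => hpos X) ⟨C, hC, fun _ X _ => ?_⟩
    · rintro (l | l | l) <;> exact le_rfl
    · change _ ≤ C * (_ / (br (fluxArg φ X).2.1 * br (fluxArg φ X).2.2))
      rw [← mul_div_assoc, le_div_iff₀ (hp X)]
      have h1 := wt_mul_le i (fun l hl => hi ⟨l, hl⟩) X
      have h2 := (Scale.pos ((stepData d 1 0 0).scale d) i X).le
      calc _ ≤ ((stepData d 1 0 0).scale d).wt i X * (C * (br X.1.2 ^ 2 * br X.2.1)) :=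
            mul_le_mul_of_nonneg_left (hb X) h2
        _ = C * (((stepData d 1 0 0).scale d).wt i X * (br X.1.2 ^ 2 * br X.2.1)) := by
            ring
        _ ≤ _ := mul_le_mul_of_nonneg_left h1 hC

lemma pd_e_fluxAmp (hB : IsMagneticField B) (hφ : IsSymbolPlus φ) (j : Fin d) :
    pd (ed (Par d) j) (fun X => fluxPhase B (fluxArg φ X)) = fun _ => 0 := by
  rw [pd_comp ((sym_fluxPhase hB (T := Unit) 0).smooth ()) (smooth_fluxArg hφ)]
  funext X
  refine sum_eq_zero fun l _ => ?_
  rw [(slow_fluxArg hφ l).ed_eq j, zero_smul]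

lemma pd_cexp {θ : E → ℝ} (hθ : Smooth θ) (i : Dirs.ι E) : pd i (fun X => eI (θ X)) =
      fun X => I * ((pd i θ X : ℝ) : ℂ) * eI (θ X) := by
  funext X
  have h1 : HasFDerivAt (fun X => I * (θ X : ℂ)) (I • (Complex.ofRealCLM.comp (fderiv ℝ θ X))) X :=
    ((Complex.ofRealCLM.hasFDerivAt.comp X (smooth_diffAt hθ X).hasFDerivAt)).const_mul _
  simp only [pd]
  rw [h1.cexp.fderiv]
  simp only [smul_eq_mul, _root_.smul_apply, ContinuousLinearMap.comp_apply,
    Complex.ofRealCLM_apply]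
  ring

lemma IsSymbol.dXi {m : ℝ} {f : Fn d F} (hf : IsSymbol m f) (j : Fin d) :
    IsSymbol (m - 1) (dXi j f) := by
  refine Sym.isSymbol () ?_
  rw [unc_dXi hf.smooth]
  refine ((hf.sym (T := Unit) 0).pd (Sum.inr j) le_rfl).congr_weight fun _ X _ => ?_
  rw [Real.rpow_sub_one (br_pos _).ne']
  rfl

/-- The amplitude `Ω(x, p, p + q + ∇_ξ φ) e^{ir} b(x + p, ξ + σ)`. -/
def stepAmp (B : Fld d) (φ : Fn d ℝ) (b : Fn d ℂ) (X : ParAmp d) : ℂ := fluxPhase B (fluxArg φ X) *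
    (eI (incr φ X) * b (X.1.1.1 + X.1.2) (X.1.1.2 + X.2.2))

lemma lam_nonneg (m : ℝ) (z : Par d) : 0 ≤ br z.1.2 ^ m := (br_rpow_pos _ _).le

lemma IsSymbol.sym_step_one (hb : IsSymbol m b) (k : ℕ) :
    Sym ((stepData d 1 0 2).scale d) k (fun _ => wgt (fun z => br z.1.2 ^ m) 0 |m|)
      (fun (_ : T) X => b (X.1.1.1 + X.1.2) (X.1.1.2 + X.2.2)) := by
  have h := hb.sym_step (a := 2) (fun _ : T => ⟨1, by simp⟩) (Or.inl one_le_two) k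
  simpa using h

lemma sym_stepInner (hφ : IsSymbolPlus φ) (hb : IsSymbol m b) (k : ℕ) :
    Sym ((stepData d 1 0 2).scale d) k (fun _ => wgt (fun z => br z.1.2 ^ m) 0 |m|)
      (fun (_ : T) X => eI (incr φ X) * b (X.1.1.1 + X.1.2) (X.1.1.2 + X.2.2)) :=
  ((sym_cexp_incr hφ.smooth hφ.dXi_symbol k).mul (hb.sym_step_one k)).congr_weight
    fun _ _ _ => one_mul _

lemma sym_pd_stepInner (hφ : IsSymbolPlus φ) (hb : IsSymbol m b) (j : Fin d) (k : ℕ) :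
    SW (stepData d 1 0 2) d k (fun z => br z.1.2 ^ (m - 1)) 0 (|m| + 2)
      (fun (_ : T) => pd (ed (Par d) j) (fun X => eI (incr φ X) *
        b (X.1.1.1 + X.1.2) (X.1.1.2 + X.2.2))) := by
  rw [Osc.pd_mul ((sym_cexp_incr (T := Unit) hφ.smooth hφ.dXi_symbol 0).smooth ())
    (smooth_yM_one hb.smooth), pd_cexp (smooth_incr hφ.smooth), (pd_yM hb.smooth j).1]
  have h1 := sym_cexp_incr (T := T) hφ.smooth hφ.dXi_symbol k
  have h2 := ((sym_pd_e_incr (T := T) hφ.smooth hφ.dXi_symbol j k).2.stepData_mono (θ' := 1)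
    (e' := 0) (a' := 2) (fun _ X => wgt_nonneg (lam_nonneg _) X) le_rfl le_rfl one_le_two).ofReal
  have h3 := (hb.dXi j).sym_step_one (T := T) k
  have h4 := ((h2.constMul I).mul h1).mul (hb.sym_step_one k)
  have h5 := h1.mul h3
  refine Sym.add (h4.mono_le fun _ X _ => le_of_eq ?_) (h5.mono_le fun _ X _ => ?_)
  · simp only [wgt, Real.rpow_zero, mul_one]
    rw [sub_eq_add_neg, Real.rpow_add (br_pos _), Real.rpow_add (br_pos _)]
    ring
  · rw [one_mul]
    refine wgt_mono (lam_nonneg _) le_rfl ?_ X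
    have := abs_sub m 1
    rw [abs_one] at this
    linarith

lemma sym_stepAmp (hB : IsMagneticField B) (hφ : IsSymbolPlus φ) (hb : IsSymbol m b) (k : ℕ) :
    Sym ((stepData d 1 2 2).scale d) k (fun _ => wgt (fun z => br z.1.2 ^ m) 0 |m|)
      (fun (_ : T) => stepAmp B φ b) := by
  have h1 := (sym_fluxAmp (T := T) hB hφ k).stepData_mono (θ' := 1) (e' := 2) (a' := 2)
    (fun _ _ => zero_le_one) le_rfl le_rfl one_le_two
  have h2 := (sym_stepInner (T := T) hφ hb k).stepData_mono (θ' := 1) (e' := 2) (a' := 2)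
    (fun _ X => wgt_nonneg (lam_nonneg _) X) le_rfl (by norm_num) le_rfl
  exact (h1.mul h2).congr_weight fun _ _ _ => one_mul _

lemma smooth_stepAmp (hB : IsMagneticField B) (hφ : IsSymbolPlus φ) (hb : IsSymbol m b) :
    Smooth (stepAmp B φ b) := (sym_stepAmp (T := Unit) hB hφ hb 0).smooth ()

lemma sym_pd_stepAmp (hB : IsMagneticField B) (hφ : IsSymbolPlus φ) (hb : IsSymbol m b)
    (j : Fin d) (k : ℕ) : SW (stepData d 1 2 2) d k (fun z => br z.1.2 ^ (m - 1)) 0 (|m| + 2)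
      (fun (_ : T) => pd (ed (Par d) j) (stepAmp B φ b)) := by
  have h1 := (sym_fluxAmp (T := T) hB hφ k).stepData_mono (θ' := 1) (e' := 2) (a' := 2)
    (fun _ _ => zero_le_one) le_rfl le_rfl one_le_two
  have h2 := (sym_pd_stepInner (T := T) hφ hb j k).stepData_mono (θ' := 1) (e' := 2) (a' := 2)
    (fun _ X => wgt_nonneg (lam_nonneg _) X) le_rfl (by norm_num) le_rfl
  have e : pd (ed (Par d) j) (stepAmp B φ b) = fun X => fluxPhase B (fluxArg φ X) *
      pd (ed (Par d) j) (fun X => eI (incr φ X) * b (X.1.1.1 + X.1.2) (X.1.1.2 + X.2.2)) X := by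
    refine (Osc.pd_mul ((sym_fluxAmp (T := Unit) hB hφ 0).smooth ())
      ((sym_stepInner (T := Unit) hφ hb 0).smooth ()) _).trans ?_
    rw [pd_e_fluxAmp hB hφ]
    simp
  rw [e]
  exact (h1.mul h2).congr_weight fun _ _ _ => one_mul _

/-- The symbol `b̃(x, ξ, p)` of the recentred Fourier integral operator. -/
def stepSym (B : Fld d) (φ : Fn d ℝ)
    (b : Fn d ℂ) (z : Par d) : ℂ := osc fun q => stepAmp B φ b (z, q)

/-- The scale for functions of `((x, ξ), p)`. -/
def parScale (d N : ℕ) : Scale (Par d) where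
  wt := Sum.elim (Sum.elim (fun _ z => br z.2 ^ N)
    (fun _ z => (br z.1.2)⁻¹ * br z.2 ^ N)) (fun _ z => br z.2 ^ N)
  pos := by
    have h : ∀ z : Par d, 0 < br z.2 ^ N := fun z => pow_pos (br_pos _) _
    rintro ((i | i) | i) z
    · exact h z
    · exact mul_pos (inv_pos.2 (br_pos _)) (h z)
    · exact h z
  cost := fun _ => 0
  dom := Set.univ

lemma Sym.to_parScale {a e : ℕ} {ϖ : T → Par d → ℝ} {f : T → Par d → ℂ} {k : ℕ}
    (h : Sym (stepData d 1 e a).out k ϖ f) (h0 : ∀ t z, 0 ≤ ϖ t z) :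
    Sym (parScale d (e + e * (2 * a))) k ϖ f := by
  refine h.rescale le_rfl (fun _ => le_rfl) le_rfl (fun i => ⟨1, zero_le_one, fun z _ => ?_⟩)
    (fun t z _ => h0 t z) ⟨1, zero_le_one, fun t z _ => by rw [one_mul]⟩
  rw [one_mul]
  refine le_of_eq ?_
  rcases i with (i | i) | i
  · change br z.2 ^ e * (br z.2 ^ e) ^ (2 * a) = br z.2 ^ (e + e * (2 * a))
    rw [← pow_mul, ← pow_add]
  · change br z.1.2 ^ (-1 : ℝ) * br z.2 ^ e * (br z.2 ^ e) ^ (2 * a) =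
      (br z.1.2)⁻¹ * br z.2 ^ (e + e * (2 * a))
    rw [← pow_mul, mul_assoc, ← pow_add, Real.rpow_neg_one]
  · change br z.2 ^ e * (br z.2 ^ e) ^ (2 * a) = br z.2 ^ (e + e * (2 * a))
    rw [← pow_mul, ← pow_add]

lemma osc_stepAmp (hB : IsMagneticField B) (hφ : IsSymbolPlus φ) (hb : IsSymbol m b) (z : Par d) :
    Osc z (stepAmp B φ b) :=
  (sym_stepAmp (T := Unit) hB hφ hb 0).toOsc rfl (lam_nonneg _) trivial ()

lemma continuous_lam (m : ℝ) : Continuous fun z : Par d => br z.1.2 ^ m :=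
  (continuous_br.comp (continuous_snd.comp continuous_fst)).rpow_const
    fun _ => Or.inl (br_pos _).ne'

lemma sym_stepSym (hB : IsMagneticField B) (hφ : IsSymbolPlus φ) (hb : IsSymbol m b) :
    ∃ K : ℕ, Sym (parScale d 10) 0 (fun _ z => br z.1.2 ^ m * br z.2 ^ K)
      (fun _ : Unit => stepSym B φ b) := by
  obtain ⟨M, hM⟩ := exists_nat_two_mul |m| (-(d + 1))
  refine ⟨2 * (2 * M), ?_⟩
  have h := (sym_stepAmp (T := Unit) hB hφ hb 0).osc (regular_stepData 1 2 2) rfl (lam_nonneg _)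
    (continuous_lam m) hM
  refine ((h.to_parScale fun _ z => mul_nonneg (lam_nonneg _ _) (pow_nonneg (zero_le_one.trans
    (OscData.one_le_v _ _)) _))).congr_weight fun _ z _ => ?_
  change _ * (br z.2 ^ 2) ^ (2 * M) = _
  rw [← pow_mul]

lemma sym_stepSym_sub (hB : IsMagneticField B) (hφ : IsSymbolPlus φ) (hb : IsSymbol m b) :
    ∃ K : ℕ, Sym (parScale d 10) 0 (fun _ z => br z.1.2 ^ (m - 1) * br z.2 ^ K)
      (fun (_ : Unit) z => stepSym B φ b z - stepAmp B φ b (z, 0)) := by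
  obtain ⟨M, hM⟩ := exists_nat_two_mul (|m| + 2) (-(d + 1))
  refine ⟨2 + 2 * (2 * M), ?_⟩
  have e : (fun z => stepSym B φ b z - stepAmp B φ b (z, 0)) =
      fun z => osc fun q => tay (stepAmp B φ b) (z, q) := by
    funext z
    rw [stepSym, (osc_stepAmp hB hφ hb z).osc_eq_add_tay]
    ring
  rw [e]
  have h1 := Sym.tay_of_pd (O := stepData d 1 2 2) (k := 0) (fun _ : Unit => smooth_stepAmp hB hφ hb)
    (fun j => sym_pd_stepAmp hB hφ hb j 0) (lam_nonneg _) (by positivity) le_rfl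
  have h := h1.osc (regular_stepData 1 2 2) rfl
    (fun z => mul_nonneg (lam_nonneg _ _) (zero_le_one.trans (OscData.one_le_v _ _)))
    ((continuous_lam _).mul (regular_stepData 1 2 2).v) hM
  refine ((h.to_parScale fun _ z => mul_nonneg (mul_nonneg (lam_nonneg _ _) (zero_le_one.trans
    (OscData.one_le_v _ _))) (pow_nonneg (zero_le_one.trans
    (OscData.one_le_v _ _)) _))).congr_weight fun _ z _ => ?_
  change _ * br z.2 ^ 2 * (br z.2 ^ 2) ^ (2 * M) = _
  rw [← pow_mul, mul_assoc, ← pow_add]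

lemma stepSym_zero (hB : IsMagneticField B) (hφ : IsSymbolPlus φ) (hb : IsSymbol m b)
    (x ξ : Conf d) : stepSym B φ b ((x, ξ), 0) = b x ξ := by
  refine ((osc_stepAmp hB hφ hb ((x, ξ), 0)).osc_of_indep_w fun w η => ?_).trans ?_
  all_goals simp [stepAmp, fluxArg, fluxPhase_zero, incr]

/-- Exchange of an oscillatory integral with a Fourier inversion integral. -/
lemma tendsto_swap (g : Sw d) {Φ : ℝ → Ph d → Conf d → ℂ} {K : Conf d → ℂ}
    {C s : ℝ} (hint : ∀ ε, 0 < ε → ε ≤ 1 →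
      Integrable fun p : Ph d × Conf d => Φ ε p.1 p.2 * hat g p.2)
    (hb : ∀ ε, 0 < ε → ε ≤ 1 → ∀ ξ, ‖∫ q, Φ ε q ξ‖ ≤ C * br ξ ^ s)
    (hl : ∀ ξ, Tendsto (fun ε => ∫ q, Φ ε q ξ) (𝓝[>] 0) (𝓝 (K ξ))) :
    Tendsto (fun ε => ∫ q, ∫ ξ, Φ ε q ξ * hat g ξ) (𝓝[>] 0) (𝓝 (∫ ξ, hat g ξ * K ξ)) := by
  have hev : ∀ᶠ ε : ℝ in 𝓝[>] 0, 0 < ε ∧ ε ≤ 1 := Ioc_mem_nhdsGT one_pos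
  have e : ∀ ε, 0 < ε → ε ≤ 1 → ∀ ξ, ∫ q, Φ ε q ξ * hat g ξ = hat g ξ * ∫ q, Φ ε q ξ :=
    fun ε _ _ ξ => by rw [integral_mul_const, mul_comm]
  have e2 : (fun ε => ∫ ξ, hat g ξ * ∫ q, Φ ε q ξ) =ᶠ[𝓝[>] 0]
      fun ε => ∫ q, ∫ ξ, Φ ε q ξ * hat g ξ := by
    filter_upwards [hev] with ε hε
    rw [integral_integral_swap (hint ε hε.1 hε.2)]
    exact integral_congr_ae (.of_forall fun ξ => (e ε hε.1 hε.2 ξ).symm)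
  refine Tendsto.congr' e2 ?_
  obtain ⟨C', hC', hg⟩ := exists_hat_bound g s
  refine tendsto_integral_filter_of_dominated_convergence
    (fun ξ => |C| * (C' * br ξ ^ (-(d + 1) : ℝ))) ?_ ?_
    (((integrable_br le_rfl).const_mul C').const_mul _)
    (.of_forall fun ξ => (hl ξ).const_mul _)
  · filter_upwards [hev] with ε hε
    have h1 := (hint ε hε.1 hε.2).integral_prod_right.aestronglyMeasurable
    exact h1.congr (.of_forall fun ξ => e ε hε.1 hε.2 ξ)
  · filter_upwards [hev] with ε hε
    refine .of_forall fun ξ => ?_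
    have h1 := (hb ε hε.1 hε.2 ξ).trans
      (mul_le_mul_of_nonneg_right (le_abs_self C) (br_rpow_pos ξ s).le)
    rw [norm_mul]
    calc _ ≤ ‖hat g ξ‖ * (|C| * br ξ ^ s) := mul_le_mul_of_nonneg_left h1 (norm_nonneg _)
      _ = |C| * (br ξ ^ s * ‖hat g ξ‖) := by ring
      _ ≤ _ := mul_le_mul_of_nonneg_left (hg ξ) (abs_nonneg _)

lemma Slow.bd_mul {c : ParAmp d → ℝ} (h : Slow c) (i : Dirs.ι (ParAmp d)) (n k : ℕ) :
    Bd ((stepData d 0 2 2).scale d) n k (fun _ X => ((stepData d 0 2 2).scale d).wt i X)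
      (fun ε : 𝕀 => pd i fun X => (ε : ℝ) * c X) := by
  have e : ∀ ε : 𝕀, pd i (fun X => (ε : ℝ) * c X) = fun X => (ε : ℝ) * pd i c X :=
    fun ε => pd_clm ((ε : ℝ) • ContinuousLinearMap.id ℝ ℝ) h.smooth i
  simp only [e]
  have h1 : Sym ((stepData d 1 0 0).scale d) k (fun _ _ => 1)
      (fun (ε : 𝕀) (_ : ParAmp d) => (ε : ℝ)) :=
    Sym.const _ ⟨1, zero_le_one, fun ε X _ => by
      rw [Real.norm_of_nonneg ε.2.1, one_mul]; exact ε.2.2⟩ fun _ _ _ => zero_le_one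
  have h2 := (h1.mulR ((h.bd i k).reindex fun _ => ())).stepData_mono (θ' := 0) (e' := 2) (a' := 2)
    (fun _ X => by rw [one_mul]; exact (Scale.pos _ _ _).le) zero_le_one (by norm_num) (by norm_num)
  exact (h2.mono_le fun _ X _ => by
    rw [one_mul]; exact stepData_wt_mono zero_le_one (by norm_num) (by norm_num) i X).bd n

def stepCut (φ : Fn d ℝ) (ε : ℝ) (X : ParAmp d) : ℂ :=
  ccut (ε • (X.2.1 + (X.1.1.1 + X.1.2 + gradXi φ (X.1.1.1 + X.1.2) X.1.1.2))) *
    ccut (ε • (X.2.2 + X.1.1.2))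

lemma smooth_gradXi_amp (hφ : IsSymbolPlus φ) :
    Smooth (fun X : ParAmp d => gradXi φ (X.1.1.1 + X.1.2) X.1.1.2) :=
  contDiff_euclidean.2 fun j => smooth_yM_zero (smooth_dXi hφ.smooth j)

lemma smooth_stepCut (hφ : IsSymbolPlus φ) :
    Smooth (fun p : ℝ × ParAmp d => stepCut φ p.1 p.2) := by
  have h := (smooth_gradXi_amp hφ).comp (contDiff_snd (𝕜 := ℝ) (E := ℝ))
  have h1 : Smooth (fun p : ℝ × ParAmp d => gradXi φ (p.2.1.1.1 + p.2.1.2) p.2.1.1.2) := h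
  refine ContDiff.mul (smooth_ccut.comp ?_) (smooth_ccut.comp ?_) <;> fun_prop

def sxM (d : ℕ) : ParAmp d →L[ℝ] Conf d := eM (Par d) d +
  (snd ℝ (Conf d) (Conf d)).comp ((fst ℝ _ (Conf d)).comp (fst ℝ _ (Ph d)))

lemma sym_cut_sx (k : ℕ) : Sym ((stepData d 0 2 2).scale d) k (fun _ _ => 1)
    (fun (ε : 𝕀) X => ccut ((ε : ℝ) • (X.2.2 + X.1.1.2))) := by
  have hc : Sym (unitScale (Conf d)) k (fun _ _ => 1)
    (fun _ : 𝕀 => ccut (d := d)) := sym_of_compact smooth_ccut ccut_compact k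
  have key : ∀ (i j : Fin d) (ε : 𝕀),
      |(ε : ℝ) * (single i (1 : ℝ) : Conf d) j| ≤ 1 := fun i j ε => by
    rw [abs_mul, abs_of_nonneg ε.2.1]
    exact mul_le_one₀ ε.2.2 (abs_nonneg _) (abs_single_le _ _)
  have h := hc.compLin (S := (stepData d 0 2 2).scale d) (fun ε => (ε : ℝ) • sxM d)
    (fun _ _ _ => trivial) (fun _ _ _ => zero_le_one)
  refine h ?_
  rintro (((i | i) | i) | i | i) j
  · right; intro t; simp [sxM]
  · left
    refine ⟨Nat.zero_le _, 1, zero_le_one, fun ε X _ => ?_⟩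
    have h3 : 1 ≤ ((stepData d 0 2 2).scale d).wt (Sum.inl (Sum.inl (Sum.inr i))) X := by
      change 1 ≤ br X.1.1.2 ^ (-0 : ℝ) * br X.1.2 ^ 2 * _
      rw [neg_zero, Real.rpow_zero, one_mul]
      exact one_le_mul (one_le_pow₀ (one_le_br _)) (one_le_pow₀
        (one_le_mul (one_le_br _) (one_le_br _)))
    rw [one_mul]
    refine le_trans ?_ ((key i j ε).trans h3)
    simp [unitScale, sxM]
  · right; intro t; simp [sxM]
  · right; intro t; simp [sxM]
  · left
    refine ⟨Nat.zero_le _, 1, zero_le_one, fun ε X _ => ?_⟩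
    change _ ≤ 1 * (1 : ℝ)
    rw [one_mul]
    refine le_trans ?_ (key i j ε)
    simp [unitScale, sxM]

lemma sym_stepCut (hφ : IsSymbolPlus φ) (k : ℕ) : Sym ((stepData d 0 2 2).scale d) k (fun _ _ => 1)
      (fun ε : 𝕀 => stepCut φ ε) := by
  have hc : Sym (unitScale (Conf d)) k (fun _ _ => 1)
    (fun _ : 𝕀 => ccut (d := d)) := sym_of_compact smooth_ccut ccut_compact k
  have h1 : Sym ((stepData d 0 2 2).scale d) k (fun _ _ => 1) (fun (ε : 𝕀) X =>
      ccut ((ε : ℝ) • (X.2.1 + (X.1.1.1 + X.1.2 + gradXi φ (X.1.1.1 + X.1.2) X.1.1.2)))) := by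
    refine hc.comp (χ := fun (ε : 𝕀) (X : ParAmp d) =>
      (ε : ℝ) • (X.2.1 + (X.1.1.1 + X.1.2 + gradXi φ (X.1.1.1 + X.1.2) X.1.1.2))) (fun ε => ?_)
      (fun _ _ _ => trivial) (fun _ _ => Or.inl (Nat.zero_le _)) (fun _ _ _ => zero_le_one)
      fun i j n => ?_
    · have := smooth_gradXi_amp hφ
      fun_prop
    · have h2 := ((slow_q j).add (((slow_x j).add (slow_p j)).add
        (slow_symbol (hφ.dXi_symbol j)))).bd_mul i n k
      refine Bd.congr_weight ?_ fun _ X _ => (div_one _).symm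
      simpa [gradXi, mul_add] using h2
  exact (h1.mul (sym_cut_sx k)).congr_weight fun _ _ _ => one_mul _

lemma fast_stepCut (hφ : IsSymbolPlus φ) {f : ParAmp d → ℂ} (hf : Smooth f) {ε : ℝ}
    (hε : 0 < ε) (z : Par d) : Fast z (fun X => stepCut φ ε X * f X) := by
  obtain ⟨C, hC, hb⟩ := exists_br_gradXi_le hφ
  refine fast_of_support (((smooth_stepCut hφ).comp (contDiff_const.prodMk contDiff_id)).mul hf)
    (R := 2 / ε + (‖z‖ + 1) + (‖z‖ + 1) + C) Metric.isOpen_ball (Metric.mem_ball_self one_pos)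
    fun X hX hR => ?_
  have hz : ‖X.1‖ ≤ ‖z‖ + 1 := by
    have := norm_le_insert' X.1 z
    rw [Metric.mem_ball, dist_eq_norm] at hX
    linarith
  have n1 : ‖X.1.1.1‖ ≤ ‖z‖ + 1 := ((norm_fst_le _).trans (norm_fst_le _)).trans hz
  have n2 : ‖X.1.1.2‖ ≤ ‖z‖ + 1 := ((norm_snd_le _).trans (norm_fst_le _)).trans hz
  have n3 : ‖X.1.2‖ ≤ ‖z‖ + 1 := (norm_snd_le _).trans hz
  have n4 := (norm_le_br _).trans (hb (X.1.1.1 + X.1.2) X.1.1.2)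
  have big : ∀ v w : Conf d, 2 / ε + ‖w‖ ≤ ‖v‖ → ccut (ε • (v + w)) = 0 := fun v w h => by
    refine ccut_eq_zero ?_
    rw [norm_smul, Real.norm_of_nonneg hε.le, ← div_le_iff₀' hε]
    have := norm_le_add_norm_add v w
    linarith
  have p0 : 0 ≤ ‖z‖ := norm_nonneg z
  rcases hR with hR | hR
  · change stepCut φ ε X * f X = 0
    rw [stepCut, big _ _ ?_, zero_mul, zero_mul]
    have h1 := norm_add_le (X.1.1.1 + X.1.2) (gradXi φ (X.1.1.1 + X.1.2) X.1.1.2)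
    have h2 := norm_add_le X.1.1.1 X.1.2
    linarith
  · change stepCut φ ε X * f X = 0
    rw [stepCut, big _ X.1.1.2 ?_, mul_zero, zero_mul]
    linarith

lemma osc_fioSymbol (hU : IsGeneratingPhase U) (hb : IsSymbol m b) (y : Conf d) :
    Osc PUnit.unit.{1} (fun X : Amp PUnit.{1} d =>
      eI (U y X.2.2) * b y X.2.2) := by
  have h1 : Osc PUnit.unit.{1} (fun X : Amp PUnit.{1} d =>
      eI (inner ℝ y X.2.2)) := by
    refine ⟨0, 0, 0, (Sym.cexp (θ := fun (_ : Unit) (X : Amp PUnit.{1} d) =>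
      (((innerSL ℝ y).comp (eM PUnit.{1} d)) X : ℝ)) (fun _ => ContinuousLinearMap.contDiff _)
      fun i n => ?_).congr_weight fun _ X _ => by simp [wgt]⟩
    rw [pd_linear]
    refine (Sym.const (k := 0) _ ⟨|((innerSL ℝ y).comp (eM PUnit.{1} d)) (Dirs.b i)|,
      abs_nonneg _, fun _ X _ => ?_⟩ fun _ X _ => (Scale.pos _ _ _).le).bd n
    rw [Real.norm_eq_abs]
    refine le_mul_of_one_le_right (abs_nonneg _) ?_
    rcases i with i | i | i <;> simp [pt, OscData.scale]
  refine cast (congrArg _ (funext fun X => ?_)) (h1.mul (osc_fioSlice hU hb y))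
  rw [← mul_assoc, ← Complex.exp_add, phaseRemainder]
  congr 3
  push_cast
  ring

lemma recentre_phase (y q ξ σ : Conf d) : ee (q + (y + gradXi (phaseRemainder U) y ξ), σ + ξ) *
      ee (q + (y + gradXi (phaseRemainder U) y ξ), -ξ) *
      eI (U y (σ + ξ)) =
    eI (U y ξ) * (ee (q, σ) *
      eI (phaseRemainder U y (ξ + σ) - phaseRemainder U y ξ - ∑ k, σ k * dXi k (phaseRemainder U) y ξ)) := by
  have h : ∑ k, σ k * dXi k (phaseRemainder U) y ξ = inner ℝ (gradXi (phaseRemainder U) y ξ) σ := by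
    simp [gradXi, PiLp.inner_apply]
  rw [h, ee, ee, ee, ← Complex.exp_add, ← Complex.exp_add, ← Complex.exp_add, ← Complex.exp_add,
    phaseRemainder, phaseRemainder, add_comm σ ξ]
  congr 1
  simp only [inner_add_left, inner_add_right, inner_neg_right]
  push_cast
  ring

/-- Recentring a magnetic Fourier integral operator at another point. -/
lemma magPhase_mul_fioValue (hA : IsVectorPotential A B) (hB : IsMagneticField B)
    (hU : IsGeneratingPhase U) (hb : IsSymbol m b) (u : Sw d) (x p : Conf d) :
    magPhase A x (x + p) * fioValue A U b u (x + p) =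
      cd d * ∫ ξ, hat (magMul A x u) ξ * (eI (U (x + p) ξ) *
        stepSym B (phaseRemainder U) b ((x, ξ), p)) := by
  have hφ := hU.remainder
  set φ := phaseRemainder U with hφU
  set g := magMul A x u with hg
  set y := x + p with hy
  set f : Conf d → ℂ := fun ζ => eI (U y ζ) * b y ζ with hf
  have hfo : Osc PUnit.unit.{1} (fun X : Amp PUnit.{1} d => f X.2.2) := osc_fioSymbol hU hb y
  set G : Sw d := magPhase A x y • magMul A y u with hG
  have hGz : ∀ z, G z = fluxPhase B (x, (p, z - x)) * g z := fun z => by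
    have h := magPhase_mul hA hB x p (z - x)
    rw [add_sub_cancel] at h
    rw [hG, hg, _root_.smul_apply, magMul_apply hA.temperate, magMul_apply hA.temperate,
      smul_eq_mul, ← mul_assoc, h, mul_assoc]
  have hΩ : Smooth fun z : Conf d => fluxPhase B (x, (p, z - x)) :=
    ((sym_fluxPhase hB (T := Unit) 0).smooth ()).comp (by fun_prop)
  have hfs : Smooth f := hfo.bound_e.1
  -- the left-hand side as a limit
  have hlim : Tendsto (fun ε : ℝ => cd d * ∫ q : Ph d, ee q *
      (ccut (ε • q.1) * ccut (ε • q.2) * (f q.2 * G q.1))) (𝓝[>] 0)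
      (𝓝 (magPhase A x y * fioValue A U b u y)) := by
    have h0 : Osc PUnit.unit.{1} (fun X : Amp PUnit.{1} d => f X.2.2 * G X.2.1) :=
      hfo.mul ((sym_schwartz_w (T := Unit) (pt PUnit.unit.{1} 0) G 0 0).toOsc rfl
        (fun _ => zero_le_one) rfl ())
    have h1 := h0.tendsto_ccut
    have h2 := hfo.osc_schwartz G
    simp only at h1 h2
    rw [h2] at h1
    have h3 : ∀ η, hat G η = magPhase A x y * hat (magMul A y u) η := fun η => by
      rw [hat_apply, hat_apply, ← integral_const_mul]
      refine integral_congr_ae (.of_forall fun z => ?_)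
      simp only [hG, _root_.smul_apply, smul_eq_mul]
      ring
    refine cast (congrArg (fun v => Tendsto _ _ (𝓝 v)) ?_) h1
    simp only [h3, mul_assoc]
    rw [integral_const_mul, fioValue]
    ring
  set Φ : ℝ → Ph d → Conf d → ℂ := fun ε q ξ => cd d * (ee q *
    (ccut (ε • q.1) * ccut (ε • q.2) * (f q.2 * fluxPhase B (x, (p, q.1 - x)))) *
      ee (q.1, -ξ)) with hΦ
  have hΦint : ∀ ε ξ, ∫ q, Φ ε q ξ = eI (U y ξ) * (cd d *
      ∫ q, ee q * (stepCut φ ε (((x, ξ), p), q) * stepAmp B φ b (((x, ξ), p), q))) := by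
    intro ε ξ
    have : (volume : Measure (Ph d)).IsAddRightInvariant :=
      inferInstanceAs ((volume : Measure (Conf d)).prod volume).IsAddRightInvariant
    rw [hΦ, integral_const_mul, ← integral_add_right_eq_self _
      ((y + gradXi φ y ξ, ξ) : Ph d), mul_left_comm]
    congr 1
    rw [← integral_const_mul]
    refine integral_congr_ae (.of_forall fun q => ?_)
    have h1 := recentre_phase (U := U) y q.1 ξ q.2
    rw [← hφU] at h1
    simp only [Prod.fst_add, Prod.snd_add, hf, stepCut, stepAmp, fluxArg, incr, ← hy]
    have e1 : q.1 + (y + gradXi φ y ξ) - x = p + q.1 + gradXi φ y ξ := by rw [hy]; abel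
    have e2 : q + (y + gradXi φ y ξ, ξ) = (q.1 + (y + gradXi φ y ξ), q.2 + ξ) := rfl
    rw [e1, e2, add_comm ξ q.2]
    rw [add_comm ξ q.2] at h1
    linear_combination (ccut (ε • (q.1 + (y + gradXi φ y ξ))) * ccut (ε • (q.2 + ξ)) *
      b y (q.2 + ξ) * fluxPhase B (x, (p, p + q.1 + gradXi φ y ξ))) * h1
  -- uniform symbol bounds for the recentred amplitude
  have hsym : Sym ((stepData d 0 2 2).scale d) 0 (fun _ => wgt (fun z => br z.1.2 ^ m) 0 |m|)
      (fun (ε : 𝕀) X => stepCut φ ε X * stepAmp B φ b X) :=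
    ((sym_stepCut hφ 0).mul ((sym_stepAmp hB hφ hb 0).stepData_mono (θ' := 0)
      (fun _ X => wgt_nonneg (lam_nonneg _) X) zero_le_one le_rfl le_rfl)).congr_weight
      fun _ _ _ => one_mul _
  have hfast : ∀ z : Par d, ∀ ε : ℝ, 0 < ε → Fast z fun X => stepCut φ ε X * stepAmp B φ b X :=
    fun z ε hε => fast_stepCut hφ (smooth_stepAmp hB hφ hb) hε z
  obtain ⟨M, hM⟩ := exists_nat_two_mul |m| (-(d + 1))
  obtain ⟨C, hC, hCb⟩ := norm_osc_le hsym (lam_nonneg _) (Nat.zero_le _) hM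
  have hlim2 := tendsto_swap g (Φ := Φ) (C := C * (br p ^ 2) ^ (2 * M)) (s := m)
    (K := fun ξ => eI (U y ξ) * stepSym B φ b ((x, ξ), p))
    (fun ε hε _ => ?_) (fun ε hε hε1 ξ => ?_) (fun ξ => ?_)
  · refine tendsto_nhds_unique hlim ((hlim2.const_mul (cd d)).congr' ?_)
    refine .of_forall fun ε => congrArg _ (integral_congr_ae (.of_forall fun q => ?_))
    simp only [hΦ]
    rw [hGz, hat_inversion g q.1]
    trans (cd d * (ee q * (ccut (ε • q.1) * ccut (ε • q.2) *
      (f q.2 * fluxPhase B (x, (p, q.1 - x)))))) * ∫ ξ, ee (q.1, -ξ) * hat g ξ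
    · rw [← integral_const_mul]
      exact integral_congr_ae (.of_forall fun ξ => by ring)
    · ring
  · have hF : Integrable fun q : Ph d => ee q * (ccut (ε • q.1) * ccut (ε • q.2) *
        (f q.2 * fluxPhase B (x, (p, q.1 - x)))) :=
      integrable_ee_mul (fast_of_cut smooth_ccut ccut_compact smooth_ccut ccut_compact
        (f := fun X : Amp PUnit.{1} d => f X.2.2 * fluxPhase B (x, (p, X.2.1 - x)))
        ((hfs.comp (by fun_prop)).mul (hΩ.comp (by fun_prop :
          Smooth fun X : Amp PUnit.{1} d => X.2.1))) hε PUnit.unit).integrable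
    have h1 := ((hF.mul_prod ((hat g).integrable (μ := volume))).bdd_mul (c := 1)
      (f := fun w : Ph d × Conf d => ee (w.1.1, -w.2))
      ((smooth_ee.continuous.comp (by fun_prop)).aestronglyMeasurable)
      (.of_forall fun w => (norm_ee _).le)).const_mul (cd d)
    refine h1.congr (.of_forall fun w => ?_)
    simp only [hΦ]
    ring
  · rw [hΦint, norm_mul, norm_cexp_I, one_mul, ← (hfast ((x, ξ), p) ε hε).osc_eq]
    refine (hCb ⟨ε, hε.le, hε1⟩ ((x, ξ), p) trivial).trans (le_of_eq ?_)
    change C * (br ξ ^ m * (br p ^ 2) ^ (2 * M)) = _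
    ring
  · simp only [hΦint]
    refine Tendsto.const_mul _ ?_
    have h1 := tendsto_osc (G := fun ε X => stepCut φ ε X * stepAmp B φ b X)
      ((smooth_stepCut hφ).mul ((smooth_stepAmp hB hφ hb).comp contDiff_snd)) hsym (lam_nonneg _) M
      (Nat.zero_le _) hM (z := ((x, ξ), p)) trivial (fun ε hε _ => hfast _ ε hε)
    have e : ∀ q : Ph d, stepCut φ 0 (((x, ξ), p), q) = 1 := fun q => by
      simp [stepCut, ccut_zero]
    simpa [e, stepSym] using h1

/-- Weights for amplitudes depending on `(x, ξ)`. -/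
def zData (d r : ℕ) (s : ℝ) (a : ℕ) : OscData (Ph d) where
  v := fun z => br z.2 ^ r
  one_le_v := fun z => one_le_pow₀ (one_le_br _)
  g := Sum.elim (fun _ z => br z.2 ^ r) (fun _ z => br z.2 ^ s)
  g_pos := by
    rintro (i | i) z
    · exact pow_pos (br_pos _) _
    · exact br_rpow_pos _ _
  a := a
  c := 0
  D := Set.univ

lemma regular_zData (r : ℕ) (s : ℝ) (a : ℕ) : (zData d r s a).Regular := by
  have h : Continuous fun z : Ph d => br z.2 := continuous_br.comp continuous_snd
  refine ⟨rfl, h.pow r, ?_⟩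
  rintro (i | i)
  · exact h.pow r
  · exact h.rpow_const fun z => Or.inl (br_pos _).ne'

/-- The scale in which derivatives in `ξ` and `η` gain `⟨ξ⟩⁻¹`. -/
def fineScale (d : ℕ) : Scale (PhAmp d) :=
  (zData d 0 (-1) 10).fine (fun z => (br z.2)⁻¹) (fun _ => inv_pos.2 (br_pos _)) 0 d

lemma one_le_pow_br (X : PhAmp d) : 1 ≤ (br X.2.1 * br X.2.2) ^ 10 :=
  one_le_pow₀ (one_le_mul (one_le_br _) (one_le_br _))

lemma fine_x (i : Fin d) (X : PhAmp d) : (fineScale d).wt (Sum.inl (Sum.inl i)) X =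
    (br X.2.1 * br X.2.2) ^ 10 := by
  change br X.1.2 ^ 0 * _ = _
  rw [pow_zero, one_mul]; rfl

lemma fine_xi (i : Fin d) (X : PhAmp d) : (fineScale d).wt (Sum.inl (Sum.inr i)) X =
      (br X.1.2)⁻¹ * (br X.2.1 * br X.2.2) ^ 10 := by
  change br X.1.2 ^ (-1 : ℝ) * _ = _
  rw [Real.rpow_neg_one]; rfl

lemma fine_w (i : Fin d) (X : PhAmp d) : (fineScale d).wt (wd (Ph d) i) X = br X.2.1 ^ 10 := by
  change br X.1.2 ^ 0 * _ = _
  rw [pow_zero, one_mul]; rfl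

lemma fine_e (i : Fin d) (X : PhAmp d) : (fineScale d).wt (ed (Ph d) i) X = (br X.1.2)⁻¹ := by
  change min 1 ((br X.1.2)⁻¹ * br X.2.2 ^ 0) = _
  rw [pow_zero, mul_one, min_eq_right (inv_le_one_of_one_le₀ (one_le_br _))]

lemma fine_cost (i : Dirs.ι (PhAmp d)) : (fineScale d).cost i = 0 := by
  rcases i with i | i | i <;> rfl

lemma fine_le {r a : ℕ} {s : ℝ} (hs : -1 ≤ s) (ha : 10 ≤ a) (i : Dirs.ι (PhAmp d))
    (X : PhAmp d) : (fineScale d).wt i X ≤ ((zData d r s a).scale d).wt i X := by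
  have h0 : 1 ≤ br X.1.2 ^ r := one_le_pow₀ (one_le_br _)
  have h1 : (br X.2.1 * br X.2.2) ^ 10 ≤ (br X.2.1 * br X.2.2) ^ a :=
    pow_le_pow_right₀ (one_le_mul (one_le_br _) (one_le_br _)) ha
  have h2 : br X.2.1 ^ 10 ≤ br X.2.1 ^ a := pow_le_pow_right₀ (one_le_br _) ha
  have h3 := one_le_pow_br X
  rcases i with (i | i) | i | i
  · rw [fine_x]
    exact h1.trans (le_mul_of_one_le_left (by linarith) h0)
  · rw [fine_xi, ← Real.rpow_neg_one]
    exact mul_le_mul (br_rpow_mono _ hs) h1 (by linarith) (br_rpow_pos _ _).le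
  · exact (fine_w i X).trans_le (h2.trans (le_mul_of_one_le_left (pow_nonneg (br_pos _).le _) h0))
  · exact (fine_e i X).trans_le (inv_le_one_of_one_le₀ (one_le_br _))

lemma Sym.of_fine {r a k : ℕ} {s : ℝ} {ϖ : T → PhAmp d → ℝ} {f : T → PhAmp d → F}
    (hf : Sym (fineScale d) k ϖ f) (h0 : ∀ t X, 0 ≤ ϖ t X) (hs : -1 ≤ s) (ha : 10 ≤ a) :
    Sym ((zData d r s a).scale d) k ϖ f :=
  hf.rescale (fun _ _ => trivial) (fun i => (fine_cost i).trans_le (Nat.zero_le _)) le_rfl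
    (fun i => ⟨1, zero_le_one, fun X _ => by rw [one_mul]; exact fine_le hs ha i X⟩)
    (fun t X _ => h0 t X) ⟨1, zero_le_one, fun t X _ => by rw [one_mul]⟩

def xpM (d : ℕ) (t : ℝ) : PhAmp d →L[ℝ] Ph d := ((fst ℝ (Conf d) (Conf d)).comp (fst ℝ _ _) +
    t • wM (Ph d) d).prod
  ((snd ℝ (Conf d) (Conf d)).comp (fst ℝ _ _))

lemma xpM_apply (t : ℝ) (X : PhAmp d) : xpM d t X = (X.1.1 + t • X.2.1, X.1.2) := rfl

lemma IsSymbol.sym_xp {m : ℝ} {f : Fn d F} (hf : IsSymbol m f) (τ : T → 𝕀) (k : ℕ) :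
    Sym (fineScale d) k (fun _ X => br X.1.2 ^ m)
      (fun t X => f (X.1.1 + (τ t : ℝ) • X.2.1) X.1.2) := by
  have key : ∀ (i j : Fin d) t, |(τ t : ℝ) * (single i (1 : ℝ) : Conf d) j| ≤ 1 := fun i j t => by
      rw [abs_mul, abs_of_nonneg (τ t).2.1]
      exact mul_le_one₀ (τ t).2.2 (abs_nonneg _) (abs_single_le i j)
  refine (hf.sym k).compLin (fun t => xpM d (τ t)) (fun _ _ _ => trivial)
    (fun _ _ _ => (br_rpow_pos _ _).le) ?_
  rintro ((i | i) | i | i) (j | j)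
  · refine Or.inl ⟨Nat.zero_le _, |(single i (1 : ℝ) : Conf d) j|, abs_nonneg _, fun t X _ => ?_⟩
    rw [fine_x]
    refine mul_le_mul (by simp [xpM]) (one_le_pow_br X) zero_le_one (abs_nonneg _)
  · right; intro t; simp [xpM]
  · right; intro t; simp [xpM]
  · refine Or.inl ⟨Nat.zero_le _, |(single i (1 : ℝ) : Conf d) j|, abs_nonneg _, fun t X _ => ?_⟩
    rw [fine_xi]
    refine mul_le_mul (by simp [xpM]) ?_ (inv_nonneg.2 (br_pos _).le) (abs_nonneg _)
    exact le_mul_of_one_le_right (inv_nonneg.2 (br_pos _).le) (one_le_pow_br X)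
  · refine Or.inl ⟨Nat.zero_le _, 1, zero_le_one, fun t X _ => ?_⟩
    rw [show (fineScale d).wt (Sum.inr (Sum.inl i)) X = _ from fine_w i X]
    refine mul_le_mul ?_ (one_le_pow₀ (one_le_br _)) zero_le_one zero_le_one
    refine le_trans ?_ (key i j t)
    simp [xpM]
  · right; intro t; simp [xpM]
  · right; intro t; simp [xpM]
  · right; intro t; simp [xpM]

def parM (d : ℕ) : PhAmp d →L[ℝ] Par d := (fst ℝ _ _).prod (wM (Ph d) d)

@[simp] lemma co_par_x (j : Fin d) (z : Par d) :
    co (E := Par d) (Sum.inl (Sum.inl j)) z = z.1.1 j :=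
  (co_inl (E := Ph d) (F := Conf d) _ z).trans
    ((co_inl (E := Conf d) (F := Conf d) _ z.1).trans (co_conf _ _))

@[simp] lemma co_par_xi (j : Fin d) (z : Par d) :
    co (E := Par d) (Sum.inl (Sum.inr j)) z = z.1.2 j :=
  (co_inl (E := Ph d) (F := Conf d) _ z).trans
    ((co_inr (E := Conf d) (F := Conf d) _ z.1).trans (co_conf _ _))

@[simp] lemma co_par_p (j : Fin d) (z : Par d) : co (E := Par d) (Sum.inr j) z = z.2 j :=
  (co_inr (E := Ph d) (F := Conf d) _ z).trans (co_conf _ _)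

lemma Sym.sym_par {ϖ : T → Par d → ℝ} {β : T → Par d → ℂ} {k : ℕ}
    (h : Sym (parScale d 10) k ϖ β) (h0 : ∀ t z, 0 ≤ ϖ t z) :
    Sym (fineScale d) k (fun t X => ϖ t (X.1, X.2.1)) (fun t X => β t (X.1, X.2.1)) := by
  refine h.compLin (fun _ => parM d) (fun _ _ _ => trivial) (fun t z _ => h0 t z) ?_
  have hp : ∀ X : PhAmp d, br X.2.1 ^ 10 ≤ (br X.2.1 * br X.2.2) ^ 10 := fun X =>
    pow_le_pow_left₀ (br_pos _).le (le_mul_of_one_le_right (br_pos _).le (one_le_br _)) _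
  rintro ((i | i) | i | i) ((j | j) | j)
  · refine Or.inl ⟨Nat.zero_le _, |(single i (1 : ℝ) : Conf d) j|, abs_nonneg _, fun t X _ => ?_⟩
    rw [fine_x]
    exact mul_le_mul (by simp [parM]) (hp X) (pow_nonneg (br_pos _).le _) (abs_nonneg _)
  · right; intro t; simp [parM]
  · right; intro t; simp [parM]
  · right; intro t; simp [parM]
  · refine Or.inl ⟨Nat.zero_le _, |(single i (1 : ℝ) : Conf d) j|, abs_nonneg _, fun t X _ => ?_⟩
    rw [fine_xi]
    exact mul_le_mul (by simp [parM]) (mul_le_mul_of_nonneg_left (hp X)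
      (inv_nonneg.2 (br_pos _).le)) (Scale.pos _ _ _).le (abs_nonneg _)
  · right; intro t; simp [parM]
  · right; intro t; simp [parM]
  · right; intro t; simp [parM]
  · refine Or.inl ⟨Nat.zero_le _, |(single i (1 : ℝ) : Conf d) j|, abs_nonneg _, fun t X _ => ?_⟩
    rw [show (fineScale d).wt (Sum.inr (Sum.inl i)) X = _ from fine_w i X]
    exact mul_le_mul (by simp [parM]) le_rfl (pow_nonneg (br_pos _).le _) (abs_nonneg _)
  · right; intro t; simp [parM]
  · right; intro t; simp [parM]
  · right; intro t; simp [parM]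

lemma fine_linear (L : PhAmp d →L[ℝ] ℝ) {ϖ : PhAmp d → ℝ} (k : ℕ) (h : ∀ X, |L X| ≤ ϖ X)
    (hd : ∀ i X, |L (Dirs.b i)| ≤ ϖ X * (fineScale d).wt i X) :
    Sym (fineScale d) k (fun _ => ϖ) (fun (_ : T) X => L X) :=
  Sym.linear (fun _ => L) ⟨1, zero_le_one, fun _ X _ => by rw [one_mul]; exact h X⟩
    (fun i => ⟨1, zero_le_one, fun _ X _ => by rw [one_mul]; exact hd i X⟩)
    fun _ X _ => (abs_nonneg _).trans (h X)

lemma one_le_fine_mul (i : Dirs.ι (PhAmp d)) (X : PhAmp d) :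
    1 ≤ br X.1.2 * (fineScale d).wt i X := by
  have h1 := one_le_br X.1.2
  have h2 := one_le_pow_br X
  rcases i with (i | i) | i | i
  · rw [fine_x]; exact one_le_mul h1 h2
  · rw [fine_xi, ← mul_assoc, mul_inv_cancel₀ (br_pos _).ne', one_mul]; exact h2
  · rw [show (fineScale d).wt (Sum.inr (Sum.inl i)) X = _ from fine_w i X]
    exact one_le_mul h1 (one_le_pow₀ (one_le_br _))
  · rw [show (fineScale d).wt (Sum.inr (Sum.inr i)) X = _ from fine_e i X,
      mul_inv_cancel₀ (br_pos _).ne']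

lemma fine_coord_xi (j : Fin d) (k : ℕ) :
    Sym (fineScale d) k (fun _ X => br X.1.2) (fun (_ : T) X => X.1.2 j) := by
  refine fine_linear ((proj j).comp ((snd ℝ _ _).comp
    (fst ℝ _ _))) k (fun X => abs_coord_le_br _ _) fun i X =>
    le_trans ?_ (one_le_fine_mul i X)
  rcases i with (i | i) | i | i
  · simp
  · simpa using abs_single_le i j
  · simp
  · simp

lemma fine_coord_w (j : Fin d) (k : ℕ) :
    Sym (fineScale d) k (fun _ X => br X.2.1) (fun (_ : T) X => X.2.1 j) := by
  refine fine_linear (wL (Ph d) j) k (fun X => abs_coord_le_br X.2.1 j) fun i X => ?_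
  have h := mul_pos (br_pos X.2.1) (Scale.pos (fineScale d) i X)
  rcases i with (i | i) | i | i
  · simpa using h.le
  · simpa using h.le
  · rw [show (fineScale d).wt (Sum.inr (Sum.inl i)) X = _ from fine_w i X]
    refine le_trans (by simpa using abs_single_le i j)
      (one_le_mul (one_le_br X.2.1) (one_le_pow₀ (one_le_br _)))
  · simpa using h.le

def shiftC (φ : Fn d ℝ) (j : Fin d) (X : PhAmp d) : ℝ :=
  X.1.2 j + ∫ t in 0..1, dX j φ (X.1.1 + t • X.2.1) X.1.2

def shiftV (φ : Fn d ℝ) (X : PhAmp d) : Conf d := WithLp.toLp 2 fun j => shiftC φ j X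

lemma smooth_xp {f : Fn d F} (hf : Smooth (unc f)) : Smooth (fun q : ℝ × PhAmp d =>
      f (q.2.1.1 + q.1 • q.2.2.1) q.2.1.2) :=
  hf.comp (by fun_prop : Smooth (fun q : ℝ × PhAmp d =>
    (q.2.1.1 + q.1 • q.2.2.1, q.2.1.2)))

lemma sym_shiftC (hφ : IsSymbolPlus φ) (j : Fin d) (k : ℕ) :
    Sym (fineScale d) k (fun _ X => br X.1.2) (fun (_ : T) => shiftC φ j) := by
  have hs : Smooth (unc (dX j φ)) := (hφ.dX_symbol j).smooth
  have h1 := smooth_xp hs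
  have h2 := (hφ.dX_symbol j).sym_xp (fun q : T × 𝕀 => q.2) k
  have h3 := Sym.integral (T := T) (ϖ := fun _ X => br X.1.2 ^ (1 : ℝ))
    (f := fun _ t X => dX j φ (X.1.1 + t • X.2.1) X.1.2)
    (S := fineScale d) (k := k) (fun _ => h1)
  exact (fine_coord_xi j k).add ((h3 h2).congr_weight fun _ X _ => Real.rpow_one _)

lemma smooth_shiftV (hφ : IsSymbolPlus φ) : Smooth (shiftV φ) :=
  contDiff_euclidean.2 fun j => (sym_shiftC (T := Unit) hφ j 0).smooth ()

/-- The phase difference `⟨p, ξ⟩ + φ(x + p, ξ) - φ(x, ξ)`. -/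
def phaseDiff (φ : Fn d ℝ) (X : PhAmp d) : ℝ := ∑ j, X.2.1 j * shiftC φ j X

lemma phaseDiff_eq (hφ : Smooth (unc φ)) (X : PhAmp d) :
    phaseDiff φ X = inner ℝ X.2.1 X.1.2 + (φ (X.1.1 + X.2.1) X.1.2 - φ X.1.1 X.1.2) := by
  have h := segment_formula (f := fun ξ x => φ x ξ) (hφ.comp (contDiff_snd.prodMk contDiff_fst))
    X.1.2 X.1.1 X.2.1
  rw [h]
  simp only [phaseDiff, shiftC, mul_add, sum_add_distrib, PiLp.inner_apply]
  congr 1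
  exact sum_congr rfl fun j _ => by simp [mul_comm]

lemma sym_phaseDiff (hφ : IsSymbolPlus φ) (k : ℕ) :
    Sym (fineScale d) k (fun _ X => br X.1.2 * br X.2.1) (fun (_ : T) => phaseDiff φ) :=
  Sym.sum _ (fun j _ => ((fine_coord_w j k).mulR (sym_shiftC hφ j k)).congr_weight
    fun _ X _ => mul_comm _ _) fun _ X _ => (mul_pos (br_pos _) (br_pos _)).le

lemma smooth_phaseDiff (hφ : IsSymbolPlus φ) : Smooth (phaseDiff φ) :=
  (sym_phaseDiff (T := Unit) hφ 0).smooth ()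

lemma pd_phaseDiff (hφ : IsSymbolPlus φ) (j : Fin d) :
    pd (ed (Ph d) j) (phaseDiff φ) = (fun _ => 0) ∧
    pd (wd (Ph d) j) (phaseDiff φ) = fun X => X.1.2 j + dX j φ (X.1.1 + X.2.1) X.1.2 := by
  have hs : Smooth (unc φ) := hφ.smooth
  have e : phaseDiff φ = fun X => (∑ i, wL (Ph d) i X * X.1.2 i) +
      (unc φ (xpM d 1 X) - unc φ (xpM d 0 X)) := by
    funext X
    rw [phaseDiff_eq hs]
    simp [unc, xpM_apply, PiLp.inner_apply, mul_comm]
  have s1 : ∀ i : Fin d, Smooth fun X : PhAmp d =>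
      wL (Ph d) i X * X.1.2 i := fun i => by fun_prop
  have s2 : ∀ t, Smooth fun X => unc φ (xpM d t X) := fun t => hs.comp (xpM d t).contDiff
  have hi : ∀ l : Dirs.ι (PhAmp d), pd l (phaseDiff φ) = fun X =>
      (∑ i, (wL (Ph d) i (Dirs.b l) * X.1.2 i + X.2.1 i * (Dirs.b l).1.2 i)) +
      (fderiv ℝ (unc φ) (xpM d 1 X) (xpM d 1 (Dirs.b l)) -
        fderiv ℝ (unc φ) (xpM d 0 X) (xpM d 0 (Dirs.b l))) := by
    intro l
    rw [e, pd_add (ContDiff.sum fun i _ => s1 i) ((s2 1).sub (s2 0)), pd_sub (s2 1) (s2 0),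
      pd_sum _ fun i _ => s1 i]
    funext X
    refine congrArg₂ _ ?_ (congrArg₂ _ (pd_comp_clm (xpM d 1) hs l X) (pd_comp_clm (xpM d 0) hs l X))
    refine sum_congr rfl fun i _ => ?_
    have h2 := congrFun (pd_bilin (ContinuousLinearMap.mul ℝ ℝ) (wL (Ph d) i).contDiff
      ((proj i : Conf d →L[ℝ] ℝ).comp ((snd ℝ _ _).comp (fst ℝ (Ph d) (Ph d)))).contDiff l) X
    refine h2.trans ?_
    rw [pd_linear, pd_linear]
    rfl
  constructor
  · rw [hi]
    funext X
    simp [xpM, Prod.mk_zero_zero]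
  · rw [hi]
    funext X
    have h3 := congrFun (unc_dX hs j) (xpM d 1 X)
    rw [pd] at h3
    have h4 : xpM d 1 (Dirs.b (wd (Ph d) j)) = Dirs.b (E := Ph d) (Sum.inl j) := by simp [xpM]
    have h5 : xpM d 0 (Dirs.b (wd (Ph d) j)) = 0 := by simp [xpM, Prod.mk_zero_zero]
    rw [h4, h5, map_zero, sub_zero, ← h3]
    simp [unc, xpM_apply]

lemma sym_cexp_phaseDiff (hφ : IsSymbolPlus φ) (k : ℕ) :
    Sym ((zData d 1 1 11).scale d) k (fun _ _ => 1) (fun (_ : T) X => eI (phaseDiff φ X)) := by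
  refine Sym.cexp (θ := fun (_ : T) => phaseDiff φ) (fun _ => smooth_phaseDiff hφ) fun i n => ?_
  have h1 := (((sym_phaseDiff (T := T) hφ k).pd i (by rw [fine_cost]; exact Nat.zero_le _)).mono_k
    (k' := k) (by rw [fine_cost]; exact le_rfl)).of_fine (r := 1) (s := 1) (a := 11)
    (fun _ X => mul_nonneg (mul_pos (br_pos _) (br_pos _)).le (Scale.pos _ _ _).le)
    (by norm_num) (by norm_num)
  have p0 := fun X : PhAmp d => br_pos X.1.2
  have p1 := fun X : PhAmp d => br_pos X.2.1
  have p2 := fun X : PhAmp d => br_pos X.2.2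
  have h11 : ∀ X : PhAmp d, br X.2.1 * (br X.2.1 * br X.2.2) ^ 10 ≤
      (br X.2.1 * br X.2.2) ^ 11 := fun X => by
    rw [pow_succ' _ 10]
    exact mul_le_mul_of_nonneg_right (le_mul_of_one_le_right (p1 X).le (one_le_br _))
      (pow_pos (mul_pos (p1 X) (p2 X)) _).le
  rcases i with (i | i) | i | i
  · refine (h1.mono_le fun _ X _ => ?_).bd n
    rw [fine_x]
    change _ ≤ br X.1.2 ^ 1 * (br X.2.1 * br X.2.2) ^ 11
    rw [pow_one, mul_assoc]
    exact mul_le_mul_of_nonneg_left (h11 X) (p0 X).le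
  · refine (h1.mono_le fun _ X _ => ?_).bd n
    rw [fine_xi]
    change _ ≤ br X.1.2 ^ (1 : ℝ) * (br X.2.1 * br X.2.2) ^ 11
    rw [Real.rpow_one]
    calc _ = br X.1.2 * (br X.1.2)⁻¹ *
          (br X.2.1 * (br X.2.1 * br X.2.2) ^ 10) := by ring
      _ = br X.2.1 * (br X.2.1 * br X.2.2) ^ 10 := by
          rw [mul_inv_cancel₀ (p0 X).ne', one_mul]
      _ ≤ _ := (h11 X).trans (le_mul_of_one_le_left (pow_pos (mul_pos (p1 X) (p2 X)) _).le
          (one_le_br _))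
  · refine (h1.mono_le fun _ X _ => le_of_eq ?_).bd n
    rw [show (fineScale d).wt (Sum.inr (Sum.inl i)) X = _ from fine_w i X]
    change _ = br X.1.2 ^ 1 * br X.2.1 ^ 11
    ring
  · rw [show (fun _ : T => pd (Sum.inr (Sum.inr i)) (phaseDiff φ)) = fun _ _ => 0 from
      funext fun _ => (pd_phaseDiff hφ i).1]
    exact Bd.zero fun _ _ _ => (Scale.pos _ _ _).le

lemma hasFDerivAt_gradX (hφ : Smooth (unc φ)) (x ξ : Conf d) : HasFDerivAt (gradX φ x)
      (Matrix.toEuclideanCLM (𝕜 := ℝ) (n := Fin d) (mixedHessian φ x ξ)) ξ := by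
  rw [← hasFDerivWithinAt_univ, hasFDerivWithinAt_euclidean]
  intro j
  rw [hasFDerivWithinAt_univ]
  have h1 : Smooth (dX j φ x) :=
    (show Smooth (unc (dX j φ)) from smooth_dX hφ j).comp (contDiff_const.prodMk contDiff_id)
  refine (smooth_diffAt h1 ξ).hasFDerivAt.congr_fderiv (ContinuousLinearMap.ext fun σ => ?_)
  rw [fderiv_eq_sum_pd]
  have h2 : (Matrix.toEuclideanCLM (𝕜 := ℝ) (n := Fin d) (mixedHessian φ x ξ) σ) j =
      ∑ k, dX j (dXi k φ) x ξ * σ k := by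
    rw [Matrix.ofLp_toEuclideanCLM]
    rfl
  refine Eq.trans (sum_congr rfl fun k _ => ?_) h2.symm
  rw [smul_eq_mul, mul_comm, co_conf, ← dXi_dX hφ j k]
  exact congrArg (fderiv ℝ (dX j φ x) ξ · * σ k) (b_conf k)

lemma exists_norm_gradX_le (hU : IsGeneratingPhase U) : ∃ δ C : ℝ, 0 ≤ δ ∧ δ < 1 ∧ 0 ≤ C ∧
    ∀ x ξ, ‖gradX (phaseRemainder U) x ξ‖ ≤ δ * ‖ξ‖ + C := by
  obtain ⟨δ, h0, h1, hδ⟩ := hU.hessian_lt_one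
  set φ := phaseRemainder U with hφU
  have hφ : Smooth (unc φ) := hU.remainder.smooth
  choose C hC hb using fun j => ((hU.remainder.dX_symbol j).sym (T := Unit) 0).bound
  refine ⟨δ, ∑ j, C j, h0, h1, sum_nonneg fun j _ => hC j, fun x ξ => ?_⟩
  have h2 : ‖gradX φ x ξ - gradX φ x 0‖ ≤ δ * ‖ξ - 0‖ :=
    Convex.norm_image_sub_le_of_norm_hasFDerivWithin_le (s := Set.univ)
      (fun η _ => (hasFDerivAt_gradX hφ x η).hasFDerivWithinAt) (fun η _ => hδ x η) convex_univ
      trivial trivial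
  have h3 : ‖gradX φ x 0‖ ≤ ∑ j, C j := (norm_le_sum_coord _).trans (sum_le_sum fun j _ => by
      simpa [bracket, gradX, unc] using hb j () (x, 0) trivial)
  have h4 := norm_le_insert' (gradX φ x ξ) (gradX φ x 0)
  rw [sub_zero] at h2
  linarith

lemma shiftV_eq (hφ : Smooth (unc φ)) (X : PhAmp d) :
    shiftV φ X = X.1.2 + ∫ t in 0..1, gradX φ (X.1.1 + t • X.2.1) X.1.2 := by
  have h1 : Continuous fun t : ℝ => gradX φ (X.1.1 + t • X.2.1) X.1.2 := by
    refine (contDiff_euclidean.2 fun j => ?_ : Smooth _).continuous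
    exact (smooth_dX hφ j).comp (by fun_prop : Smooth fun t : ℝ =>
      ((X.1.1 + t • X.2.1, X.1.2) : Ph d))
  ext j
  have h2 := (proj j : Conf d →L[ℝ] ℝ).intervalIntegral_comp_comm
    (h1.intervalIntegrable (μ := volume) 0 1)
  exact congrArg (X.1.2 j + ·) h2

/-- A constant quantifying how far `ξ + ∇_x φ(x, ξ)` stays from the low frequencies. -/
structure Gap (φ : Fn d ℝ) (N : ℝ) : Prop where
  one_le : 1 ≤ N
  low : ∃ C : ℝ, 0 ≤ C ∧ ∀ y ξ η : Conf d, N * br η ≤ br ξ → br ξ ≤ C * ‖ξ + gradX φ y ξ - η‖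
  lt_shift : ∀ X, br X.1.2 < N * br (shiftV φ X)
  shift_le : ∀ X, br (shiftV φ X) ≤ N * br X.1.2

lemma exists_gap (hU : IsGeneratingPhase U) : ∃ N, Gap (phaseRemainder U) N := by
  obtain ⟨δ, C, h0, h1, hC, hb⟩ := exists_norm_gradX_le hU
  set φ := phaseRemainder U with hφU
  have hφ : Smooth (unc φ) := hU.remainder.smooth
  have hδ : 0 < 1 - δ := by linarith
  set N := 2 * (3 + C) / (1 - δ) with hN
  have hN1 : 2 * (3 + C) ≤ N := by
    rw [hN, le_div_iff₀ hδ]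
    nlinarith
  have hNδ : (1 - δ) * N = 2 * (3 + C) := by rw [hN]; field_simp
  have hs : ∀ X, ‖shiftV φ X - X.1.2‖ ≤ δ * ‖X.1.2‖ + C := fun X => by
    rw [shiftV_eq hφ, add_sub_cancel_left]
    have := intervalIntegral.norm_integral_le_of_norm_le_const (a := 0) (b := 1)
      (f := fun t : ℝ => gradX φ (X.1.1 + t • X.2.1) X.1.2) fun t _ => hb (X.1.1 + t • X.2.1) X.1.2
    simpa using this
  have lower : ∀ ξ s : Conf d, ‖s - ξ‖ ≤ δ * ‖ξ‖ + C → (1 - δ) * br ξ ≤ 1 + C + ‖s‖ :=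
    fun ξ s h => by
      have h2 := norm_sub_norm_le ξ (ξ - s)
      rw [sub_sub_cancel, norm_sub_rev ξ s] at h2
      have h3 := mul_le_mul_of_nonneg_left (br_le_one_add ξ) hδ.le
      nlinarith
  refine ⟨N, by linarith, ⟨2 / (1 - δ), by positivity, fun y ξ η h => ?_⟩, fun X => ?_, fun X => ?_⟩
  · rw [div_mul_eq_mul_div, le_div_iff₀ hδ]
    have h2 := lower ξ (ξ + gradX φ y ξ) (by rw [add_sub_cancel_left]; exact hb y ξ)
    have h3 := norm_le_insert' (ξ + gradX φ y ξ) η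
    have h4 := norm_le_br η
    have h5 := one_le_br η
    have h6 : 2 * (3 + C) * br η ≤ (1 - δ) * br ξ := by
      rw [← hNδ, mul_assoc]
      exact mul_le_mul_of_nonneg_left h hδ.le
    nlinarith
  · have h2 := lower X.1.2 (shiftV φ X) (hs X)
    have h3 := norm_le_br (shiftV φ X)
    have h4 := one_le_br (shiftV φ X)
    refine lt_of_mul_lt_mul_left ?_ hδ.le
    rw [← mul_assoc, hNδ]
    nlinarith
  · have h2 := norm_le_insert' (shiftV φ X) X.1.2
    have h3 := hs X
    have h4 := br_le_one_add (shiftV φ X)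
    have h5 := norm_le_br X.1.2
    have h6 := one_le_br X.1.2
    nlinarith

/-- The scale on `((x, ξ), η)` in which derivatives in `ξ` and `η` gain `⟨ξ⟩⁻¹`. -/
def cutScale (D : Set (Par d)) : Scale (Par d) where
  wt := Sum.elim (Sum.elim (fun _ _ => 1) (fun _ z => (br z.1.2)⁻¹)) (fun _ z => (br z.1.2)⁻¹)
  pos := by
    rintro ((i | i) | i) z
    · exact one_pos
    · exact inv_pos.2 (br_pos _)
    · exact inv_pos.2 (br_pos _)
  cost := fun _ => 0
  dom := D

/-- A smooth cut-off to the region `⟨η⟩ ≪ ⟨ξ⟩`. -/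
def lowCut (N : ℝ) (z : Par d) : ℂ := ccut ((2 * N ^ 2 * ((1 + ‖z.2‖ ^ 2) * (1 + ‖z.1.2‖ ^ 2)⁻¹)) •
    (single 0 1 : Conf 1))

lemma lowCut_arg (z : Par d) : 2 * N ^ 2 * ((1 + ‖z.2‖ ^ 2) * (1 + ‖z.1.2‖ ^ 2)⁻¹) =
    2 * (N * br z.2) ^ 2 / br z.1.2 ^ 2 := by
  rw [← br_sq, ← br_sq]
  ring

lemma lowCut_eq_zero (hN : 1 ≤ N) {z : Par d} (h : br z.1.2 ≤ N * br z.2) : lowCut N z = 0 := by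
  refine ccut_eq_zero ?_
  rw [norm_smul, PiLp.norm_single, norm_one, mul_one, lowCut_arg, Real.norm_eq_abs]
  refine le_trans ?_ (le_abs_self _)
  rw [le_div_iff₀ (pow_pos (br_pos _) 2)]
  have := pow_le_pow_left₀ (br_pos _).le h 2
  linarith

lemma lowCut_eq_one {z : Par d} (h : 2 * N * br z.2 ≤ br z.1.2) (hN : 1 ≤ N) : lowCut N z = 1 := by
  rw [lowCut, ccut, cut_eq_one, Complex.ofReal_one]
  rw [norm_smul, PiLp.norm_single, norm_one, mul_one, lowCut_arg, Real.norm_of_nonneg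
    (by positivity), div_le_one (pow_pos (br_pos _) 2)]
  have h0 : 0 < N * br z.2 := mul_pos (by linarith) (br_pos _)
  have := pow_le_pow_left₀ (by linarith) h 2
  nlinarith

lemma sym_lowCut (hN : 1 ≤ N) (k : ℕ) :
    Sym (cutScale (d := d) Set.univ) k (fun _ _ => 1) (fun _ : T => lowCut N) := by
  set D : Set (Par d) := {z | N * br z.2 ≤ br z.1.2} with hD
  have hle : ∀ z ∈ D, br z.2 ≤ br z.1.2 := fun z hz =>
    (le_mul_of_one_le_left (br_pos _).le hN).trans hz
  have h0 : ∀ z : Par d, br z.1.2 * (br z.1.2)⁻¹ = 1 := fun z =>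
    mul_inv_cancel₀ (br_pos _).ne'
  have hl : ∀ L : Par d →L[ℝ] ℝ, (∀ z ∈ D, |L z| ≤ br z.1.2) →
      (∀ i : Fin d, L (Dirs.b (E := Par d) (Sum.inl (Sum.inl i))) = 0) →
      (∀ i : Fin d, |L (Dirs.b (E := Par d) (Sum.inl (Sum.inr i)))| ≤ 1) →
      (∀ i : Fin d, |L (Dirs.b (E := Par d) (Sum.inr i))| ≤ 1) →
      Sym (cutScale D) k (fun _ z => br z.1.2) (fun (_ : T) z => L z) := by
    intro L h1 h2 h3 h4
    refine Sym.linear (fun _ => L) ⟨1, zero_le_one, fun _ z hz => by rw [one_mul]; exact h1 z hz⟩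
      ?_ fun _ z _ => (br_pos _).le
    rintro ((i | i) | i)
    · exact ⟨0, le_rfl, fun _ z _ => by rw [h2, norm_zero, zero_mul]⟩
    · refine ⟨1, zero_le_one, fun _ z _ => ?_⟩
      change _ ≤ 1 * (br z.1.2 * (br z.1.2)⁻¹)
      rw [h0, one_mul]
      exact h3 i
    · refine ⟨1, zero_le_one, fun _ z _ => ?_⟩
      change _ ≤ 1 * (br z.1.2 * (br z.1.2)⁻¹)
      rw [h0, one_mul]
      exact h4 i
  have hξ : ∀ j : Fin d, Sym (cutScale D) k (fun _ z => br z.1.2)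
      (fun (_ : T) z => z.1.2 j) := fun j =>
    hl (co (E := Par d) (Sum.inl (Sum.inr j))) (fun z _ => by
      rw [co_par_xi]; exact abs_coord_le_br _ _) (fun i => by simp)
      (fun i => by simpa using abs_single_le i j) fun i => by simp [Prod.mk_zero_zero]
  have hη : ∀ j : Fin d, Sym (cutScale D) k (fun _ z => br z.1.2)
      (fun (_ : T) z => z.2 j) := fun j =>
    hl (co (E := Par d) (Sum.inr j)) (fun z hz => by
      rw [co_par_p]; exact (abs_coord_le_br _ _).trans (hle z hz)) (fun i => by simp)
      (fun i => by simp) fun i => by simpa using abs_single_le i j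
  have e2 : Sym (cutScale D) k (fun _ z => br z.1.2 * br z.1.2)
      (fun (_ : T) z => 1 + ‖z.2‖ ^ 2) := by
    have h1 : Sym (cutScale D) k (fun _ z => br z.1.2 * br z.1.2)
        (fun (_ : T) _ => (1 : ℝ)) := Sym.const _ ⟨1, zero_le_one, fun _ z _ => by
      rw [norm_one, one_mul]
      exact one_le_mul (one_le_br _) (one_le_br _)⟩ fun _ z _ =>
      (mul_pos (br_pos _) (br_pos _)).le
    refine cast (congrArg _ (funext fun t => funext fun z => ?_)) (h1.add (Sym.sum univ
      (fun j _ => (hη j).mulR (hη j)) fun _ z _ => (mul_pos (br_pos _) (br_pos _)).le))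
    rw [norm_sq_eq]
  have e3 : Sym (cutScale D) k (fun _ _ => 1)
      (fun (_ : T) z => 2 * N ^ 2 * ((1 + ‖z.2‖ ^ 2) * (1 + ‖z.1.2‖ ^ 2)⁻¹)) := by
    refine ((Sym.const (ϖ := fun _ _ => 1) (fun _ : T => 2 * N ^ 2) ⟨‖2 * N ^ 2‖, norm_nonneg _,
      fun _ _ _ => (mul_one _).ge⟩ fun _ _ _ => zero_le_one).mulR (e2.mulR
        (sym_inv_one_add_sq hξ))).congr_weight fun _ z _ => ?_
    rw [one_mul, Real.rpow_neg (br_pos _).le, Real.rpow_two, ← pow_two]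
    exact mul_inv_cancel₀ (pow_pos (br_pos _) 2).ne'
  have e4 : Sym (cutScale D) k (fun _ _ => 1) (fun _ : T => lowCut N) := by
    have hc : Sym (unitScale (Conf 1)) k (fun _ _ => 1) (fun _ : T => ccut (d := 1)) :=
      sym_of_compact smooth_ccut ccut_compact k
    have h4 := Sym.comp (S := cutScale D) hc
      (χ := fun _ z => (2 * N ^ 2 * ((1 + ‖z.2‖ ^ 2) * (1 + ‖z.1.2‖ ^ 2)⁻¹)) •
        (single 0 1 : Conf 1)) (fun t => (e3.smooth t).smul contDiff_const)
      (fun _ _ _ => trivial) (fun _ _ => Or.inl (Nat.zero_le _)) (fun _ _ _ => zero_le_one)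
    refine h4 fun i j n => ?_
    have h5 := (e3.pd i (Nat.zero_le _)).bd n
    refine Bd.congr_weight ?_ fun _ X _ => (div_one _).symm
    simpa [Fin.fin_one_eq_zero j, cutScale] using h5
  refine Sym.of_support (S₁ := cutScale D) (S₂ := cutScale Set.univ) e4 ?_ rfl rfl
    (fun _ z hz => ?_) fun _ _ _ => zero_le_one
  · exact isClosed_le ((continuous_br.comp continuous_snd).const_mul N)
      (continuous_br.comp (continuous_snd.comp continuous_fst))
  · exact lowCut_eq_zero hN (not_le.1 hz).le

/-- The part of a symbol `a(x, η)` away from the region `⟨η⟩ ≪ ⟨ξ⟩`. -/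
def highSym (N : ℝ) (a : Fn d ℂ) (z : Par d) : ℂ := (1 - lowCut N z) * a z.1.1 z.2

/-- The map `((x, ξ), η) ↦ (x, η)`. -/
def xetaM (d : ℕ) : Par d →L[ℝ] Ph d := ((fst ℝ (Conf d) (Conf d)).comp (fst ℝ _ _)).prod
    (snd ℝ _ _)

lemma sym_highSym (hN : 1 ≤ N) {m : ℝ} {a : Fn d ℂ} (ha : IsSymbol m a) (k : ℕ) :
    Sym (cutScale (d := d) Set.univ) k (fun _ z => br z.2 ^ m) (fun _ : T => highSym N a) := by
  set D : Set (Par d) := {z | br z.1.2 ≤ 2 * N * br z.2} with hD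
  have h1 : Sym (cutScale D) k (fun _ z => br z.2 ^ m) (fun (_ : T) z => a z.1.1 z.2) := by
    refine (ha.sym k).compLin (fun _ => xetaM d) (fun _ _ _ => trivial)
      (fun _ _ _ => (br_rpow_pos _ _).le) ?_
    rintro ((i | i) | i) (j | j)
    · refine Or.inl ⟨le_rfl, |(single i (1 : ℝ) : Conf d) j|, abs_nonneg _, fun t X _ => ?_⟩
      exact mul_le_mul (by simp [xetaM]) le_rfl zero_le_one (abs_nonneg _)
    · right; intro t; simp [xetaM]
    · right; intro t; simp [xetaM]
    · right; intro t; simp [xetaM]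
    · right; intro t; simp [xetaM]
    · refine Or.inl ⟨le_rfl, 2 * N, by linarith, fun t X hX => ?_⟩
      refine (mul_le_of_le_one_left (Scale.pos _ _ _).le
        (le_trans (by simp [xetaM]) (abs_single_le i j))).trans ?_
      change (br X.2)⁻¹ ≤ 2 * N * (br X.1.2)⁻¹
      rw [← div_eq_mul_inv, le_div_iff₀ (br_pos _), inv_mul_le_iff₀ (br_pos _), mul_comm]
      exact hX
  have h2 : Sym (cutScale (d := d) Set.univ) k (fun _ _ => 1)
      (fun (_ : T) z => 1 - lowCut N z) := (Sym.const _ ⟨1, zero_le_one, fun _ _ _ => by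
    rw [norm_one, one_mul]⟩ fun _ _ _ => zero_le_one).sub (sym_lowCut hN k)
  have h3 : Sym (cutScale D) k (fun _ _ => 1) (fun (_ : T) z => 1 - lowCut N z) :=
    h2.rescale (Set.subset_univ _) (fun _ => le_rfl) le_rfl
      (fun i => ⟨1, zero_le_one, fun X _ => (one_mul _).ge⟩)
      (fun _ _ _ => zero_le_one) ⟨1, zero_le_one, fun _ _ _ => (one_mul _).ge⟩
  have h4 : Sym (cutScale D) k (fun _ z => br z.2 ^ m) (fun _ : T => highSym N a) :=
    (h3.mul h1).congr_weight fun _ _ _ => one_mul _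
  refine Sym.of_support (S₁ := cutScale D) (S₂ := cutScale Set.univ) h4 ?_ rfl rfl
    (fun _ z hz => ?_) fun _ _ _ => (br_rpow_pos _ _).le
  · exact isClosed_le (continuous_br.comp (continuous_snd.comp continuous_fst))
      ((continuous_br.comp continuous_snd).const_mul (2 * N))
  · rw [highSym, lowCut_eq_one (not_le.1 hz).le hN, sub_self, zero_mul]

/-- The scale with weights `(⟨p⟩⟨η⟩)^10`, `⟨p⟩^10`, `1` on a given domain. -/
def flatScale (D : Set (PhAmp d)) : Scale (PhAmp d) :=
  { (zData d 0 0 10).scale d with dom := D }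

lemma Sym.flat_of_fine {k : ℕ} {D : Set (PhAmp d)} {ϖ : T → PhAmp d → ℝ} {f : T → PhAmp d → F}
    (hf : Sym (fineScale d) k ϖ f) (h0 : ∀ t X, 0 ≤ ϖ t X) : Sym (flatScale D) k ϖ f :=
  (hf.of_fine (r := 0) (s := 0) (a := 10) h0 (by norm_num) le_rfl).rescale (fun _ _ => trivial)
    (fun _ => le_rfl) le_rfl (fun i => ⟨1, zero_le_one, fun X _ => (one_mul _).ge⟩)
    (fun t X _ => h0 t X) ⟨1, zero_le_one, fun _ _ _ => (one_mul _).ge⟩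

lemma one_le_flat (D : Set (PhAmp d)) (i : Dirs.ι (PhAmp d))
    (X : PhAmp d) : 1 ≤ (flatScale D).wt i X := by
  have h := one_le_pow_br X
  rcases i with (i | i) | i | i
  · change 1 ≤ br X.1.2 ^ 0 * (br X.2.1 * br X.2.2) ^ 10
    rwa [pow_zero, one_mul]
  · change 1 ≤ br X.1.2 ^ (0 : ℝ) * (br X.2.1 * br X.2.2) ^ 10
    rwa [Real.rpow_zero, one_mul]
  · exact OscData.one_le_wt_w (zData d 0 0 10) (i : Fin d) X
  · exact le_rfl

/-- The gradient in `p` of the full phase `⟨p, ξ - η⟩ + φ(x + p, ξ)`. -/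
def slope (φ : Fn d ℝ) (X : PhAmp d) : Conf d := X.1.2 + gradX φ (X.1.1 + X.2.1) X.1.2 - X.2.2

lemma sym_slope (hφ : IsSymbolPlus φ) {D : Set (PhAmp d)}
    (hD : ∃ C : ℝ, 0 ≤ C ∧ ∀ X ∈ D, br X.1.2 ≤ C * br (slope φ X)) (j : Fin d) (k : ℕ) :
    Sym (flatScale D) k (fun _ X => br (slope φ X)) (fun (_ : T) X => slope φ X j) := by
  obtain ⟨C, hC, hb⟩ := hD
  have h1 : Sym (flatScale D) k (fun _ X => br X.1.2)
      (fun (_ : T) X => dX j φ (X.1.1 + X.2.1) X.1.2) := by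
    have h := ((hφ.dX_symbol j).sym_xp (fun _ : T => (⟨1, by simp⟩ : 𝕀)) k).flat_of_fine
      (D := D) fun _ X => (br_rpow_pos _ _).le
    simpa using h
  obtain ⟨C', hC', hb'⟩ := h1.bound
  have h2 := h1.mono (ϖ₂ := fun _ X => br (slope φ X)) ⟨C, hC, fun _ X hX => hb X hX⟩
  set L : PhAmp d →L[ℝ] ℝ := (proj j : Conf d →L[ℝ] ℝ).comp ((snd ℝ _ _).comp (fst ℝ _ _)) -
      eL (Ph d) j with hL
  have h3 : Sym (flatScale D) k (fun _ X => br (slope φ X)) (fun (_ : T) X => L X) := by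
    refine Sym.linear (fun _ => L) ⟨1 + C' * C, by positivity, fun t X hX => ?_⟩
      (fun i => ⟨|L (Dirs.b i)|, abs_nonneg _, fun t X _ => ?_⟩) fun _ X _ => (br_pos _).le
    · have e : L X = slope φ X j - dX j φ (X.1.1 + X.2.1) X.1.2 := by
        simp [hL, slope, gradX]
        ring
      change ‖L X‖ ≤ (1 + C' * C) * br (slope φ X)
      rw [e]
      have b1 := hb' t X hX
      have b2 := mul_le_mul_of_nonneg_left (hb X hX) hC'
      have b3 := abs_coord_le_br (slope φ X) j
      have b4 := norm_sub_le (slope φ X j) (dX j φ (X.1.1 + X.2.1) X.1.2)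
      rw [Real.norm_eq_abs (slope φ X j)] at b4
      linarith
    · exact le_mul_of_one_le_right (abs_nonneg _) (one_le_mul (one_le_br _) (one_le_flat _ _ _))
  refine cast (congrArg _ (funext fun t => funext fun X => ?_)) (h2.add h3)
  simp [slope, gradX, hL]
  ring

def slopeC (φ : Fn d ℝ) (j : Fin d) (X : PhAmp d) : ℂ :=
  ((slope φ X j * (1 + ‖slope φ X‖ ^ 2)⁻¹ : ℝ) : ℂ)

def slopeI (φ : Fn d ℝ) (X : PhAmp d) : ℂ := (((1 + ‖slope φ X‖ ^ 2)⁻¹ : ℝ) : ℂ)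

lemma sym_slopeC (hφ : IsSymbolPlus φ) {D : Set (PhAmp d)}
    (hD : ∃ C : ℝ, 0 ≤ C ∧ ∀ X ∈ D, br X.1.2 ≤ C * br (slope φ X)) (k : ℕ) :
    (∀ j, Sym (flatScale D) k (fun _ X => (br X.1.2)⁻¹) (fun (_ : T) => slopeC φ j)) ∧
    Sym (flatScale D) k (fun _ X => (br X.1.2)⁻¹) (fun (_ : T) => slopeI φ) := by
  obtain ⟨C, hC, hb⟩ := id hD
  have h1 := sym_inv_one_add_sq (T := T) fun j => sym_slope hφ hD j k
  have key : ∀ X ∈ D, (br (slope φ X))⁻¹ ≤ C * (br X.1.2)⁻¹ := fun X hX => by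
    rw [← div_eq_mul_inv, le_div_iff₀ (br_pos _), inv_mul_le_iff₀ (br_pos _), mul_comm]
    exact hb X hX
  have e : ∀ X, br (slope φ X) ^ (-2 : ℝ) = (br (slope φ X))⁻¹ * (br (slope φ X))⁻¹ :=
    fun X => by rw [Real.rpow_neg (br_pos _).le, Real.rpow_two, pow_two, mul_inv]
  refine ⟨fun j => (((sym_slope hφ hD j k).mulR h1).mono ⟨C, hC, fun _ X hX => ?_⟩).ofReal,
    (h1.mono ⟨C, hC, fun _ X hX => ?_⟩).ofReal⟩
  · rw [e, ← mul_assoc, mul_inv_cancel₀ (br_pos _).ne', one_mul]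
    exact key X hX
  · rw [e]
    exact (mul_le_of_le_one_left (inv_nonneg.2 (br_pos _).le)
      (inv_le_one_of_one_le₀ (one_le_br _))).trans (key X hX)

/-- Integration by parts in `p` against the phase `⟨p, ξ - η⟩ + φ(x + p, ξ)`. -/
def slopeStep (φ : Fn d ℝ) (f : PhAmp d → ℂ) (X : PhAmp d) : ℂ :=
  slopeI φ X * f X + ∑ j, I * pd (wd (Ph d) j) (fun X => slopeC φ j X * f X) X

lemma Sym.slopeStep (hφ : IsSymbolPlus φ) {D : Set (PhAmp d)}
    (hD : ∃ C : ℝ, 0 ≤ C ∧ ∀ X ∈ D, br X.1.2 ≤ C * br (slope φ X)) {k : ℕ}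
    {μ r s : ℝ} {f : T → PhAmp d → ℂ}
    (hf : Sym (flatScale D) k (fun _ => wgt (fun z => br z.2 ^ μ) r s) f) :
    Sym (flatScale D) k (fun _ => wgt (fun z => br z.2 ^ (μ - 1)) (r + 10) s)
      (fun t => slopeStep φ (f t)) := by
  obtain ⟨h1, h2⟩ := sym_slopeC (T := T) hφ hD k
  have h0 : ∀ r s (X : PhAmp d), 0 ≤ wgt (fun z : Ph d => br z.2 ^ (μ - 1)) r s X := fun r s =>
      wgt_nonneg fun z => (br_rpow_pos _ _).le
  have e : ∀ X : PhAmp d, (br X.1.2)⁻¹ * wgt (fun z : Ph d => br z.2 ^ μ) r s X =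
      wgt (fun z => br z.2 ^ (μ - 1)) r s X := fun X => by
    simp only [wgt, Real.rpow_sub_one (br_pos X.1.2).ne']
    ring
  refine ((h2.mul hf).mono_le fun _ X _ => ?_).add (Sym.sum _ (fun j _ => Sym.constMul ?_ _)
    fun _ X _ => h0 _ _ X)
  · rw [e]
    exact wgt_mono (fun z => (br_rpow_pos _ _).le) (by linarith) le_rfl X
  · refine (((h1 j).mul hf).pd (wd (Ph d) j) (Nat.zero_le _)).congr_weight fun _ X _ => ?_
    rw [e]
    change wgt _ r s X * (br X.1.2 ^ 0 * br X.2.1 ^ 10) = _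
    simp only [wgt, Real.rpow_add (br_pos X.2.1)]
    norm_cast
    ring

lemma slopeStep_eq_zero {D : Set (PhAmp d)} (hD : IsClosed D)
    {f : PhAmp d → ℂ} (h : ∀ X ∉ D, f X = 0) : ∀ X ∉ D, slopeStep φ f X = 0 := by
  intro X hX
  rw [slopeStep, h X hX, mul_zero, zero_add]
  refine sum_eq_zero fun j _ => ?_
  have h1 : (fun X => slopeC φ j X * f X) =ᶠ[𝓝 X] fun _ => 0 := by
    filter_upwards [hD.isOpen_compl.mem_nhds hX] with Y hY
    rw [h Y hY, mul_zero]
  rw [pd, h1.fderiv_eq]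
  simp

lemma slope_eq (φ : Fn d ℝ) (X : PhAmp d) (j : Fin d) :
    slope φ X j = X.1.2 j + dX j φ (X.1.1 + X.2.1) X.1.2 - X.2.2 j := by simp [slope, gradX]

def phaseExp (φ : Fn d ℝ) (X : PhAmp d) : ℂ := eI (phaseDiff φ X)

lemma osc_phaseExp (hφ : IsSymbolPlus φ) (z : Ph d) : Osc z (phaseExp φ) :=
  ((sym_cexp_phaseDiff (T := Unit) hφ 0).congr_weight (ϖ₂ := fun _ => wgt (fun _ => 1) 0 0)
    fun _ X _ => by simp [wgt]).toOsc rfl (fun _ => zero_le_one) trivial ()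

lemma osc_slope (hφ : IsSymbolPlus φ) (z : Ph d) :
    (∀ j, Osc z (slopeC φ j)) ∧ Osc z (slopeI φ) := by
  have hD : ∃ C : ℝ, 0 ≤ C ∧ ∀ X ∈ {X : PhAmp d | X.1 ∈ ({z} : Set _)},
      br X.1.2 ≤ C * br (slope φ X) := ⟨br z.2, (br_pos _).le, fun X hX => by
    rw [show X.1 = z from hX]
    exact le_mul_of_one_le_right (br_pos _).le (one_le_br _)⟩
  obtain ⟨h1, h2⟩ := sym_slopeC (T := Unit) hφ hD 0
  have key : ∀ f : PhAmp d → ℂ, Sym (flatScale {X | X.1 ∈ ({z} : Set _)}) 0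
      (fun _ X => (br X.1.2)⁻¹) (fun _ : Unit => f) → Osc z f := fun f h => by
    have h' : Sym (OscData.scale { zData d 0 0 10 with D := {z} } d) 0
      (fun _ => wgt (fun z => (br z.2)⁻¹) 0 0) (fun _ : Unit => f) :=
        h.congr_weight fun _ X _ => by simp [wgt]
    exact h'.toOsc rfl (fun z => inv_nonneg.2 (br_pos _).le) rfl ()
  exact ⟨fun j => key _ (h1 j), key _ h2⟩

lemma osc_slopeStep (hφ : IsSymbolPlus φ) {z : Ph d}
    {f : PhAmp d → ℂ} (hf : Osc z f) : Osc z (slopeStep φ f) ∧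
    osc (fun q => phaseExp φ (z, q) * slopeStep φ f (z, q)) =
      osc (fun q => phaseExp φ (z, q) * f (z, q)) := by
  obtain ⟨o1, o2⟩ := osc_slope hφ z
  have o3 := osc_phaseExp hφ z
  refine ⟨(o2.mul hf).add (Osc.sum _ fun j _ => (((o1 j).mul hf).pd_w j).const_mul _), ?_⟩
  set F : Fin d → PhAmp d → ℂ := fun j X => phaseExp φ X * (slopeC φ j X * f X) with hF
  have oF : ∀ j, Osc z (F j) := fun j => o3.mul ((o1 j).mul hf)
  have hpd : ∀ j X, pd (wd (Ph d) j) (F j) X = I *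
      ((X.1.2 j + dX j φ (X.1.1 + X.2.1) X.1.2 : ℝ) : ℂ) * F j X +
        phaseExp φ X * pd (wd (Ph d) j) (fun X => slopeC φ j X * f X) X := fun j X => by
    have h1 := congrFun (Osc.pd_mul o3.smooth ((o1 j).mul hf).smooth (wd (Ph d) j)) X
    have h2 := congrFun (pd_cexp (smooth_phaseDiff hφ) (wd (Ph d) j)) X
    rw [(pd_phaseDiff hφ j).2] at h2
    refine h1.trans ?_
    rw [show pd (wd (Ph d) j) (phaseExp φ) X = _ from h2]
    simp only [hF, phaseExp]
    ring
  have hsum : ∀ X, f X = slopeI φ X * f X + ∑ j, (slope φ X j : ℂ) * (slopeC φ j X * f X) :=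
    fun X => by
      simp only [← mul_assoc]
      rw [← sum_mul, ← add_mul]
      have h1 : (1 + ‖slope φ X‖ ^ 2) * (1 + ‖slope φ X‖ ^ 2)⁻¹ = 1 :=
        mul_inv_cancel₀ (one_add_sq_ne _)
      have h2 : slopeI φ X + ∑ j, (slope φ X j : ℂ) * slopeC φ j X = 1 := by
        have h3 : ∀ c : ℝ, ‖slope φ X‖ ^ 2 * c = ∑ j, slope φ X j * (slope φ X j * c) := fun c => by
          rw [norm_sq_eq, sum_mul]
          simp only [mul_assoc]
        rw [← Complex.ofReal_one, ← h1, one_add_mul, h3]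
        push_cast [slopeI, slopeC]
        rfl
      rw [h2, one_mul]
  have e : ∀ X, phaseExp φ X * slopeStep φ f X = phaseExp φ X * f X +
      ∑ j, (I * pd (wd (Ph d) j) (F j) X + (X.2.2 j : ℂ) * F j X) := fun X => by
    rw [hsum X]
    rw [slopeStep, mul_add, mul_add, add_assoc, mul_sum, mul_sum, ← sum_add_distrib]
    congr 1
    refine sum_congr rfl fun j _ => ?_
    rw [hpd, slope_eq]
    simp only [hF]
    push_cast
    linear_combination (-((X.1.2 j : ℂ) + ((dX j φ (X.1.1 + X.2.1) X.1.2 : ℝ) : ℂ)) *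
      (phaseExp φ X * (slopeC φ j X * f X))) * Complex.I_mul_I
  have oj : ∀ j, Osc z (fun X => (X.2.2 j : ℂ) * F j X) := fun j => (Osc.coord_e j).mul (oF j)
  have oi : ∀ j, Osc z (fun X => I * pd (wd (Ph d) j) (F j) X) := fun j =>
    ((oF j).pd_w j).const_mul _
  simp only [e]
  rw [(o3.mul hf).osc_add (Osc.sum _ fun j _ => (oi j).add (oj j)),
    Osc.osc_sum _ fun j _ => (oi j).add (oj j)]
  refine add_eq_left.2 (sum_eq_zero fun j _ => ?_)
  rw [(oi j).osc_add (oj j), ((oF j).pd_w j).osc_const_mul, (oF j).osc_pd_w,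
    (oj j).osc_const_mul, ← mul_assoc, Complex.I_mul_I]
  ring

lemma Bd.absorb {S₁ S₂ : Scale E} {n k : ℕ} {ϖ : T → E → ℝ}
    {f : T → E → F} (h : Bd S₁ n k ϖ f) (hdom : S₂.dom = S₁.dom) (hcost : S₂.cost = S₁.cost)
    {w : E → ℝ} (hw : ∀ X, 1 ≤ w X) (hwt : ∀ i X, S₁.wt i X ≤ w X * S₂.wt i X)
    (h0 : ∀ t X, 0 ≤ ϖ t X) : Bd S₂ n k (fun t X => ϖ t X * w X ^ n) f := by
  induction n generalizing k ϖ f with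
  | zero => simpa [Bd, Est, hdom] using h
  | succ n ih =>
    refine ⟨?_, fun i hi => ?_⟩
    · obtain ⟨C, hC, hb⟩ := h.bound
      refine ⟨C, hC, fun t X hX => (hb t X (hdom ▸ hX)).trans (mul_le_mul_of_nonneg_left
        (le_mul_of_one_le_right (h0 t X) (one_le_pow₀ (hw X))) hC)⟩
    · rw [hcost] at hi ⊢
      refine (ih (h.2 i hi) fun t X => mul_nonneg (h0 t X) (S₁.pos _ _).le).mono
        ⟨1, zero_le_one, fun t X _ => ?_⟩
      change _ ≤ 1 * (ϖ t X * w X ^ (n + 1) * S₂.wt i X)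
      rw [one_mul, pow_succ]
      have h2 := mul_le_mul_of_nonneg_left (hwt i X)
        (mul_nonneg (h0 t X) (pow_nonneg (zero_le_one.trans (hw X)) n))
      calc _ = ϖ t X * w X ^ n * S₁.wt i X := by ring
        _ ≤ _ := h2
        _ = _ := by ring

/-- Oscillatory integrals without stationary points define symbols of order `-∞`. -/
lemma Sym.zData_of_flat {k : ℕ} {ϖ : T → PhAmp d → ℝ}
    {f : T → PhAmp d → ℂ} (h1 : Sym (flatScale Set.univ) k ϖ f)
    (h0 : ∀ t X, 0 ≤ ϖ t X) : Sym ((zData d 1 1 11).scale d) k ϖ f := by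
  refine h1.rescale (fun _ _ => trivial) (fun i => le_rfl) le_rfl
    (fun i => ⟨1, zero_le_one, fun X _ => ?_⟩) (fun t X _ => h0 t X)
    ⟨1, zero_le_one, fun _ _ _ => (one_mul _).ge⟩
  rw [one_mul]
  have l0 := one_le_br X.1.2
  have l1 := one_le_br X.2.1
  have l3 : 1 ≤ br X.2.1 * br X.2.2 := one_le_mul l1 (one_le_br _)
  have l4 := pow_le_pow_right₀ l3 (show 10 ≤ 11 by norm_num)
  have l5 := pow_le_pow_right₀ l1 (show 10 ≤ 11 by norm_num)
  rcases i with (i | i) | i | i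
  · change br X.1.2 ^ 0 * _ ≤ br X.1.2 ^ 1 * _
    rw [pow_zero, pow_one]
    exact mul_le_mul l0 l4 (by positivity) (by positivity)
  · change br X.1.2 ^ (0 : ℝ) * _ ≤ br X.1.2 ^ (1 : ℝ) * _
    rw [Real.rpow_zero, Real.rpow_one]
    exact mul_le_mul l0 l4 (by positivity) (by positivity)
  · change br X.1.2 ^ 0 * _ ≤ br X.1.2 ^ 1 * _
    rw [pow_zero, pow_one]
    exact mul_le_mul l0 l5 (by positivity) (by positivity)
  · exact le_rfl

lemma isSymbol_nonStationary (hφ : IsSymbolPlus φ) {D : Set (PhAmp d)} (hcl : IsClosed D)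
    (hD : ∃ C : ℝ, 0 ≤ C ∧ ∀ X ∈ D, br X.1.2 ≤ C * br (slope φ X)) {μ r s : ℝ}
    {f : PhAmp d → ℂ}
    (hf : Sym (flatScale D) 0 (fun _ => wgt (fun z => br z.2 ^ μ) r s) (fun _ : Unit => f))
    (hz : ∀ X ∉ D, f X = 0) (m : ℝ) :
    (∀ z, Osc z f) ∧ IsSymbol m (fun x ξ => osc fun q => phaseExp φ ((x, ξ), q) * f ((x, ξ), q)) := by
  have iter : ∀ n : ℕ, Sym (flatScale D) 0 (fun _ => wgt (fun z => br z.2 ^ (μ - n))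
      (r + 10 * n) s) (fun _ : Unit => (slopeStep φ)^[n] f) ∧
      ∀ X ∉ D, (slopeStep φ)^[n] f X = 0 := by
    intro n
    induction n with
    | zero => exact ⟨by simpa using hf, hz⟩
    | succ n ih =>
      rw [Function.iterate_succ_apply']
      refine ⟨?_, slopeStep_eq_zero hcl ih.2⟩
      have h := ih.1.slopeStep hφ hD
      push_cast
      rwa [sub_sub, add_assoc, ← mul_add_one] at h
  have ext : ∀ n : ℕ, SW (zData d 1 1 11) d 0 (fun z => br z.2 ^ (μ - n)) (r + 10 * n) s (fun _ : Unit => (slopeStep φ)^[n] f) := by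
    intro n
    have h0 : ∀ X : PhAmp d, 0 ≤ wgt (fun z : Ph d =>
      br z.2 ^ (μ - n)) (r + 10 * n) s X := wgt_nonneg fun z => (br_rpow_pos _ _).le
    have h1 : Sym (flatScale Set.univ) 0 (fun _ => wgt (fun z => br z.2 ^ (μ - n))
        (r + 10 * n) s) (fun _ : Unit => (slopeStep φ)^[n] f) :=
      Sym.of_support (S₁ := flatScale D) (iter n).1 hcl rfl rfl (fun _ X hX => (iter n).2 X hX)
        fun _ X _ => h0 X
    exact h1.zData_of_flat fun _ X => h0 X
  have hosc : ∀ n z, Osc z ((slopeStep φ)^[n] f) := fun n z =>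
    (ext n).toOsc rfl (fun z => (br_rpow_pos _ _).le) trivial ()
  refine ⟨hosc 0, ?_⟩
  have eq : ∀ n : ℕ, (fun z : Ph d => osc fun q => phaseExp φ (z, q) * f (z, q)) =
      fun z => osc fun q => phaseExp φ (z, q) * (slopeStep φ)^[n] f (z, q) := by
    intro n
    induction n with
    | zero => rfl
    | succ n ih =>
      rw [ih]
      funext z
      rw [Function.iterate_succ_apply', (osc_slopeStep hφ (hosc n z)).2]
  obtain ⟨M, hM⟩ := exists_nat_two_mul s (-(d + 1))
  have main : ∀ n : ℕ, Sym (zData d 1 1 11).out 0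
      (fun _ z => br z.2 ^ (μ - n) * (br z.2 ^ 1) ^ (2 * M))
      (fun (_ : Unit) z => osc fun q => phaseExp φ (z, q) * f (z, q)) := by
    intro n
    rw [eq n]
    have h1 : SW (zData d 1 1 11) d 0 (fun z => br z.2 ^ (μ - n)) (r + 10 * n) s (fun (_ : Unit) X => phaseExp φ X * (slopeStep φ)^[n] f X) :=
      ((sym_cexp_phaseDiff hφ 0).mul (ext n)).congr_weight fun _ _ _ => one_mul _
    exact h1.osc (regular_zData _ _ _) rfl (fun z => (br_rpow_pos _ _).le)
      ((continuous_br.comp continuous_snd).rpow_const fun z => Or.inl (br_pos _).ne') hM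
  refine Sym.isSymbol () ⟨(main 0).smooth, fun n => ?_⟩
  obtain ⟨L, hL⟩ := exists_nat_two_mul (μ + 2 * M + 24 * n) m
  refine (((main (2 * L)).bd n).absorb (S₂ := symScale d) rfl rfl
    (w := fun z => br z.2 ^ 24) (fun z => one_le_pow₀ (one_le_br _)) ?_
    fun _ z => mul_nonneg (br_rpow_pos _ _).le (by have := br_pos z.2; positivity)).mono
    ⟨1, zero_le_one, fun _ z _ => ?_⟩
  · have e : ∀ z : Ph d, br z.2 ^ 1 * (br z.2 ^ 1) ^ (2 * 11) = br z.2 ^ 23 := fun z => by ring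
    rintro (i | i) z
    · change br z.2 ^ 1 * (br z.2 ^ 1) ^ (2 * 11) ≤ br z.2 ^ 24 * 1
      rw [e, mul_one]
      exact pow_le_pow_right₀ (one_le_br _) (by norm_num)
    · change br z.2 ^ (1 : ℝ) * (br z.2 ^ 1) ^ (2 * 11) ≤ br z.2 ^ 24 * (br z.2)⁻¹
      rw [Real.rpow_one, pow_succ _ 23, mul_assoc, mul_inv_cancel₀ (br_pos _).ne', mul_one]
      exact le_of_eq (by ring)
  · have p := br_pos z.2
    rw [one_mul, pow_one, ← pow_mul, ← Real.rpow_natCast, ← Real.rpow_natCast, ← Real.rpow_add p,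
      ← Real.rpow_add p]
    refine br_rpow_mono _ ?_
    push_cast
    linarith

lemma sym_cut_shift (hφ : IsSymbolPlus φ) (z : Ph d) {a : ℕ} (ha : 10 ≤ a) :
    Sym ((pt z a).scale d) 0 (fun _ _ => 1)
      (fun (ε : 𝕀) X => ccut ((ε : ℝ) • (shiftV φ X + X.2.2))) := by
  have hc : Sym (unitScale (Conf d)) 0 (fun _ _ => 1)
    (fun _ : 𝕀 => ccut (d := d)) := sym_of_compact smooth_ccut ccut_compact 0
  refine hc.comp (χ := fun (ε : 𝕀) (X : PhAmp d) =>
    (ε : ℝ) • (shiftV φ X + X.2.2)) (fun ε => ?_) (fun _ _ _ => trivial)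
    (fun _ _ => Or.inl (Nat.zero_le _)) (fun _ _ _ => zero_le_one) fun i j n => ?_
  · have := smooth_shiftV hφ
    fun_prop
  have hs : Smooth (shiftC φ j) := (sym_shiftC (T := Unit) hφ j 0).smooth ()
  have e : ∀ ε : 𝕀, pd i (fun X : PhAmp d =>
      co (E := Conf d) j ((ε : ℝ) • (shiftV φ X + X.2.2))) =
      fun X => (ε : ℝ) * (pd i (shiftC φ j) X + eL (Ph d) j (Dirs.b i)) := fun ε => by
    have h := pd_clm ((ε : ℝ) • ContinuousLinearMap.id ℝ ℝ) (hs.add (eL (Ph d) j).contDiff) i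
    rw [pd_add hs (eL (Ph d) j).contDiff, pd_linear] at h
    refine Eq.trans (congrArg _ (funext fun X => ?_)) h
    simp [shiftV, mul_add]
  simp only [e]
  have w1 : ∀ X, 1 ≤ ((pt z a).scale d).wt i X := fun X => by
    have h1 := one_le_br X.2.1
    have h2 := one_le_br X.2.2
    rcases i with i | i | i
    · exact (one_le_pow₀ (one_le_mul h1 h2)).trans (one_mul _).ge
    · exact (one_le_pow₀ h1).trans (one_mul _).ge
    · exact le_rfl
  have h1 : Sym (flatScale {X | X.1 ∈ ({z} : Set _)}) 0 (fun _ X => br X.1.2)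
      (fun (_ : 𝕀) => shiftC φ j) :=
    (sym_shiftC hφ j 0).flat_of_fine fun _ X => (br_pos _).le
  have wle : ∀ l, ∀ X ∈ ((pt z a).scale d).dom,
      (flatScale {X | X.1 ∈ ({z} : Set _)}).wt l X ≤ 1 * ((pt z a).scale d).wt l X := by
    intro l X _
    have h1 := one_le_br X.2.1
    have h2 := one_le_br X.2.2
    rw [one_mul]
    rcases l with (l | l) | l | l
    · change br X.1.2 ^ 0 * _ ≤ _
      rw [pow_zero]
      exact mul_le_mul_of_nonneg_left (pow_le_pow_right₀ (one_le_mul h1 h2) ha) zero_le_one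
    · change br X.1.2 ^ (0 : ℝ) * _ ≤ _
      rw [Real.rpow_zero]
      exact mul_le_mul_of_nonneg_left (pow_le_pow_right₀ (one_le_mul h1 h2) ha) zero_le_one
    · change br X.1.2 ^ 0 * _ ≤ _
      rw [pow_zero]
      exact mul_le_mul_of_nonneg_left (pow_le_pow_right₀ h1 ha) zero_le_one
    · exact le_rfl
  have h2 : Sym ((pt z a).scale d) 0 (fun _ _ => 1) (fun (_ : 𝕀) => shiftC φ j) :=
    h1.rescale (fun _ h => h) (fun _ => le_rfl) le_rfl (fun l => ⟨1, zero_le_one, wle l⟩)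
      (fun _ _ _ => zero_le_one) ⟨br z.2, (br_pos _).le, fun _ X hX => by
        rw [show X.1 = z from hX, mul_one]⟩
  have c0 : ((pt z a).scale d).cost i ≤ 0 := by
    rcases i with i | i | i <;> exact le_rfl
  have h3 := (h2.pd i c0).add (Sym.const (ϖ := fun _ X => 1 * ((pt z a).scale d).wt i X)
    (fun _ => eL (Ph d) j (Dirs.b i)) ⟨|eL (Ph d) j (Dirs.b i)|, abs_nonneg _,
      fun _ X _ => le_mul_of_one_le_right (abs_nonneg _) ((w1 X).trans (one_mul _).ge)⟩
    fun _ X _ => by rw [one_mul]; exact (Scale.pos _ _ _).le)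
  have h4 : Sym ((pt z a).scale d) (0 - ((pt z a).scale d).cost i) (fun _ _ => 1)
      (fun (ε : 𝕀) (_ : PhAmp d) => (ε : ℝ)) :=
    Sym.const _ ⟨1, zero_le_one, fun ε X _ => by
      rw [Real.norm_of_nonneg ε.2.1, one_mul]; exact ε.2.2⟩ fun _ _ _ => zero_le_one
  have h5 := ((h4.mulR h3).mono_k (k' := 0) (by simp)).bd n
  refine h5.congr_weight fun _ X _ => ?_
  rw [one_mul, one_mul]
  exact (div_one _).symm

lemma shiftV_indep (φ : Fn d ℝ) (z : Ph d) (p η : Conf d) :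
    shiftV φ (z, (p, η)) = shiftV φ (z, (p, 0)) := rfl

lemma ee_shear (φ : Fn d ℝ) (X : PhAmp d) :
    ee (X.2.1, shiftV φ X + X.2.2) * phaseExp φ X = ee X.2 := by
  rw [ee, phaseExp, ← Complex.exp_add, ee, inner_add_right,
    show phaseDiff φ X = inner ℝ X.2.1 (shiftV φ X) by
      simp [phaseDiff, shiftV, PiLp.inner_apply, mul_comm]]
  congr 1
  push_cast
  ring

lemma integral_shear {S : Conf d → Conf d} (hS : Continuous S) (g : Ph d → ℂ) :
    ∫ q : Ph d, g (q.1, S q.1 + q.2) = ∫ q, g q := by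
  let e : Ph d ≃ₜ Ph d :=
    { toFun := fun q => (q.1, S q.1 + q.2)
      invFun := fun q => (q.1, q.2 - S q.1)
      left_inv := fun q => by simp
      right_inv := fun q => by simp
      continuous_toFun := by fun_prop
      continuous_invFun := by fun_prop }
  have h : MeasurePreserving (fun q : Ph d => (q.1, S q.1 + q.2)) :=
    (MeasurePreserving.id (volume : Measure (Conf d))).skew_product (μc := (volume : Measure (Conf d)))
      (μd := (volume : Measure (Conf d))) (g := fun p η => S p + η)
      (by fun_prop : Continuous fun q : Ph d => S q.1 + q.2).measurable
      (.of_forall fun p => map_add_left_eq_self _ _)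
  exact h.integral_comp e.measurableEmbedding g

/-- The change of variables `η = ξ + ∫₀¹ ∇_x φ(x + tp, ξ) dt + τ` in oscillatory integrals. -/
lemma osc_shear (hφ : IsSymbolPlus φ) (hN : Gap φ N) {z : Ph d} {f : PhAmp d → ℂ} (hf : Osc z f)
    (hf' : Osc z (fun X => f (X.1, (X.2.1, shiftV φ X + X.2.2)))) :
    osc (fun q => phaseExp φ (z, q) * f (z, q)) =
      osc (fun q => f (z, (q.1, shiftV φ (z, q) + q.2))) := by
  set g : PhAmp d → ℂ := fun X => f (X.1, (X.2.1, shiftV φ X + X.2.2)) with hg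
  have hs := smooth_shiftV hφ
  set G : ℝ → PhAmp d → ℂ := fun ε X =>
    ccut (ε • X.2.1) * ccut (ε • (shiftV φ X + X.2.2)) * g X with hG
  obtain ⟨a, r, s, hsym⟩ := hf'
  have h1 := pt_mono (le_max_left a 10) le_rfl le_rfl hsym
  have h2 : SW (pt z (max a 10)) d 0 (fun _ => 1) r s (fun ε : 𝕀 => G ε) :=
    (((sym_cut_w smooth_ccut ccut_compact (pt z (max a 10)) 0).mul (sym_cut_shift hφ z
      (le_max_right a 10))).mul (h1.reindex fun _ => ())).congr_weight fun _ _ _ => by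
        rw [one_mul, one_mul]
  have hgs : Smooth g := h1.smooth ()
  have hGs : Smooth (fun p : ℝ × PhAmp d => G p.1 p.2) := by
    refine ContDiff.mul (ContDiff.mul ?_ ?_) (hgs.comp contDiff_snd)
    · exact smooth_ccut.comp (by fun_prop)
    · exact smooth_ccut.comp (contDiff_fst.smul ((hs.comp contDiff_snd).add (by fun_prop)))
  have hfast : ∀ ε, 0 < ε → ε ≤ 1 → Fast z (G ε) := by
    intro ε hε _
    refine fast_of_support (hGs.comp (contDiff_const.prodMk contDiff_id))
      (R := 2 / ε + N * (‖z‖ + 2)) Metric.isOpen_ball (Metric.mem_ball_self one_pos)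
      fun X hX hR => ?_
    have hz : ‖X.1‖ ≤ ‖z‖ + 1 := by
      have := norm_le_insert' X.1 z
      rw [Metric.mem_ball, dist_eq_norm] at hX
      linarith
    have hb : br X.1.2 ≤ ‖z‖ + 2 := (br_le_one_add _).trans (by
      have := (norm_snd_le X.1).trans hz; linarith)
    have hN0 := hN.one_le
    have hv : ‖shiftV φ X‖ ≤ N * (‖z‖ + 2) := ((norm_le_br _).trans (hN.shift_le X)).trans
      (mul_le_mul_of_nonneg_left hb (by linarith))
    have big : ∀ v : Conf d, 2 / ε ≤ ‖v‖ → ccut (ε • v) = 0 := fun v h => by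
      refine ccut_eq_zero ?_
      rwa [norm_smul, Real.norm_of_nonneg hε.le, ← div_le_iff₀' hε]
    have hv0 := norm_nonneg (shiftV φ X)
    change G ε X = 0
    rcases hR with hR | hR
    · simp only [hG]
      rw [big _ (by linarith), zero_mul, zero_mul]
    · simp only [hG]
      have := norm_le_add_norm_add X.2.2 (shiftV φ X)
      rw [big (shiftV φ X + X.2.2) (by rw [add_comm]; linarith), mul_zero, zero_mul]
  obtain ⟨M, hM⟩ := exists_nat_two_mul s (-(d + 1))
  have l1 := tendsto_osc hGs h2 (fun _ => zero_le_one) M (by simp [pt]) hM rfl hfast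
  have l2 := ((osc_phaseExp hφ z).mul hf).tendsto_ccut
  have e0 : ∀ q, G 0 (z, q) = g (z, q) := fun q => by
    simp only [hG, zero_smul, ccut_zero, one_mul]
  simp only [e0] at l1
  refine tendsto_nhds_unique (l2.congr fun ε => ?_) l1
  congr 1
  have hS : Continuous fun p : Conf d => shiftV φ (z, (p, 0)) := by
    have := hs.continuous
    fun_prop
  rw [← integral_shear hS]
  refine integral_congr_ae (.of_forall fun q => ?_)
  have h3 := ee_shear φ (z, q)
  have h4 : phaseExp φ (z, q) = phaseExp φ (z, (q.1, shiftV φ (z, (q.1, 0)) + q.2)) := rfl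
  rw [h4] at h3
  simp only [hG, hg, ← h3, shiftV_indep φ z q.1 q.2]
  ring

lemma rpow_le_of_le_mul {s l N : ℝ} (hs : 0 < s) (hl : 0 < l) (hN : 1 ≤ N) (h1 : l ≤ N * s)
    (h2 : s ≤ N * l) (m : ℝ) : s ^ m ≤ N ^ |m| * l ^ m := by
  have hN0 : 0 < N := by linarith
  rcases le_total 0 m with h | h
  · rw [abs_of_nonneg h, ← Real.mul_rpow hN0.le hl.le]
    exact Real.rpow_le_rpow hs.le h2 h
  · rw [abs_of_nonpos h, Real.rpow_neg hN0.le, ← Real.inv_rpow hN0.le,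
      ← Real.mul_rpow (inv_pos.2 hN0).le hl.le]
    exact Real.rpow_le_rpow_of_nonpos (mul_pos (inv_pos.2 hN0) hl) (by rwa [inv_mul_le_iff₀ hN0]) h

/-- The high frequency part of a symbol along the change of variables. -/
def highAmp (N : ℝ) (φ : Fn d ℝ) (a : Fn d ℂ)
    (X : PhAmp d) : ℂ := highSym N a (X.1, shiftV φ X + X.2.2)

lemma sym_highAmp (hφ : IsSymbolPlus φ) (hN : Gap φ N) {a : Fn d ℂ}
    (ha : IsSymbol m a) (k : ℕ) : Sym (fineScale d) k
      (fun _ => wgt (fun z => br z.2 ^ m) 0 |m|) (fun (_ : T) => highAmp N φ a) := by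
  have hs := smooth_shiftV hφ
  have hlin : ∀ (L : PhAmp d →L[ℝ] ℝ) i n (w : PhAmp d → ℝ),
      (∀ X, |L (Dirs.b i)| ≤ w X) → Bd (fineScale d) n k (fun _ => w)
        (fun _ : T => pd i fun X => L X) := fun L i n w h => by
    rw [pd_linear]
    exact (Sym.const _ ⟨1, zero_le_one, fun _ X _ => (h X).trans (one_mul _).ge⟩
      fun _ X _ => (abs_nonneg _).trans (h X)).bd n
  have main : Sym (fineScale d) k (fun _ X => br (shiftV φ X + X.2.2) ^ m)
      (fun _ : T => highAmp N φ a) := by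
    refine Sym.comp (S := fineScale d) (sym_highSym hN.one_le ha k)
      (χ := fun _ X => (X.1, shiftV φ X + X.2.2)) (fun _ => by fun_prop) (fun _ _ _ => trivial)
      (fun _ _ => Or.inl (Nat.zero_le _)) (fun _ _ _ => (br_rpow_pos _ _).le) fun i j n => ?_
    rcases j with (j | j) | j
    · refine (hlin ((proj j : Conf d →L[ℝ] ℝ).comp ((fst ℝ _ _).comp
        (fst ℝ _ _))) i n _ fun X => ?_).congr_weight fun _ X _ => (div_one _).symm
      rcases i with (i | i) | i | i
      · rw [fine_x]
        exact le_trans (by simpa using abs_single_le i j) (one_le_pow_br X)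
      · simpa using (Scale.pos (fineScale d) _ X).le
      · simpa using (Scale.pos (fineScale d) _ X).le
      · simpa using (Scale.pos (fineScale d) _ X).le
    · refine (((fine_coord_xi (T := T) j k).pd i ((fine_cost i).trans_le (Nat.zero_le _))).mono_k
        (k' := k) (by rw [fine_cost]; exact le_rfl)).bd n |>.congr_weight fun _ X _ => ?_
      change _ = _ / (br X.1.2)⁻¹
      rw [div_inv_eq_mul, mul_comm]
    · have h1 := (((sym_shiftC (T := T) hφ j k).pd i ((fine_cost i).trans_le (Nat.zero_le _))).mono_k
        (k' := k) (by rw [fine_cost]; exact le_rfl)).bd n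
      have h2 := hlin (eL (Ph d) j) i n (fun X => br X.1.2 * (fineScale d).wt i X) fun X => by
          refine le_trans ?_ (one_le_fine_mul i X)
          rcases i with (i | i) | i | i
          · simp
          · simp
          · simp
          · simpa using abs_single_le i j
      have hsj : Smooth (shiftC φ j) := (sym_shiftC (T := Unit) hφ j 0).smooth ()
      have h3 := Bd.add (fun _ => smooth_pd hsj i)
        (fun _ => smooth_pd (eL (Ph d) j).contDiff i) h1 h2
      rw [← pd_add hsj (eL (Ph d) j).contDiff] at h3
      refine cast (congrArg _ (funext fun _ => congrArg _ (funext fun X => ?_)))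
        (h3.congr_weight fun _ X _ => ?_)
      · rw [co_par_p]
        simp [shiftV]
      · change _ = _ / (br X.1.2)⁻¹
        rw [div_inv_eq_mul, mul_comm]
  refine main.mono ⟨2 ^ |m| * N ^ |m|, mul_nonneg (Real.rpow_nonneg zero_le_two _)
    (Real.rpow_nonneg (zero_le_one.trans hN.one_le) _), fun _ X _ => ?_⟩
  have h1 := rpow_le_of_le_mul (br_pos _) (br_pos _) hN.one_le (hN.lt_shift X).le (hN.shift_le X) m
  refine (br_add_rpow_le _ _ m).trans ?_
  rw [wgt, Real.rpow_zero, mul_one, ← mul_assoc]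
  refine mul_le_mul_of_nonneg_right ?_ (br_rpow_pos _ _).le
  rw [mul_assoc]
  exact mul_le_mul_of_nonneg_left h1 (Real.rpow_nonneg zero_le_two _)

lemma sym_highAmp_mul (hφ : IsSymbolPlus φ) (hN : Gap φ N) {a : Fn d ℂ}
    (ha : IsSymbol m a) {β : Par d → ℂ} (hβ : Sym (parScale d 10) 0
      (fun _ z => br z.1.2 ^ μ * br z.2 ^ K) (fun _ : Unit => β)) :
    Sym (fineScale d) 0 (fun _ => wgt (fun z => br z.2 ^ (μ + m)) K |m|)
      (fun (_ : Unit) X => highAmp N φ a X * β (X.1, X.2.1)) := by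
  refine ((sym_highAmp hφ hN ha 0).mul (hβ.sym_par fun _ z => mul_nonneg (br_rpow_pos _ _).le
    (pow_nonneg (br_pos _).le _))).congr_weight fun _ X _ => ?_
  simp only [wgt, Real.rpow_add (br_pos X.1.2), Real.rpow_natCast, Real.rpow_zero]
  ring

lemma lam_continuous (μ : ℝ) : Continuous fun z : Ph d => br z.2 ^ μ :=
  (continuous_br.comp continuous_snd).rpow_const fun z => Or.inl (br_pos _).ne'

lemma fine_osc {r s : ℝ} {f : PhAmp d → ℂ}
    (hf : Sym (fineScale d) 0 (fun _ => wgt (fun z => br z.2 ^ μ) r s) (fun _ : Unit => f)) :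
    (∀ z, Osc z f) ∧ IsSymbol μ (fun x ξ => osc fun q => f ((x, ξ), q)) := by
  have h0 : ∀ z : Ph d, 0 ≤ br z.2 ^ μ := fun z => (br_rpow_pos _ _).le
  have h1 : SW (zData d 0 (-1) 10) d 0 (fun z => br z.2 ^ μ) r s
      (fun _ : Unit => f) := hf.of_fine (fun _ X => wgt_nonneg h0 X) le_rfl le_rfl
  obtain ⟨M, hM⟩ := exists_nat_two_mul s (-(d + 1))
  have h2 := h1.osc (regular_zData _ _ _) rfl h0 (lam_continuous μ) hM
  refine ⟨fun z => h1.toOsc rfl h0 trivial (), Sym.isSymbol () (h2.rescale (fun _ _ => trivial)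
    (fun _ => le_rfl) le_rfl (fun i => ⟨1, zero_le_one, fun z _ => le_of_eq ?_⟩)
    (fun _ z _ => h0 z) ⟨1, zero_le_one, fun _ z _ => le_of_eq ?_⟩)⟩
  · rcases i with i | i
    · change br z.2 ^ 0 * (br z.2 ^ 0) ^ _ = 1 * 1
      simp
    · change br z.2 ^ (-1 : ℝ) * (br z.2 ^ 0) ^ _ = 1 * (br z.2)⁻¹
      rw [pow_zero, one_pow, Real.rpow_neg_one, mul_one, one_mul]
  · change br z.2 ^ μ * (br z.2 ^ 0) ^ _ = 1 * br z.2 ^ μ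
    rw [pow_zero, one_pow, mul_one, one_mul]

lemma fine_tay {r s : ℝ} (hs : 0 ≤ s) {f : PhAmp d → ℂ}
    (hf : Sym (fineScale d) 0 (fun _ => wgt (fun z => br z.2 ^ μ) r s) (fun _ : Unit => f)) :
    Sym (fineScale d) 0 (fun _ => wgt (fun z => br z.2 ^ (μ - 1)) (r + 10) s)
      (fun _ : Unit => tay f) := by
  have h0 : ∀ z : Ph d, 0 ≤ br z.2 ^ μ := fun z => (br_rpow_pos _ _).le
  refine (Sym.tay hf (fun X => wgt_nonneg h0 X) (fun X t ht => wgt_scaleE h0 hs X ht)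
    le_rfl).mono_le fun _ X _ => ?_
  have h1 : gain (fun z : Ph d => (br z.2)⁻¹) 0 X ≤ (br X.1.2)⁻¹ :=
    (min_le_right _ _).trans (by rw [pow_zero, mul_one])
  change wgt _ r s X * _ * (br X.1.2 ^ 0 * br X.2.1 ^ 10) ≤ _
  rw [pow_zero, one_mul]
  refine (mul_le_mul_of_nonneg_right (mul_le_mul_of_nonneg_left h1 (wgt_nonneg h0 X))
    (pow_nonneg (br_pos _).le _)).trans (le_of_eq ?_)
  simp only [wgt, Real.rpow_add (br_pos X.2.1), Real.rpow_sub_one (br_pos X.1.2).ne']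
  norm_cast
  ring

/-- Two terms of the Taylor expansion of an oscillatory integral. -/
lemma fine_expansion {r s : ℝ} (hs : 0 ≤ s) {f : PhAmp d → ℂ}
    (hf : Sym (fineScale d) 0 (fun _ => wgt (fun z => br z.2 ^ μ) r s) (fun _ : Unit => f)) :
    IsSymbol (μ - 1) (fun x ξ => osc (fun q => f ((x, ξ), q)) - f ((x, ξ), 0)) ∧
    IsSymbol (μ - 2) (fun x ξ => osc (fun q => f ((x, ξ), q)) -
      (f ((x, ξ), 0) + tay f ((x, ξ), 0))) := by
  have h1 := fine_tay hs hf
  have h2 := fine_tay hs h1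
  have o1 := fine_osc h1
  have o2 := fine_osc h2
  rw [sub_sub, one_add_one_eq_two] at o2
  refine ⟨cast (congrArg _ (funext fun x => funext fun ξ => ?_)) o1.2,
    cast (congrArg _ (funext fun x => funext fun ξ => ?_)) o2.2⟩
  · rw [((fine_osc hf).1 (x, ξ)).osc_eq_add_tay]
    ring
  · rw [((fine_osc hf).1 (x, ξ)).osc_eq_add_tay, (o1.1 (x, ξ)).osc_eq_add_tay]
    ring

section

variable {f g : Fn d ℂ}

lemma IsSymbol.add (hf : IsSymbol m f) (hg : IsSymbol m g) :
    IsSymbol m (fun x ξ => f x ξ + g x ξ) := Sym.isSymbol () ((hf.sym 0).add (hg.sym 0))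

lemma IsSymbol.mono (hf : IsSymbol m f) (h : m ≤ m') : IsSymbol m' f :=
  Sym.isSymbol () ((hf.sym 0).mono_le fun _ X _ =>
    br_rpow_mono _ h)

lemma Sym.unit_comp
    {S : Scale E} {k : ℕ} {ϖ : T → E' → ℝ} {f : T → E' → F} (hf : Sym (unitScale E') k ϖ f)
    (L : E →L[ℝ] E') (h0 : ∀ t X, 0 ≤ ϖ t X) (hS : ∀ i X, 1 ≤ S.wt i X) :
    Sym S k (fun t X => ϖ t (L X)) (fun t X => f t (L X)) :=
  hf.compLin (fun _ => L) (fun _ _ _ => trivial) (fun t X _ => h0 t X) fun i j =>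
    Or.inl ⟨Nat.zero_le _, |co j (L (Dirs.b i))|, abs_nonneg _, fun _ X _ =>
      mul_le_mul_of_nonneg_left (hS i X) (abs_nonneg _)⟩

lemma Sym.to_unit {S : Scale E} {k : ℕ} {ϖ : T → E → ℝ} {f : T → E → F}
    (hf : Sym S k ϖ f) (hdom : S.dom = Set.univ) (hc : ∀ i, S.cost i = 0)
    (hS : ∀ i X, S.wt i X ≤ 1) (h0 : ∀ t X, 0 ≤ ϖ t X) : Sym (unitScale E) k ϖ f :=
  hf.rescale (by rw [hdom]; exact Set.subset_univ _) (fun i => (hc i).le) le_rfl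
    (fun i => ⟨1, zero_le_one, fun X _ => (hS i X).trans (one_mul _).ge⟩) (fun t X _ => h0 t X)
    ⟨1, zero_le_one, fun _ _ _ => (one_mul _).ge⟩

end

section

variable {β : Par d → ℂ}

def compAmp (a : Fn d ℂ) (β : Par d → ℂ) (X : PhAmp d) : ℂ := a X.1.1 X.2.2 * β (X.1, X.2.1)

/-- The symbol obtained by composing `a` with a recentred amplitude `β`. -/
def compSym (φ : Fn d ℝ) (a : Fn d ℂ) (β : Par d → ℂ)
    (x ξ : Conf d) : ℂ := osc fun q => phaseExp φ ((x, ξ), q) * compAmp a β ((x, ξ), q)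

lemma sym_compAmp (D : Set (PhAmp d)) (ha : IsSymbol m a) (hβ : Sym (parScale d 10) 0
      (fun _ z => br z.1.2 ^ μ * br z.2 ^ K) (fun _ : Unit => β)) :
    Sym (flatScale D) 0 (fun _ => wgt (fun z => br z.2 ^ μ) K m) (fun _ : Unit => compAmp a β) := by
  have h1 : Sym (unitScale (Ph d)) 0 (fun _ X => br X.2 ^ m)
      (fun _ : Unit => unc a) := (ha.sym 0).to_unit rfl (fun _ => rfl) (by
    rintro (i | i) X
    · exact le_rfl
    · exact inv_le_one_of_one_le₀ (one_le_br _)) fun _ X => (br_rpow_pos _ _).le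
  have h2 := h1.unit_comp (S := flatScale D) (((fst ℝ (Conf d) (Conf d)).comp (fst ℝ _ _)).prod
      (eM (Ph d) d)) (fun _ X => (br_rpow_pos _ _).le) (one_le_flat D)
  have h0 : ∀ z : Par d, 0 ≤ br z.1.2 ^ μ * br z.2 ^ K := fun z =>
    mul_nonneg (br_rpow_pos _ _).le (pow_nonneg (br_pos _).le _)
  refine (h2.mul ((hβ.sym_par fun _ z => h0 z).flat_of_fine (D := D)
    fun _ X => h0 _)).congr_weight fun _ X _ => ?_
  change br X.2.2 ^ m * _ = _
  simp only [wgt, Real.rpow_natCast]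
  ring

lemma sym_lowCut_flat (hN : 1 ≤ N) (D : Set (PhAmp d)) : Sym (flatScale D) 0 (fun _ _ => 1)
      (fun (_ : Unit) X => lowCut N (X.1, X.2.2)) :=
  ((sym_lowCut (T := Unit) hN 0).to_unit rfl (fun _ => rfl) (by
    rintro ((i | i) | i) X
    · exact le_rfl
    · exact inv_le_one_of_one_le₀ (one_le_br _)
    · exact inv_le_one_of_one_le₀ (one_le_br _)) fun _ _ => zero_le_one).unit_comp
    (S := flatScale D) ((fst ℝ _ _).prod (eM (Ph d) d))
    (fun _ _ => zero_le_one) (one_le_flat D)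

lemma osc_of_flat {r s : ℝ} {f : PhAmp d → ℂ}
    (hf : Sym (flatScale Set.univ) 0 (fun _ => wgt (fun z => br z.2 ^ μ) r s)
      (fun _ : Unit => f)) (z : Ph d) : Osc z f :=
  (show Sym ((zData d 0 0 10).scale d) 0 _ _ from hf).toOsc rfl
    (fun z => (br_rpow_pos _ _).le) trivial ()

lemma compSym_expansion (hφ : IsSymbolPlus φ) (hN : Gap φ N) (ha : IsSymbol m a)
    (hβ : Sym (parScale d 10) 0 (fun _ z => br z.1.2 ^ μ * br z.2 ^ K) (fun _ : Unit => β)) :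
    IsSymbol (μ + m) (compSym φ a β) ∧
    IsSymbol (μ + m - 1) (fun x ξ => compSym φ a β x ξ -
      highAmp N φ a ((x, ξ), 0) * β ((x, ξ), 0)) ∧
    IsSymbol (μ + m - 2) (fun x ξ => compSym φ a β x ξ -
      (highAmp N φ a ((x, ξ), 0) * β ((x, ξ), 0) +
        tay (fun X => highAmp N φ a X * β (X.1, X.2.1)) ((x, ξ), 0))) := by
  set D : Set (PhAmp d) := {X | N * br X.2.2 ≤ br X.1.2} with hD
  have hcl : IsClosed D := isClosed_le
    ((continuous_br.comp (continuous_snd.comp continuous_snd)).const_mul N)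
    (continuous_br.comp (continuous_snd.comp continuous_fst))
  set fl : PhAmp d → ℂ := fun X => lowCut N (X.1, X.2.2) * compAmp a β X with hfl
  set fh : PhAmp d → ℂ := fun X => highSym N a (X.1, X.2.2) * β (X.1, X.2.1) with hfh
  have hlow : ∀ D, Sym (flatScale D) 0 (fun _ => wgt (fun z => br z.2 ^ μ) K m)
      (fun _ : Unit => fl) := fun D =>
    ((sym_lowCut_flat hN.one_le D).mul (sym_compAmp D ha hβ)).congr_weight fun _ _ _ => one_mul _
  have hz : ∀ X ∉ D, fl X = 0 := fun X hX => by
    have h : ¬ N * br X.2.2 ≤ br X.1.2 := hX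
    have h1 : lowCut N (X.1, X.2.2) = 0 := lowCut_eq_zero hN.one_le (not_le.1 h).le
    simp only [hfl]
    rw [h1, zero_mul]
  have hns := fun m => isSymbol_nonStationary hφ hcl (by
    obtain ⟨C, hC, hb⟩ := hN.low
    exact ⟨C, hC, fun X hX => (hb (X.1.1 + X.2.1) X.1.2 X.2.2 hX).trans
      (mul_le_mul_of_nonneg_left (norm_le_br _) hC)⟩) (hlow D) hz m
  have hG := sym_highAmp_mul hφ hN ha hβ
  have ol := (hns 0).1
  have oh : ∀ z, Osc z fh := fun z => by
    refine cast (congrArg _ (funext fun X => ?_)) ((osc_of_flat (sym_compAmp Set.univ ha hβ) z).add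
      ((ol z).const_mul (-1)))
    simp only [hfl, hfh, highSym, compAmp]
    ring
  have key : ∀ x ξ, compSym φ a β x ξ = osc (fun q => phaseExp φ ((x, ξ), q) * fl ((x, ξ), q)) +
      osc (fun q => (fun X => highAmp N φ a X * β (X.1, X.2.1)) ((x, ξ), q)) := fun x ξ => by
    have hp := osc_phaseExp hφ (x, ξ)
    have og := (fine_osc hG).1 (x, ξ)
    have h1 : osc (fun q => phaseExp φ ((x, ξ), q) * fh ((x, ξ), q)) =
      osc (fun q => (fun X => highAmp N φ a X * β (X.1, X.2.1)) ((x, ξ), q)) :=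
        osc_shear hφ hN (f := fh) (oh (x, ξ)) og
    rw [← h1, ← (hp.mul (ol _)).osc_add (hp.mul (oh _)), compSym]
    refine congrArg osc (funext fun q => ?_)
    simp only [hfl, hfh, highSym, compAmp]
    ring
  have hs := fine_expansion (abs_nonneg m) hG
  refine ⟨cast (congrArg _ (funext fun x => funext fun ξ => ?_)) ((hns _).2.add (fine_osc hG).2),
    cast (congrArg _ (funext fun x => funext fun ξ => ?_)) ((hns _).2.add hs.1),
    cast (congrArg _ (funext fun x => funext fun ξ => ?_)) ((hns _).2.add hs.2)⟩
  · exact (key x ξ).symm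
  · rw [key]
    exact (add_sub_assoc _ _ _).symm
  · rw [key]
    exact (add_sub_assoc _ _ _).symm

lemma compSym_add {β' : Par d → ℂ} {μ' : ℝ} {K' : ℕ} (hφ : IsSymbolPlus φ) (ha : IsSymbol m a)
    (hβ : Sym (parScale d 10) 0 (fun _ z => br z.1.2 ^ μ * br z.2 ^ K) (fun _ : Unit => β))
    (hβ' : Sym (parScale d 10) 0
      (fun _ z => br z.1.2 ^ μ' * br z.2 ^ K') (fun _ : Unit => β')) (x ξ : Conf d) :
    compSym φ a (fun z => β z + β' z) x ξ = compSym φ a β x ξ + compSym φ a β' x ξ := by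
  have hp := osc_phaseExp hφ (x, ξ)
  rw [compSym, compSym, compSym, ← (hp.mul (osc_of_flat (sym_compAmp _ ha hβ) _)).osc_add
    (hp.mul (osc_of_flat (sym_compAmp _ ha hβ') _))]
  refine congrArg osc (funext fun q => ?_)
  simp only [compAmp]
  ring

end

def stepZero (B : Fld d) (φ : Fn d ℝ) (b : Fn d ℂ) (z : Par d) : ℂ := stepAmp B φ b (z, 0)

lemma stepZero_eq (B : Fld d) (φ : Fn d ℝ) (b : Fn d ℂ) (z : Par d) : stepZero B φ b z =
      fluxPhase B (z.1.1, (z.2, z.2 + gradXi φ (z.1.1 + z.2) z.1.2)) * b (z.1.1 + z.2) z.1.2 := by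
  simp [stepZero, stepAmp, fluxArg, incr]

lemma compSym_stepSym (hB : IsMagneticField B) (hφ : IsSymbolPlus φ) (hN : Gap φ N)
    (ha : IsSymbol m a) (hb : IsSymbol m' b) :
    IsSymbol (m' + m) (compSym φ a (stepSym B φ b)) ∧
    IsSymbol (m' + m - 2) (fun x ξ => compSym φ a (stepSym B φ b) x ξ -
      (highAmp N φ a ((x, ξ), 0) * b x ξ +
        tay (fun X => highAmp N φ a X * stepZero B φ b (X.1, X.2.1)) ((x, ξ), 0))) := by
  obtain ⟨K₁, h1⟩ := sym_stepSym hB hφ hb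
  obtain ⟨K₂, h2⟩ := sym_stepSym_sub hB hφ hb
  have mono : ∀ {μ μ' : ℝ} {K K' : ℕ}, μ ≤ μ' → K ≤ K' → ∀ z : Par d,
      br z.1.2 ^ μ * br z.2 ^ K ≤ br z.1.2 ^ μ' * br z.2 ^ K' :=
    fun hμ hK z => mul_le_mul (br_rpow_mono _ hμ)
      (pow_le_pow_right₀ (one_le_br _) hK) (pow_nonneg (br_pos _).le _) (br_rpow_pos _ _).le
  have h3 : Sym (parScale d 10) 0 (fun _ z => br z.1.2 ^ m' * br z.2 ^ (K₁ + K₂))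
      (fun _ : Unit => stepZero B φ b) := by
    refine cast (congrArg _ (funext fun _ => funext fun z => ?_)) ((h1.mono_le fun _ z _ =>
      mono le_rfl (Nat.le_add_right _ _) z).sub (h2.mono_le fun _ z _ =>
        mono (by linarith) (Nat.le_add_left _ _) z))
    exact sub_sub_cancel _ _
  have z0 : ∀ x ξ, stepZero B φ b ((x, ξ), 0) = b x ξ := fun x ξ => by
    rw [stepZero_eq, fluxPhase_zero, add_zero, one_mul]
  have e0 := (compSym_expansion hφ hN ha h3).2.2
  have e1 := (compSym_expansion hφ hN ha h2).2.1
  refine ⟨(compSym_expansion hφ hN ha h1).1, cast (congrArg _ (funext fun x => funext fun ξ => ?_))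
    (e0.add (e1.mono (by linarith)))⟩
  have h4 := compSym_add hφ ha h3 h2 x ξ
  have h5 : (fun z => stepZero B φ b z + (stepSym B φ b z - stepAmp B φ b (z, 0))) =
      stepSym B φ b := funext fun z => add_sub_cancel _ _
  have h6 : stepAmp B φ b (((x, ξ), 0), 0) = b x ξ := z0 x ξ
  rw [h5] at h4
  rw [h4, z0, stepSym_zero hB hφ hb, h6, sub_self, mul_zero, sub_zero]
  ring

lemma hasDerivAt_pd {f : E → F} (hf : Smooth f) (i : Dirs.ι E) (X : E) :
    HasDerivAt (fun t : ℝ => f (X + t • Dirs.b i)) (pd i f X) 0 :=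
  (smooth_diffAt hf X).hasFDerivAt.hasLineDerivAt (Dirs.b i)

lemma tay_zero {d : ℕ} {f : Amp Z d → ℂ} (hf : Smooth f) (z : Z) :
    tay f (z, 0) = ∑ j, -I * pd (wd Z j) (pd (ed Z j) f) (z, 0) := by
  refine sum_congr rfl fun j _ => congrArg _ ?_
  refine (hasDerivAt_pd (smooth_avgE hf j) (wd Z j) (z, 0)).unique ?_
  refine cast (congrArg (HasDerivAt · _ _) (funext fun t => ?_))
    (hasDerivAt_pd (smooth_pd hf (ed Z j)) (wd Z j) (z, 0))
  have h : ∀ s : ℝ, scaleE Z d s ((z, 0) + t • Dirs.b (wd Z j)) = (z, 0) + t • Dirs.b (wd Z j) :=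
    fun s => by
      rw [scaleE_apply, b_inr, b_inl]
      simp
  simp [avgE, h]

lemma line_w (x ξ : Conf d) (j : Fin d) (t : ℝ) :
    (((x, ξ), 0) + t • Dirs.b (wd (Ph d) j) : PhAmp d) = ((x, ξ), (t • single j 1, 0)) := by
  rw [b_inr, b_inl, b_conf]
  simp [Prod.ext_iff]

lemma smooth_slice {f : Fn d F}
    (hf : Smooth (unc f)) (x : Conf d) : Smooth (f x) ∧ Smooth (fun y => f y x) :=
  ⟨hf.comp (contDiff_const.prodMk contDiff_id), hf.comp (contDiff_id.prodMk contDiff_const)⟩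

lemma shiftV_zero (φ : Fn d ℝ) (x ξ : Conf d) : shiftV φ ((x, ξ), 0) = ξ + gradX φ x ξ := by
  ext j
  simp [shiftV, shiftC, gradX]

lemma pd_w_shiftC_zero (hφ : IsSymbolPlus φ) (x ξ : Conf d) (j k : Fin d) :
    pd (wd (Ph d) j) (shiftC φ k) ((x, ξ), 0) = 1 / 2 * dX j (dX k φ) x ξ := by
  have hs : Smooth (unc (dX k φ)) := smooth_dX hφ.smooth k
  set L : PhAmp d →L[ℝ] ℝ := (proj k : Conf d →L[ℝ] ℝ).comp ((snd ℝ _ _).comp (fst ℝ _ _)) with hL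
  have h1 := pd_intervalIntegral (smooth_xp hs) (wd (Ph d) j)
  have h2 := pd_add L.contDiff (contDiff_intervalIntegral (smooth_xp hs)) (wd (Ph d) j)
  have e : shiftC φ k = fun X => L X + ∫ s in 0..1, dX k φ (X.1.1 + s • X.2.1) X.1.2 := rfl
  rw [e, h2, h1, pd_linear]
  have h3 : ∀ s : ℝ, pd (wd (Ph d) j)
      (fun X : PhAmp d => dX k φ (X.1.1 + s • X.2.1) X.1.2) ((x, ξ), 0) =
      s * dX j (dX k φ) x ξ := fun s => by
    refine (pd_comp_clm (xpM d s) hs (wd (Ph d) j) ((x, ξ), 0)).trans ?_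
    have h4 : xpM d s (Dirs.b (wd (Ph d) j)) = s • Dirs.b (E := Ph d) (Sum.inl j) := by simp [xpM]
    have h5 : xpM d s ((x, ξ), 0) = (x, ξ) := by simp [xpM_apply]
    rw [h4, h5, map_smul, smul_eq_mul]
    exact congrArg (s * ·) (congrFun (unc_dX hs j) (x, ξ)).symm
  simp only [h3]
  rw [intervalIntegral.integral_mul_const, integral_id]
  simp [hL]

lemma hasDerivAt_stepZero (hB : IsMagneticField B) (hφ : IsSymbolPlus φ) (hb : IsSymbol m' b)
    (x ξ : Conf d) (j : Fin d) :
    HasDerivAt (fun t : ℝ => stepZero B φ b ((x, ξ), t • single j 1))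
      (-I * ((∑ k, (∫ t in 0..1, (1 - t) * B (x + t • gradXi φ x ξ) j k) *
        gradXi φ x ξ k : ℝ) : ℂ) * b x ξ + dX j b x ξ) 0 := by
  have hF : Smooth (fluxPhase B) := (sym_fluxPhase hB (T := Unit) 0).smooth ()
  have hbs : Smooth (unc b) := hb.smooth
  set e : Conf d := single j 1 with he
  set r₀ := gradXi φ x ξ with hr
  have hgs : Smooth (fun y => gradXi φ y ξ) :=
    contDiff_euclidean.2 fun k => (smooth_slice (smooth_dXi hφ.smooth k) ξ).2
  have hr' : HasDerivAt (fun t : ℝ => t • e + gradXi φ (x + t • e) ξ)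
      ((1 : ℝ) • e + fderiv ℝ (fun y => gradXi φ y ξ) x e) 0 :=
    ((hasDerivAt_id (0 : ℝ)).smul_const e).add ((smooth_diffAt hgs x).hasFDerivAt.hasLineDerivAt e)
  have hp : HasDerivAt (fun t : ℝ => t • e) ((1 : ℝ) • e) 0 := (hasDerivAt_id (0 : ℝ)).smul_const e
  have d1 : HasFDerivAt (fluxPhase B) (fderiv ℝ (fluxPhase B) (x, (0, r₀))) (x, (0, r₀)) :=
    (smooth_diffAt hF _).hasFDerivAt
  have s1 : ∀ v : Conf d, fderiv ℝ (fluxPhase B) (x, (0, r₀)) (0, (0, v)) = 0 := fun v => by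
    have h2 : HasFDerivAt (fun r : Conf d => (x, ((0 : Conf d), r)))
        ((inr ℝ (Conf d) _).comp (inr ℝ (Conf d) (Conf d)))
        r₀ := (hasFDerivAt_prodMk_right x _).comp r₀ (hasFDerivAt_prodMk_right 0 r₀)
    have h3 := d1.comp r₀ h2
    rw [show fluxPhase B ∘ (fun r : Conf d => (x, ((0 : Conf d), r))) = fun _ => 1 from
      funext fun r => fluxPhase_zero B x r] at h3
    exact congrArg (fun L => L v) (h3.unique (hasFDerivAt_const (1 : ℂ) r₀))
  have s2 : fderiv ℝ (fluxPhase B) (x, (0, r₀)) (0, (e, 0)) = -I *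
      ((∑ k, (∫ t in 0..1, (1 - t) * B (x + t • r₀) j k) * r₀ k : ℝ) : ℂ) := by
    have h2 : HasFDerivAt (fun p : Conf d => (x, (p, r₀)))
        ((inr ℝ (Conf d) _).comp (inl ℝ (Conf d) (Conf d)))
        0 := (hasFDerivAt_prodMk_right x _).comp 0 (hasFDerivAt_prodMk_left 0 r₀)
    have h3 := d1.comp (0 : Conf d) h2
    rw [← pd_fluxPhase_zero hB x r₀ j]
    exact (congrArg (fun L => L e) h3.fderiv).symm
  have d2 : HasDerivAt (fun t : ℝ => fluxPhase B (x, (t • e, t • e + gradXi φ (x + t • e) ξ)))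
      (fderiv ℝ (fluxPhase B) (x, (0, r₀)) (0, (e, 0))) 0 := by
    have h2 := (hasDerivAt_const (0 : ℝ) x).prodMk (hp.prodMk hr')
    have h3 : HasFDerivAt (fluxPhase B) (fderiv ℝ (fluxPhase B) (x, (0, r₀)))
        (x, ((0 : ℝ) • e, (0 : ℝ) • e + gradXi φ (x + (0 : ℝ) • e) ξ)) := by
      simpa [← hr] using d1
    refine (h3.comp_hasDerivAt (0 : ℝ) h2).congr_deriv ?_
    rw [show ((0 : Conf d), ((1 : ℝ) • e, (1 : ℝ) • e + fderiv ℝ (fun y => gradXi φ y ξ) x e)) =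
      (0, (e, 0)) + (0, (0, (1 : ℝ) • e + fderiv ℝ (fun y => gradXi φ y ξ) x e)) by simp, map_add,
      s1, add_zero]
  have d3 : HasDerivAt (fun t : ℝ => b (x + t • e) ξ) (dX j b x ξ) 0 :=
    (smooth_diffAt (smooth_slice hbs ξ).2 x).hasFDerivAt.hasLineDerivAt e
  refine cast (congrArg (HasDerivAt · _ _) (funext fun t => (stepZero_eq B φ b _).symm))
    ((d2.mul d3).congr_deriv ?_)
  rw [s2]
  simp [fluxPhase_zero]

lemma tay_leading (hB : IsMagneticField B) (hφ : IsSymbolPlus φ) (hN : Gap φ N)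
    (ha : IsSymbol m a) (hb : IsSymbol m' b) (x ξ : Conf d) :
    highAmp N φ a ((x, ξ), 0) = a x (ξ + gradX φ x ξ) ∧
    tay (fun X => highAmp N φ a X * stepZero B φ b (X.1, X.2.1)) ((x, ξ), 0) =
      ∑ j, -I * ((∑ k, ((1 / 2 * dX j (dX k φ) x ξ : ℝ) : ℂ) *
        dXi k (dXi j a) x (ξ + gradX φ x ξ)) * b x ξ + dXi j a x (ξ + gradX φ x ξ) *
          (-I * ((∑ k, (∫ t in 0..1, (1 - t) * B (x + t • gradXi φ x ξ) j k) *
            gradXi φ x ξ k : ℝ) : ℂ) * b x ξ + dX j b x ξ)) := by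
  have has : Smooth (unc a) := ha.smooth
  have hS := smooth_shiftV hφ
  have hb0 : Smooth (fun X : PhAmp d => stepZero B φ b (X.1, X.2.1)) :=
    (smooth_stepAmp hB hφ hb).comp (by fun_prop)
  have hh : Smooth (highAmp N φ a) := (sym_highAmp (T := Unit) hφ hN ha 0).smooth ()
  have ev : ∀ᶠ X in 𝓝 (((x, ξ), 0) : PhAmp d), highAmp N φ a X = a X.1.1 (shiftV φ X + X.2.2) := by
    have c1 : Continuous fun X : PhAmp d => br X.1.2 := continuous_br.comp (by fun_prop)
    have c2 : Continuous fun X : PhAmp d => N * br (shiftV φ X + X.2.2) :=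
      (continuous_br.comp (hS.continuous.add (by fun_prop))).const_mul N
    have h0 : br ξ < N * br (shiftV φ ((x, ξ), 0) + 0) := by
      rw [add_zero]
      exact hN.lt_shift ((x, ξ), 0)
    filter_upwards [(isOpen_lt c1 c2).mem_nhds h0] with X hX
    have h1 : lowCut N (X.1, shiftV φ X + X.2.2) = 0 := lowCut_eq_zero hN.one_le (le_of_lt hX)
    rw [highAmp, highSym, h1, sub_zero, one_mul]
  refine ⟨by simpa [shiftV_zero] using ev.self_of_nhds, ?_⟩
  set g : PhAmp d → ℂ := fun X =>
    a X.1.1 (shiftV φ X + X.2.2) * stepZero B φ b (X.1, X.2.1) with hg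
  have hgs : Smooth g := ContDiff.mul (has.comp (by fun_prop :
    Smooth fun X : PhAmp d => (X.1.1, shiftV φ X + X.2.2))) hb0
  have evg : (fun X => highAmp N φ a X * stepZero B φ b (X.1, X.2.1)) =ᶠ[𝓝 ((x, ξ), 0)] g := by
    filter_upwards [ev] with X hX
    rw [hX]
  have pe : ∀ j, pd (ed (Ph d) j) g = fun X =>
      dXi j a X.1.1 (shiftV φ X + X.2.2) * stepZero B φ b (X.1, X.2.1) := fun j => funext fun X => by
    refine (hasDerivAt_pd hgs (ed (Ph d) j) X).unique ?_
    have h1 := (hasDerivAt_pd (E := Conf d) (smooth_slice has X.1.1).1 j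
      (shiftV φ X + X.2.2)).mul_const (stepZero B φ b (X.1, X.2.1))
    rw [show pd (E := Conf d) j (a X.1.1) (shiftV φ X + X.2.2) =
      dXi j a X.1.1 (shiftV φ X + X.2.2) from congrArg (fderiv ℝ (a X.1.1) _) (b_conf j)] at h1
    refine cast (congrArg (HasDerivAt · _ _) (funext fun t => ?_)) h1
    have e1 : X + t • Dirs.b (ed (Ph d) j) =
        (X.1, (X.2.1, X.2.2 + t • Dirs.b (E := Conf d) j)) := by
      rw [b_inr, b_inr]
      simp [Prod.ext_iff]
    rw [hg, e1, add_assoc]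
    rfl
  rw [tay_zero (hh.mul hb0)]
  refine sum_congr rfl fun j _ => congrArg _ ?_
  have h1 : pd (ed (Ph d) j) (fun X => highAmp N φ a X * stepZero B φ b (X.1, X.2.1))
      =ᶠ[𝓝 ((x, ξ), 0)] pd (ed (Ph d) j) g := by
    filter_upwards [evg.fderiv (𝕜 := ℝ)] with X hX
    rw [pd, hX, pd]
  have h2 : pd (wd (Ph d) j) (pd (ed (Ph d) j)
      (fun X => highAmp N φ a X * stepZero B φ b (X.1, X.2.1))) ((x, ξ), 0) =
      pd (wd (Ph d) j) (pd (ed (Ph d) j) g) ((x, ξ), 0) := by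
    rw [pd, h1.fderiv_eq, pd]
  rw [h2]
  refine (hasDerivAt_pd (smooth_pd hgs _) (wd (Ph d) j) ((x, ξ), 0)).unique ?_
  have hd : Smooth (dXi j a x) := (smooth_slice (smooth_dXi has j) x).1
  have e0 : shiftV φ (((x, ξ), 0) + (0 : ℝ) • Dirs.b (wd (Ph d) j)) =
      ξ + gradX φ x ξ := by rw [zero_smul, add_zero, shiftV_zero]
  have k1 : HasDerivAt (fun t : ℝ => dXi j a x (shiftV φ (((x, ξ), 0) +
      t • Dirs.b (wd (Ph d) j)))) (∑ k, ((1 / 2 * dX j (dX k φ) x ξ : ℝ) : ℂ) *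
        dXi k (dXi j a) x (ξ + gradX φ x ξ)) 0 := by
    have h3 := hasDerivAt_pd hS (wd (Ph d) j) ((x, ξ), 0)
    have h4 := (smooth_diffAt hd (shiftV φ (((x, ξ), 0) +
      (0 : ℝ) • Dirs.b (wd (Ph d) j)))).hasFDerivAt.comp_hasDerivAt (0 : ℝ) h3
    refine h4.congr_deriv ?_
    rw [e0, fderiv_eq_sum_pd]
    refine sum_congr rfl fun k _ => ?_
    have h5 := congrFun (pd_clm (proj k : Conf d →L[ℝ] ℝ) hS (wd (Ph d) j)) ((x, ξ), 0)
    have h6 : pd (wd (Ph d) j) (fun X => (proj k : Conf d →L[ℝ] ℝ)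
      (shiftV φ X)) ((x, ξ), 0) = _ := pd_w_shiftC_zero hφ x ξ j k
    rw [h6] at h5
    rw [co_conf, ← Complex.real_smul]
    refine congrArg₂ (· • ·) h5.symm ?_
    exact congrArg (fderiv ℝ (dXi j a x) _) (b_conf k)
  refine cast (congrArg (HasDerivAt · _ _) (funext fun t => ?_))
    ((k1.mul (hasDerivAt_stepZero hB hφ hb x ξ j)).congr_deriv ?_)
  · rw [pe]
    simp only [line_w, add_zero]
    rfl
  · rw [e0]
    simp [stepZero_eq, fluxPhase_zero]

lemma dX_phase (hU : IsGeneratingPhase U) (j : Fin d) :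
    dX j U = fun x ξ => ξ j + dX j (phaseRemainder U) x ξ := by
  funext x ξ
  have hs : Smooth (unc (phaseRemainder U)) := hU.remainder.smooth
  have h1 : (fun y => U y ξ) = fun y => innerSL ℝ ξ y + phaseRemainder U y ξ := by
    funext y
    simp [phaseRemainder, real_inner_comm]
  rw [dX, h1]
  refine (congrArg (fun L => L (single j 1)) ((innerSL ℝ ξ).hasFDerivAt.add
    (smooth_diffAt (smooth_slice hs ξ).2 x).hasFDerivAt).fderiv).trans ?_
  simp [dX, EuclideanSpace.inner_single_right]

lemma leading_eq (hB : IsMagneticField B) (hU : IsGeneratingPhase U)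
    (hN : Gap (phaseRemainder U) N) (ha : IsSymbol m a) (hb : IsSymbol m' b) (x ξ : Conf d) :
    highAmp N (phaseRemainder U) a ((x, ξ), 0) * b x ξ + tay (fun X =>
      highAmp N (phaseRemainder U) a X * stepZero B (phaseRemainder U) b (X.1, X.2.1)) ((x, ξ), 0) =
    symbolZero U a b x ξ + symbolMagnetic B U a b x ξ := by
  obtain ⟨h1, h2⟩ := tay_leading hB hU.remainder hN ha hb x ξ
  set φ := phaseRemainder U with hφ
  have hgrad : gradX U x ξ = ξ + gradX φ x ξ := by
    ext j
    simp [gradX, dX_phase hU, hφ]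
  have hhess : ∀ j k, dX k (dX j U) x ξ = dX k (dX j φ) x ξ := fun j k => by
    rw [dX_phase hU]
    simp [dX, fderiv_const_add, hφ]
  rw [h1, h2, symbolZero, symbolMagnetic, hgrad]
  simp only [hhess, ← hφ]
  set η := ξ + gradX φ x ξ
  have hM : ∀ j k, averagedField B U x ξ j k = -averagedField B U x ξ k j := fun j k => by
    simp only [averagedField, Matrix.of_apply]
    rw [← intervalIntegral.integral_neg]
    refine intervalIntegral.integral_congr fun t _ => ?_
    simp only [hB.antisymm _ j k]
    ring
  have e1 : ∀ j k, ∫ t in 0..1, (1 - t) * B (x + t • gradXi φ x ξ) j k =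
    averagedField B U x ξ j k := fun j k => rfl
  have e2 : ∀ k, gradXi φ x ξ k = dXi k φ x ξ := fun k => rfl
  simp only [e1, e2]
  have s1 : ∑ j, (∑ k, (averagedField B U x ξ j k : ℂ) * dXi k a x η) * ((dXi j φ x ξ : ℝ) : ℂ) =
      -∑ j, dXi j a x η * ((∑ k, averagedField B U x ξ j k * dXi k φ x ξ : ℝ) : ℂ) := by
    rw [← sum_neg_distrib]
    push_cast
    simp only [sum_mul, mul_sum, ← sum_neg_distrib]
    rw [sum_comm]
    refine sum_congr rfl fun j _ => sum_congr rfl fun k _ => ?_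
    rw [hM k j]
    push_cast
    ring
  have s2 : ∑ j, ∑ k, dXi j (dXi k a) x η * ((dX k (dX j φ) x ξ : ℝ) : ℂ) =
      2 * ∑ j, ∑ k, ((1 / 2 * dX j (dX k φ) x ξ : ℝ) : ℂ) * dXi k (dXi j a) x η := by
    rw [sum_comm, mul_sum]
    refine sum_congr rfl fun j _ => ?_
    rw [mul_sum]
    refine sum_congr rfl fun k _ => ?_
    push_cast
    ring
  rw [s1, s2, sum_congr rfl fun j _ => (show _ =
    -I * b x ξ * (∑ k, ((1 / 2 * dX j (dX k φ) x ξ : ℝ) : ℂ) * dXi k (dXi j a) x η) +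
    (-(b x ξ) * (dXi j a x η * ((∑ k, averagedField B U x ξ j k * dXi k φ x ξ : ℝ) : ℂ)) +
      -I * (dXi j a x η * dX j b x ξ)) by
        linear_combination (dXi j a x η * ((∑ k, averagedField B U x ξ j k * dXi k φ x ξ : ℝ) : ℂ) *
          b x ξ) * Complex.I_mul_I)]
  rw [sum_add_distrib, sum_add_distrib, ← mul_sum, ← mul_sum, ← mul_sum]
  ring

section

variable {β : Par d → ℂ}

lemma cexp_phase_add (hU : IsGeneratingPhase U) (x ξ p η : Conf d) : eI (U (x + p) ξ) = eI (U x ξ) *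
      phaseExp (phaseRemainder U) ((x, ξ), (p, η)) := by
  rw [phaseExp, ← Complex.exp_add, phaseDiff_eq hU.remainder.smooth, phaseRemainder, phaseRemainder]
  congr 1
  simp only [inner_add_left]
  push_cast
  ring

lemma integrable_recentred (hU : IsGeneratingPhase U) (ha : IsSymbol m a)
    (hβ : Sym (parScale d 10) 0 (fun _ z => br z.1.2 ^ μ * br z.2 ^ K) (fun _ : Unit => β))
    (g : Sw d) (x : Conf d) {ε : ℝ} (hε : 0 < ε) :
    Integrable fun w : Ph d × Conf d => cd d * (ee w.1 *
      (ccut (ε • w.1.1) * ccut (ε • w.1.2) * (a x w.1.2 *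
        (eI (U (x + w.1.1) w.2) * β ((x, w.2), w.1.1))))) * hat g w.2 := by
  have hs : Smooth (fun X : Amp PUnit.{1} d =>
      a x X.2.2 * ((((1 : ℝ) + ‖X.2.1‖ ^ 2) ^ K : ℝ) : ℂ)) :=
    (ha.smooth.comp (contDiff_const.prodMk (eM PUnit.{1} d).contDiff)).mul
      (Complex.ofRealCLM.contDiff.comp ((contDiff_const.add
        ((wM PUnit.{1} d).contDiff.norm_sq ℝ)).pow K))
  have hF := (fast_of_cut smooth_ccut ccut_compact smooth_ccut ccut_compact hs hε
    PUnit.unit).integrable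
  have hh := integrable_hat_mul g (φ := fun η => ((br η ^ μ : ℝ) : ℂ)) (C := 1) (s := μ)
    (Complex.continuous_ofReal.comp (continuous_br.rpow_const fun x => Or.inl (br_pos x).ne'))
    fun η => by rw [Complex.norm_real, Real.norm_of_nonneg (br_rpow_pos _ _).le, one_mul]
  obtain ⟨C, hC, hb⟩ := hβ.bound
  have hβc : Continuous β := (hβ.smooth ()).continuous
  have ha' := ha.smooth.continuous
  have hU' := hU.smooth.continuous
  have hc : Continuous (ccut (d := d)) := smooth_ccut.continuous
  have c1 : Continuous fun w : Ph d × Conf d => a x w.1.2 :=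
    ha'.comp (continuous_const.prodMk (continuous_snd.comp continuous_fst))
  have c2 : Continuous fun w : Ph d × Conf d => U (x + w.1.1) w.2 :=
    hU'.comp (by fun_prop : Continuous fun w : Ph d × Conf d => (x + w.1.1, w.2))
  have c3 : Continuous fun w : Ph d × Conf d => ee w.1 := smooth_ee.continuous.comp continuous_fst
  have c4 : Continuous fun w : Ph d × Conf d => hat g w.2 := (hat g).continuous.comp continuous_snd
  refine ((hF.mul_prod hh).const_mul (cd d * C)).mono
    (Continuous.aestronglyMeasurable (by fun_prop)) (.of_forall fun w => ?_)
  have h1 := hb () ((x, w.2), w.1.1) trivial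
  have h2 : br w.1.1 ^ K ≤ (1 + ‖w.1.1‖ ^ 2) ^ K := by
    refine pow_le_pow_left₀ (br_pos _).le ?_ K
    have h := Real.sq_sqrt (show 0 ≤ 1 + ‖w.1.1‖ ^ 2 by positivity)
    change br w.1.1 ^ 2 = _ at h
    rw [← h, sq]
    exact le_mul_of_one_le_left (br_pos _).le (one_le_br _)
  have h3 : ‖β ((x, w.2), w.1.1)‖ ≤ C * (br w.2 ^ μ * (1 + ‖w.1.1‖ ^ 2) ^ K) :=
    h1.trans (mul_le_mul_of_nonneg_left (mul_le_mul_of_nonneg_left h2 (br_rpow_pos _ _).le) hC)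
  simp only [norm_mul, norm_ee, norm_cexp_I, one_mul, Complex.norm_real,
    Real.norm_of_nonneg (br_rpow_pos w.2 μ).le, Real.norm_of_nonneg hC,
    Real.norm_of_nonneg (show 0 ≤ (1 + ‖w.1.1‖ ^ 2) ^ K by positivity)]
  calc _ = (‖cd d‖ * (‖ccut (ε • w.1.1)‖ * ‖ccut (ε • w.1.2)‖ * ‖a x w.1.2‖) * ‖hat g w.2‖) *
        ‖β ((x, w.2), w.1.1)‖ := by ring
    _ ≤ _ := mul_le_mul_of_nonneg_left h3 (by positivity)
    _ = _ := by ring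

/-- Composition of a magnetic pseudodifferential operator with a magnetic Fourier integral
operator, on the level of symbols. -/
lemma fioValue_comp (hA : IsVectorPotential A B) (hB : IsMagneticField B)
    (hU : IsGeneratingPhase U) (ha : IsSymbol m a) (hb : IsSymbol m' b) (u : Sw d)
    (x : Conf d) : fioValue A (idPhase d) a (fioOp hA.temperate hU hb u) x =
      fioValue A U (compSym (phaseRemainder U) a (stepSym B (phaseRemainder U) b)) u x := by
  have hφ := hU.remainder
  obtain ⟨K, hβ⟩ := sym_stepSym hB hφ hb
  have hrec := magPhase_mul_fioValue hA hB hU hb u x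
  set φ := phaseRemainder U
  set β := stepSym B φ b
  set g := magMul A x u
  set v := fioOp hA.temperate hU hb u
  set G := SchwartzMap.compSubConstCLM ℂ (-x) (magMul A x v) with hG
  have hGp : ∀ p, G p = cd d * ∫ ξ, hat g ξ * (eI (U (x + p) ξ) * β ((x, ξ), p)) := fun p => by
    rw [← hrec, hG, SchwartzMap.compSubConstCLM_apply, magMul_apply hA.temperate, sub_neg_eq_add,
      add_comm p]
    rfl
  have hid : ∀ y η : Conf d, phaseRemainder (idPhase d) y η = 0 := fun y η => sub_self _
  have hao : Osc PUnit.unit.{1} (fun X : Amp PUnit.{1} d => a x X.2.2) := by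
    simpa [hid] using osc_fioSlice isGeneratingPhase_idPhase ha x
  have hlim : Tendsto (fun ε : ℝ => cd d * ∫ q : Ph d, ee q *
      (ccut (ε • q.1) * ccut (ε • q.2) * (a x q.2 * G q.1))) (𝓝[>] 0)
      (𝓝 (fioValue A (idPhase d) a v x)) := by
    refine cast (congrArg (fun v => Tendsto _ _ (𝓝 v)) ?_) (hao.mul ((sym_schwartz_w (T := Unit)
      (pt PUnit.unit.{1} 0) G 0 0).toOsc rfl (fun _ => zero_le_one) rfl ())).tendsto_ccut
    rw [fioValue_eq_osc hA.temperate isGeneratingPhase_idPhase ha]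
    refine congrArg osc (funext fun q => ?_)
    simp only [fioAmp, hid]
    rw [hG, SchwartzMap.compSubConstCLM_apply, magMul_apply hA.temperate, sub_neg_eq_add,
      add_comm q.1]
    simp
  set f : PhAmp d → ℂ := fun X => phaseExp φ X * compAmp a β X with hf
  have hsym : SW (zData d 1 1 11) d 0 (fun z => br z.2 ^ m') K m (fun _ : Unit => f) :=
    ((sym_cexp_phaseDiff hφ 0).mul ((sym_compAmp Set.univ ha hβ).zData_of_flat
      fun _ => wgt_nonneg fun z => (br_rpow_pos _ _).le)).congr_weight fun _ _ _ => one_mul _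
  have hcut := sym_cut_mul (smooth_ccut (d := d)) ccut_compact smooth_ccut ccut_compact
    (hsym.reindex fun _ : 𝕀 => ())
  have hfast : ∀ z : Ph d, ∀ ε : ℝ, 0 < ε →
      Fast z fun X => ccut (ε • X.2.1) * ccut (ε • X.2.2) * f X := fun z ε hε =>
    fast_of_cut smooth_ccut ccut_compact smooth_ccut ccut_compact (hsym.smooth ()) hε z
  have h0 : ∀ z : Ph d, 0 ≤ br z.2 ^ m' := fun z => (br_rpow_pos _ _).le
  obtain ⟨M, hM⟩ := exists_nat_two_mul m (-(d + 1))
  obtain ⟨C, hC, hCb⟩ := norm_osc_le hcut h0 (Nat.zero_le _) hM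
  set Φ : ℝ → Ph d → Conf d → ℂ := fun ε q ξ => cd d * (ee q *
    (ccut (ε • q.1) * ccut (ε • q.2) * (a x q.2 * (eI (U (x + q.1) ξ) * β ((x, ξ), q.1))))) with hΦ
  have hΦint : ∀ ε ξ, ∫ q, Φ ε q ξ = eI (U x ξ) * (cd d *
      ∫ q, ee q * (ccut (ε • q.1) * ccut (ε • q.2) * f ((x, ξ), q))) := fun ε ξ => by
    rw [hΦ, integral_const_mul, mul_left_comm]
    congr 1
    rw [← integral_const_mul]
    refine integral_congr_ae (.of_forall fun q => ?_)
    simp only [cexp_phase_add hU x ξ q.1 q.2, hf, compAmp]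
    ring
  have hlim2 := tendsto_swap g (Φ := Φ) (C := C) (s := m' + (2 * M : ℕ))
    (K := fun ξ => eI (U x ξ) * compSym φ a β x ξ)
    (fun ε hε _ => integrable_recentred hU ha hβ g x hε) (fun ε hε hε1 ξ => ?_) (fun ξ => ?_)
  · refine tendsto_nhds_unique hlim ((hlim2.const_mul (cd d)).congr' ?_)
    refine .of_forall fun ε => congrArg _ (integral_congr_ae (.of_forall fun q => ?_))
    simp only [hΦ]
    rw [hGp q.1]
    trans (cd d * (ee q * (ccut (ε • q.1) * ccut (ε • q.2) * a x q.2))) *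
      ∫ ξ, hat g ξ * (eI (U (x + q.1) ξ) * β ((x, ξ), q.1))
    · rw [← integral_const_mul]
      exact integral_congr_ae (.of_forall fun ξ => by ring)
    · ring
  · rw [hΦint, norm_mul, norm_cexp_I, one_mul, ← (hfast (x, ξ) ε hε).osc_eq]
    refine (hCb ⟨ε, hε.le, hε1⟩ (x, ξ) trivial).trans (le_of_eq ?_)
    change C * (br ξ ^ m' * (br ξ ^ 1) ^ (2 * M)) = _
    rw [Real.rpow_add (br_pos _), Real.rpow_natCast, pow_one]
  · simp only [hΦint]
    exact ((hsym.toOsc rfl h0 trivial () : Osc (x, ξ) f).tendsto_ccut).const_mul _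

end

end MagneticFIO

end

theorem theorem3p6 (d : ℕ) (hd : 0 < d)
    (B : MagneticFIO.Conf d → Matrix (Fin d) (Fin d) ℝ) (hB : MagneticFIO.IsMagneticField B)
    (A : MagneticFIO.Conf d → MagneticFIO.Conf d) (hA : MagneticFIO.IsVectorPotential A B)
    (U : MagneticFIO.Conf d → MagneticFIO.Conf d → ℝ) (hU : MagneticFIO.IsGeneratingPhase U)
    (m' m'' : ℝ) (a b : MagneticFIO.Conf d → MagneticFIO.Conf d → ℂ)
    (ha : MagneticFIO.IsSymbol m'' a) (hb : MagneticFIO.IsSymbol m' b) :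
    ∃ E F : 𝓢(MagneticFIO.Conf d, ℂ) →L[ℂ] 𝓢(MagneticFIO.Conf d, ℂ),
      MagneticFIO.IsMagneticPsiDO A a E ∧
      MagneticFIO.IsMagneticFIO A U b F ∧
      ∃ c : MagneticFIO.Conf d → MagneticFIO.Conf d → ℂ,
        MagneticFIO.IsSymbol (m' + m'') c ∧
        MagneticFIO.IsMagneticFIO A U c (E ∘L F) ∧
        MagneticFIO.IsSymbol (m' + m'' - 2)
          (fun x ξ => c x ξ -
            (MagneticFIO.symbolZero U a b x ξ + MagneticFIO.symbolMagnetic B U a b x ξ)) := by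
  have hT := hA.temperate
  obtain ⟨N, hN⟩ := MagneticFIO.exists_gap hU
  obtain ⟨h1, h2⟩ := MagneticFIO.compSym_stepSym hB hU.remainder hN ha hb
  refine ⟨MagneticFIO.fioOp hT MagneticFIO.isGeneratingPhase_idPhase ha,
    MagneticFIO.fioOp hT hU hb, MagneticFIO.isMagneticPsiDO_fioOp hT ha,
    MagneticFIO.isMagneticFIO_fioOp hT hU hb, _, h1, fun u x => ?_, ?_⟩
  · have h := MagneticFIO.isOscillatingIntegral_fioValue hT hU h1 u x
    rw [← MagneticFIO.fioValue_comp hA hB hU ha hb u x] at h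
    exact h
  · simpa only [MagneticFIO.leading_eq hB hU hN ha hb] using h2
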